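/- **Theorem (Local well-posedness of the nonlinear problem).** Let $\mathbb T=[-\pi,\pi]$ with periodic identification, let $Hf(\theta)=\frac1{2\pi}\,\mathrm{p.v.}\int_{-\pi}^{\pi}\cot\!\big(\tfrac{\theta-\vartheta}2\big)f(\vartheta)\,d\vartheta$ be the Hilbert transform on $\mathbb T$, and write $\{f,g\}=f\,\partial_\theta g-g\,\partial_\theta f$. For functions $\eta^\pm(t,\theta)$ let $v^\pm$ be determined by $\partial_\theta v^\pm=H\eta^\pm$, $v^\pm(t,0)=0$, and consider the system $$\begin{cases}\partial_t\eta^+=\{\tfrac12\eta^++v^+,\sin 2\theta\}+\{\eta^+,v^+\}-\{\eta^-,v^-\},\\ \partial_t\eta^-=\{\tfrac12\eta^--v^-,\sin 2\theta\}+\{\eta^-,v^+\}-\{\eta^+,v^-\}.\end{cases}\tag{P}$$ Let $\rho_2=\frac1{4\pi\sin^2\theta}$, with the convention $\rho_2^{1/2}=\frac1{2\sqrt\pi\,\sin\theta}$ (the root carries the sign of $\sin\theta$), and let $\|f\|_{H^m}^2=\sum_{k=0}^m\|f^{(k)}\|_{L^2(\mathbb T)}^2$, with weak derivatives. There are absolute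 constants $C_1,C_2>0$ such that the following holds. Let $m>3$ be an integer, and let $\eta_0^\pm\in H^1(\mathbb T)$ be real-valued and odd (identified with their continuous representatives), with $\rho_2^{1/2}\partial_\theta\eta_0^\pm\in H^m(\mathbb T)$ and $$I_m(0)^2:=\|\rho_2^{1/2}\partial_\theta\eta_0^+\|_{H^m}^2+\|\rho_2^{1/2}\partial_\theta\eta_0^-\|_{H^m}^2=\delta^2\quad\text{for some }0<\delta<\infty.$$ Put $$T_0=\frac1{C_1}\ln\Big(1+\frac{C_1}{2C_2I_m(0)}\Big)>0.$$ Then (P) has a unique classical odd solution $\eta^\pm$ on $[0,T_0]\times\mathbb T$ with $\eta^\pm(0,\cdot)=\eta_0^\pm$; here a classical odd solution is a pair of functions that are $C^1$ on $[0,T_0]\times\mathbb T$, odd in $\theta$, and satisfy (P) pointwise for $0<t\le T_0$. Moreover $u^\pm:=\rho_2^{1/2}\partial_\theta\eta^\pm$ satisfies $$u^\pm\in C([0,T_0];H^m(\mathbb T))\cap C^2([0,T_0];H^{m-2}(\mathbb T)),$$ and, with a constant $C(T_0)$ that depends only on $m$ and $T_0$, $$\sup_{0\le t\le T_0}\|u^\pm(t)\|_{H^m},\quad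 \sup_{0\le t\le T_0}\|\partial_tu^\pm(t)\|_{H^{m-1}},\quad \sup_{0\le t\le T_0}\|\partial_t^2u^\pm(t)\|_{H^{m-2}}\ \le\ C(T_0)\,\delta .$$ -/

import Mathlib

open Set Filter Topology MeasureTheory
open scoped ContDiff

noncomputable section

namespace MHD

/-! ### Sobolev spaces on the torus `𝕋 = [-π, π]`

Functions on the torus are `2π`-periodic functions on `ℝ`; integrals are taken over one period. -/

/-- Lebesgue measure on one period. -/
def periodMeasure : Measure ℝ := volume.restrict (Ioc (-Real.pi) Real.pi)

/-- `L²(𝕋)`. -/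
abbrev L2 : Type := Lp ℝ 2 periodMeasure

/-- `g` is the weak derivative of `f` on the torus (the test functions are smooth and periodic). -/
def IsWeakDeriv (f g : L2) : Prop :=
  ∀ φ : ℝ → ℝ, ContDiff ℝ ∞ φ → Function.Periodic φ (2 * Real.pi) →
    ∫ θ, f θ * deriv φ θ ∂periodMeasure = -∫ θ, g θ * φ θ ∂periodMeasure

theorem integrable_mul (f : L2) {φ : ℝ → ℝ} (hφ : Continuous φ) :
    Integrable (fun θ => f θ * φ θ) periodMeasure := by
  have hfin : IsFiniteMeasure periodMeasure := by
    unfold periodMeasure; infer_instance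
  have hf : Integrable (f : ℝ → ℝ) periodMeasure :=
    (Lp.memLp f).integrable (by norm_num)
  obtain ⟨K, hK⟩ := (isCompact_Icc (a := -Real.pi) (b := Real.pi)).exists_bound_of_continuousOn
    hφ.continuousOn
  refine hf.mul_bdd (c := K) hφ.aestronglyMeasurable ?_
  unfold periodMeasure
  exact (ae_restrict_mem measurableSet_Ioc).mono fun θ hθ => hK θ (Ioc_subset_Icc_self hθ)

theorem IsWeakDeriv.zero : IsWeakDeriv 0 0 := by
  intro φ _ _
  have h : ∀ ψ : ℝ → ℝ, ∫ θ, (0 : L2) θ * ψ θ ∂periodMeasure = 0 := fun ψ => by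
    refine integral_eq_zero_of_ae ?_
    filter_upwards [Lp.coeFn_zero ℝ 2 periodMeasure] with θ hθ
    rw [hθ]
    simp
  rw [h, h, neg_zero]

theorem IsWeakDeriv.add {f₁ g₁ f₂ g₂ : L2} (h₁ : IsWeakDeriv f₁ g₁) (h₂ : IsWeakDeriv f₂ g₂) :
    IsWeakDeriv (f₁ + f₂) (g₁ + g₂) := by
  intro φ hφ hp
  have h : ∀ (a b : L2) (ψ : ℝ → ℝ), Continuous ψ →
      ∫ θ, (a + b) θ * ψ θ ∂periodMeasure
        = ∫ θ, a θ * ψ θ ∂periodMeasure + ∫ θ, b θ * ψ θ ∂periodMeasure := fun a b ψ hψ => by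
    rw [← integral_add (integrable_mul a hψ) (integrable_mul b hψ)]
    refine integral_congr_ae ?_
    filter_upwards [Lp.coeFn_add a b] with θ hθ
    rw [hθ, Pi.add_apply, add_mul]
  rw [h _ _ _ (hφ.continuous_deriv (by simp)), h _ _ _ hφ.continuous, h₁ φ hφ hp, h₂ φ hφ hp]
  ring

theorem IsWeakDeriv.smul {f g : L2} (c : ℝ) (h₁ : IsWeakDeriv f g) :
    IsWeakDeriv (c • f) (c • g) := by
  intro φ hφ hp
  have h : ∀ (a : L2) (ψ : ℝ → ℝ),
      ∫ θ, (c • a) θ * ψ θ ∂periodMeasure = c * ∫ θ, a θ * ψ θ ∂periodMeasure := fun a ψ => by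
    rw [← integral_const_mul]
    refine integral_congr_ae ?_
    filter_upwards [Lp.coeFn_smul c a] with θ hθ
    rw [hθ, Pi.smul_apply, smul_eq_mul, mul_assoc]
  rw [h, h, h₁ φ hφ hp]
  ring

/-- `H^m(𝕋)`: an element is the tuple `(f, f', …, f^(m))` of a function and its weak derivatives,
all in `L²(𝕋)`. The norm inherited from `PiLp 2` is
`‖f‖_{H^m}² = ∑_{k ≤ m} ‖f^(k)‖_{L²}²`. -/
def Sobolev (m : ℕ) : Submodule ℝ (PiLp 2 fun _ : Fin (m + 1) => L2) where
  carrier := {F | ∀ k : Fin m, IsWeakDeriv (F k.castSucc) (F k.succ)}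
  zero_mem' := fun _ => IsWeakDeriv.zero
  add_mem' := fun hF hG k => (hF k).add (hG k)
  smul_mem' := fun c _ hF k => (hF k).smul c

/-- The `k`-th weak derivative of an element of `H^m(𝕋)`. -/
def jet {m : ℕ} (F : Sobolev m) (k : Fin (m + 1)) : L2 :=
  (F : PiLp 2 fun _ : Fin (m + 1) => L2) k

/-- `ρ₂^{1/2}` with `ρ₂ = 1 / (4π sin² θ)`, the root taken with the sign of `sin θ`, so that
`ρ₂^{1/2} ∂_θ η` is odd, and as smooth as `η` allows, for odd `η`. -/
def rhoSqrt (θ : ℝ) : ℝ := 1 / (2 * Real.sqrt Real.pi * Real.sin θ)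

/-- `F ∈ H^m(𝕋)` is the class of `ρ₂^{1/2} ∂_θ η`, where `η ∈ H¹(𝕋)`. -/
def IsWeightedDeriv {m : ℕ} (η : ℝ → ℝ) (F : Sobolev m) : Prop :=
  ∃ G : Sobolev 1, (jet G 0 : ℝ → ℝ) =ᵐ[periodMeasure] η ∧
    (jet F 0 : ℝ → ℝ) =ᵐ[periodMeasure] fun θ => rhoSqrt θ * jet G 1 θ

/-! ### The perturbation system -/

/-- The Hilbert transform on the torus,
`H f(θ) = (1/2π) p.v. ∫_{-π}^{π} cot((θ - ϑ)/2) f(ϑ) dϑ`, with `s = θ - ϑ`. -/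
def hilbert (f : ℝ → ℝ) (θ : ℝ) : ℝ :=
  limUnder (𝓝[>] (0 : ℝ)) fun ε =>
    1 / (2 * Real.pi) *
      ((∫ s in (-Real.pi)..(-ε), Real.cot (s / 2) * f (θ - s))
        + ∫ s in ε..Real.pi, Real.cot (s / 2) * f (θ - s))

/-- The solution `v(f)` of `∂_θ v = H f`, `v(0) = 0`. -/
def velocity (f : ℝ → ℝ) (θ : ℝ) : ℝ := ∫ y in (0 : ℝ)..θ, hilbert f y

/-- The Lie bracket `{f, g} = f ∂_θ g - g ∂_θ f`. -/
def bracket (f g : ℝ → ℝ) (θ : ℝ) : ℝ := f θ * deriv g θ - g θ * deriv f θ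

/-- `L⁺ f = {f/2 + v(f), sin 2θ}`. -/
def Lplus (f : ℝ → ℝ) : ℝ → ℝ :=
  bracket (fun θ => 1 / 2 * f θ + velocity f θ) (fun θ => Real.sin (2 * θ))

/-- `L⁻ f = {f/2 - v(f), sin 2θ}`. -/
def Lminus (f : ℝ → ℝ) : ℝ → ℝ :=
  bracket (fun θ => 1 / 2 * f θ - velocity f θ) (fun θ => Real.sin (2 * θ))

/-- `N₁ = {η⁺, v⁺} - {η⁻, v⁻}`. -/
def N₁ (ηp ηm : ℝ → ℝ) (θ : ℝ) : ℝ :=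
  bracket ηp (velocity ηp) θ - bracket ηm (velocity ηm) θ

/-- `N₂ = {η⁻, v⁺} - {η⁺, v⁻}`. -/
def N₂ (ηp ηm : ℝ → ℝ) (θ : ℝ) : ℝ :=
  bracket ηm (velocity ηp) θ - bracket ηp (velocity ηm) θ

/-- `(η⁺, η⁻)`, with `ηp t θ = η⁺(t, θ)` and `ηm t θ = η⁻(t, θ)`, is a classical odd solution on
`[0, T] × 𝕋` of `∂_t η⁺ = L⁺ η⁺ + N₁`, `∂_t η⁻ = L⁻ η⁻ + N₂`. -/
structure IsClassicalOddSolution (T : ℝ) (ηp ηm : ℝ → ℝ → ℝ) : Prop where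
  contDiffOn_p : ContDiffOn ℝ 1 (fun p : ℝ × ℝ => ηp p.1 p.2) (Icc 0 T ×ˢ univ)
  contDiffOn_m : ContDiffOn ℝ 1 (fun p : ℝ × ℝ => ηm p.1 p.2) (Icc 0 T ×ˢ univ)
  periodic_p : ∀ t ∈ Icc 0 T, Function.Periodic (ηp t) (2 * Real.pi)
  periodic_m : ∀ t ∈ Icc 0 T, Function.Periodic (ηm t) (2 * Real.pi)
  odd_p : ∀ t ∈ Icc 0 T, Function.Odd (ηp t)
  odd_m : ∀ t ∈ Icc 0 T, Function.Odd (ηm t)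
  eq_p : ∀ t ∈ Ioc 0 T, ∀ θ : ℝ,
    derivWithin (fun s => ηp s θ) (Icc 0 T) t = Lplus (ηp t) θ + N₁ (ηp t) (ηm t) θ
  eq_m : ∀ t ∈ Ioc 0 T, ∀ θ : ℝ,
    derivWithin (fun s => ηm s θ) (Icc 0 T) t = Lminus (ηm t) θ + N₂ (ηp t) (ηm t) θ

/-- For `u = ρ₂^{1/2} ∂_θ η`: `u ∈ C([0,T]; H^m) ∩ C²([0,T]; H^{m-2})`, and for all `t ∈ [0, T]`
`‖u(t)‖_{H^m} ≤ B`, `∂_t u(t) ∈ H^{m-1}` with `‖∂_t u(t)‖_{H^{m-1}} ≤ B`, and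
`‖∂_t² u(t)‖_{H^{m-2}} ≤ B`. Here `U` and `W` are the curve `u` in `H^m` and in `H^{m-2}`, and `V t`
is the derivative `∂_t u(t)` seen in `H^{m-1}`. -/
def RegularWithBound (m : ℕ) (T B : ℝ) (η : ℝ → ℝ → ℝ) : Prop :=
  ∃ (U : ℝ → Sobolev m) (V : ℝ → Sobolev (m - 1)) (W : ℝ → Sobolev (m - 2)),
    ContinuousOn U (Icc 0 T) ∧ ContDiffOn ℝ 2 W (Icc 0 T) ∧
    ∀ t ∈ Icc 0 T,
      IsWeightedDeriv (η t) (U t) ∧ IsWeightedDeriv (η t) (W t) ∧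
      jet (V t) 0 = jet (derivWithin W (Icc 0 T) t) 0 ∧
      ‖U t‖ ≤ B ∧ ‖V t‖ ≤ B ∧ ‖iteratedDerivWithin 2 W (Icc 0 T) t‖ ≤ B

/-- `T₀ = C₁⁻¹ ln(1 + C₁ / (2 C₂ I))`. -/
def existenceTime (C₁ C₂ I : ℝ) : ℝ := 1 / C₁ * Real.log (1 + C₁ / (2 * C₂ * I))

end MHD

end

/-!
In the Elsasser variables `a = η⁺ + η⁻`, `b = η⁺ - η⁻` the system is symmetric: with `S = sin 2θ`,

`∂_t a = {a - S, v_b + S / 2}`,  `∂_t b = {b - S, v_a + S / 2}`.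

For `α = ∂_θ a / sin θ` and `β = ∂_θ b / sin θ`, differentiation in `θ` and division by `sin θ`
give, up to linear terms, `∂_t α = a H β - v_b ∂_θ α - v_b cot θ α`, because `∂_θ H b = sin θ H β`
for odd `β` without the frequencies `±1`. Thus there is no singular weight left, and only the
transport term `v_b ∂_θ α` is of order one. The unknowns are the sine coefficients of `α` and `β`; the operators `aSeq`, `vSeq`,
`qSeq`, `cSeq` describe `a`, `v_a`, `v_a / sin θ`, `v_a cot θ` in terms of them, and the system
becomes the quadratic vector field `mhdScale` on a scale of weighted sequence spaces. The
frequencies `±1` are absent from `α` because `sin θ α = ∂_θ a` has mean zero; for this reason the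
projection `oddProj` inside `mhdScale` does not change the equation.

The energy estimates `energyBound` and `differenceBound` rest on a commutator bound,
`transport_symbol_le`: paired with the square of a weight, the transport term loses one derivative
only on its coefficient `v_b`, which is smoother than `β` by two orders. The weighted energies then
grow at a rate `C (1 + ‖(α, β)‖_{L²})`. With the trivial weight this is the Bernoulli inequality
`z' ≤ C (1 + √z) z`, with absolute constants; it bounds the `L²` norm up to the time `existenceTime`,
and on that time interval the energy inequalities at order `m` are linear.

Existence is proved in the abstract setting `QuadraticScale`, in `QuadraticScale.exists_solution`.
Galerkin solutions exist on the whole interval by the Bernoulli inequality, they form a Cauchy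
sequence in `ℓ²` by the difference estimate, and they are bounded at order `m`. Strong continuity
in time at the top order is obtained without smoothing of the data. The weights `cappedPow`, which
are powers of the frequency with one factor capped at a level `K`, satisfy the energy estimate with a
constant that does not depend on `K`. The capped energies of the limit are therefore Lipschitz in
time with a uniform constant, hence so is the energy at order `m`, and continuity of the norm
together with weak continuity is continuity.

The way back to functions goes through absolutely convergent sine series. The principal value
integral of such a series is the conjugate series (`hilbert_sinS`), so the vector field on
coefficients is the bracket in physical space (`sinS_aSeq_G`, `elsasser_field`), and the coefficient
solution gives a classical solution (`IsCoeffSolution.isClassicalOddSolution`). Its Sobolev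
regularity, with two time derivatives, is read off from the equation (`IsCoeffSolution.regular`).
Conversely an odd function whose weighted derivative lies in `H^m` has coefficients of the form
`aSeq X` with `X` in the weighted space of order `m` (`IsWeightedDeriv.exists_coeff`), which provides
the initial data.

Uniqueness among classical odd solutions is an `L²` estimate for the difference
(`OddC1.integral_elsasser_sub_le`): `H` is bounded on `L²`, the velocity is controlled pointwise by
the `L²` norm, and the transport term is integrated by parts.

The constant in the final bound may depend on `m`, `T₀` and `δ`, because `T₀` determines `δ`
(`existenceTime_injective`).
-/

noncomputable section

namespace MHD

/-! ### Weighted composition operators on `ℓ²` -/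

/-- Real square-summable families. -/
abbrev Sq (ι : Type*) : Type _ := lp (fun _ : ι => ℝ) 2

section Sq

variable {ι κ : Type*}

theorem Sq.hasSum_sq (x : Sq ι) : HasSum (fun i => x i ^ 2) (‖x‖ ^ 2) := by
  have h := lp.hasSum_norm (p := 2) (by norm_num) x
  simpa using h

theorem Sq.norm_sq (x : Sq ι) : ‖x‖ ^ 2 = ∑' i, x i ^ 2 := (Sq.hasSum_sq x).tsum_eq.symm

theorem Sq.summable_sq (x : Sq ι) : Summable fun i => x i ^ 2 := (Sq.hasSum_sq x).summable

theorem Sq.abs_apply_le (x : Sq ι) (i : ι) : |x i| ≤ ‖x‖ :=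
  lp.norm_apply_le_norm (by norm_num) x i

theorem Sq.memlp {f : ι → ℝ} (hf : Summable fun i => f i ^ 2) : Memℓp f 2 :=
  memℓp_gen (by simpa using hf)

/-- The element of `ℓ²` with square-summable entries `f`. -/
def Sq.mk (f : ι → ℝ) (hf : Summable fun i => f i ^ 2) : Sq ι := ⟨f, Sq.memlp hf⟩

@[simp] theorem Sq.mk_apply (f : ι → ℝ) (hf : Summable fun i => f i ^ 2) (i : ι) :
    Sq.mk f hf i = f i := rfl

theorem Sq.inner_eq (x y : Sq ι) : inner ℝ x y = ∑' i, x i * y i := by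
  rw [lp.inner_eq_tsum]
  exact tsum_congr fun i => by simp [mul_comm]

theorem Sq.hasSum_inner (x y : Sq ι) : HasSum (fun i => x i * y i) (inner ℝ x y) := by
  convert! lp.hasSum_inner (𝕜 := ℝ) x y using 1
  ext i
  simp [mul_comm]

theorem Sq.ext {x y : Sq ι} (h : ∀ i, x i = y i) : x = y := lp.ext (funext h)

/-- A pointwise bound by the pullback of a square-summable family along an injection. -/
theorem Sq.tsum_comp_le {σ : κ → ι} (hσ : Function.Injective σ) {f : ι → ℝ}
    (hf : Summable fun i => f i ^ 2) {g : κ → ℝ} (hg : ∀ k, |g k| ≤ |f (σ k)|) :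
    (Summable fun k => g k ^ 2) ∧ ∑' k, g k ^ 2 ≤ ∑' i, f i ^ 2 := by
  have h1 : ∀ k, g k ^ 2 ≤ f (σ k) ^ 2 := fun k => sq_le_sq.2 (hg k)
  have h2 : Summable fun k => f (σ k) ^ 2 := hf.comp_injective hσ
  have h3 : Summable fun k => g k ^ 2 := Summable.of_nonneg_of_le (fun _ => sq_nonneg _) h1 h2
  refine ⟨h3, (h3.tsum_le_tsum h1 h2).trans ?_⟩
  exact h2.tsum_le_tsum_of_inj σ hσ (fun _ _ => sq_nonneg _) (fun _ => le_rfl) hf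

/-- Admissible data for a weighted composition operator. -/
def WcompOK (d : κ → ℝ) (σ : κ → ι) : Prop :=
  (∃ C, ∀ k, |d k| ≤ C) ∧ Function.Injective σ

open Classical in
/-- The weighted composition operator `x ↦ (k ↦ d k * x (σ k))` on `ℓ²`, for bounded `d` and
injective `σ` (and `0` for other data). -/
def wcomp (d : κ → ℝ) (σ : κ → ι) : Sq ι →L[ℝ] Sq κ :=
  if h : WcompOK d σ then
    LinearMap.mkContinuousOfExistsBound
      { toFun := fun x => Sq.mk (fun k => d k * x (σ k)) (by
          obtain ⟨C, hC⟩ := h.1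
          refine (Sq.tsum_comp_le h.2 (f := fun i => C * x i) ?_ fun k => ?_).1
          · simpa [mul_pow] using (Sq.summable_sq x).mul_left (C ^ 2)
          · rw [abs_mul, abs_mul]
            exact mul_le_mul_of_nonneg_right ((hC k).trans (le_abs_self C)) (abs_nonneg _))
        map_add' := fun x y => Sq.ext fun k => by simp [mul_add]
        map_smul' := fun c x => Sq.ext fun k => by simp; ring }
      (by
        obtain ⟨C, hC⟩ := h.1
        refine ⟨|C|, fun x => ?_⟩
        refine le_of_sq_le_sq ?_ (by positivity)
        rw [Sq.norm_sq, mul_pow, sq_abs, Sq.norm_sq, ← tsum_mul_left]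
        have := (Sq.tsum_comp_le h.2 (f := fun i => C * x i) (g := fun k => d k * x (σ k))
          (by simpa [mul_pow] using (Sq.summable_sq x).mul_left (C ^ 2)) fun k => ?_).2
        · simpa [mul_pow] using this
        · rw [abs_mul, abs_mul]
          exact mul_le_mul_of_nonneg_right ((hC k).trans (le_abs_self C)) (abs_nonneg _))
  else 0

theorem wcomp_apply {d : κ → ℝ} {σ : κ → ι} (h : WcompOK d σ) (x : Sq ι) (k : κ) :
    wcomp d σ x k = d k * x (σ k) := by
  rw [wcomp, dif_pos h]
  rfl

theorem norm_wcomp_apply_le {d : κ → ℝ} {σ : κ → ι} {C : ℝ} (hC : ∀ k, |d k| ≤ C)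
    (hC0 : 0 ≤ C) (hσ : Function.Injective σ) (x : Sq ι) : ‖wcomp d σ x‖ ≤ C * ‖x‖ := by
  refine le_of_sq_le_sq ?_ (by positivity)
  rw [Sq.norm_sq, mul_pow, Sq.norm_sq, ← tsum_mul_left]
  have := (Sq.tsum_comp_le hσ (f := fun i => C * x i) (g := fun k => d k * x (σ k))
    (by simpa [mul_pow] using (Sq.summable_sq x).mul_left (C ^ 2)) fun k => ?_).2
  · simpa [mul_pow, wcomp_apply ⟨⟨C, hC⟩, hσ⟩] using this
  · rw [abs_mul, abs_mul]
    exact mul_le_mul_of_nonneg_right ((hC k).trans (le_abs_self C)) (abs_nonneg _)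

theorem norm_wcomp_le {d : κ → ℝ} {σ : κ → ι} {C : ℝ} (hC : ∀ k, |d k| ≤ C) (hC0 : 0 ≤ C)
    (hσ : Function.Injective σ) : ‖wcomp d σ‖ ≤ C :=
  ContinuousLinearMap.opNorm_le_bound _ hC0 (norm_wcomp_apply_le hC hC0 hσ)

/-- The diagonal operator with bounded entries `d`. -/
def dg (d : ι → ℝ) : Sq ι →L[ℝ] Sq ι := wcomp d id

theorem dg_apply {d : ι → ℝ} {C : ℝ} (hC : ∀ i, |d i| ≤ C) (x : Sq ι) (i : ι) :
    dg d x i = d i * x i := wcomp_apply ⟨⟨C, hC⟩, Function.injective_id⟩ x i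

theorem norm_dg_apply_le {d : ι → ℝ} {C : ℝ} (hC : ∀ i, |d i| ≤ C) (hC0 : 0 ≤ C) (x : Sq ι) :
    ‖dg d x‖ ≤ C * ‖x‖ := norm_wcomp_apply_le hC hC0 Function.injective_id x

theorem Sq.norm_le_of_abs_le {x y : Sq ι} (h : ∀ i, |x i| ≤ |y i|) : ‖x‖ ≤ ‖y‖ := by
  refine le_of_sq_le_sq ?_ (norm_nonneg _)
  rw [Sq.norm_sq, Sq.norm_sq]
  exact (Sq.summable_sq x).tsum_le_tsum (fun i => sq_le_sq.2 (h i)) (Sq.summable_sq y)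

/-- Cauchy–Schwarz for families, one of them read along an injection. -/
theorem tsum_abs_mul_le (x y : Sq ι) {σ : ι → ι} (hσ : Function.Injective σ) {F : ι → ℝ} {C : ℝ}
    (hC : 0 ≤ C) (hF : ∀ i, |F i| ≤ C * (|x i| * |y (σ i)|)) :
    Summable F ∧ |∑' i, F i| ≤ C * (‖x‖ * ‖y‖) := by
  have hd : ∀ z : Sq ι, ∀ i, |(|z i|)| ≤ |z i| := fun z i => by rw [abs_abs]
  let x' : Sq ι := Sq.mk (fun i => |x i|) (by simpa using Sq.summable_sq x)
  let y' : Sq ι := Sq.mk (fun i => |y (σ i)|) (by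
    simpa [Function.comp_def] using (Sq.summable_sq y).comp_injective hσ)
  have hx : ‖x'‖ ≤ ‖x‖ := Sq.norm_le_of_abs_le fun i => by simp [x']
  have hy : ‖y'‖ ≤ ‖y‖ := by
    refine le_of_sq_le_sq ?_ (norm_nonneg _)
    rw [Sq.norm_sq, Sq.norm_sq]
    exact (Sq.tsum_comp_le hσ (Sq.summable_sq y) fun i => by simp [y']).2
  have hs := (Sq.hasSum_inner x' y').mul_left C
  have hsF : Summable fun i => |F i| :=
    Summable.of_nonneg_of_le (fun _ => abs_nonneg _) hF hs.summable
  refine ⟨hsF.of_abs, ?_⟩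
  calc |∑' i, F i| ≤ ∑' i, |F i| := by
        simpa using norm_tsum_le_tsum_norm (f := F) (by simpa using hsF)
    _ ≤ C * inner ℝ x' y' := by
        rw [← hs.tsum_eq]
        exact hsF.tsum_le_tsum hF hs.summable
    _ ≤ C * (‖x‖ * ‖y‖) := by
        refine mul_le_mul_of_nonneg_left ?_ hC
        exact (real_inner_le_norm _ _).trans (mul_le_mul hx hy (norm_nonneg _) (norm_nonneg _))

theorem Sq.continuous_apply (i : ι) : Continuous fun x : Sq ι => x i :=
  (lp.evalCLM ℝ (fun _ : ι => ℝ) 2 i).continuous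

/-- The `i`-th coordinate as a continuous linear functional. -/
def coord (i : ι) : Sq ι →L[ℝ] ℝ := lp.evalCLM ℝ (fun _ : ι => ℝ) 2 i

@[simp] theorem coord_apply (i : ι) (x : Sq ι) : coord i x = x i := rfl

theorem norm_coord_le (i : ι) : ‖coord (ι := ι) i‖ ≤ 1 :=
  ContinuousLinearMap.opNorm_le_bound _ zero_le_one fun x => by
    simpa using Sq.abs_apply_le x i

/-- A family bounded by `R` all of whose limits are coordinatewise lies in the ball of radius `R`. -/
theorem Sq.exists_of_tendsto {u : ℕ → Sq ι} {R : ℝ} (hu : ∀ n, ‖u n‖ ≤ R) {f : ι → ℝ}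
    (hf : ∀ i, Tendsto (fun n => u n i) atTop (𝓝 (f i))) :
    ∃ x : Sq ι, (∀ i, x i = f i) ∧ ‖x‖ ≤ R := by
  have hb : Bornology.IsBounded (Set.range u) :=
    (Metric.isBounded_closedBall (x := (0 : Sq ι)) (r := R)).subset (by
      rintro _ ⟨n, rfl⟩
      simpa using hu n)
  have ht : Tendsto (id fun n => (u n : ι → ℝ)) atTop (𝓝 f) := tendsto_pi_nhds.2 hf
  refine ⟨⟨f, lp.memℓp_of_tendsto hb ht⟩, fun i => rfl, ?_⟩
  exact lp.norm_le_of_tendsto (F := u) (l := atTop) (Eventually.of_forall hu) ht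

/-- Weak convergence (coordinatewise) together with convergence of the norms gives convergence. -/
theorem Sq.tendsto_of_coord_of_norm {α : Type*} {l : Filter α} [l.NeBot] {u : α → Sq ι} {x : Sq ι}
    (hc : ∀ i, Tendsto (fun a => u a i) l (𝓝 (x i)))
    (hn : Tendsto (fun a => ‖u a‖ ^ 2) l (𝓝 (‖x‖ ^ 2))) : Tendsto u l (𝓝 x) := by
  classical
  rw [Metric.tendsto_nhds]
  intro ε hε
  -- split off a finite set of coordinates that carries almost all of the norm of `x`
  have h1 : Tendsto (fun F : Finset ι => ∑ i ∈ F, x i ^ 2) atTop (𝓝 (‖x‖ ^ 2)) := Sq.hasSum_sq x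
  obtain ⟨F, hF⟩ := (h1.eventually (lt_mem_nhds (show ‖x‖ ^ 2 - ε ^ 2 / 16 < ‖x‖ ^ 2 by
    have := sq_pos_of_pos hε; linarith))).exists
  have h2 : Tendsto (fun a => ∑ i ∈ F, (u a i - x i) ^ 2) l (𝓝 0) := by
    have : Tendsto (fun a => ∑ i ∈ F, (u a i - x i) ^ 2) l (𝓝 (∑ i ∈ F, (x i - x i) ^ 2)) :=
      tendsto_finsetSum _ fun i _ => ((hc i).sub_const _).pow 2
    simpa using this
  have h3 : Tendsto (fun a => ‖u a‖ ^ 2 - ∑ i ∈ F, u a i ^ 2) l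
      (𝓝 (‖x‖ ^ 2 - ∑ i ∈ F, x i ^ 2)) :=
    hn.sub (tendsto_finsetSum _ fun i _ => (hc i).pow 2)
  have hε2 := sq_pos_of_pos hε
  filter_upwards [h2.eventually (gt_mem_nhds (show (0 : ℝ) < ε ^ 2 / 4 by positivity)),
    h3.eventually (gt_mem_nhds (show ‖x‖ ^ 2 - ∑ i ∈ F, x i ^ 2 < ε ^ 2 / 8 by linarith))]
    with a ha2 ha3
  rw [dist_eq_norm]
  refine lt_of_pow_lt_pow_left₀ 2 hε.le ?_
  have hs := (Sq.hasSum_sq (u a - x)).summable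
  have hsu := Sq.hasSum_sq (u a)
  have hsx := Sq.hasSum_sq x
  have e1 := hs.sum_add_tsum_subtype_compl F
  have e2 := hsu.summable.sum_add_tsum_subtype_compl F
  have e3 := hsx.summable.sum_add_tsum_subtype_compl F
  rw [← Sq.norm_sq] at e1 e2 e3
  have hp : Summable fun i : {i // i ∉ F} => u a i ^ 2 := hsu.summable.subtype _
  have hq : Summable fun i : {i // i ∉ F} => x i ^ 2 := hsx.summable.subtype _
  have hpq : ∑' i : {i // i ∉ F}, (2 * u a i ^ 2 + 2 * x i ^ 2)
      = 2 * ∑' i : {i // i ∉ F}, u a i ^ 2 + 2 * ∑' i : {i // i ∉ F}, x i ^ 2 := by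
    rw [(hp.mul_left 2).tsum_add (hq.mul_left 2), tsum_mul_left, tsum_mul_left]
  have hle : ∑' i : {i // i ∉ F}, (u a - x) i ^ 2
      ≤ ∑' i : {i // i ∉ F}, (2 * u a i ^ 2 + 2 * x i ^ 2) := by
    refine (hs.subtype _).tsum_le_tsum (fun i => ?_) ((hp.mul_left 2).add (hq.mul_left 2))
    simp only [lp.coeFn_sub, Pi.sub_apply]
    nlinarith [sq_nonneg (u a i + x i)]
  rw [hpq] at hle
  simp only [lp.coeFn_sub, Pi.sub_apply] at e1 hle
  change _ + ∑' i : {i // i ∉ F}, _ = _ at e1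
  change _ + ∑' i : {i // i ∉ F}, _ = _ at e2
  change _ + ∑' i : {i // i ∉ F}, _ = _ at e3
  nlinarith

end Sq

/-! ### Differential inequalities and a global existence theorem for ODEs -/

theorem monotoneOn_Icc_of_hasDerivWithinAt {g g' : ℝ → ℝ} {T : ℝ}
    (hg : ∀ t ∈ Icc 0 T, HasDerivWithinAt g (g' t) (Icc 0 T) t) (h0 : ∀ t ∈ Icc 0 T, 0 ≤ g' t) :
    MonotoneOn g (Icc 0 T) := by
  refine monotoneOn_of_deriv_nonneg (convex_Icc 0 T) (fun t ht => (hg t ht).continuousWithinAt)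
    (fun t ht => ?_) fun t ht => ?_
  · exact ((hg t (interior_subset ht)).mono interior_subset).differentiableWithinAt
  · rw [interior_Icc] at ht
    rw [((hg t (Ioo_subset_Icc_self ht)).hasDerivAt (Icc_mem_nhds ht.1 ht.2)).deriv]
    exact h0 t (Ioo_subset_Icc_self ht)

/-- Grönwall's inequality with a constant forcing term. -/
theorem gronwall_Icc {E E' : ℝ → ℝ} {T K c : ℝ} (hK : 0 ≤ K) (hc : 0 ≤ c)
    (hE : ∀ t ∈ Icc 0 T, HasDerivWithinAt E (E' t) (Icc 0 T) t)
    (h : ∀ t ∈ Icc 0 T, E' t ≤ K * E t + c) {t : ℝ} (ht : t ∈ Icc 0 T) :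
    E t ≤ (E 0 + c * t) * Real.exp (K * t) := by
  have hd : ∀ s ∈ Icc 0 T, HasDerivWithinAt (fun s => c * s - E s * Real.exp (-(K * s)))
      (c - (E' s * Real.exp (-(K * s)) + E s * (Real.exp (-(K * s)) * (-K)))) (Icc 0 T) s := by
    intro s hs
    have h1 : HasDerivAt (fun s : ℝ => Real.exp (-(K * s))) (Real.exp (-(K * s)) * (-K)) s := by
      have : HasDerivAt (fun s : ℝ => -(K * s)) (-K) s := by
        simpa using ((hasDerivAt_id s).const_mul K).fun_neg
      exact this.exp
    have h2 : HasDerivAt (fun s : ℝ => c * s) c s := by simpa using (hasDerivAt_id s).const_mul c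
    exact h2.hasDerivWithinAt.sub ((hE s hs).mul h1.hasDerivWithinAt)
  have hm := monotoneOn_Icc_of_hasDerivWithinAt hd (fun s hs => by
    have h1 : Real.exp (-(K * s)) ≤ 1 := Real.exp_le_one_iff.2 (by nlinarith [hs.1])
    have h2 := Real.exp_pos (-(K * s))
    have h3 := mul_le_mul_of_nonneg_right (h s hs) h2.le
    nlinarith)
  have := hm (left_mem_Icc.2 (ht.1.trans ht.2)) ht ht.1
  simp only [mul_zero, neg_zero, Real.exp_zero, mul_one, zero_sub] at this
  have h4 : E t * Real.exp (-(K * t)) ≤ E 0 + c * t := by linarith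
  calc E t = E t * Real.exp (-(K * t)) * Real.exp (K * t) := by
        rw [mul_assoc, ← Real.exp_add]; simp
    _ ≤ _ := mul_le_mul_of_nonneg_right h4 (Real.exp_pos _).le

theorem constant_Icc_of_hasDerivWithinAt_zero {F : Type*} [NormedAddCommGroup F] [NormedSpace ℝ F]
    {f : ℝ → F} {T : ℝ} (h : ∀ t ∈ Icc 0 T, HasDerivWithinAt f 0 (Icc 0 T) t) {t : ℝ}
    (ht : t ∈ Icc 0 T) : f t = f 0 := by
  refine constant_of_derivWithin_zero (fun s hs => (h s hs).differentiableWithinAt)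
    (fun s hs => ?_) t ht
  have hT : (0 : ℝ) < T := hs.1.trans_lt hs.2
  exact (h s (Ico_subset_Icc_self hs)).derivWithin (uniqueDiffOn_Icc hT s (Ico_subset_Icc_self hs))

/-- A bounded Lipschitz vector field has integral curves on every time interval. -/
theorem exists_integralCurve_of_bounded_lipschitz {F : Type*} [NormedAddCommGroup F]
    [NormedSpace ℝ F] [CompleteSpace F] {f : F → F} {K : NNReal} (hK : LipschitzWith K f) {L : ℝ}
    (hL : ∀ x, ‖f x‖ ≤ L) (x₀ : F) {T : ℝ} (hT : 0 ≤ T) :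
    ∃ x : ℝ → F, x 0 = x₀ ∧ ∀ t ∈ Icc 0 T, HasDerivWithinAt x (f (x t)) (Icc 0 T) t := by
  have hL0 : 0 ≤ L := (norm_nonneg _).trans (hL x₀)
  have hP : IsPicardLindelof (fun _ => f) (⟨0, left_mem_Icc.2 hT⟩ : Icc (0 : ℝ) T) x₀
      (⟨L, hL0⟩ * ⟨T, hT⟩) 0 ⟨L, hL0⟩ K :=
    { lipschitzOnWith := fun _ _ => hK.lipschitzOnWith
      continuousOn := fun _ _ => continuousOn_const
      norm_le := fun _ _ x _ => hL x
      mul_max_le := by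
        simp only [sub_zero, sub_self, max_eq_left hT, NNReal.coe_zero]
        exact le_rfl }
  obtain ⟨x, hx0, hx⟩ := hP.exists_eq_forall_mem_Icc_hasDerivWithinAt₀
  exact ⟨x, hx0, hx⟩

/-- The cutoff `1` on the ball of radius `R`, `0` off the ball of radius `R + 1`. -/
def radialCutoff {F : Type*} [NormedAddCommGroup F] (R : ℝ) (x : F) : ℝ :=
  max 0 (min 1 (R + 1 - ‖x‖))

section cutoff
variable {F : Type*} [NormedAddCommGroup F] {R : ℝ}

theorem radialCutoff_nonneg (x : F) : 0 ≤ radialCutoff R x := le_max_left _ _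

theorem radialCutoff_le_one (x : F) : radialCutoff R x ≤ 1 :=
  max_le zero_le_one (min_le_left _ _)

theorem radialCutoff_eq_one {x : F} (hx : ‖x‖ ≤ R) : radialCutoff R x = 1 := by
  rw [radialCutoff, min_eq_left (by linarith), max_eq_right zero_le_one]

theorem radialCutoff_eq_zero {x : F} (hx : R + 1 ≤ ‖x‖) : radialCutoff R x = 0 := by
  rw [radialCutoff, max_eq_left]
  exact (min_le_right _ _).trans (by linarith)

theorem abs_radialCutoff_sub_le (x y : F) :
    |radialCutoff R x - radialCutoff R y| ≤ ‖x - y‖ := by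
  refine (abs_max_sub_max_le_max _ _ _ _).trans ?_
  simp only [sub_self, abs_zero]
  refine max_le (norm_nonneg _) ((abs_min_sub_min_le_max _ _ _ _).trans ?_)
  simp only [sub_self, abs_zero]
  refine max_le (norm_nonneg _) ?_
  have : R + 1 - ‖x‖ - (R + 1 - ‖y‖) = ‖y‖ - ‖x‖ := by ring
  rw [this, norm_sub_rev]
  exact abs_norm_sub_norm_le _ _

/-- Cutting off a vector field that is bounded and Lipschitz on a ball makes it globally so. -/
theorem radialCutoff_smul_lipschitz [NormedSpace ℝ F] {Q : F → F} {b l : ℝ} (hb : 0 ≤ b)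
    (hl : 0 ≤ l) (hQ : ∀ x, ‖x‖ ≤ R + 1 → ‖Q x‖ ≤ b)
    (hQl : ∀ x y, ‖x‖ ≤ R + 1 → ‖y‖ ≤ R + 1 → ‖Q x - Q y‖ ≤ l * ‖x - y‖) :
    LipschitzWith (⟨b + l, by positivity⟩ : NNReal) (fun x => radialCutoff R x • Q x) ∧
      ∀ x, ‖radialCutoff R x • Q x‖ ≤ b := by
  -- if the first point lies in the ball
  have key : ∀ x y : F, ‖x‖ ≤ R + 1 →
      ‖radialCutoff R x • Q x - radialCutoff R y • Q y‖ ≤ (b + l) * ‖x - y‖ := by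
    intro x y hx
    rcases le_total ‖y‖ (R + 1) with hy | hy
    · have : radialCutoff R x • Q x - radialCutoff R y • Q y
          = (radialCutoff R x - radialCutoff R y) • Q x + radialCutoff R y • (Q x - Q y) := by
        rw [sub_smul, smul_sub]; abel
      rw [this]
      refine (norm_add_le _ _).trans ?_
      rw [norm_smul, norm_smul, Real.norm_eq_abs, Real.norm_eq_abs, add_mul,
        abs_of_nonneg (radialCutoff_nonneg y)]
      have h1 := mul_le_mul (abs_radialCutoff_sub_le (R := R) x y) (hQ x hx) (norm_nonneg _)
        (norm_nonneg _)
      have h2 := mul_le_mul (radialCutoff_le_one (R := R) y) (hQl x y hx hy) (norm_nonneg _)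
        zero_le_one
      linarith
    · have h0 := radialCutoff_eq_zero hy
      have h1 := abs_radialCutoff_sub_le (R := R) x y
      rw [h0, sub_zero] at h1
      rw [h0, zero_smul, sub_zero, norm_smul, Real.norm_eq_abs]
      have h2 := mul_le_mul h1 (hQ x hx) (norm_nonneg _) (norm_nonneg _)
      nlinarith [mul_nonneg hl (norm_nonneg (x - y))]
  refine ⟨LipschitzWith.of_dist_le_mul fun x y => ?_, fun x => ?_⟩
  · rw [dist_eq_norm, dist_eq_norm]
    change _ ≤ (b + l) * _
    rcases le_total ‖x‖ (R + 1) with hx | hx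
    · exact key x y hx
    · rcases le_total ‖y‖ (R + 1) with hy | hy
      · rw [norm_sub_rev, norm_sub_rev x]
        exact key y x hy
      · rw [radialCutoff_eq_zero hx, radialCutoff_eq_zero hy]
        simp only [zero_smul, sub_zero, norm_zero]
        positivity
  · rw [norm_smul, Real.norm_eq_abs, abs_of_nonneg (radialCutoff_nonneg x)]
    rcases le_total ‖x‖ (R + 1) with hx | hx
    · exact (mul_le_mul (radialCutoff_le_one x) (hQ x hx) (norm_nonneg _) zero_le_one).trans
        (one_mul b).le
    · rw [radialCutoff_eq_zero hx, zero_mul]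
      exact hb

end cutoff

/-- The Bernoulli inequality `y' ≤ C (1 + y) y` keeps `y` finite on the stated time interval. The
quantity `exp (C t) (1 / y + 1)` is nondecreasing. -/
theorem bernoulli_bound {z z' : ℝ → ℝ} {T C r : ℝ} (hr : 0 < r) (hC : 0 ≤ C)
    (hz : ∀ t ∈ Icc 0 T, HasDerivWithinAt z (z' t) (Icc 0 T) t) (hz0 : ∀ t ∈ Icc 0 T, 0 < z t)
    (h : ∀ t ∈ Icc 0 T, z' t ≤ 2 * C * (1 + √(z t)) * z t) (hi : z 0 ≤ r ^ 2)
    (hT : Real.exp (C * T) ≤ 1 + 1 / (2 * r)) {t : ℝ} (ht : t ∈ Icc 0 T) :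
    √(z t) ≤ 2 * r + 1 := by
  have hd : ∀ s ∈ Icc 0 T, HasDerivWithinAt (fun s => Real.exp (C * s) * ((√(z s))⁻¹ + 1))
      (Real.exp (C * s) * C * ((√(z s))⁻¹ + 1)
        + Real.exp (C * s) * (-(z' s / (2 * √(z s))) / √(z s) ^ 2)) (Icc 0 T) s := by
    intro s hs
    have h1 : HasDerivAt (fun s : ℝ => Real.exp (C * s)) (Real.exp (C * s) * C) s := by
      have : HasDerivAt (fun s : ℝ => C * s) C s := by simpa using (hasDerivAt_id s).const_mul C
      exact this.exp
    have h2 := ((hz s hs).sqrt (hz0 s hs).ne').fun_inv (Real.sqrt_ne_zero'.2 (hz0 s hs))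
    exact h1.hasDerivWithinAt.mul (h2.add_const 1)
  have hm := monotoneOn_Icc_of_hasDerivWithinAt hd (fun s hs => by
    have hy : 0 < √(z s) := Real.sqrt_pos.2 (hz0 s hs)
    have hzz : z s = √(z s) ^ 2 := (Real.sq_sqrt (hz0 s hs).le).symm
    have h3 := h s hs
    rw [hzz, Real.sqrt_sq hy.le] at h3
    set y := √(z s)
    have h4 : z' s / (2 * y) / y ^ 2 ≤ C * (1 + y) / y := by
      rw [div_div, div_le_div_iff₀ (by positivity) hy]
      nlinarith [pow_pos hy 1]
    have h5 : C * (1 + y) / y = C * (y⁻¹ + 1) := by field_simp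
    rw [neg_div]
    have := Real.exp_pos (C * s)
    rw [h5] at h4
    nlinarith)
  have h0 : (0 : ℝ) ∈ Icc 0 T := left_mem_Icc.2 (ht.1.trans ht.2)
  have h6 := hm h0 ht ht.1
  simp only [mul_zero, Real.exp_zero, one_mul] at h6
  have hy0 : 0 < √(z 0) := Real.sqrt_pos.2 (hz0 0 h0)
  have hy : 0 < √(z t) := Real.sqrt_pos.2 (hz0 t ht)
  have hy1 : √(z 0) ≤ r := Real.sqrt_le_iff.2 ⟨hr.le, hi⟩
  have h7 : r⁻¹ ≤ (√(z 0))⁻¹ := inv_anti₀ hy0 hy1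
  have h8 : Real.exp (C * t) ≤ 1 + 1 / (2 * r) :=
    (Real.exp_le_exp.2 (mul_le_mul_of_nonneg_left ht.2 hC)).trans hT
  have h9 : r⁻¹ + 1 ≤ (1 + 1 / (2 * r)) * ((√(z t))⁻¹ + 1) := by
    have : (0 : ℝ) < (√(z t))⁻¹ + 1 := by positivity
    nlinarith
  have h10 : (√(z t))⁻¹ ≥ (2 * r + 1)⁻¹ := by
    have e1 : r⁻¹ + 1 = (1 + 1 / (2 * r)) * ((2 * r + 1)⁻¹ + 1) := by field_simp; ring
    rw [e1] at h9
    have := le_of_mul_le_mul_left h9 (by positivity)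
    linarith
  exact (inv_le_inv₀ (by positivity) hy).1 h10

/-! ### Quadratic evolution equations on a scale of sequence spaces -/

section cut

variable {ι : Type*} {w : ι → ℝ}

/-- The diagonal operator with entries `w⁻¹`. A sequence lies in the space of order `s` of the scale
exactly if it is the `s`-fold image of an element of `ℓ²`. -/
def smoothing (w : ι → ℝ) : Sq ι →L[ℝ] Sq ι := dg fun i => (w i)⁻¹

theorem smoothing_apply (hw : ∀ i, 1 ≤ w i) (x : Sq ι) (i : ι) :
    smoothing w x i = (w i)⁻¹ * x i :=
  dg_apply (C := 1) (fun i => by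
    rw [abs_of_nonneg (inv_nonneg.2 (zero_le_one.trans (hw i)))]
    exact inv_le_one_of_one_le₀ (hw i)) x i

theorem smoothing_pow_apply (hw : ∀ i, 1 ≤ w i) (s : ℕ) (x : Sq ι) (i : ι) :
    (smoothing w ^ s) x i = (w i ^ s)⁻¹ * x i := by
  induction s with
  | zero => simp
  | succ s ih =>
    rw [pow_succ', mul_apply_eq_comp, smoothing_apply hw, ih, pow_succ]
    have := (zero_lt_one.trans_le (hw i)).ne'
    field_simp

theorem smoothing_injective (hw : ∀ i, 1 ≤ w i) (s : ℕ) :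
    Function.Injective (smoothing w ^ s) := by
  intro x y h
  refine Sq.ext fun i => ?_
  have := congrArg (fun z : Sq ι => z i) h
  simp only [smoothing_pow_apply hw] at this
  exact mul_left_cancel₀ (inv_ne_zero (pow_ne_zero _ (zero_lt_one.trans_le (hw i)).ne')) this

theorem norm_smoothing_pow_apply_le (hw : ∀ i, 1 ≤ w i) (s : ℕ) (x : Sq ι) :
    ‖(smoothing w ^ s) x‖ ≤ ‖x‖ := by
  refine Sq.norm_le_of_abs_le fun i => ?_
  rw [smoothing_pow_apply hw, abs_mul]
  have h1 : 1 ≤ w i ^ s := one_le_pow₀ (hw i)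
  rw [abs_of_nonneg (inv_nonneg.2 (zero_le_one.trans h1))]
  exact mul_le_of_le_one_left (abs_nonneg _) (inv_le_one_of_one_le₀ h1)

/-- A family bounded in `ℓ²` that tends to `0` after `m` smoothings does so after one smoothing. -/
theorem tendsto_smoothing_of_tendsto_pow (hw : ∀ i, 1 ≤ w i) {m : ℕ} (hm : 1 ≤ m) {α : Type*}
    {l : Filter α} {u : α → Sq ι} {R : ℝ} (hu : ∀ᶠ a in l, ‖u a‖ ≤ R)
    (h : Tendsto (fun a => (smoothing w ^ m) (u a)) l (𝓝 0)) :
    Tendsto (fun a => smoothing w (u a)) l (𝓝 0) := by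
  -- interpolation: high frequencies are controlled by the bound, low ones by the limit
  have key : ∀ (x : Sq ι) (K : ℝ), 1 ≤ K →
      ‖smoothing w x‖ ^ 2 ≤ (K⁻¹) ^ 2 * ‖x‖ ^ 2 + (K ^ (m - 1)) ^ 2 * ‖(smoothing w ^ m) x‖ ^ 2 := by
    intro x K hK
    rw [Sq.norm_sq, Sq.norm_sq x, Sq.norm_sq ((smoothing w ^ m) x), ← tsum_mul_left,
      ← tsum_mul_left, ← (((Sq.summable_sq x).mul_left _).tsum_add
        ((Sq.summable_sq ((smoothing w ^ m) x)).mul_left _))]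
    refine (Sq.summable_sq _).tsum_le_tsum (fun i => ?_) (((Sq.summable_sq x).mul_left _).add
        ((Sq.summable_sq ((smoothing w ^ m) x)).mul_left _))
    rw [smoothing_apply hw, smoothing_pow_apply hw]
    have hwi := zero_lt_one.trans_le (hw i)
    have hK0 := zero_lt_one.trans_le hK
    rcases le_total K (w i) with h1 | h1
    · have : ((w i)⁻¹ * x i) ^ 2 ≤ (K⁻¹) ^ 2 * x i ^ 2 := by
        rw [mul_pow]
        exact mul_le_mul_of_nonneg_right (pow_le_pow_left₀ (by positivity) (inv_anti₀ hK0 h1) 2)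
          (sq_nonneg _)
      have h3 : 0 ≤ (K ^ (m - 1)) ^ 2 * ((w i ^ m)⁻¹ * x i) ^ 2 := by positivity
      linarith
    · have e : (w i)⁻¹ = w i ^ (m - 1) * (w i ^ m)⁻¹ := by
        obtain ⟨k, rfl⟩ := Nat.exists_eq_add_of_le hm
        rw [add_tsub_cancel_left, add_comm, pow_succ]
        field_simp
      have : ((w i)⁻¹ * x i) ^ 2 ≤ (K ^ (m - 1)) ^ 2 * ((w i ^ m)⁻¹ * x i) ^ 2 := by
        rw [e, mul_assoc, mul_pow]
        refine mul_le_mul_of_nonneg_right ?_ (sq_nonneg _)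
        exact pow_le_pow_left₀ (by positivity) (pow_le_pow_left₀ hwi.le h1 _) 2
      have h3 : 0 ≤ (K⁻¹) ^ 2 * x i ^ 2 := by positivity
      linarith
  rw [tendsto_zero_iff_norm_tendsto_zero] at h ⊢
  rw [Metric.tendsto_nhds]
  intro ε hε
  let K : ℝ := max 1 (2 * (|R| + 1) / ε)
  have hK : 1 ≤ K := le_max_left _ _
  have h2 : Tendsto (fun a => (K ^ (m - 1)) ^ 2 * ‖(smoothing w ^ m) (u a)‖ ^ 2) l (𝓝 0) := by
    simpa using (h.pow 2).const_mul ((K ^ (m - 1)) ^ 2)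
  filter_upwards [hu, h2.eventually (gt_mem_nhds (show (0 : ℝ) < ε ^ 2 / 4 by positivity))]
    with a ha ha2
  rw [Real.dist_eq, sub_zero, abs_of_nonneg (norm_nonneg _)]
  refine lt_of_pow_lt_pow_left₀ 2 hε.le ?_
  have h3 := key (u a) K hK
  have h4 : K⁻¹ * ‖u a‖ ≤ ε / 2 := by
    have h5 : 2 * (|R| + 1) / ε ≤ K := le_max_right _ _
    rw [inv_mul_le_iff₀ (by linarith)]
    rw [div_le_iff₀ hε] at h5
    have := le_abs_self R
    nlinarith
  have h6 : (K⁻¹) ^ 2 * ‖u a‖ ^ 2 ≤ ε ^ 2 / 4 := by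
    rw [← mul_pow]
    have : 0 ≤ K⁻¹ * ‖u a‖ := by positivity
    nlinarith
  nlinarith [sq_pos_of_pos hε]

/-- Restriction to the frequencies `w ≤ N`, composed with the Fourier multiplier `φ (w)`. -/
def cut (w : ι → ℝ) (N : ℝ) (φ : ℝ → ℝ) : Sq ι →L[ℝ] Sq ι :=
  dg fun i => if w i ≤ N then φ (w i) else 0

theorem cut_apply (hfin : ∀ N : ℝ, {i | w i ≤ N}.Finite) (N : ℝ) (φ : ℝ → ℝ) (x : Sq ι) (i : ι) :
    cut w N φ x i = (if w i ≤ N then φ (w i) else 0) * x i := by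
  obtain ⟨C, hC⟩ := ((hfin N).image fun i => |φ (w i)|).bddAbove
  refine dg_apply (C := max C 0) (fun i => ?_) x i
  split_ifs with h
  · exact (hC ⟨i, h, rfl⟩).trans (le_max_left _ _)
  · simp

theorem cut_cut (hfin : ∀ N : ℝ, {i | w i ≤ N}.Finite) (N : ℝ) (φ ψ : ℝ → ℝ) (x : Sq ι) :
    cut w N φ (cut w N ψ x) = cut w N (fun a => φ a * ψ a) x :=
  Sq.ext fun i => by
    simp only [cut_apply hfin]
    split_ifs <;> ring

theorem cut_cut_of_le (hfin : ∀ N : ℝ, {i | w i ≤ N}.Finite) {N N' : ℝ} (h : N ≤ N')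
    (φ ψ : ℝ → ℝ) (x : Sq ι) :
    cut w N' φ (cut w N ψ x) = cut w N (fun a => φ a * ψ a) x :=
  Sq.ext fun i => by
    simp only [cut_apply hfin]
    split_ifs with h1 h2 h2
    · ring
    · ring
    · exact absurd (h2.trans h) h1
    · ring

theorem norm_cut_one_le (hfin : ∀ N : ℝ, {i | w i ≤ N}.Finite) (N : ℝ) (x : Sq ι) :
    ‖cut w N (fun _ => 1) x‖ ≤ ‖x‖ :=
  Sq.norm_le_of_abs_le fun i => by
    rw [cut_apply hfin]
    split_ifs <;> simp

theorem inner_cut (hfin : ∀ N : ℝ, {i | w i ≤ N}.Finite) (N : ℝ) (φ : ℝ → ℝ) (x y : Sq ι) :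
    inner ℝ (cut w N φ x) y = inner ℝ x (cut w N φ y) := by
  rw [Sq.inner_eq, Sq.inner_eq]
  exact tsum_congr fun i => by rw [cut_apply hfin, cut_apply hfin]; ring

/-- Frequencies above `N` of a smoothed sequence are small. -/
theorem norm_smoothing_sub_cut_le (hw : ∀ i, 1 ≤ w i) (hfin : ∀ N : ℝ, {i | w i ≤ N}.Finite)
    {N : ℝ} (hN : 0 < N) (z : Sq ι) :
    ‖smoothing w z - cut w N (fun _ => 1) (smoothing w z)‖ ≤ N⁻¹ * ‖z‖ := by
  have : ‖smoothing w z - cut w N (fun _ => 1) (smoothing w z)‖ ≤ ‖N⁻¹ • z‖ := by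
    refine Sq.norm_le_of_abs_le fun i => ?_
    simp only [lp.coeFn_sub, Pi.sub_apply, lp.coeFn_smul, Pi.smul_apply, smul_eq_mul,
      cut_apply hfin, smoothing_apply hw]
    split_ifs with h
    · rw [one_mul, sub_self, abs_zero]
      exact abs_nonneg _
    · have h1 := zero_lt_one.trans_le (hw i)
      rw [zero_mul, sub_zero, abs_mul, abs_mul, abs_of_pos (inv_pos.2 h1),
        abs_of_pos (inv_pos.2 hN)]
      exact mul_le_mul_of_nonneg_right (inv_anti₀ hN (not_le.1 h).le) (abs_nonneg _)
  rwa [norm_smul, Real.norm_of_nonneg (inv_pos.2 hN).le] at this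

end cut

/-- A quadratic vector field `G = L + B` of order one on the scale of sequence spaces with
frequencies `w`. The operators `L s` and `B s` act between copies of `ℓ²` that represent the spaces
of order `s + 1` (source) and `s` (target). -/
structure QuadraticScale (ι : Type*) where
  /-- the frequencies -/
  w : ι → ℝ
  one_le : ∀ i, 1 ≤ w i
  fin : ∀ N : ℝ, {i | w i ≤ N}.Finite
  /-- the linear part -/
  L : ℕ → Sq ι →L[ℝ] Sq ι
  /-- the quadratic part -/
  B : ℕ → Sq ι →L[ℝ] Sq ι →L[ℝ] Sq ι
  smoothing_L : ∀ s y, smoothing w (L (s + 1) y) = L s (smoothing w y)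
  smoothing_B : ∀ s y z, smoothing w (B (s + 1) y z) = B s (smoothing w y) (smoothing w z)

namespace QuadraticScale

variable {ι : Type*} (𝒬 : QuadraticScale ι)

/-- The vector field, from the space of order `s + 1` to the space of order `s`. -/
def G (s : ℕ) (y : Sq ι) : Sq ι := 𝒬.L s y + 𝒬.B s y y

theorem smoothing_G (s : ℕ) (y : Sq ι) :
    smoothing 𝒬.w (𝒬.G (s + 1) y) = 𝒬.G s (smoothing 𝒬.w y) := by
  rw [G, G, map_add, 𝒬.smoothing_L, 𝒬.smoothing_B]

theorem smoothing_pow_G (s k : ℕ) (y : Sq ι) :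
    (smoothing 𝒬.w ^ k) (𝒬.G (s + k) y) = 𝒬.G s ((smoothing 𝒬.w ^ k) y) := by
  induction k generalizing s with
  | zero => simp
  | succ k ih =>
    rw [pow_succ', mul_apply_eq_comp, mul_apply_eq_comp, ← smoothing_G,
      ← ih (s + 1), add_assoc, add_comm 1 k]

theorem contDiff_G (s : ℕ) : ContDiff ℝ ∞ (𝒬.G s) := by
  unfold G
  exact (𝒬.L s).contDiff.add ((𝒬.B s).contDiff.clm_apply contDiff_id)

theorem continuous_G (s : ℕ) : Continuous (𝒬.G s) := (𝒬.contDiff_G s).continuous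

theorem norm_G_le (s : ℕ) (y : Sq ι) : ‖𝒬.G s y‖ ≤ (‖𝒬.L s‖ + ‖𝒬.B s‖ * ‖y‖) * ‖y‖ := by
  refine (norm_add_le _ _).trans ?_
  have h1 := (𝒬.L s).le_opNorm y
  have h2 := (𝒬.B s).le_opNorm₂ y y
  linarith

theorem norm_G_sub_le (s : ℕ) (y z : Sq ι) :
    ‖𝒬.G s y - 𝒬.G s z‖ ≤ (‖𝒬.L s‖ + ‖𝒬.B s‖ * (‖y‖ + ‖z‖)) * ‖y - z‖ := by
  have e : 𝒬.G s y - 𝒬.G s z = 𝒬.L s (y - z) + (𝒬.B s y (y - z) + 𝒬.B s (y - z) z) := by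
    simp only [G, map_sub, sub_apply]
    abel
  rw [e]
  refine (norm_add_le _ _).trans ((add_le_add le_rfl (norm_add_le _ _)).trans ?_)
  have h1 := (𝒬.L s).le_opNorm (y - z)
  have h2 := (𝒬.B s).le_opNorm₂ y (y - z)
  have h3 := (𝒬.B s).le_opNorm₂ (y - z) z
  nlinarith

/-- The energy estimate with weight `φ (w)` and constant `C`, for truncated sequences. It is linear
in the weighted energy, with a factor that only sees the `ℓ²` norm. -/
def EnergyBound (φ : ℝ → ℝ) (C : ℝ) : Prop :=
  ∀ (N : ℝ) (u : Sq ι),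
    |inner ℝ (cut 𝒬.w N (fun a => φ a ^ 2) u) (𝒬.G 0 (cut 𝒬.w N id u))|
      ≤ C * (1 + ‖cut 𝒬.w N (fun _ => 1) u‖) * ‖cut 𝒬.w N φ u‖ ^ 2

/-- The `ℓ²` estimate for the difference of two truncated sequences. -/
def DifferenceBound (C : ℝ) : Prop :=
  ∀ (N : ℝ) (u v : Sq ι),
    |inner ℝ (cut 𝒬.w N (fun _ => 1) (u - v))
        (𝒬.G 0 (cut 𝒬.w N id u) - 𝒬.G 0 (cut 𝒬.w N id v))|
      ≤ C * (1 + ‖cut 𝒬.w N id u‖ + ‖cut 𝒬.w N id v‖) * ‖cut 𝒬.w N (fun _ => 1) (u - v)‖ ^ 2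

/-- The Galerkin vector field. -/
def galerkin (N : ℝ) (x : Sq ι) : Sq ι :=
  cut 𝒬.w N (fun _ => 1) (𝒬.G 0 (cut 𝒬.w N id x))

theorem galerkin_bounds (N ρ : ℝ) : ∃ b l : ℝ, 0 ≤ b ∧ 0 ≤ l ∧
    (∀ x, ‖x‖ ≤ ρ → ‖𝒬.galerkin N x‖ ≤ b) ∧
    ∀ x y, ‖x‖ ≤ ρ → ‖y‖ ≤ ρ → ‖𝒬.galerkin N x - 𝒬.galerkin N y‖ ≤ l * ‖x - y‖ := by
  set R := cut 𝒬.w N id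
  have hR : ∀ x, ‖x‖ ≤ ρ → ‖R x‖ ≤ ‖R‖ * |ρ| := fun x hx =>
    (R.le_opNorm x).trans (mul_le_mul_of_nonneg_left (hx.trans (le_abs_self ρ)) (norm_nonneg _))
  refine ⟨(‖𝒬.L 0‖ + ‖𝒬.B 0‖ * (‖R‖ * |ρ|)) * (‖R‖ * |ρ|),
    (‖𝒬.L 0‖ + ‖𝒬.B 0‖ * (‖R‖ * |ρ| + ‖R‖ * |ρ|)) * ‖R‖, by positivity, by positivity,
    fun x hx => ?_, fun x y hx hy => ?_⟩
  · refine (norm_cut_one_le 𝒬.fin N _).trans ((𝒬.norm_G_le 0 _).trans ?_)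
    have h1 := hR x hx
    change (_ + _ * ‖R x‖) * ‖R x‖ ≤ _
    gcongr
  · rw [galerkin, galerkin, ← map_sub]
    refine (norm_cut_one_le 𝒬.fin N _).trans ((𝒬.norm_G_sub_le 0 _ _).trans ?_)
    have h1 := hR x hx
    have h2 := hR y hy
    have h3 : ‖R x - R y‖ ≤ ‖R‖ * ‖x - y‖ := by
      rw [← map_sub]; exact R.le_opNorm _
    change (_ + _ * (‖R x‖ + ‖R y‖)) * ‖R x - R y‖ ≤ _
    rw [mul_assoc _ ‖R‖]
    gcongr

theorem hasDerivWithinAt_norm_cut_sq {x : ℝ → Sq ι} {x' : Sq ι} {S : Set ℝ} {t : ℝ}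
    (h : HasDerivWithinAt x x' S t) (N : ℝ) (φ : ℝ → ℝ) :
    HasDerivWithinAt (fun s => ‖cut 𝒬.w N φ (x s)‖ ^ 2)
      (2 * inner ℝ (cut 𝒬.w N (fun a => φ a ^ 2) (x t)) x') S t := by
  have h1 : HasDerivWithinAt (fun s => cut 𝒬.w N φ (x s)) (cut 𝒬.w N φ x') S t :=
    (cut 𝒬.w N φ).hasFDerivAt.comp_hasDerivWithinAt t h
  convert! h1.norm_sq using 1
  rw [← inner_cut 𝒬.fin, cut_cut 𝒬.fin]
  simp only [pow_two]

/-- Galerkin solutions exist, and remain bounded in `ℓ²`, on the whole time interval on which the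
Bernoulli inequality controls them. -/
theorem exists_galerkin {C₀ T r : ℝ} (hC₀ : 0 ≤ C₀) (hE : 𝒬.EnergyBound (fun _ => 1) C₀)
    (hr : 0 < r) (hT0 : 0 ≤ T) (hT : Real.exp (C₀ * T) ≤ 1 + 1 / (2 * r)) {x₀ : Sq ι}
    (hx₀ : ‖x₀‖ ^ 2 ≤ r ^ 2 / 2) (N : ℝ) :
    ∃ x : ℝ → Sq ι, x 0 = cut 𝒬.w N (fun _ => 1) x₀ ∧
      ∀ t ∈ Icc 0 T, HasDerivWithinAt x (𝒬.galerkin N (x t)) (Icc 0 T) t ∧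
        cut 𝒬.w N (fun _ => 1) (x t) = x t ∧ ‖x t‖ ≤ 2 * r + 1 := by
  set P := cut 𝒬.w N (fun _ => 1) with hP
  obtain ⟨b, l, hb, hl, hQ, hQl⟩ := 𝒬.galerkin_bounds N (2 * r + 1 + 1)
  obtain ⟨h1, h2⟩ := radialCutoff_smul_lipschitz (R := 2 * r + 1) hb hl hQ hQl
  obtain ⟨x, hx0, hx⟩ := exists_integralCurve_of_bounded_lipschitz h1 h2 (P x₀) hT0
  have hPP : ∀ z, P (P z) = P z := fun z => by rw [hP, cut_cut 𝒬.fin]; simp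
  have hPx : ∀ t ∈ Icc 0 T, P (x t) = x t := by
    intro t ht
    have hd : ∀ s ∈ Icc 0 T, HasDerivWithinAt (fun s => P (x s) - x s) 0 (Icc 0 T) s := by
      intro s hs
      have h3 := P.hasFDerivAt.comp_hasDerivWithinAt s (hx s hs)
      have h4 := h3.sub (hx s hs)
      have e : P (radialCutoff (2 * r + 1) (x s) • 𝒬.galerkin N (x s))
          - radialCutoff (2 * r + 1) (x s) • 𝒬.galerkin N (x s) = 0 := by
        rw [map_smul, galerkin, ← hP, hPP, sub_self]
      rw [e] at h4
      exact h4
    have := constant_Icc_of_hasDerivWithinAt_zero hd ht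
    simp only [hx0, hPP, sub_self] at this
    exact sub_eq_zero.1 this
  have hbound : ∀ t ∈ Icc 0 T, ‖x t‖ ≤ 2 * r + 1 := by
    intro t ht
    have hr2 : 0 < r ^ 2 / 2 := by positivity
    have hnn : ∀ s, ‖x s‖ ≤ √(‖x s‖ ^ 2 + r ^ 2 / 2) := fun s =>
      Real.le_sqrt_of_sq_le (by linarith)
    have hz : ∀ s ∈ Icc 0 T, HasDerivWithinAt (fun s => ‖x s‖ ^ 2 + r ^ 2 / 2)
        (2 * inner ℝ (x s) (radialCutoff (2 * r + 1) (x s) • 𝒬.galerkin N (x s)))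
        (Icc 0 T) s := fun s hs => (hx s hs).norm_sq.add_const _
    refine (hnn t).trans (bernoulli_bound hr hC₀ hz (fun s _ => by positivity) (fun s hs => ?_)
      ?_ hT ht)
    · have h5 := hE N (x s)
      have h6 := hPx s hs
      simp only [one_pow] at h5
      change |inner ℝ (P (x s)) _| ≤ C₀ * (1 + ‖P (x s)‖) * ‖P (x s)‖ ^ 2 at h5
      rw [real_inner_smul_right, galerkin, ← inner_cut 𝒬.fin]
      change 2 * (_ * inner ℝ (P (x s)) _) ≤ _
      have h7 := (le_abs_self _).trans h5
      rw [h6] at h7 ⊢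
      have h8 := radialCutoff_nonneg (R := 2 * r + 1) (x s)
      have h9 := radialCutoff_le_one (R := 2 * r + 1) (x s)
      have h10 := hnn s
      set I := inner ℝ (x s) (𝒬.G 0 (cut 𝒬.w N id (x s)))
      have h11 : radialCutoff (2 * r + 1) (x s) * I ≤ C₀ * (1 + ‖x s‖) * ‖x s‖ ^ 2 := by
        have : 0 ≤ C₀ * (1 + ‖x s‖) * ‖x s‖ ^ 2 := by positivity
        nlinarith
      have h12 : C₀ * (1 + ‖x s‖) * ‖x s‖ ^ 2
          ≤ C₀ * (1 + √(‖x s‖ ^ 2 + r ^ 2 / 2)) * (‖x s‖ ^ 2 + r ^ 2 / 2) := by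
        gcongr
        linarith
      linarith
    · rw [hx0]
      have := norm_cut_one_le 𝒬.fin N x₀
      have : ‖P x₀‖ ^ 2 ≤ ‖x₀‖ ^ 2 := pow_le_pow_left₀ (norm_nonneg _) this 2
      linarith
  refine ⟨x, hx0, fun t ht => ⟨?_, hPx t ht, hbound t ht⟩⟩
  have := hx t ht
  rwa [radialCutoff_eq_one (hbound t ht), one_smul] at this

end QuadraticScale

/-! ### Energy estimates for Galerkin solutions -/

namespace QuadraticScale

variable {ι : Type*} (𝒬 : QuadraticScale ι)

/-- Two-sided control of the weighted energy along a Galerkin solution. -/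
theorem energy_of_galerkin {φ : ℝ → ℝ} {C R T N : ℝ} (hC : 0 ≤ C) (hE : 𝒬.EnergyBound φ C)
    {x : ℝ → Sq ι}
    (hx : ∀ t ∈ Icc 0 T, HasDerivWithinAt x (𝒬.galerkin N (x t)) (Icc 0 T) t ∧
        cut 𝒬.w N (fun _ => 1) (x t) = x t ∧ ‖x t‖ ≤ R) :
    (∀ t ∈ Icc 0 T, ‖cut 𝒬.w N φ (x t)‖ ^ 2
        ≤ ‖cut 𝒬.w N φ (x 0)‖ ^ 2 * Real.exp (2 * C * (1 + R) * t)) ∧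
    ∀ Λ : ℝ, (∀ t ∈ Icc 0 T, ‖cut 𝒬.w N φ (x t)‖ ^ 2 ≤ Λ) → ∀ s ∈ Icc 0 T, ∀ t ∈ Icc 0 T,
      |‖cut 𝒬.w N φ (x t)‖ ^ 2 - ‖cut 𝒬.w N φ (x s)‖ ^ 2| ≤ 2 * C * (1 + R) * Λ * |t - s| := by
  have hd : ∀ t ∈ Icc 0 T, HasDerivWithinAt (fun s => ‖cut 𝒬.w N φ (x s)‖ ^ 2)
      (2 * inner ℝ (cut 𝒬.w N (fun a => φ a ^ 2) (x t)) (𝒬.galerkin N (x t))) (Icc 0 T) t :=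
    fun t ht => 𝒬.hasDerivWithinAt_norm_cut_sq (hx t ht).1 N φ
  have hb : ∀ t ∈ Icc 0 T,
      |2 * inner ℝ (cut 𝒬.w N (fun a => φ a ^ 2) (x t)) (𝒬.galerkin N (x t))|
        ≤ 2 * C * (1 + R) * ‖cut 𝒬.w N φ (x t)‖ ^ 2 := by
    intro t ht
    have h1 := hE N (x t)
    rw [(hx t ht).2.1] at h1
    have h2 : inner ℝ (cut 𝒬.w N (fun a => φ a ^ 2) (x t)) (𝒬.galerkin N (x t))
        = inner ℝ (cut 𝒬.w N (fun a => φ a ^ 2) (x t)) (𝒬.G 0 (cut 𝒬.w N id (x t))) := by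
      rw [galerkin, ← inner_cut 𝒬.fin, cut_cut 𝒬.fin]
      simp
    rw [h2, abs_mul, abs_two]
    have h3 : C * (1 + ‖x t‖) * ‖cut 𝒬.w N φ (x t)‖ ^ 2
        ≤ C * (1 + R) * ‖cut 𝒬.w N φ (x t)‖ ^ 2 := by
      have := (hx t ht).2.2
      gcongr
    linarith
  refine ⟨fun t ht => ?_, fun Λ hΛ s hs t ht => ?_⟩
  · have hR : 0 ≤ R := (norm_nonneg _).trans (hx t ht).2.2
    have := gronwall_Icc (K := 2 * C * (1 + R)) (c := 0) (by positivity) le_rfl hd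
      (fun s hs => by rw [add_zero]; exact (le_abs_self _).trans (hb s hs)) ht
    simpa using this
  · have hR : 0 ≤ R := (norm_nonneg _).trans (hx t ht).2.2
    have := (convex_Icc (0 : ℝ) T).norm_image_sub_le_of_norm_hasDerivWithin_le
      (C := 2 * C * (1 + R) * Λ) hd (fun u hu => ?_) hs ht
    · simpa [Real.norm_eq_abs] using this
    · rw [Real.norm_eq_abs]
      refine (hb u hu).trans ?_
      have := hΛ u hu
      gcongr

/-- Two Galerkin solutions with the same data, at different truncations, are close in `ℓ²`. -/
theorem galerkin_sub_le {C T R N N' κ g : ℝ} (hC : 0 ≤ C) (hD : 𝒬.DifferenceBound C)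
    (hN : 0 < N) (hNN' : N ≤ N') (hκ : 0 ≤ κ) (hg : 0 ≤ g) {x x' : ℝ → Sq ι}
    (hx : ∀ t ∈ Icc 0 T, HasDerivWithinAt x (𝒬.galerkin N (x t)) (Icc 0 T) t ∧
        cut 𝒬.w N (fun _ => 1) (x t) = x t ∧ ‖x t‖ ≤ R)
    (hx' : ∀ t ∈ Icc 0 T, HasDerivWithinAt x' (𝒬.galerkin N' (x' t)) (Icc 0 T) t ∧
        cut 𝒬.w N' (fun _ => 1) (x' t) = x' t ∧ ‖x' t‖ ≤ R)
    (h1 : ∀ t ∈ Icc 0 T, ‖cut 𝒬.w N id (x t)‖ ≤ κ)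
    (h1' : ∀ t ∈ Icc 0 T, ‖cut 𝒬.w N' id (x' t)‖ ≤ κ)
    (hG : ∀ t ∈ Icc 0 T, ∃ z, 𝒬.G 0 (cut 𝒬.w N id (x t)) = smoothing 𝒬.w z ∧ ‖z‖ ≤ g)
    {t : ℝ} (ht : t ∈ Icc 0 T) :
    ‖x t - x' t‖ ^ 2 ≤ (‖x 0 - x' 0‖ ^ 2 + 8 * R * g * N⁻¹ * t)
      * Real.exp (2 * C * (1 + κ + κ) * t) := by
  have hR : 0 ≤ R := (norm_nonneg _).trans (hx t ht).2.2
  set P := cut 𝒬.w N (fun _ => 1)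
  set P' := cut 𝒬.w N' (fun _ => 1)
  have hP'x : ∀ s ∈ Icc 0 T, P' (x s) = x s := by
    intro s hs
    rw [← (hx s hs).2.1, cut_cut_of_le 𝒬.fin hNN']
    simp only [mul_one]
    rfl
  have hidx : ∀ s ∈ Icc 0 T, cut 𝒬.w N' id (x s) = cut 𝒬.w N id (x s) := by
    intro s hs
    conv_lhs => rw [← (hx s hs).2.1]
    rw [cut_cut_of_le 𝒬.fin hNN']
    simp only [mul_one]
  have hd : ∀ s ∈ Icc 0 T, HasDerivWithinAt (fun s => ‖x s - x' s‖ ^ 2)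
      (2 * inner ℝ (x s - x' s) (𝒬.galerkin N (x s) - 𝒬.galerkin N' (x' s))) (Icc 0 T) s :=
    fun s hs => ((hx s hs).1.sub (hx' s hs).1).norm_sq
  refine gronwall_Icc (by positivity) (by positivity) hd (fun s hs => ?_) ht
  have hPd : P' (x s - x' s) = x s - x' s := by
    rw [map_sub, hP'x s hs, (hx' s hs).2.1]
  have h2 := hD N' (x s) (x' s)
  rw [hidx s hs] at h2
  change |inner ℝ (P' (x s - x' s)) _| ≤ _ * ‖P' (x s - x' s)‖ ^ 2 at h2
  have h3 : inner ℝ (x s - x' s) (𝒬.galerkin N (x s) - 𝒬.galerkin N' (x' s))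
      = inner ℝ (P' (x s - x' s))
          (𝒬.G 0 (cut 𝒬.w N id (x s)) - 𝒬.G 0 (cut 𝒬.w N' id (x' s)))
        + inner ℝ (x s - x' s) (P (𝒬.G 0 (cut 𝒬.w N id (x s)))
            - 𝒬.G 0 (cut 𝒬.w N id (x s)) )
        - inner ℝ (x s - x' s) (P' (𝒬.G 0 (cut 𝒬.w N id (x s)))
            - 𝒬.G 0 (cut 𝒬.w N id (x s)) ) := by
    have e : inner ℝ (P' (x s - x' s))
          (𝒬.G 0 (cut 𝒬.w N id (x s)) - 𝒬.G 0 (cut 𝒬.w N' id (x' s)))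
        = inner ℝ (x s - x' s)
          (P' (𝒬.G 0 (cut 𝒬.w N id (x s))) - P' (𝒬.G 0 (cut 𝒬.w N' id (x' s)))) := by
      rw [inner_cut 𝒬.fin, map_sub]
    rw [e, ← inner_add_right, ← inner_sub_right]
    congr 1
    simp only [galerkin]
    change P _ - P' _ = _
    abel
  obtain ⟨z, hz, hzg⟩ := hG s hs
  have hdR : ‖x s - x' s‖ ≤ 2 * R := (norm_sub_le _ _).trans (by
    linarith [(hx s hs).2.2, (hx' s hs).2.2])
  have hgN : N⁻¹ * ‖z‖ ≤ g * N⁻¹ := by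
    rw [mul_comm]; exact mul_le_mul_of_nonneg_right hzg (inv_pos.2 hN).le
  have hgN' : N'⁻¹ * ‖z‖ ≤ g * N⁻¹ :=
    (mul_le_mul_of_nonneg_right (inv_anti₀ hN hNN') (norm_nonneg _)).trans hgN
  have h4 : |inner ℝ (x s - x' s) (P (𝒬.G 0 (cut 𝒬.w N id (x s)))
            - 𝒬.G 0 (cut 𝒬.w N id (x s)))| ≤ 2 * R * (g * N⁻¹) := by
    refine (abs_real_inner_le_norm _ _).trans (mul_le_mul hdR ?_ (norm_nonneg _) (by positivity))
    rw [hz, norm_sub_rev]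
    exact (norm_smoothing_sub_cut_le 𝒬.one_le 𝒬.fin hN z).trans hgN
  have h5 : |inner ℝ (x s - x' s) (P' (𝒬.G 0 (cut 𝒬.w N id (x s)))
            - 𝒬.G 0 (cut 𝒬.w N id (x s)))| ≤ 2 * R * (g * N⁻¹) := by
    refine (abs_real_inner_le_norm _ _).trans (mul_le_mul hdR ?_ (norm_nonneg _) (by positivity))
    rw [hz, norm_sub_rev]
    exact (norm_smoothing_sub_cut_le 𝒬.one_le 𝒬.fin (hN.trans_le hNN') z).trans hgN'
  rw [h3]
  have h6 := (abs_le.1 h4).2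
  have h7 := (abs_le.1 h5).1
  have h8 := (le_abs_self _).trans h2
  rw [hPd] at h8 ⊢
  have h9 : C * (1 + ‖cut 𝒬.w N id (x s)‖ + ‖cut 𝒬.w N' id (x' s)‖) * ‖x s - x' s‖ ^ 2
      ≤ C * (1 + κ + κ) * ‖x s - x' s‖ ^ 2 := by
    have := h1 s hs
    have := h1' s hs
    gcongr
  linarith

/-- The weights used for the energy estimate at order `m`: the power `a ^ m`, with the last factor
capped at `K`. -/
def cappedPow (m : ℕ) (K a : ℝ) : ℝ := a ^ (m - 1) * min a K

theorem cappedPow_eq {m : ℕ} (hm : 1 ≤ m) {K a : ℝ} (ha : a ≤ K) : cappedPow m K a = a ^ m := by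
  obtain ⟨k, rfl⟩ := Nat.exists_eq_add_of_le hm
  rw [cappedPow, add_tsub_cancel_left, add_comm, pow_succ, min_eq_left ha]

end QuadraticScale

/-! ### Existence for quadratic evolution equations -/

/-- Primitives of a continuous curve on a closed interval, with one-sided derivatives at the ends. -/
theorem hasDerivWithinAt_Icc_of_eq_integral {F : Type*} [NormedAddCommGroup F] [NormedSpace ℝ F]
    [CompleteSpace F] {f g : ℝ → F} {c : F} {T : ℝ} (hg : ContinuousOn g (Icc 0 T))
    (hf : ∀ t ∈ Icc 0 T, f t = c + ∫ s in (0 : ℝ)..t, g s) {t : ℝ} (ht : t ∈ Icc 0 T) :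
    HasDerivWithinAt f (g t) (Icc 0 T) t := by
  have : Fact (t ∈ Icc 0 T) := ⟨ht⟩
  have hi : IntervalIntegrable g volume 0 t := by
    refine ContinuousOn.intervalIntegrable (hg.mono ?_)
    rw [uIcc_of_le ht.1]
    exact Icc_subset_Icc_right ht.2
  have h1 : HasDerivWithinAt (fun u => ∫ s in (0 : ℝ)..u, g s) (g t) (Icc 0 T) t :=
    intervalIntegral.integral_hasDerivWithinAt_right hi
      (hg.stronglyMeasurableAtFilter_nhdsWithin measurableSet_Icc t) (hg t ht)
  exact (h1.const_add c).congr hf (hf t ht)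

theorem integral_of_hasDerivWithinAt_Icc {F : Type*} [NormedAddCommGroup F] [NormedSpace ℝ F]
    [CompleteSpace F] {f g : ℝ → F} {T : ℝ} (hg : ContinuousOn g (Icc 0 T))
    (hf : ∀ t ∈ Icc 0 T, HasDerivWithinAt f (g t) (Icc 0 T) t) {t : ℝ} (ht : t ∈ Icc 0 T) :
    f t = f 0 + ∫ s in (0 : ℝ)..t, g s := by
  have hs : Icc 0 t ⊆ Icc 0 T := Icc_subset_Icc_right ht.2
  rw [intervalIntegral.integral_eq_sub_of_hasDerivAt_of_le ht.1
    (fun s hs' => ((hf s (hs hs')).continuousWithinAt.mono hs)) (fun s hs' => ?_)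
    (ContinuousOn.intervalIntegrable (by rw [uIcc_of_le ht.1]; exact hg.mono hs))]
  · abel
  · exact (hf s (hs (Ioo_subset_Icc_self hs'))).hasDerivAt
      (Icc_mem_nhds hs'.1 (hs'.2.trans_le ht.2))

namespace QuadraticScale

variable {ι : Type*} (𝒬 : QuadraticScale ι)

/-- Well-posedness in the space of order `m`. The solution is the limit of Galerkin solutions: these
converge in `ℓ²` and stay bounded at order `m`. Continuity in time at order `m` holds because the
energies with capped weights are Lipschitz in time uniformly in the truncation and in the cap, so
that the norm of the limit is continuous; together with weak continuity this is strong continuity. -/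
theorem exists_solution {C₀ Cm Cd T r : ℝ} {m : ℕ} (hm : 2 ≤ m) (hC₀ : 0 ≤ C₀) (hCm : 0 ≤ Cm)
    (hCd : 0 ≤ Cd) (hE0 : 𝒬.EnergyBound (fun _ => 1) C₀)
    (hEm : ∀ K, 1 ≤ K → 𝒬.EnergyBound (cappedPow m K) Cm) (hD : 𝒬.DifferenceBound Cd)
    (hr : 0 < r) (hT0 : 0 ≤ T) (hT : Real.exp (C₀ * T) ≤ 1 + 1 / (2 * r)) (y₀ : Sq ι)
    (hy₀ : ‖(smoothing 𝒬.w ^ m) y₀‖ ^ 2 ≤ r ^ 2 / 2) :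
    ∃ y : ℝ → Sq ι, y 0 = y₀ ∧ ContinuousOn y (Icc 0 T) ∧
      (∀ t ∈ Icc 0 T, ‖y t‖ ≤ ‖y₀‖ * Real.exp (Cm * (1 + (2 * r + 1)) * T)) ∧
      ∀ t ∈ Icc 0 T,
        HasDerivWithinAt (fun s => smoothing 𝒬.w (y s)) (𝒬.G (m - 1) (y t)) (Icc 0 T) t := by
  set M := smoothing 𝒬.w with hM
  set R := 2 * r + 1 with hR
  set Y := ‖y₀‖ * Real.exp (Cm * (1 + R) * T) with hY
  have hY0 : 0 ≤ Y := by positivity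
  have hR0 : 0 ≤ R := by positivity
  have h00 : (0 : ℝ) ∈ Icc 0 T := left_mem_Icc.2 hT0
  have hw0 : ∀ i, 𝒬.w i ≠ 0 := fun i => (zero_lt_one.trans_le (𝒬.one_le i)).ne'
  obtain ⟨k, hk⟩ : ∃ k, m = k + 2 := ⟨m - 2, by omega⟩
  have hm1 : m - 1 = k + 1 := by omega
  choose x hx0 hx using fun n : ℕ => 𝒬.exists_galerkin hC₀ hE0 hr hT0 hT hy₀ ((n : ℝ) + 1)
  have hn0 : ∀ n : ℕ, (0 : ℝ) < (n : ℝ) + 1 := fun n => by positivity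
  -- the Galerkin solutions, normalized at order `m`
  let Yn : ℕ → ℝ → Sq ι := fun n t => cut 𝒬.w ((n : ℝ) + 1) (fun a => a ^ m) (x n t)
  have hMYn : ∀ n, ∀ t ∈ Icc 0 T, (M ^ m) (Yn n t) = x n t := by
    intro n t ht
    conv_rhs => rw [← (hx n t ht).2.1]
    refine Sq.ext fun i => ?_
    simp only [Yn, hM, smoothing_pow_apply 𝒬.one_le, cut_apply 𝒬.fin]
    split_ifs
    · rw [← mul_assoc, inv_mul_cancel₀ (pow_ne_zero _ (hw0 i))]
    · ring
  have hid : ∀ (n : ℕ) (t : ℝ), cut 𝒬.w ((n : ℝ) + 1) id (x n t) = (M ^ (m - 1)) (Yn n t) := by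
    intro n t
    refine Sq.ext fun i => ?_
    simp only [Yn, hM, smoothing_pow_apply 𝒬.one_le, cut_apply 𝒬.fin]
    split_ifs
    · rw [← mul_assoc, hk, show k + 2 - 1 = k + 1 from rfl, pow_succ _ (k + 1), ← mul_assoc,
        inv_mul_cancel₀ (pow_ne_zero _ (hw0 i)), one_mul, id]
    · ring
  let ψ : ℝ → Sq ι → Sq ι := fun K z => dg (fun i => min (𝒬.w i) K) (M z)
  have hψa : ∀ K, 1 ≤ K → ∀ z i, ψ K z i = min (𝒬.w i) K * ((𝒬.w i)⁻¹ * z i) := by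
    intro K hK z i
    simp only [ψ]
    rw [dg_apply (C := K) (fun i => ?_), hM, smoothing_apply 𝒬.one_le]
    rw [abs_of_nonneg (le_min (zero_le_one.trans (𝒬.one_le i)) (by linarith))]
    exact min_le_right _ _
  have hcap : ∀ K, 1 ≤ K → ∀ (n : ℕ) (t : ℝ),
      cut 𝒬.w ((n : ℝ) + 1) (cappedPow m K) (x n t) = ψ K (Yn n t) := by
    intro K hK n t
    refine Sq.ext fun i => ?_
    rw [hψa K hK]
    simp only [Yn, cut_apply 𝒬.fin, cappedPow]
    split_ifs
    · have := hw0 i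
      rw [hk, show k + 2 - 1 = k + 1 from rfl, pow_succ _ (k + 1)]
      field_simp
    · ring
  have hψle : ∀ K, 1 ≤ K → ∀ z, ‖ψ K z‖ ≤ ‖z‖ := by
    intro K hK z
    refine Sq.norm_le_of_abs_le fun i => ?_
    have hwi := zero_lt_one.trans_le (𝒬.one_le i)
    rw [hψa K hK, ← mul_assoc, abs_mul, abs_of_nonneg (mul_nonneg
      (le_min hwi.le (by linarith)) (inv_nonneg.2 hwi.le))]
    refine mul_le_of_le_one_left (abs_nonneg _) ?_
    rw [← div_eq_mul_inv, div_le_one hwi]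
    exact min_le_left _ _
  have hYn0 : ∀ n, ‖Yn n 0‖ ≤ ‖y₀‖ := by
    intro n
    have : Yn n 0 = cut 𝒬.w ((n : ℝ) + 1) (fun _ => 1) y₀ := by
      refine Sq.ext fun i => ?_
      simp only [Yn, hx0, cut_apply 𝒬.fin, hM, smoothing_pow_apply 𝒬.one_le]
      split_ifs
      · rw [one_mul, ← mul_assoc, mul_inv_cancel₀ (pow_ne_zero _ (hw0 i))]
      · ring
    rw [this]
    exact norm_cut_one_le 𝒬.fin _ _
  have hYn : ∀ n, ∀ t ∈ Icc 0 T, ‖Yn n t‖ ≤ Y := by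
    intro n t ht
    have h1 : ∀ s, cut 𝒬.w ((n : ℝ) + 1) (cappedPow m ((n : ℝ) + 1)) (x n s) = Yn n s := by
      intro s
      refine Sq.ext fun i => ?_
      simp only [Yn, cut_apply 𝒬.fin]
      split_ifs with h
      · rw [cappedPow_eq (by omega) h]
      · rfl
    have h2 := (𝒬.energy_of_galerkin hCm (hEm ((n : ℝ) + 1) (by simp)) (hx n)).1 t ht
    rw [h1, h1] at h2
    refine le_of_sq_le_sq (h2.trans ?_) hY0
    rw [hY, mul_pow, ← Real.exp_nat_mul]
    have h3 : 2 * Cm * (1 + R) * t ≤ ((2 : ℕ) : ℝ) * (Cm * (1 + R) * T) := by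
      have : Cm * (1 + R) * t ≤ Cm * (1 + R) * T :=
        mul_le_mul_of_nonneg_left ht.2 (by positivity)
      push_cast
      linarith
    exact mul_le_mul (pow_le_pow_left₀ (norm_nonneg _) (hYn0 n) 2) (Real.exp_le_exp.2 h3)
      (Real.exp_pos _).le (by positivity)
  have hpow : ∀ j z, ‖(M ^ j) z‖ ≤ ‖z‖ := norm_smoothing_pow_apply_le 𝒬.one_le
  -- the Galerkin vector field is bounded at order one
  set g := (‖𝒬.L 1‖ + ‖𝒬.B 1‖ * Y) * Y with hg
  have hg0 : 0 ≤ g := by positivity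
  have hG1 : ∀ (n : ℕ) (t : ℝ), 𝒬.G 0 (cut 𝒬.w ((n : ℝ) + 1) id (x n t)) = M (𝒬.G 1 ((M ^ k) (Yn n t))) := by
    intro n t
    rw [hid, hM, smoothing_G, hm1, pow_succ', mul_apply_eq_comp]
  have hG1le : ∀ z, ‖z‖ ≤ Y → ‖𝒬.G 1 ((M ^ k) z)‖ ≤ g := by
    intro z hz
    have h1 := (hpow k z).trans hz
    refine (𝒬.norm_G_le 1 _).trans ?_
    rw [hg]
    gcongr
  have hcutid : ∀ n : ℕ, ∀ t ∈ Icc 0 T, ‖cut 𝒬.w ((n : ℝ) + 1) id (x n t)‖ ≤ Y := fun n t ht => by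
    rw [hid]; exact (hpow _ _).trans (hYn n t ht)
  -- convergence in `ℓ²`
  set A := (4 * ‖y₀‖ ^ 2 + 8 * R * g * T) * Real.exp (2 * Cd * (1 + Y + Y) * T) with hA
  have hcauchy : ∀ t ∈ Icc 0 T, ∀ n n' : ℕ, n ≤ n' →
      ‖x n t - x n' t‖ ^ 2 ≤ A * ((n : ℝ) + 1)⁻¹ := by
    intro t ht n n' hnn
    have hle : (n : ℝ) + 1 ≤ (n' : ℝ) + 1 := by
      have : (n : ℝ) ≤ n' := by exact_mod_cast hnn
      linarith
    have h1 := 𝒬.galerkin_sub_le hCd hD (hn0 n) hle hY0 hg0 (hx n) (hx n') (hcutid n) (hcutid n')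
      (fun s hs => ⟨_, hG1 n s, hG1le _ (hYn n s hs)⟩) ht
    refine h1.trans ?_
    have hinv : ((n : ℝ) + 1)⁻¹ ≤ 1 := inv_le_one_of_one_le₀ (by linarith [n.cast_nonneg (α := ℝ)])
    have hinv0 : 0 ≤ ((n : ℝ) + 1)⁻¹ := (inv_pos.2 (hn0 n)).le
    have h2 : ‖x n 0 - x n' 0‖ ≤ 2 * (((n : ℝ) + 1)⁻¹ * ‖y₀‖) := by
      have hz : (M ^ m) y₀ = M ((M ^ (k + 1)) y₀) := by
        rw [hk, ← mul_apply_eq_comp, ← pow_succ']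
      have h3 := norm_smoothing_sub_cut_le 𝒬.one_le 𝒬.fin (hn0 n) ((M ^ (k + 1)) y₀)
      have h4 := norm_smoothing_sub_cut_le 𝒬.one_le 𝒬.fin (hn0 n') ((M ^ (k + 1)) y₀)
      rw [hx0, hx0, hz]
      have h5 := hpow (k + 1) y₀
      have h6 : ((n' : ℝ) + 1)⁻¹ ≤ ((n : ℝ) + 1)⁻¹ := inv_anti₀ (hn0 n) hle
      have h7 : ((n : ℝ) + 1)⁻¹ * ‖(M ^ (k + 1)) y₀‖ ≤ ((n : ℝ) + 1)⁻¹ * ‖y₀‖ :=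
        mul_le_mul_of_nonneg_left h5 hinv0
      have h8 : ((n' : ℝ) + 1)⁻¹ * ‖(M ^ (k + 1)) y₀‖ ≤ ((n : ℝ) + 1)⁻¹ * ‖y₀‖ :=
        mul_le_mul h6 h5 (norm_nonneg _) hinv0
      rw [norm_sub_rev] at h3
      have h9 := norm_sub_le_norm_sub_add_norm_sub
        (cut 𝒬.w ((n : ℝ) + 1) (fun _ => 1) (M ((M ^ (k + 1)) y₀))) (M ((M ^ (k + 1)) y₀))
        (cut 𝒬.w ((n' : ℝ) + 1) (fun _ => 1) (M ((M ^ (k + 1)) y₀)))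
      linarith
    have h3 : ‖x n 0 - x n' 0‖ ^ 2 ≤ 4 * ‖y₀‖ ^ 2 * ((n : ℝ) + 1)⁻¹ := by
      have := pow_le_pow_left₀ (norm_nonneg _) h2 2
      refine this.trans ?_
      have e : (2 * (((n : ℝ) + 1)⁻¹ * ‖y₀‖)) ^ 2
          = 4 * ‖y₀‖ ^ 2 * ((n : ℝ) + 1)⁻¹ * ((n : ℝ) + 1)⁻¹ := by ring
      rw [e]
      exact mul_le_of_le_one_right (by positivity) hinv
    have h4 : ‖x n 0 - x n' 0‖ ^ 2 + 8 * R * g * ((n : ℝ) + 1)⁻¹ * t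
        ≤ (4 * ‖y₀‖ ^ 2 + 8 * R * g * T) * ((n : ℝ) + 1)⁻¹ := by
      have : 8 * R * g * ((n : ℝ) + 1)⁻¹ * t ≤ 8 * R * g * ((n : ℝ) + 1)⁻¹ * T :=
        mul_le_mul_of_nonneg_left ht.2 (by positivity)
      linarith
    have h5 : Real.exp (2 * Cd * (1 + Y + Y) * t) ≤ Real.exp (2 * Cd * (1 + Y + Y) * T) :=
      Real.exp_le_exp.2 (mul_le_mul_of_nonneg_left ht.2 (by positivity))
    calc _ ≤ (4 * ‖y₀‖ ^ 2 + 8 * R * g * T) * ((n : ℝ) + 1)⁻¹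
          * Real.exp (2 * Cd * (1 + Y + Y) * T) :=
          mul_le_mul h4 h5 (Real.exp_pos _).le (by positivity)
      _ = _ := by rw [hA]; ring
  have hA0 : 0 ≤ A := by positivity
  have hlim : ∀ t ∈ Icc 0 T, ∃ z : Sq ι, ‖z‖ ≤ Y ∧
      Tendsto (fun n => x n t) atTop (𝓝 ((M ^ m) z)) := by
    intro t ht
    have hcs : CauchySeq fun n => x n t := by
      refine cauchySeq_of_le_tendsto_0 (fun n : ℕ => √(A * ((n : ℝ) + 1)⁻¹)) (fun n n' N hn hn' => ?_)
        ?_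
      · have key : ∀ a b : ℕ, N ≤ a → a ≤ b → dist (x a t) (x b t) ≤ √(A * ((N : ℝ) + 1)⁻¹) := by
          intro a b hNa hab
          rw [dist_eq_norm]
          refine Real.le_sqrt_of_sq_le ((hcauchy t ht a b hab).trans ?_)
          refine mul_le_mul_of_nonneg_left (inv_anti₀ (hn0 N) ?_) hA0
          have : (N : ℝ) ≤ a := by exact_mod_cast hNa
          linarith
        rcases le_total n n' with h | h
        · exact key n n' hn h
        · rw [dist_comm]; exact key n' n hn' h
      · have h1 : Tendsto (fun n : ℕ => A * ((n : ℝ) + 1)⁻¹) atTop (𝓝 (A * 0)) := by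
          refine Tendsto.const_mul A ?_
          simpa only [one_div] using tendsto_one_div_add_atTop_nhds_zero_nat (𝕜 := ℝ)
        rw [mul_zero] at h1
        simpa using h1.sqrt
    obtain ⟨xl, hxl⟩ := cauchySeq_tendsto_of_complete hcs
    obtain ⟨z, hz, hzY⟩ := Sq.exists_of_tendsto (u := fun n => Yn n t) (R := Y)
      (f := fun i => 𝒬.w i ^ m * xl i) (fun n => hYn n t ht) (fun i => by
        have h1 : Tendsto (fun n => x n t i) atTop (𝓝 (xl i)) :=
          ((Sq.continuous_apply i).tendsto xl).comp hxl
        refine (h1.const_mul (𝒬.w i ^ m)).congr' ?_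
        filter_upwards [eventually_ge_atTop ⌈𝒬.w i⌉₊] with n hn
        simp only [Yn, cut_apply 𝒬.fin]
        rw [if_pos]
        have := (Nat.le_ceil (𝒬.w i)).trans (by exact_mod_cast hn : ((⌈𝒬.w i⌉₊ : ℕ) : ℝ) ≤ n)
        linarith)
    refine ⟨z, hzY, ?_⟩
    have : (M ^ m) z = xl := by
      refine Sq.ext fun i => ?_
      rw [hM, smoothing_pow_apply 𝒬.one_le, hz, ← mul_assoc,
        inv_mul_cancel₀ (pow_ne_zero _ (hw0 i)), one_mul]
    rwa [this]
  choose! y hyY hylim using hlim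
  have hMlim : ∀ t ∈ Icc 0 T, Tendsto (fun n => M (Yn n t)) atTop (𝓝 (M (y t))) := by
    intro t ht
    have h1 : Tendsto (fun n => M (Yn n t - y t)) atTop (𝓝 0) := by
      refine tendsto_smoothing_of_tendsto_pow 𝒬.one_le (m := m) (by omega) (R := Y + Y)
        (Eventually.of_forall fun n => (norm_sub_le _ _).trans (add_le_add (hYn n t ht) (hyY t ht)))
        ?_
      have h2 := (hylim t ht).sub_const ((M ^ m) (y t))
      rw [sub_self] at h2
      refine h2.congr fun n => ?_
      rw [map_sub]
      change _ = (M ^ m) (Yn n t) - _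
      rw [hMYn n t ht]
    have h3 := h1.add_const (M (y t))
    rw [zero_add] at h3
    refine h3.congr fun n => ?_
    rw [map_sub]; abel
  have hMklim : ∀ t ∈ Icc 0 T, Tendsto (fun n => 𝒬.G 0 ((M ^ (m - 1)) (Yn n t))) atTop
      (𝓝 (𝒬.G 0 ((M ^ (m - 1)) (y t)))) := by
    intro t ht
    have h1 := ((M ^ k).continuous.tendsto _).comp (hMlim t ht)
    have h2 := ((𝒬.continuous_G 0).tendsto _).comp h1
    have e : ∀ z, (M ^ (m - 1)) z = (M ^ k) (M z) := fun z => by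
      rw [hm1, pow_succ, mul_apply_eq_comp]
    simp only [e]
    exact h2
  have hy0 : y 0 = y₀ := by
    refine smoothing_injective 𝒬.one_le m ?_
    refine tendsto_nhds_unique (hylim 0 h00) ?_
    have h1 : Tendsto (fun n : ℕ => ((n : ℝ) + 1)⁻¹ * ‖(M ^ (k + 1)) y₀‖) atTop (𝓝 0) := by
      have := (tendsto_one_div_add_atTop_nhds_zero_nat (𝕜 := ℝ)).mul_const ‖(M ^ (k + 1)) y₀‖
      simpa only [one_div, zero_mul] using this
    rw [tendsto_iff_norm_sub_tendsto_zero]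
    refine squeeze_zero (fun _ => norm_nonneg _) (fun n => ?_) h1
    have hz : (smoothing 𝒬.w ^ m) y₀ = M ((M ^ (k + 1)) y₀) := by
      rw [hk, ← mul_apply_eq_comp, ← pow_succ']
    rw [hx0, norm_sub_rev, hz]
    exact norm_smoothing_sub_cut_le 𝒬.one_le 𝒬.fin (hn0 n) _
  -- the norm at order `m` is Lipschitz in time
  have hLip : ∀ s ∈ Icc 0 T, ∀ t ∈ Icc 0 T,
      |‖y t‖ ^ 2 - ‖y s‖ ^ 2| ≤ 2 * Cm * (1 + R) * Y ^ 2 * |t - s| := by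
    intro s hs t ht
    have h1 : ∀ K, 1 ≤ K →
        |‖ψ K (y t)‖ ^ 2 - ‖ψ K (y s)‖ ^ 2| ≤ 2 * Cm * (1 + R) * Y ^ 2 * |t - s| := by
      intro K hK
      have h2 : ∀ u ∈ Icc 0 T, Tendsto (fun n => ‖ψ K (Yn n u)‖ ^ 2) atTop
          (𝓝 (‖ψ K (y u)‖ ^ 2)) := fun u hu =>
        ((((dg fun i => min (𝒬.w i) K).continuous.tendsto _).comp (hMlim u hu)).norm).pow 2
      refine le_of_tendsto ((h2 t ht).sub (h2 s hs)).abs (Eventually.of_forall fun n => ?_)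
      have h3 := (𝒬.energy_of_galerkin hCm (hEm K hK) (hx n)).2 (Y ^ 2) (fun u hu => by
        rw [hcap K hK]
        exact pow_le_pow_left₀ (norm_nonneg _) ((hψle K hK _).trans (hYn n u hu)) 2) s hs t ht
      rwa [hcap K hK, hcap K hK] at h3
    have h2 : ∀ z : Sq ι, Tendsto (fun n : ℕ => ‖ψ ((n : ℝ) + 1) z‖ ^ 2) atTop (𝓝 (‖z‖ ^ 2)) := by
      intro z
      simp only [Sq.norm_sq]
      refine tendsto_tsum_of_dominated_convergence (bound := fun i => z i ^ 2) (Sq.summable_sq z)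
        (fun i => ?_) (Eventually.of_forall fun n i => ?_)
      · refine tendsto_const_nhds.congr' ?_
        filter_upwards [eventually_ge_atTop ⌈𝒬.w i⌉₊] with n hn
        have := (Nat.le_ceil (𝒬.w i)).trans (by exact_mod_cast hn : ((⌈𝒬.w i⌉₊ : ℕ) : ℝ) ≤ n)
        rw [hψa _ (by simp), min_eq_left (by linarith), ← mul_assoc, mul_inv_cancel₀ (hw0 i),
          one_mul]
      · have hwi := zero_lt_one.trans_le (𝒬.one_le i)
        rw [Real.norm_of_nonneg (sq_nonneg _), hψa _ (by simp), ← mul_assoc]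
        refine sq_le_sq.2 ?_
        rw [abs_mul, abs_of_nonneg (mul_nonneg (le_min hwi.le (hn0 n).le) (inv_nonneg.2 hwi.le))]
        refine mul_le_of_le_one_left (abs_nonneg _) ?_
        rw [← div_eq_mul_inv, div_le_one hwi]
        exact min_le_left _ _
    exact le_of_tendsto ((h2 (y t)).sub (h2 (y s))).abs
      (Eventually.of_forall fun n => h1 _ (by simp))
  -- the coordinates are Lipschitz in time
  have hxLip : ∀ s ∈ Icc 0 T, ∀ t ∈ Icc 0 T, ‖(M ^ m) (y t) - (M ^ m) (y s)‖ ≤ g * |t - s| := by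
    intro s hs t ht
    refine le_of_tendsto ((hylim t ht).sub (hylim s hs)).norm (Eventually.of_forall fun n => ?_)
    have := (convex_Icc (0 : ℝ) T).norm_image_sub_le_of_norm_hasDerivWithin_le (C := g)
      (fun u hu => (hx n u hu).1) (fun u hu => ?_) hs ht
    · simpa [Real.norm_eq_abs] using this
    · refine (norm_cut_one_le 𝒬.fin _ _).trans ?_
      rw [hG1]
      exact (by simpa using hpow 1 _ : ‖M _‖ ≤ _).trans (hG1le _ (hYn n u hu))
  have hycont : ContinuousOn y (Icc 0 T) := by
    intro t ht
    have : (𝓝[Icc 0 T] t).NeBot := nhdsWithin_neBot_of_mem ht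
    have h0 : ∀ c : ℝ, Tendsto (fun s => c * |s - t|) (𝓝[Icc 0 T] t) (𝓝 0) := by
      intro c
      have : Continuous fun s : ℝ => c * |s - t| := by fun_prop
      simpa using (this.tendsto t).mono_left nhdsWithin_le_nhds
    refine Sq.tendsto_of_coord_of_norm (fun i => ?_) ?_
    · have h1 : Tendsto (fun s => (M ^ m) (y s)) (𝓝[Icc 0 T] t) (𝓝 ((M ^ m) (y t))) := by
        rw [tendsto_iff_norm_sub_tendsto_zero]
        refine squeeze_zero' (Eventually.of_forall fun _ => norm_nonneg _) ?_ (h0 g)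
        filter_upwards [self_mem_nhdsWithin] with s hs using hxLip t ht s hs
      have h2 := (((Sq.continuous_apply i).tendsto _).comp h1).const_mul (𝒬.w i ^ m)
      have e : ∀ s, 𝒬.w i ^ m * ((M ^ m) (y s)) i = y s i := fun s => by
        rw [hM, smoothing_pow_apply 𝒬.one_le, ← mul_assoc,
          mul_inv_cancel₀ (pow_ne_zero _ (hw0 i)), one_mul]
      simpa only [Function.comp_def, e] using h2
    · rw [tendsto_iff_norm_sub_tendsto_zero]
      refine squeeze_zero' (Eventually.of_forall fun _ => norm_nonneg _) ?_
        (h0 (2 * Cm * (1 + R) * Y ^ 2))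
      filter_upwards [self_mem_nhdsWithin] with s hs using hLip t ht s hs
  -- the equation, integrated in time
  have hint : ∀ t ∈ Icc 0 T,
      (M ^ m) (y t) = (M ^ m) y₀ + ∫ s in (0 : ℝ)..t, 𝒬.G 0 ((M ^ (m - 1)) (y s)) := by
    intro t ht
    have hsub : Icc 0 t ⊆ Icc 0 T := Icc_subset_Icc_right ht.2
    have hgc : ∀ n : ℕ, ContinuousOn (fun s => 𝒬.galerkin ((n : ℝ) + 1) (x n s)) (Icc 0 T) := by
      intro n
      have h1 : ContinuousOn (x n) (Icc 0 T) := fun s hs => (hx n s hs).1.continuousWithinAt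
      have h2 : Continuous (𝒬.galerkin ((n : ℝ) + 1)) :=
        (cut _ _ _).continuous.comp ((𝒬.continuous_G 0).comp (cut _ _ _).continuous)
      exact h2.comp_continuousOn h1
    have h1 : ∀ n : ℕ, x n t = x n 0 + ∫ s in (0 : ℝ)..t, 𝒬.galerkin ((n : ℝ) + 1) (x n s) := fun n =>
      integral_of_hasDerivWithinAt_Icc (hgc n) (fun s hs => (hx n s hs).1) ht
    have h2 : Tendsto (fun n : ℕ => ∫ s in (0 : ℝ)..t, 𝒬.galerkin ((n : ℝ) + 1) (x n s)) atTop
        (𝓝 (∫ s in (0 : ℝ)..t, 𝒬.G 0 ((M ^ (m - 1)) (y s)))) := by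
      refine intervalIntegral.tendsto_integral_filter_of_dominated_convergence (fun _ => g) ?_ ?_
        intervalIntegrable_const ?_
      · refine Eventually.of_forall fun n => ?_
        rw [uIoc_of_le ht.1]
        exact ((hgc n).mono (Ioc_subset_Icc_self.trans hsub)).aestronglyMeasurable
          measurableSet_Ioc
      · refine Eventually.of_forall fun n => Eventually.of_forall fun s hs => ?_
        rw [uIoc_of_le ht.1] at hs
        refine (norm_cut_one_le 𝒬.fin _ _).trans ?_
        rw [hG1]
        exact (by simpa using hpow 1 _ : ‖M _‖ ≤ _).trans
          (hG1le _ (hYn n s (hsub (Ioc_subset_Icc_self hs))))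
      · refine Eventually.of_forall fun s hs => ?_
        rw [uIoc_of_le ht.1] at hs
        have hs' := hsub (Ioc_subset_Icc_self hs)
        have h3 : Tendsto (fun n : ℕ => 𝒬.galerkin ((n : ℝ) + 1) (x n s)
            - 𝒬.G 0 ((M ^ (m - 1)) (Yn n s))) atTop (𝓝 0) := by
          rw [tendsto_zero_iff_norm_tendsto_zero]
          have h4 : Tendsto (fun n : ℕ => ((n : ℝ) + 1)⁻¹ * g) atTop (𝓝 0) := by
            have := (tendsto_one_div_add_atTop_nhds_zero_nat (𝕜 := ℝ)).mul_const g
            simpa only [one_div, zero_mul] using this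
          refine squeeze_zero (fun _ => norm_nonneg _) (fun n => ?_) h4
          rw [galerkin, ← hid, hG1, norm_sub_rev]
          refine (norm_smoothing_sub_cut_le 𝒬.one_le 𝒬.fin (hn0 n) _).trans ?_
          exact mul_le_mul_of_nonneg_left (hG1le _ (hYn n s hs')) (inv_pos.2 (hn0 n)).le
        have h5 := h3.add (hMklim s hs')
        simpa using h5
    have h3 := (hylim 0 h00).add h2
    rw [hy0] at h3
    exact tendsto_nhds_unique (hylim t ht) (h3.congr fun n => (h1 n).symm)
  have hGc : ContinuousOn (fun s => 𝒬.G (m - 1) (y s)) (Icc 0 T) :=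
    (𝒬.continuous_G _).comp_continuousOn hycont
  refine ⟨y, hy0, hycont, hyY, fun t ht => ?_⟩
  refine hasDerivWithinAt_Icc_of_eq_integral (c := M y₀) hGc (fun s hs => ?_) ht
  refine smoothing_injective 𝒬.one_le (m - 1) ?_
  have hi : IntervalIntegrable (fun u => 𝒬.G (m - 1) (y u)) volume 0 s := by
    refine ContinuousOn.intervalIntegrable (hGc.mono ?_)
    rw [uIcc_of_le hs.1]
    exact Icc_subset_Icc_right hs.2
  have e : ∀ z, (M ^ m) z = (M ^ (m - 1)) (M z) := fun z => by
    rw [← mul_apply_eq_comp, ← pow_succ, hm1, hk]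
  have h1 := hint s hs
  rw [e, e] at h1
  change (M ^ (m - 1)) (M (y s)) = (M ^ (m - 1)) _
  rw [h1, map_add, ← ContinuousLinearMap.intervalIntegral_comp_comm _ hi]
  congr 1
  refine intervalIntegral.integral_congr fun u _ => ?_
  have := 𝒬.smoothing_pow_G 0 (m - 1) (y u)
  rw [zero_add] at this
  exact this.symm

end QuadraticScale

/-! ### The vector field of the system on Fourier coefficients -/

/-- The index set of the coefficient sequences: two components, and the frequencies. -/
abbrev Idx : Type := Bool × ℤ

/-- The weight `1 + |n|` of the frequency `n`. -/
def fr (n : ℤ) : ℝ := 1 + |(n : ℝ)|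

theorem one_le_fr (n : ℤ) : 1 ≤ fr n := by
  unfold fr; linarith [abs_nonneg (n : ℝ)]

theorem fr_pos (n : ℤ) : 0 < fr n := zero_lt_one.trans_le (one_le_fr n)

theorem fr_add_le (a b : ℤ) : fr (a + b) ≤ fr a * fr b := by
  unfold fr
  push_cast
  have := abs_add_le (a : ℝ) b
  nlinarith [abs_nonneg (a : ℝ), abs_nonneg (b : ℝ), mul_nonneg (abs_nonneg (a : ℝ)) (abs_nonneg (b : ℝ))]

theorem fr_neg (n : ℤ) : fr (-n) = fr n := by simp [fr]

theorem abs_le_fr (n : ℤ) : |(n : ℝ)| ≤ fr n := by unfold fr; linarith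

/-- The weight of an index. -/
def wt (i : Idx) : ℝ := fr i.2

theorem one_le_wt (i : Idx) : 1 ≤ wt i := one_le_fr i.2

theorem wt_fin (N : ℝ) : {i : Idx | wt i ≤ N}.Finite := by
  have h : {i : Idx | wt i ≤ N} ⊆ (univ : Set Bool) ×ˢ (Icc (-⌈N⌉) ⌈N⌉) := by
    rintro ⟨c, n⟩ h
    simp only [Set.mem_ofPred_eq, wt, fr] at h
    have h1 : |(n : ℝ)| ≤ ⌈N⌉ := by linarith [Int.le_ceil N]
    have h2 := abs_le.1 h1
    simp only [mem_prod, mem_univ, true_and, mem_Icc]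
    exact ⟨by exact_mod_cast h2.1, by exact_mod_cast h2.2⟩
  exact (finite_univ.prod (finite_Icc _ _)).subset h

theorem smoothing_wt_apply (y : Sq Idx) (c : Bool) (n : ℤ) :
    smoothing wt y (c, n) = (fr n)⁻¹ * y (c, n) := smoothing_apply one_le_wt y (c, n)

/-- The index map of `shiftOp`. -/
def shiftIdx (fl : Bool) (p : ℤ) (i : Idx) : Idx := (xor fl i.1, i.2 - p)

theorem shiftIdx_injective (fl : Bool) (p : ℤ) : Function.Injective (shiftIdx fl p) := by
  rintro ⟨a, n⟩ ⟨b, k⟩ h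
  simp only [shiftIdx, Prod.mk.injEq] at h
  refine Prod.ext ?_ (by simpa using h.2)
  have := h.1
  revert this
  cases fl <;> cases a <;> cases b <;> simp

/-- The operator `x ↦ ((c, n) ↦ χ c * θ (n - p) * x (c', n - p))` with `c' = c` or `c' ≠ c` according
to `fl`, normalized as an operator from the space of order `s + 1` to that of order `s`. It
multiplies a Fourier series by a pure wave of frequency `p`, after the Fourier multiplier `θ`. -/
def shiftOp (s : ℕ) (χ : Bool → ℝ) (θ : ℤ → ℝ) (fl : Bool) (p : ℤ) : Sq Idx →L[ℝ] Sq Idx :=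
  wcomp (fun i => fr i.2 ^ s * (χ i.1 * θ (i.2 - p)) * (fr (i.2 - p) ^ (s + 1))⁻¹) (shiftIdx fl p)

section shiftOp

variable {χ : Bool → ℝ} {θ : ℤ → ℝ} {Θ : ℝ}

theorem shiftOp_coeff_le (hχ : ∀ c, |χ c| ≤ 1) (hθ : ∀ l, |θ l| ≤ Θ * fr l) (s : ℕ) (p : ℤ)
    (i : Idx) :
    |fr i.2 ^ s * (χ i.1 * θ (i.2 - p)) * (fr (i.2 - p) ^ (s + 1))⁻¹| ≤ Θ * fr p ^ s := by
  have h1 : fr i.2 ≤ fr p * fr (i.2 - p) := by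
    simpa using fr_add_le p (i.2 - p)
  have hp := fr_pos p
  have hn := fr_pos i.2
  have hl := fr_pos (i.2 - p)
  have hΘ : 0 ≤ Θ * fr (i.2 - p) := (abs_nonneg _).trans (hθ _)
  rw [abs_mul, abs_mul, abs_mul, abs_of_pos (pow_pos hn s), abs_of_pos (inv_pos.2 (pow_pos hl _))]
  rw [← div_eq_mul_inv, div_le_iff₀ (pow_pos hl _)]
  have h2 : fr i.2 ^ s ≤ fr p ^ s * fr (i.2 - p) ^ s := by
    rw [← mul_pow]; exact pow_le_pow_left₀ hn.le h1 s
  have h3 : |χ i.1| * |θ (i.2 - p)| ≤ Θ * fr (i.2 - p) := by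
    have := mul_le_mul (hχ i.1) (hθ (i.2 - p)) (abs_nonneg _) zero_le_one
    linarith
  calc _ ≤ (fr p ^ s * fr (i.2 - p) ^ s) * (Θ * fr (i.2 - p)) :=
        mul_le_mul h2 h3 (by positivity) (by positivity)
    _ = _ := by ring

theorem shiftOp_ok (hχ : ∀ c, |χ c| ≤ 1) (hθ : ∀ l, |θ l| ≤ Θ * fr l) (s : ℕ) (fl : Bool) (p : ℤ) :
    WcompOK (fun i : Idx => fr i.2 ^ s * (χ i.1 * θ (i.2 - p)) * (fr (i.2 - p) ^ (s + 1))⁻¹)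
      (shiftIdx fl p) :=
  ⟨⟨_, shiftOp_coeff_le hχ hθ s p⟩, shiftIdx_injective fl p⟩

theorem shiftOp_apply (hχ : ∀ c, |χ c| ≤ 1) (hθ : ∀ l, |θ l| ≤ Θ * fr l) (s : ℕ) (fl : Bool) (p : ℤ)
    (y : Sq Idx) (c : Bool) (n : ℤ) :
    shiftOp s χ θ fl p y (c, n)
      = fr n ^ s * (χ c * θ (n - p)) * (fr (n - p) ^ (s + 1))⁻¹ * y (xor fl c, n - p) :=
  wcomp_apply (shiftOp_ok hχ hθ s fl p) y (c, n)

theorem norm_shiftOp_le (hΘ : 0 ≤ Θ) (hχ : ∀ c, |χ c| ≤ 1) (hθ : ∀ l, |θ l| ≤ Θ * fr l) (s : ℕ)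
    (fl : Bool) (p : ℤ) : ‖shiftOp s χ θ fl p‖ ≤ Θ * fr p ^ s :=
  norm_wcomp_le (shiftOp_coeff_le hχ hθ s p) (mul_nonneg hΘ (pow_nonneg (fr_pos p).le _))
    (shiftIdx_injective fl p)

theorem smoothing_shiftOp (hχ : ∀ c, |χ c| ≤ 1) (hθ : ∀ l, |θ l| ≤ Θ * fr l) (s : ℕ) (fl : Bool)
    (p : ℤ) (y : Sq Idx) :
    smoothing wt (shiftOp (s + 1) χ θ fl p y) = shiftOp s χ θ fl p (smoothing wt y) := by
  refine Sq.ext fun ⟨c, n⟩ => ?_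
  rw [smoothing_wt_apply, shiftOp_apply hχ hθ, shiftOp_apply hχ hθ, smoothing_wt_apply]
  have h1 := (fr_pos n).ne'
  have h2 := (fr_pos (n - p)).ne'
  rw [pow_succ (fr n), pow_succ (fr (n - p)) (s + 1)]
  field_simp

end shiftOp

/-- The coefficient sequence of component `c` of the element of the space of order `s + 1` that `y`
represents. -/
def raw (s : ℕ) (y : Sq Idx) (c : Bool) (n : ℤ) : ℝ := (fr n ^ (s + 1))⁻¹ * y (c, n)

theorem raw_smoothing (s : ℕ) (y : Sq Idx) : raw s (smoothing wt y) = raw (s + 1) y := by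
  ext c n
  rw [raw, raw, smoothing_wt_apply, pow_succ _ (s + 1), mul_inv, mul_assoc]

/-- Sine coefficients of the odd primitive of `sin θ * α`, where `x` are the sine coefficients
of `α`. -/
def aSeq (x : ℤ → ℝ) (n : ℤ) : ℝ := (2 * (n : ℝ))⁻¹ * (x (n + 1) - x (n - 1))

/-- Sine coefficients of the velocity of that primitive. -/
def vSeq (x : ℤ → ℝ) (n : ℤ) : ℝ := -(|(n : ℝ)|⁻¹ * aSeq x n)

/-- Cosine coefficients of the velocity divided by `sin θ`. -/
def qSeq (x : ℤ → ℝ) (j : ℤ) : ℝ := 2 * ∑' i : ℕ, vSeq x (|j| + 1 + 2 * i)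

/-- Cosine coefficients of the velocity times `cot θ`. -/
def cSeq (x : ℤ → ℝ) (j : ℤ) : ℝ := 1 / 2 * (qSeq x (j - 1) + qSeq x (j + 1))

/-- `aSeq` as a continuous functional on the space of order `s + 1`. -/
def aF (s : ℕ) (c : Bool) (n : ℤ) : Sq Idx →L[ℝ] ℝ :=
  (2 * (n : ℝ))⁻¹ • ((fr (n + 1) ^ (s + 1))⁻¹ • coord (c, n + 1)
    - (fr (n - 1) ^ (s + 1))⁻¹ • coord (c, n - 1))

/-- `vSeq` as a continuous functional on the space of order `s + 1`. -/
def vF (s : ℕ) (c : Bool) (n : ℤ) : Sq Idx →L[ℝ] ℝ := -(|(n : ℝ)|⁻¹ • aF s c n)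

/-- `qSeq` as a continuous functional on the space of order `s + 1`. -/
def qF (s : ℕ) (c : Bool) (j : ℤ) : Sq Idx →L[ℝ] ℝ :=
  (2 : ℝ) • ∑' i : ℕ, vF s c (|j| + 1 + 2 * i)

/-- `cSeq` as a continuous functional on the space of order `s + 1`. -/
def cF (s : ℕ) (c : Bool) (j : ℤ) : Sq Idx →L[ℝ] ℝ :=
  (1 / 2 : ℝ) • (qF s c (j - 1) + qF s c (j + 1))

theorem aF_apply (s : ℕ) (c : Bool) (n : ℤ) (y : Sq Idx) : aF s c n y = aSeq (raw s y c) n := by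
  simp [aF, aSeq, raw]

theorem vF_apply (s : ℕ) (c : Bool) (n : ℤ) (y : Sq Idx) : vF s c n y = vSeq (raw s y c) n := by
  simp [vF, vSeq, aF_apply]

theorem abs_cast_le_of_ne {n : ℤ} (hn : n ≠ 0) : 1 ≤ |(n : ℝ)| := by
  exact_mod_cast Int.one_le_abs hn

theorem fr_le_two_mul_abs {n : ℤ} (hn : n ≠ 0) : fr n ≤ 2 * |(n : ℝ)| := by
  unfold fr; linarith [abs_cast_le_of_ne hn]

/-- The decay of the functionals `aF`, at order `s`. -/
theorem norm_aF_le (s : ℕ) (c : Bool) (n : ℤ) :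
    fr n ^ s * ‖aF s c n‖ ≤ 2 ^ (s + 1) * (fr n)⁻¹ * |(n : ℝ)|⁻¹ := by
  have key : ∀ k : ℤ, fr n ≤ 2 * fr k → ‖(fr k ^ (s + 1))⁻¹ • coord (c, k)‖
      ≤ 2 ^ (s + 1) * (fr n ^ (s + 1))⁻¹ := by
    intro k hk
    rw [norm_smul, Real.norm_of_nonneg (inv_nonneg.2 (pow_nonneg (fr_pos k).le _))]
    refine (mul_le_of_le_one_right (inv_nonneg.2 (pow_nonneg (fr_pos k).le _))
      (norm_coord_le _)).trans ?_
    rw [← div_eq_mul_inv, inv_eq_one_div, div_le_div_iff₀ (pow_pos (fr_pos k) _)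
      (pow_pos (fr_pos n) _), one_mul, ← mul_pow]
    exact pow_le_pow_left₀ (fr_pos n).le hk _
  have hf : fr 1 = 2 := by norm_num [fr]
  have h1 : fr n ≤ 2 * fr (n + 1) := by
    have := fr_add_le (-1) (n + 1)
    rw [fr_neg, hf] at this
    simpa using this
  have h2 : fr n ≤ 2 * fr (n - 1) := by
    have := fr_add_le 1 (n - 1)
    rw [hf] at this
    simpa using this
  have h3 : ‖aF s c n‖ ≤ (2 * |(n : ℝ)|)⁻¹ * (2 * (2 ^ (s + 1) * (fr n ^ (s + 1))⁻¹)) := by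
    rw [aF, norm_smul, norm_inv, norm_mul, Real.norm_two, Real.norm_eq_abs]
    refine mul_le_mul_of_nonneg_left ((norm_sub_le _ _).trans ?_) (by positivity)
    linarith [key _ h1, key _ h2]
  have hp := fr_pos n
  calc fr n ^ s * ‖aF s c n‖
      ≤ fr n ^ s * ((2 * |(n : ℝ)|)⁻¹ * (2 * (2 ^ (s + 1) * (fr n ^ (s + 1))⁻¹))) :=
        mul_le_mul_of_nonneg_left h3 (by positivity)
    _ = _ := by
      rw [pow_succ (fr n), mul_inv, mul_inv]
      have : fr n ^ s ≠ 0 := (pow_pos hp s).ne'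
      field_simp

theorem summable_inv_sq_int : Summable fun n : ℤ => (fr n)⁻¹ * |(n : ℝ)|⁻¹ := by
  have h : Summable fun n : ℤ => 1 / |(n : ℝ)| ^ (2 : ℝ) := by
    simpa using Real.summable_one_div_int_add_rpow 0 2
  refine Summable.of_nonneg_of_le (fun n => by have := fr_pos n; positivity) (fun n => ?_) h
  rcases eq_or_ne n 0 with rfl | hn
  · simp
  · have h1 := abs_cast_le_of_ne hn
    rw [Real.rpow_two, one_div, pow_two, mul_inv]
    exact mul_le_mul_of_nonneg_right (inv_anti₀ (by linarith) (abs_le_fr n)) (by positivity)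

theorem summable_aF (s : ℕ) (c : Bool) : Summable fun n : ℤ => fr n ^ s * ‖aF s c n‖ := by
  refine Summable.of_nonneg_of_le (fun n => by have := fr_pos n; positivity) (norm_aF_le s c) ?_
  simpa only [mul_assoc] using summable_inv_sq_int.mul_left (2 ^ (s + 1))

theorem norm_vF (s : ℕ) (c : Bool) (n : ℤ) : ‖vF s c n‖ = |(n : ℝ)|⁻¹ * ‖aF s c n‖ := by
  rw [vF, norm_neg, norm_smul, norm_inv, Real.norm_eq_abs, abs_abs]

theorem inv_abs_cast_le_one (n : ℤ) : |(n : ℝ)|⁻¹ ≤ 1 := by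
  rcases eq_or_ne n 0 with rfl | hn
  · simp
  · exact inv_le_one_of_one_le₀ (abs_cast_le_of_ne hn)

theorem summable_vF (s : ℕ) (c : Bool) : Summable fun n : ℤ => fr n ^ s * ‖vF s c n‖ := by
  refine Summable.of_nonneg_of_le (fun n => by have := fr_pos n; positivity) (fun n => ?_)
    (summable_aF s c)
  rw [norm_vF]
  refine mul_le_mul_of_nonneg_left ?_ (pow_nonneg (fr_pos n).le _)
  exact mul_le_of_le_one_left (norm_nonneg _) (inv_abs_cast_le_one n)

/-- Each `n` is of the form `|j| + 1 + 2 i` for at most `2 n` integers `j`. -/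
theorem tail_sums {g : ℕ → ℝ} (hg : ∀ n, 0 ≤ g n) (hs : Summable fun n : ℕ => (n : ℝ) * g n) :
    (∀ j : ℤ, Summable fun i : ℕ => g (j.natAbs + 1 + 2 * i)) ∧
    (Summable fun j : ℤ => ∑' i : ℕ, g (j.natAbs + 1 + 2 * i)) ∧
    ∑' j : ℤ, ∑' i : ℕ, g (j.natAbs + 1 + 2 * i) ≤ 2 * ∑' n : ℕ, (n : ℝ) * g n := by
  have hinj : ∀ j : ℤ, Function.Injective fun i : ℕ => j.natAbs + 1 + 2 * i := fun j a b h => by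
    simp only at h; omega
  have hgs : ∀ j : ℤ, Summable fun i : ℕ => g (j.natAbs + 1 + 2 * i) := by
    intro j
    refine Summable.of_nonneg_of_le (fun _ => hg _) (fun i => ?_) (hs.comp_injective (hinj j))
    simp only [Function.comp]
    refine le_mul_of_one_le_left (hg _) ?_
    push_cast
    have : (0 : ℝ) ≤ j.natAbs := by positivity
    have : (0 : ℝ) ≤ i := by positivity
    linarith
  have hE : ∑' j : ℤ, ∑' i : ℕ, ENNReal.ofReal (g (j.natAbs + 1 + 2 * i))
      ≤ ∑' n : ℕ, ENNReal.ofReal (2 * (n * g n)) := by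
    calc _ ≤ ∑' j : ℤ, ∑' n : ℕ, if j.natAbs < n then ENNReal.ofReal (g n) else 0 := by
          refine ENNReal.tsum_le_tsum fun j => ?_
          refine le_trans (le_of_eq ?_) (ENNReal.tsum_comp_le_tsum_of_injective (hinj j) _)
          refine tsum_congr fun i => ?_
          rw [if_pos (by omega)]
      _ = ∑' n : ℕ, ∑' j : ℤ, if j.natAbs < n then ENNReal.ofReal (g n) else 0 :=
          ENNReal.tsum_comm
      _ ≤ _ := by
          refine ENNReal.tsum_le_tsum fun n => ?_
          have hF : ∀ j : ℤ, j ∉ Finset.Ioo (-(n : ℤ)) n →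
              (if j.natAbs < n then ENNReal.ofReal (g n) else 0) = 0 := by
            intro j hj
            rw [if_neg]
            intro h
            exact hj (by rw [Finset.mem_Ioo]; omega)
          rw [tsum_eq_sum hF]
          refine (Finset.sum_le_card_nsmul _ _ (ENNReal.ofReal (g n)) fun j _ => ?_).trans ?_
          · split_ifs <;> simp
          · rw [Int.card_Ioo, nsmul_eq_mul, ← ENNReal.ofReal_natCast,
              ← ENNReal.ofReal_mul (by positivity)]
            refine ENNReal.ofReal_le_ofReal ?_
            rw [← mul_assoc]
            refine mul_le_mul_of_nonneg_right ?_ (hg n)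
            have : ((n : ℤ) - -(n : ℤ) - 1).toNat ≤ 2 * n := by omega
            exact_mod_cast this
  have hs2 : Summable fun n : ℕ => 2 * ((n : ℝ) * g n) := hs.mul_left 2
  have hn2 : ∀ n : ℕ, 0 ≤ 2 * ((n : ℝ) * g n) := fun n =>
    mul_nonneg zero_le_two (mul_nonneg (by positivity) (hg n))
  have hin : ∀ j : ℤ, ∑' i : ℕ, ENNReal.ofReal (g (j.natAbs + 1 + 2 * i))
      = ENNReal.ofReal (∑' i : ℕ, g (j.natAbs + 1 + 2 * i)) := fun j =>
    (ENNReal.ofReal_tsum_of_nonneg (fun _ => hg _) (hgs j)).symm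
  simp only [hin] at hE
  rw [← ENNReal.ofReal_tsum_of_nonneg hn2 hs2] at hE
  have hnn : ∀ j : ℤ, 0 ≤ ∑' i : ℕ, g (j.natAbs + 1 + 2 * i) := fun j => tsum_nonneg fun _ => hg _
  have hsum : Summable fun j : ℤ => ∑' i : ℕ, g (j.natAbs + 1 + 2 * i) := by
    have h1 : ∑' j : ℤ, ENNReal.ofReal (∑' i : ℕ, g (j.natAbs + 1 + 2 * i)) ≠ ⊤ :=
      ne_top_of_le_ne_top ENNReal.ofReal_ne_top hE
    have h2 := ENNReal.summable_toReal h1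
    refine h2.congr fun j => ENNReal.toReal_ofReal (hnn j)
  refine ⟨hgs, hsum, ?_⟩
  rw [← ENNReal.ofReal_tsum_of_nonneg hnn hsum] at hE
  rw [← tsum_mul_left]
  exact (ENNReal.ofReal_le_ofReal_iff (tsum_nonneg hn2)).1 hE

theorem natAbs_tail (j : ℤ) (i : ℕ) :
    ((j.natAbs + 1 + 2 * i : ℕ) : ℤ) = |j| + 1 + 2 * i := by
  push_cast
  rfl

theorem fr_mono {a b : ℤ} (h : |a| ≤ |b|) : fr a ≤ fr b := by
  unfold fr
  have : |(a : ℝ)| ≤ |(b : ℝ)| := by exact_mod_cast h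
  linarith

theorem summable_nat_vF (s : ℕ) (c : Bool) :
    Summable fun n : ℕ => (n : ℝ) * (fr n ^ s * ‖vF s c n‖) := by
  refine Summable.of_nonneg_of_le (fun n => by have := fr_pos n; positivity) (fun n => ?_)
    ((summable_aF s c).comp_injective Nat.cast_injective)
  simp only [Function.comp]
  rw [norm_vF, Int.cast_natCast, Nat.abs_cast]
  rcases eq_or_ne n 0 with rfl | hn
  · have := fr_pos 0
    simp only [CharP.cast_eq_zero, zero_mul]
    positivity
  · have : (n : ℝ) ≠ 0 := by exact_mod_cast hn
    refine le_of_eq ?_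
    field_simp

theorem summable_vF_tail (s : ℕ) (c : Bool) (j : ℤ) :
    Summable fun i : ℕ => vF s c (|j| + 1 + 2 * i) := by
  refine Summable.of_norm_bounded ((tail_sums (g := fun n => fr n ^ s * ‖vF s c n‖)
    (fun n => by have := fr_pos n; positivity) (summable_nat_vF s c)).1 j) fun i => ?_
  rw [natAbs_tail]
  exact le_mul_of_one_le_left (norm_nonneg _) (one_le_pow₀ (one_le_fr _))

theorem qF_apply (s : ℕ) (c : Bool) (j : ℤ) (y : Sq Idx) : qF s c j y = qSeq (raw s y c) j := by
  have h := ((ContinuousLinearMap.apply ℝ ℝ y).hasSum (summable_vF_tail s c j).hasSum).tsum_eq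
  rw [qF, qSeq, smul_apply, smul_eq_mul]
  congr 1
  refine Eq.trans h.symm (tsum_congr fun i => vF_apply _ _ _ _)

theorem cF_apply (s : ℕ) (c : Bool) (j : ℤ) (y : Sq Idx) : cF s c j y = cSeq (raw s y c) j := by
  simp [cF, cSeq, qF_apply]
  ring

theorem summable_qF (s : ℕ) (c : Bool) : Summable fun j : ℤ => fr j ^ s * ‖qF s c j‖ := by
  have h := tail_sums (g := fun n => fr n ^ s * ‖vF s c n‖)
    (fun n => by have := fr_pos n; positivity) (summable_nat_vF s c)
  refine Summable.of_nonneg_of_le (fun n => by have := fr_pos n; positivity) (fun j => ?_)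
    (h.2.1.mul_left 2)
  have hv : Summable fun i : ℕ => ‖vF s c (|j| + 1 + 2 * i)‖ := by
    refine Summable.of_nonneg_of_le (fun _ => norm_nonneg _) (fun i => ?_) (h.1 j)
    rw [natAbs_tail]
    exact le_mul_of_one_le_left (norm_nonneg _) (one_le_pow₀ (one_le_fr _))
  have h1 : ‖qF s c j‖ ≤ 2 * ∑' i : ℕ, ‖vF s c (|j| + 1 + 2 * i)‖ := by
    rw [qF, norm_smul, Real.norm_two]
    exact mul_le_mul_of_nonneg_left (norm_tsum_le_tsum_norm hv) zero_le_two
  calc fr j ^ s * ‖qF s c j‖ ≤ fr j ^ s * (2 * ∑' i : ℕ, ‖vF s c (|j| + 1 + 2 * i)‖) :=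
        mul_le_mul_of_nonneg_left h1 (pow_nonneg (fr_pos j).le _)
    _ = 2 * ∑' i : ℕ, fr j ^ s * ‖vF s c (|j| + 1 + 2 * i)‖ := by rw [tsum_mul_left]; ring
    _ ≤ _ := by
      refine mul_le_mul_of_nonneg_left ((hv.mul_left _).tsum_le_tsum (fun i => ?_) (h.1 j))
        zero_le_two
      rw [natAbs_tail]
      refine mul_le_mul_of_nonneg_right (pow_le_pow_left₀ (fr_pos j).le (fr_mono ?_) s)
        (norm_nonneg _)
      have := abs_nonneg j
      rw [abs_of_nonneg (by omega : 0 ≤ |j| + 1 + 2 * (i : ℤ))]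
      omega

theorem summable_cF (s : ℕ) (c : Bool) : Summable fun j : ℤ => fr j ^ s * ‖cF s c j‖ := by
  have h1 : Summable fun j : ℤ => fr (j - 1) ^ s * ‖qF s c (j - 1)‖ :=
    (summable_qF s c).comp_injective (sub_left_injective (b := (1 : ℤ)))
  have h2 : Summable fun j : ℤ => fr (j + 1) ^ s * ‖qF s c (j + 1)‖ :=
    (summable_qF s c).comp_injective (add_left_injective (1 : ℤ))
  refine Summable.of_nonneg_of_le (fun n => by have := fr_pos n; positivity) (fun j => ?_)
    ((h1.add h2).mul_left (2 ^ s))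
  have hf : fr 1 = 2 := by norm_num [fr]
  have e1 : fr j ^ s ≤ 2 ^ s * fr (j + 1) ^ s := by
    have := fr_add_le (-1) (j + 1)
    rw [fr_neg, hf] at this
    rw [← mul_pow]
    exact pow_le_pow_left₀ (fr_pos j).le (by simpa using this) s
  have e2 : fr j ^ s ≤ 2 ^ s * fr (j - 1) ^ s := by
    have := fr_add_le 1 (j - 1)
    rw [hf] at this
    rw [← mul_pow]
    exact pow_le_pow_left₀ (fr_pos j).le (by simpa using this) s
  have h3 : ‖cF s c j‖ ≤ ‖qF s c (j - 1)‖ + ‖qF s c (j + 1)‖ := by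
    rw [cF, norm_smul]
    have := norm_add_le (qF s c (j - 1)) (qF s c (j + 1))
    rw [Real.norm_of_nonneg (by norm_num)]
    linarith [norm_nonneg (qF s c (j - 1)), norm_nonneg (qF s c (j + 1)),
      norm_nonneg (qF s c (j - 1) + qF s c (j + 1))]
  calc fr j ^ s * ‖cF s c j‖ ≤ fr j ^ s * (‖qF s c (j - 1)‖ + ‖qF s c (j + 1)‖) :=
        mul_le_mul_of_nonneg_left h3 (pow_nonneg (fr_pos j).le _)
    _ ≤ _ := by
      have := mul_le_mul_of_nonneg_right e1 (norm_nonneg (qF s c (j + 1)))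
      have := mul_le_mul_of_nonneg_right e2 (norm_nonneg (qF s c (j - 1)))
      nlinarith

/-! ### The quadratic vector field -/

/-- The bilinear operator `(y, z) ↦ ∑ p, f p y • T p z`. -/
def bil (f : ℤ → Sq Idx →L[ℝ] ℝ) (T : ℤ → Sq Idx →L[ℝ] Sq Idx) :
    Sq Idx →L[ℝ] Sq Idx →L[ℝ] Sq Idx :=
  ∑' p, (f p).smulRight (T p)

theorem summable_smulRight_of_norm {E F : Type*} [NormedAddCommGroup E] [NormedSpace ℝ E]
    [NormedAddCommGroup F] [NormedSpace ℝ F] [CompleteSpace F] {ι : Type*} {f : ι → E →L[ℝ] ℝ}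
    {T : ι → F} (h : Summable fun p => ‖f p‖ * ‖T p‖) :
    Summable fun p => (f p).smulRight (T p) :=
  Summable.of_norm_bounded h fun _ => (ContinuousLinearMap.norm_smulRight_apply _ _).le

theorem summable_smulRight {f : ℤ → Sq Idx →L[ℝ] ℝ} {T : ℤ → Sq Idx →L[ℝ] Sq Idx} {s : ℕ} {K : ℝ}
    (hf : Summable fun p => fr p ^ s * ‖f p‖) (hT : ∀ p, ‖T p‖ ≤ K * fr p ^ s) :
    Summable fun p => (f p).smulRight (T p) := by
  refine summable_smulRight_of_norm (Summable.of_nonneg_of_le (fun p => by positivity) (fun p => ?_)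
    (hf.mul_left K))
  have h2 := mul_le_mul_of_nonneg_left (hT p) (norm_nonneg (f p))
  exact h2.trans_eq (by ring)

theorem hasSum_bil {f : ℤ → Sq Idx →L[ℝ] ℝ} {T : ℤ → Sq Idx →L[ℝ] Sq Idx}
    (h : Summable fun p => (f p).smulRight (T p)) (y z : Sq Idx) :
    HasSum (fun p => f p y • T p z) (bil f T y z) := by
  have h1 : HasSum (fun p => (f p).smulRight (T p)) (bil f T) := h.hasSum
  have h2 : HasSum (fun p => (f p).smulRight (T p) y) (bil f T y) :=
    h1.mapL (ContinuousLinearMap.apply ℝ (Sq Idx →L[ℝ] Sq Idx) y)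
  have h3 : HasSum (fun p => ((f p).smulRight (T p) y) z) (bil f T y z) :=
    h2.mapL (ContinuousLinearMap.apply ℝ (Sq Idx) z)
  exact h3

/-- The indicator of a component. -/
def comp (c : Bool) (b : Bool) : ℝ := if b = c then 1 else 0

theorem abs_comp_le (c b : Bool) : |comp c b| ≤ 1 := by
  unfold comp; split_ifs <;> simp

theorem abs_one_le (_ : Bool) : |(1 : ℝ)| ≤ 1 := by simp

theorem abs_sign_le (l : ℤ) : |((l.sign : ℤ) : ℝ)| ≤ 1 := by
  rcases lt_trichotomy l 0 with h | h | h
  · simp [Int.sign_eq_neg_one_of_neg h]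
  · simp [h]
  · simp [Int.sign_eq_one_of_pos h]

theorem le_mul_fr {x Θ : ℝ} (hΘ : 0 ≤ Θ) (h : x ≤ Θ) (l : ℤ) : x ≤ Θ * fr l :=
  h.trans (le_mul_of_one_le_right hΘ (one_le_fr l))

/-- The three kinds of bilinear terms: transport by the velocity, multiplication by the velocity
times `cot θ`, and multiplication of the Hilbert transform by the primitive. -/
inductive Kind
  | transport | stretch | hilbert
  deriving DecidableEq

instance : Fintype Kind :=
  ⟨{.transport, .stretch, .hilbert}, fun k => by cases k <;> simp⟩

namespace Kind

/-- The Fourier multiplier of a bilinear term. -/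
def mult : Kind → ℤ → ℝ
  | transport, l => l
  | stretch, _ => 1
  | hilbert, l => (l.sign : ℤ)

/-- Whether a bilinear term acts on the other component. -/
def flip : Kind → Bool
  | transport => false
  | stretch => false
  | hilbert => true

/-- The coefficients of a bilinear term in component `c`, as functionals. -/
def coef (s : ℕ) (c : Bool) : Kind → ℤ → Sq Idx →L[ℝ] ℝ
  | transport, p => (-(1 / 2) : ℝ) • vF s (!c) p
  | stretch, p => (-(1 / 2) : ℝ) • cF s (!c) p
  | hilbert, p => (-(1 / 2) : ℝ) • aF s c p

/-- The coefficients of a bilinear term, in terms of the two coefficient sequences. -/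
def seq (x : Bool → ℤ → ℝ) (c : Bool) : Kind → ℤ → ℝ
  | transport, p => -(1 / 2) * vSeq (x (!c)) p
  | stretch, p => -(1 / 2) * cSeq (x (!c)) p
  | hilbert, p => -(1 / 2) * aSeq (x c) p

theorem abs_mult_le (k : Kind) (l : ℤ) : |k.mult l| ≤ 1 * fr l := by
  cases k
  · rw [one_mul]; exact abs_le_fr l
  · exact le_mul_fr zero_le_one (by simp [mult]) l
  · exact le_mul_fr zero_le_one (abs_sign_le l) l

theorem coef_apply (s : ℕ) (c : Bool) (k : Kind) (p : ℤ) (y : Sq Idx) :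
    k.coef s c p y = k.seq (raw s y) c p := by
  cases k <;> simp [coef, seq, vF_apply, cF_apply, aF_apply]

theorem summable_coef (s : ℕ) (c : Bool) (k : Kind) :
    Summable fun p : ℤ => fr p ^ s * ‖k.coef s c p‖ := by
  cases k
  · refine ((summable_vF s (!c)).mul_left (1 / 2)).congr fun p => ?_
    simp only [coef, norm_smul, norm_neg]
    rw [Real.norm_of_nonneg (by norm_num)]
    ring
  · refine ((summable_cF s (!c)).mul_left (1 / 2)).congr fun p => ?_
    simp only [coef, norm_smul, norm_neg]
    rw [Real.norm_of_nonneg (by norm_num)]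
    ring
  · refine ((summable_aF s c).mul_left (1 / 2)).congr fun p => ?_
    simp only [coef, norm_smul, norm_neg]
    rw [Real.norm_of_nonneg (by norm_num)]
    ring

end Kind

/-- The operators of a bilinear term. -/
def bilShift (s : ℕ) (c : Bool) (k : Kind) (p : ℤ) : Sq Idx →L[ℝ] Sq Idx :=
  shiftOp s (comp c) k.mult k.flip p

theorem summable_bilTerm (s : ℕ) (c : Bool) (k : Kind) :
    Summable fun p => (k.coef s c p).smulRight (bilShift s c k p) :=
  summable_smulRight (K := 1) (k.summable_coef s c) fun p =>
    norm_shiftOp_le zero_le_one (abs_comp_le c) k.abs_mult_le s _ p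

/-- The quadratic part of the vector field. -/
def bilinearPart (s : ℕ) : Sq Idx →L[ℝ] Sq Idx →L[ℝ] Sq Idx :=
  ∑ j : Bool × Kind, bil (j.2.coef s j.1) (bilShift s j.1 j.2)

theorem bilinearPart_apply (s : ℕ) (y z : Sq Idx) :
    bilinearPart s y z = ∑ j : Bool × Kind, bil (j.2.coef s j.1) (bilShift s j.1 j.2) y z := by
  simp [bilinearPart, sum_apply]

theorem hasSum_bilTerm (s : ℕ) (c : Bool) (k : Kind) (y z : Sq Idx) :
    HasSum (fun p => k.seq (raw s y) c p • bilShift s c k p z)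
      (bil (k.coef s c) (bilShift s c k) y z) := by
  simpa only [Kind.coef_apply] using hasSum_bil (summable_bilTerm s c k) y z

theorem smoothing_bilinearPart (s : ℕ) (y z : Sq Idx) :
    smoothing wt (bilinearPart (s + 1) y z)
      = bilinearPart s (smoothing wt y) (smoothing wt z) := by
  rw [bilinearPart_apply, bilinearPart_apply, map_sum]
  refine Finset.sum_congr rfl fun j _ => ?_
  have h1 := (smoothing wt).hasSum (hasSum_bilTerm (s + 1) j.1 j.2 y z)
  have h2 := hasSum_bilTerm s j.1 j.2 (smoothing wt y) (smoothing wt z)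
  have e : (fun p => smoothing wt (j.2.seq (raw (s + 1) y) j.1 p • bilShift (s + 1) j.1 j.2 p z))
      = fun p => j.2.seq (raw s (smoothing wt y)) j.1 p • bilShift s j.1 j.2 p (smoothing wt z) := by
    ext1 p
    rw [map_smul, bilShift, smoothing_shiftOp (abs_comp_le _) j.2.abs_mult_le, raw_smoothing]
    rfl
  rw [← e] at h2
  exact h1.unique h2

/-- The frequencies of the linear part. -/
def linFreq : Finset ℤ := {0, 2, -2}

/-- The diagonal multipliers of the linear part. -/
def linMult₁ (p l : ℤ) : ℝ :=
  if p = 0 then -(1 / 2) + (-(((l : ℝ) - 1)⁻¹) + ((l : ℝ) + 1)⁻¹)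
  else if p = 2 then -(1 / 4) + ((l : ℝ) + 1)⁻¹
  else -(1 / 4) - ((l : ℝ) - 1)⁻¹

/-- The off-diagonal multipliers of the linear part. -/
def linMult₂ (p l : ℤ) : ℝ :=
  if p = 0 then 2 * (((l : ℝ) - 1)⁻¹ * |(l : ℝ) - 1|⁻¹) - 2 * (((l : ℝ) + 1)⁻¹ * |(l : ℝ) + 1|⁻¹)
  else if p = 2 then 1 / 2 * (l.sign : ℤ) - 2 * (((l : ℝ) + 1)⁻¹ * |(l : ℝ) + 1|⁻¹)
  else -(1 / 2) * (l.sign : ℤ) + 2 * (((l : ℝ) - 1)⁻¹ * |(l : ℝ) - 1|⁻¹)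

theorem abs_inv_int_le (n : ℤ) : |((n : ℝ))⁻¹| ≤ 1 := by
  rw [abs_inv]; exact inv_abs_cast_le_one n

theorem abs_linMult₁_le (p l : ℤ) : |linMult₁ p l| ≤ 5 := by
  have h1 := abs_le.1 (abs_inv_int_le (l - 1))
  have h2 := abs_le.1 (abs_inv_int_le (l + 1))
  push_cast at h1 h2
  unfold linMult₁
  split_ifs <;> rw [abs_le] <;> constructor <;> linarith [h1.1, h1.2, h2.1, h2.2]

theorem abs_linMult₂_le (p l : ℤ) : |linMult₂ p l| ≤ 5 := by
  have key : ∀ n : ℤ, |(n : ℝ)⁻¹ * |(n : ℝ)|⁻¹| ≤ 1 := fun n => by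
    rw [abs_mul, abs_inv, abs_inv, abs_abs]
    exact mul_le_one₀ (inv_abs_cast_le_one n) (by positivity) (inv_abs_cast_le_one n)
  have h1 := abs_le.1 (key (l - 1))
  have h2 := abs_le.1 (key (l + 1))
  have h3 := abs_le.1 (abs_sign_le l)
  push_cast at h1 h2
  unfold linMult₂
  split_ifs <;> rw [abs_le] <;> constructor <;> linarith [h1.1, h1.2, h2.1, h2.2, h3.1, h3.2]

/-- The linear part of the vector field. -/
def linearPart (s : ℕ) : Sq Idx →L[ℝ] Sq Idx :=
  (-(1 / 4) : ℝ) • (shiftOp s (fun _ => 1) (fun l => l) false 2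
      - shiftOp s (fun _ => 1) (fun l => l) false (-2))
    + ∑ p ∈ linFreq, (shiftOp s (fun _ => 1) (linMult₁ p) false p
      + shiftOp s (fun _ => 1) (linMult₂ p) true p)

theorem abs_id_le (l : ℤ) : |(l : ℝ)| ≤ 1 * fr l := by rw [one_mul]; exact abs_le_fr l

theorem smoothing_linearPart (s : ℕ) (y : Sq Idx) :
    smoothing wt (linearPart (s + 1) y) = linearPart s (smoothing wt y) := by
  have h1 := fun (p l : ℤ) => le_mul_fr (by norm_num) (abs_linMult₁_le p l) l
  have h2 := fun (p l : ℤ) => le_mul_fr (by norm_num) (abs_linMult₂_le p l) l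
  simp only [linearPart, add_apply, smul_apply, sub_apply, sum_apply, map_add, map_smul, map_sub,
    map_sum, smoothing_shiftOp abs_one_le abs_id_le, smoothing_shiftOp abs_one_le (h1 _),
    smoothing_shiftOp abs_one_le (h2 _)]

/-- The projection onto odd sequences without the frequencies `0` and `±1`. -/
def oddProj : Sq Idx →L[ℝ] Sq Idx :=
  (1 / 2 : ℝ) • (dg (fun i => if 2 ≤ |i.2| then 1 else 0)
    - wcomp (fun i => if 2 ≤ |i.2| then 1 else 0) (fun i => (i.1, -i.2)))

theorem oddProj_apply (y : Sq Idx) (c : Bool) (n : ℤ) :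
    oddProj y (c, n) = if 2 ≤ |n| then 1 / 2 * (y (c, n) - y (c, -n)) else 0 := by
  have hb : ∀ i : Idx, |(if 2 ≤ |i.2| then 1 else 0 : ℝ)| ≤ 1 := fun i => by
    split_ifs <;> simp
  have hinj : Function.Injective fun i : Idx => (i.1, -i.2) := by
    rintro ⟨a, n⟩ ⟨b, k⟩ h
    simpa using h
  have h1 := dg_apply hb y (c, n)
  have h2 := wcomp_apply ⟨⟨1, hb⟩, hinj⟩ y (c, n)
  simp only [oddProj, smul_apply, sub_apply, lp.coeFn_smul, lp.coeFn_sub, Pi.smul_apply,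
    Pi.sub_apply, smul_eq_mul, h1, h2]
  split_ifs <;> ring

theorem smoothing_oddProj (y : Sq Idx) :
    smoothing wt (oddProj y) = oddProj (smoothing wt y) := by
  refine Sq.ext fun ⟨c, n⟩ => ?_
  rw [smoothing_wt_apply, oddProj_apply, oddProj_apply, smoothing_wt_apply, smoothing_wt_apply,
    fr_neg]
  split_ifs <;> ring

/-- The system, as a quadratic vector field on the scale of coefficient sequences. -/
def mhdScale : QuadraticScale Idx where
  w := wt
  one_le := one_le_wt
  fin := wt_fin
  L s := oddProj ∘L linearPart s ∘L oddProj
  B s := ((ContinuousLinearMap.compL ℝ _ _ _ oddProj) ∘L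
    ((ContinuousLinearMap.compL ℝ _ _ _).flip oddProj) ∘L bilinearPart s) ∘L oddProj
  smoothing_L s y := by
    simp only [ContinuousLinearMap.comp_apply, smoothing_oddProj, smoothing_linearPart]
  smoothing_B s y z := by
    simp [smoothing_oddProj, smoothing_bilinearPart]

theorem mhdScale_G (s : ℕ) (y : Sq Idx) : mhdScale.G s y
    = oddProj (linearPart s (oddProj y) + bilinearPart s (oddProj y) (oddProj y)) := by
  rw [map_add]
  rfl

/-! ### Admissible weights and the sums of the coefficients -/

/-- Weights on frequencies for which the energy estimate holds with a constant that depends on `K`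
only. -/
structure Admissible (φ : ℝ → ℝ) (K : ℝ) : Prop where
  one_le : 1 ≤ K
  map_one : φ 1 = 1
  mono : ∀ {x y}, 1 ≤ x → x ≤ y → φ x ≤ φ y
  add_le : ∀ {x y}, 1 ≤ x → 1 ≤ y → φ (x + y) ≤ K * (φ x + φ y)
  diff_le : ∀ {x y}, 1 ≤ x → x ≤ y → y * (φ y - φ x) ≤ K * ((y - x) * φ y)

theorem admissible_one : Admissible (fun _ => 1) 1 where
  one_le := le_rfl
  map_one := rfl
  mono _ _ := le_rfl
  add_le _ _ := by norm_num
  diff_le _ h := by simpa using h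

theorem pow_diff_le (k : ℕ) {x y : ℝ} (hx : 0 ≤ x) (h : x ≤ y) :
    y * (y ^ k - x ^ k) ≤ k * ((y - x) * y ^ k) := by
  induction k with
  | zero => simp
  | succ k ih =>
    have h1 : x * (y * (y ^ k - x ^ k)) ≤ x * (k * ((y - x) * y ^ k)) :=
      mul_le_mul_of_nonneg_left ih hx
    have h2 : x * (k * ((y - x) * y ^ k)) ≤ y * (k * ((y - x) * y ^ k)) :=
      mul_le_mul_of_nonneg_right h (mul_nonneg (Nat.cast_nonneg k)
        (mul_nonneg (sub_nonneg.2 h) (pow_nonneg (hx.trans h) k)))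
    push_cast
    rw [pow_succ, pow_succ]
    nlinarith

/-- Capped powers are admissible, with a constant that does not depend on the cap. -/
theorem admissible_cappedPow {m : ℕ} (hm : 1 ≤ m) {K : ℝ} (hK : 1 ≤ K) :
    Admissible (QuadraticScale.cappedPow m K) (2 ^ m) := by
  have hmono : ∀ {x y : ℝ}, 1 ≤ x → x ≤ y → QuadraticScale.cappedPow m K x ≤ QuadraticScale.cappedPow m K y := by
    intro x y hx h
    unfold QuadraticScale.cappedPow
    have : 0 ≤ min x K := le_min (by linarith) (by linarith)
    have : 0 ≤ y := by linarith
    gcongr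
  have hnn : ∀ {x : ℝ}, 1 ≤ x → 0 ≤ QuadraticScale.cappedPow m K x := fun hx => by
    unfold QuadraticScale.cappedPow
    have : 0 ≤ min _ K := le_min (zero_le_one.trans hx) (by linarith)
    have := zero_le_one.trans hx
    positivity
  have hdbl : ∀ {x : ℝ}, 1 ≤ x → QuadraticScale.cappedPow m K (x + x) ≤ 2 ^ m * QuadraticScale.cappedPow m K x := by
    intro x hx
    unfold QuadraticScale.cappedPow
    obtain ⟨k, rfl⟩ := Nat.exists_eq_add_of_le' hm
    rw [add_tsub_cancel_right, ← two_mul, mul_pow, pow_succ]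
    have h1 : min (2 * x) K ≤ 2 * min x K := by
      rcases le_total x K with h | h
      · rw [min_eq_left h]; exact min_le_left _ _
      · rw [min_eq_right h]; exact (min_le_right _ _).trans (by linarith)
    have : 0 ≤ 2 ^ k * x ^ k := by positivity
    nlinarith [mul_le_mul_of_nonneg_left h1 this]
  refine ⟨one_le_pow₀ (by norm_num), by simp [QuadraticScale.cappedPow, hK], hmono, fun {x y} hx hy => ?_,
    fun {x y} hx h => ?_⟩
  · have h1 := hnn hx
    have h2 := hnn hy
    have h3 : (0 : ℝ) ≤ 2 ^ m := by positivity
    rcases le_total x y with h | h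
    · refine (hmono (by linarith) (by linarith : x + y ≤ y + y)).trans ((hdbl hy).trans ?_)
      exact mul_le_mul_of_nonneg_left (by linarith) h3
    · refine (hmono (by linarith) (by linarith : x + y ≤ x + x)).trans ((hdbl hx).trans ?_)
      exact mul_le_mul_of_nonneg_left (by linarith) h3
  · have hy : 1 ≤ y := hx.trans h
    unfold QuadraticScale.cappedPow
    have h1 := pow_diff_le (m - 1) (zero_le_one.trans hx) h
    have hmy : 0 ≤ min y K := le_min (by linarith) (by linarith)
    have h2 : y * (min y K - min x K) ≤ (y - x) * min y K := by
      have : x * min y K ≤ y * min x K := by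
        rcases le_total x K with h' | h'
        · rw [min_eq_left h', mul_comm]
          exact mul_le_mul_of_nonneg_right (min_le_left _ _) (by linarith)
        · rw [min_eq_right h', min_eq_right (h'.trans h)]
          exact mul_le_mul_of_nonneg_right h (by linarith)
      linarith
    have h3 : x ^ (m - 1) * (y * (min y K - min x K)) ≤ y ^ (m - 1) * ((y - x) * min y K) :=
      (mul_le_mul_of_nonneg_left h2 (by positivity)).trans
        (mul_le_mul_of_nonneg_right (pow_le_pow_left₀ (by linarith) h _)
          (mul_nonneg (by linarith) hmy))
    have h4 := mul_le_mul_of_nonneg_left h1 hmy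
    have h5 : (((m - 1 : ℕ) : ℝ) + 1) ≤ 2 ^ m := by
      have : m - 1 + 1 ≤ 2 ^ m := by
        rw [Nat.sub_add_cancel hm]; exact Nat.lt_two_pow_self.le
      exact_mod_cast this
    have h6 : 0 ≤ (y - x) * (y ^ (m - 1) * min y K) :=
      mul_nonneg (by linarith) (mul_nonneg (by positivity) hmy)
    have h7 := mul_le_mul_of_nonneg_right h5 h6
    nlinarith

namespace Admissible

variable {φ : ℝ → ℝ} {K : ℝ} (h : Admissible φ K)
include h

theorem one_le_apply {x : ℝ} (hx : 1 ≤ x) : 1 ≤ φ x := h.map_one ▸ h.mono le_rfl hx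

theorem pos {x : ℝ} (hx : 1 ≤ x) : 0 < φ x := zero_lt_one.trans_le (h.one_le_apply hx)

theorem fr_pos (n : ℤ) : 0 < φ (fr n) := h.pos (one_le_fr n)

theorem fr_add_le (a b : ℤ) : φ (fr (a + b)) ≤ K * (φ (fr a) + φ (fr b)) := by
  refine (h.mono (one_le_fr _) ?_).trans (h.add_le (one_le_fr a) (one_le_fr b))
  unfold fr
  push_cast
  linarith [abs_add_le (a : ℝ) b]

theorem fr_le_of_abs_sub {a b : ℤ} (hab : |a - b| ≤ 1) : φ (fr a) ≤ 2 * K * φ (fr b) := by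
  have h1 : fr a ≤ fr b + 1 := by
    unfold fr
    have h2 := abs_sub_abs_le_abs_sub (a : ℝ) b
    have h3 : |(a : ℝ) - b| ≤ 1 := by exact_mod_cast hab
    linarith
  have h2 := (h.mono (one_le_fr _) h1).trans (h.add_le (one_le_fr b) le_rfl)
  have h3 := h.one_le_apply (one_le_fr b)
  have h4 := h.one_le
  rw [h.map_one] at h2
  nlinarith

/-- The commutator of a weight with a wave of frequency `k - l` gains one derivative. -/
theorem mul_abs_sub_le (k l : ℤ) :
    max (fr k) (fr l) * |φ (fr k) - φ (fr l)|
      ≤ K * (fr (k - l) * max (φ (fr k)) (φ (fr l))) := by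
  have key : ∀ k l : ℤ, fr l ≤ fr k →
      fr k * (φ (fr k) - φ (fr l)) ≤ K * (fr (k - l) * φ (fr k)) := by
    intro k l hkl
    refine (h.diff_le (one_le_fr l) hkl).trans ?_
    have h1 : fr k - fr l ≤ fr (k - l) := by
      unfold fr
      push_cast
      linarith [abs_sub_abs_le_abs_sub (k : ℝ) l]
    have := h.one_le
    have := (h.fr_pos k).le
    gcongr
  rcases le_total (fr l) (fr k) with hkl | hkl
  · have h1 := h.mono (one_le_fr l) hkl
    rw [max_eq_left hkl, max_eq_left h1, abs_of_nonneg (sub_nonneg.2 h1)]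
    exact key k l hkl
  · have h1 := h.mono (one_le_fr k) hkl
    rw [max_eq_right hkl, max_eq_right h1, abs_sub_comm, abs_of_nonneg (sub_nonneg.2 h1),
      ← fr_neg (k - l), neg_sub]
    exact key l k hkl

/-- The cancellation in the transport term: the symbol loses one power of the frequency. -/
theorem transport_symbol_le (k l : ℤ) :
    |φ (fr k) ^ 2 * l - φ (fr l) ^ 2 * k|
      ≤ 3 * K ^ 2 * fr (k - l) * (φ (fr k) * (φ (fr l) + φ (fr (k - l)))
          + φ (fr (k - l)) * φ (fr l)) := by
  set a := φ (fr k) with ha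
  set b := φ (fr l) with hb
  set d := φ (fr (k - l)) with hd
  have hK := h.one_le
  have ha0 : 0 < a := h.fr_pos k
  have hb0 : 0 < b := h.fr_pos l
  have hd0 : 0 < d := h.fr_pos _
  have hp := MHD.fr_pos (k - l)
  have e : a ^ 2 * l - b ^ 2 * k = a * b * (l - k) + (a * l + b * k) * (a - b) := by ring
  have h1 : a ≤ K * (b + d) := by
    have := h.fr_add_le l (k - l)
    rwa [add_sub_cancel] at this
  have h2 : b ≤ K * (a + d) := by
    have := h.fr_add_le k (-(k - l))
    rwa [fr_neg, show k + -(k - l) = l by ring] at this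
  have h3 := h.mul_abs_sub_le k l
  have hM1 : max a b ≤ K * (b + d) := max_le h1 (by nlinarith)
  have hM2 : max a b ≤ K * (a + d) := max_le (by nlinarith) h2
  have hl : |(l : ℝ)| * |a - b| ≤ K * (fr (k - l) * (K * (b + d))) := by
    refine le_trans (mul_le_mul_of_nonneg_right ((abs_le_fr l).trans (le_max_right _ _))
      (abs_nonneg _)) (h3.trans ?_)
    gcongr
  have hk : |(k : ℝ)| * |a - b| ≤ K * (fr (k - l) * (K * (a + d))) := by
    refine le_trans (mul_le_mul_of_nonneg_right ((abs_le_fr k).trans (le_max_left _ _))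
      (abs_nonneg _)) (h3.trans ?_)
    gcongr
  have hlk : |(l : ℝ) - k| ≤ fr (k - l) := by
    rw [abs_sub_comm]
    exact_mod_cast abs_le_fr (k - l)
  rw [e]
  calc |a * b * (l - k) + (a * l + b * k) * (a - b)|
      ≤ a * b * |(l : ℝ) - k| + (a * (|(l : ℝ)| * |a - b|) + b * (|(k : ℝ)| * |a - b|)) := by
        refine (abs_add_le _ _).trans (add_le_add ?_ ?_)
        · rw [abs_mul, abs_mul, abs_of_pos ha0, abs_of_pos hb0]
        · rw [add_mul]
          refine (abs_add_le _ _).trans (le_of_eq ?_)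
          rw [abs_mul, abs_mul, abs_mul, abs_mul, abs_of_pos ha0, abs_of_pos hb0]
          ring
    _ ≤ a * b * fr (k - l) + (a * (K * (fr (k - l) * (K * (b + d))))
          + b * (K * (fr (k - l) * (K * (a + d))))) := by gcongr
    _ = fr (k - l) * (a * b) + K ^ 2 * fr (k - l) * (2 * (a * b) + a * d + b * d) := by ring
    _ ≤ K ^ 2 * (fr (k - l) * (a * b)) + K ^ 2 * fr (k - l) * (2 * (a * b) + a * d + b * d) := by
        have : 1 ≤ K ^ 2 := one_le_pow₀ hK
        have := le_mul_of_one_le_left (by positivity : 0 ≤ fr (k - l) * (a * b)) this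
        linarith
    _ ≤ _ := by
        have : 0 ≤ K ^ 2 * fr (k - l) * (a * d + b * d) := by positivity
        nlinarith

end Admissible

/-- The square summable sequence `1 / |n|`. -/
def invSq : Sq ℤ := Sq.mk (fun n => |(n : ℝ)|⁻¹) (by
  simpa using Real.summable_one_div_int_pow.2 one_lt_two)

section sums

variable {φ : ℝ → ℝ} {K : ℝ}

/-- The weighted absolute sums below are controlled by the weighted `ℓ²` norm: the factor `1 / n` in
`aSeq` is square summable. -/
theorem weighted_sum_aSeq (h : Admissible φ K) {x : ℤ → ℝ} {y : Sq ℤ}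
    (hy : ∀ n, φ (fr n) * |x n| ≤ |y n|) :
    (Summable fun p => φ (fr p) * |aSeq x p|) ∧
      ∑' p, φ (fr p) * |aSeq x p| ≤ 2 * K * ‖invSq‖ * ‖y‖ := by
  have hK : 0 ≤ K := zero_le_one.trans h.one_le
  have key : ∀ e : ℤ, |e| ≤ 1 →
      (Summable fun p : ℤ => |(p : ℝ)|⁻¹ * (φ (fr p) * |x (p + e)|)) ∧
      |∑' p : ℤ, |(p : ℝ)|⁻¹ * (φ (fr p) * |x (p + e)|)| ≤ 2 * K * (‖invSq‖ * ‖y‖) := by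
    intro e he
    refine tsum_abs_mul_le invSq y (σ := fun p => p + e) (add_left_injective e) (by positivity)
      fun p => ?_
    have h0 := (h.fr_pos p).le
    rw [abs_mul, abs_of_nonneg (mul_nonneg h0 (abs_nonneg _))]
    change _ ≤ 2 * K * (|(|(p : ℝ)|⁻¹)| * |y (p + e)|)
    have h1 : φ (fr p) ≤ 2 * K * φ (fr (p + e)) :=
      h.fr_le_of_abs_sub (by rw [sub_add_cancel_left, abs_neg]; exact he)
    have h2 := mul_le_mul_of_nonneg_right h1 (abs_nonneg (x (p + e)))
    have h3 := mul_le_mul_of_nonneg_left (hy (p + e)) (by positivity : 0 ≤ 2 * K)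
    have h4 : φ (fr p) * |x (p + e)| ≤ 2 * K * |y (p + e)| := by linarith
    have := mul_le_mul_of_nonneg_left h4 (abs_nonneg (|(p : ℝ)|⁻¹))
    linarith
  obtain ⟨s1, b1⟩ := key 1 (by norm_num)
  obtain ⟨s2, b2⟩ := key (-1) (by norm_num)
  have hle : ∀ p : ℤ, φ (fr p) * |aSeq x p| ≤ 1 / 2 * (|(p : ℝ)|⁻¹ * (φ (fr p) * |x (p + 1)|)
      + |(p : ℝ)|⁻¹ * (φ (fr p) * |x (p + -1)|)) := by
    intro p
    rw [aSeq, abs_mul, abs_inv, abs_mul, abs_two, mul_inv]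
    have h1 := abs_sub (x (p + 1)) (x (p - 1))
    have h2 : 0 ≤ φ (fr p) * ((2 : ℝ)⁻¹ * |(p : ℝ)|⁻¹) := by
      have := (h.fr_pos p).le
      positivity
    have := mul_le_mul_of_nonneg_left h1 h2
    rw [← sub_eq_add_neg]
    linarith
  have s3 := (s1.add s2).mul_left (1 / 2)
  have s4 : Summable fun p => φ (fr p) * |aSeq x p| :=
    Summable.of_nonneg_of_le (fun p => mul_nonneg (h.fr_pos p).le (abs_nonneg _)) hle s3
  refine ⟨s4, (s4.tsum_le_tsum hle s3).trans ?_⟩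
  rw [tsum_mul_left, s1.tsum_add s2]
  have := (le_abs_self _).trans b1
  have := (le_abs_self _).trans b2
  linarith

theorem fr_mul_inv_abs_le (p : ℤ) : fr p * |(p : ℝ)|⁻¹ ≤ 2 := by
  rcases eq_or_ne p 0 with rfl | hp
  · simp
  · have := abs_cast_le_of_ne hp
    rw [← div_eq_mul_inv, div_le_iff₀ (by linarith)]
    exact fr_le_two_mul_abs hp

theorem abs_vSeq (x : ℤ → ℝ) (p : ℤ) : |vSeq x p| = |(p : ℝ)|⁻¹ * |aSeq x p| := by
  rw [vSeq, abs_neg, abs_mul, abs_inv, abs_abs]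

theorem weighted_sum_vSeq (h : Admissible φ K) {x : ℤ → ℝ} {y : Sq ℤ}
    (hy : ∀ n, φ (fr n) * |x n| ≤ |y n|) :
    (Summable fun p => φ (fr p) * (fr p * |vSeq x p|)) ∧
      ∑' p, φ (fr p) * (fr p * |vSeq x p|) ≤ 4 * K * ‖invSq‖ * ‖y‖ := by
  obtain ⟨s1, b1⟩ := weighted_sum_aSeq h hy
  have hle : ∀ p, φ (fr p) * (fr p * |vSeq x p|) ≤ 2 * (φ (fr p) * |aSeq x p|) := by
    intro p
    rw [abs_vSeq]
    have := mul_le_mul_of_nonneg_right (fr_mul_inv_abs_le p)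
      (mul_nonneg (h.fr_pos p).le (abs_nonneg (aSeq x p)))
    linarith
  have s2 : Summable fun p => φ (fr p) * (fr p * |vSeq x p|) :=
    Summable.of_nonneg_of_le (fun p => mul_nonneg (h.fr_pos p).le
      (mul_nonneg (fr_pos p).le (abs_nonneg _))) hle (s1.mul_left 2)
  refine ⟨s2, (s2.tsum_le_tsum hle (s1.mul_left 2)).trans ?_⟩
  rw [tsum_mul_left]
  linarith

/-- The sum of the tails of `vSeq` is the sum of `n * vSeq x n`, that is, the sum of `aSeq`. -/
theorem weighted_sum_qSeq (h : Admissible φ K) {x : ℤ → ℝ} {y : Sq ℤ}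
    (hy : ∀ n, φ (fr n) * |x n| ≤ |y n|) :
    (Summable fun p => φ (fr p) * |qSeq x p|) ∧
      ∑' p, φ (fr p) * |qSeq x p| ≤ 8 * K * ‖invSq‖ * ‖y‖ := by
  obtain ⟨s1, b1⟩ := weighted_sum_aSeq h hy
  set g : ℕ → ℝ := fun n => φ (fr n) * |vSeq x n| with hg
  have hg0 : ∀ n, 0 ≤ g n := fun n => mul_nonneg (h.fr_pos _).le (abs_nonneg _)
  have hle : ∀ n : ℕ, (n : ℝ) * g n ≤ φ (fr n) * |aSeq x n| := by
    intro n
    simp only [hg]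
    rw [abs_vSeq, Int.cast_natCast, Nat.abs_cast]
    have h1 : (n : ℝ) * (n : ℝ)⁻¹ ≤ 1 := mul_inv_le_one
    have := mul_le_mul_of_nonneg_right h1 (mul_nonneg (h.fr_pos n).le (abs_nonneg (aSeq x n)))
    linarith
  have s2 : Summable fun n : ℕ => φ (fr n) * |aSeq x n| := s1.comp_injective Nat.cast_injective
  have s3 : Summable fun n : ℕ => (n : ℝ) * g n :=
    Summable.of_nonneg_of_le (fun n => mul_nonneg (Nat.cast_nonneg n) (hg0 n)) hle s2
  have b3 : ∑' n : ℕ, (n : ℝ) * g n ≤ ∑' p : ℤ, φ (fr p) * |aSeq x p| :=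
    (s3.tsum_le_tsum hle s2).trans (tsum_comp_le_tsum_of_inj s1
      (fun p => mul_nonneg (h.fr_pos p).le (abs_nonneg _)) Nat.cast_injective)
  obtain ⟨t1, t2, t3⟩ := tail_sums hg0 s3
  have hv : ∀ j : ℤ, ∀ i : ℕ, φ (fr j) * |vSeq x (|j| + 1 + 2 * i)| ≤ g (j.natAbs + 1 + 2 * i) := by
    intro j i
    simp only [hg]
    rw [natAbs_tail]
    refine mul_le_mul_of_nonneg_right (h.mono (one_le_fr j) (fr_mono ?_)) (abs_nonneg _)
    have := abs_nonneg j
    rw [abs_of_nonneg (by omega : 0 ≤ |j| + 1 + 2 * (i : ℤ))]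
    omega
  have hv' : ∀ j : ℤ, Summable fun i : ℕ => |vSeq x (|j| + 1 + 2 * i)| := by
    intro j
    refine Summable.of_nonneg_of_le (fun _ => abs_nonneg _) (fun i => ?_) (t1 j)
    have h1 := mul_le_mul_of_nonneg_right (h.one_le_apply (one_le_fr j))
      (abs_nonneg (vSeq x (|j| + 1 + 2 * i)))
    have h2 := hv j i
    rw [one_mul] at h1
    exact h1.trans h2
  have hq : ∀ j : ℤ, φ (fr j) * |qSeq x j| ≤ 2 * ∑' i : ℕ, g (j.natAbs + 1 + 2 * i) := by
    intro j
    have h1 : |qSeq x j| ≤ 2 * ∑' i : ℕ, |vSeq x (|j| + 1 + 2 * i)| := by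
      have h2 : Summable fun i : ℕ => ‖vSeq x (|j| + 1 + 2 * i)‖ := hv' j
      have h3 := norm_tsum_le_tsum_norm h2
      simp only [Real.norm_eq_abs] at h3
      rw [qSeq, abs_mul, abs_two]
      linarith
    calc _ ≤ φ (fr j) * (2 * ∑' i : ℕ, |vSeq x (|j| + 1 + 2 * i)|) :=
          mul_le_mul_of_nonneg_left h1 (h.fr_pos j).le
      _ = 2 * ∑' i : ℕ, φ (fr j) * |vSeq x (|j| + 1 + 2 * i)| := by rw [tsum_mul_left]; ring
      _ ≤ _ := mul_le_mul_of_nonneg_left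
          (((hv' j).mul_left _).tsum_le_tsum (hv j) (t1 j)) zero_le_two
  have s4 : Summable fun p => φ (fr p) * |qSeq x p| :=
    Summable.of_nonneg_of_le (fun p => mul_nonneg (h.fr_pos p).le (abs_nonneg _)) hq (t2.mul_left 2)
  refine ⟨s4, (s4.tsum_le_tsum hq (t2.mul_left 2)).trans ?_⟩
  rw [tsum_mul_left]
  linarith

theorem weighted_sum_cSeq (h : Admissible φ K) {x : ℤ → ℝ} {y : Sq ℤ}
    (hy : ∀ n, φ (fr n) * |x n| ≤ |y n|) :
    (Summable fun p => φ (fr p) * |cSeq x p|) ∧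
      ∑' p, φ (fr p) * |cSeq x p| ≤ 16 * K ^ 2 * ‖invSq‖ * ‖y‖ := by
  obtain ⟨s1, b1⟩ := weighted_sum_qSeq h hy
  have hK := h.one_le
  have s2 : Summable fun p : ℤ => φ (fr (p - 1)) * |qSeq x (p - 1)| :=
    s1.comp_injective (sub_left_injective (b := (1 : ℤ)))
  have s3 : Summable fun p : ℤ => φ (fr (p + 1)) * |qSeq x (p + 1)| :=
    s1.comp_injective (add_left_injective (1 : ℤ))
  have e2 : ∑' p : ℤ, φ (fr (p - 1)) * |qSeq x (p - 1)| = ∑' p, φ (fr p) * |qSeq x p| :=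
    (Equiv.subRight (1 : ℤ)).tsum_eq fun p => φ (fr p) * |qSeq x p|
  have e3 : ∑' p : ℤ, φ (fr (p + 1)) * |qSeq x (p + 1)| = ∑' p, φ (fr p) * |qSeq x p| :=
    (Equiv.addRight (1 : ℤ)).tsum_eq fun p => φ (fr p) * |qSeq x p|
  have hle : ∀ p : ℤ, φ (fr p) * |cSeq x p| ≤ K * (φ (fr (p - 1)) * |qSeq x (p - 1)|
      + φ (fr (p + 1)) * |qSeq x (p + 1)|) := by
    intro p
    have h1 : φ (fr p) ≤ 2 * K * φ (fr (p - 1)) := h.fr_le_of_abs_sub (by simp)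
    have h2 : φ (fr p) ≤ 2 * K * φ (fr (p + 1)) := h.fr_le_of_abs_sub (by simp)
    have h3 : |cSeq x p| ≤ 1 / 2 * (|qSeq x (p - 1)| + |qSeq x (p + 1)|) := by
      rw [cSeq, abs_mul, abs_of_pos (by norm_num : (0 : ℝ) < 1 / 2)]
      exact mul_le_mul_of_nonneg_left (abs_add_le _ _) (by norm_num)
    have h4 := mul_le_mul_of_nonneg_left h3 (h.fr_pos p).le
    have h5 := mul_le_mul_of_nonneg_right h1 (abs_nonneg (qSeq x (p - 1)))
    have h6 := mul_le_mul_of_nonneg_right h2 (abs_nonneg (qSeq x (p + 1)))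
    linarith
  have s4 : Summable fun p => φ (fr p) * |cSeq x p| :=
    Summable.of_nonneg_of_le (fun p => mul_nonneg (h.fr_pos p).le (abs_nonneg _)) hle
      ((s2.add s3).mul_left K)
  refine ⟨s4, (s4.tsum_le_tsum hle ((s2.add s3).mul_left K)).trans ?_⟩
  rw [tsum_mul_left, s2.tsum_add s3, e2, e3]
  nlinarith

end sums

/-- The order, in the frequency of the coefficient, of the energy estimate of a bilinear term. -/
def Kind.loss : Kind → ℤ → ℝ
  | .transport, p => fr p
  | .stretch, _ => 1
  | .hilbert, _ => 1

theorem Kind.one_le_loss (k : Kind) (p : ℤ) : 1 ≤ k.loss p := by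
  cases k
  · exact one_le_fr p
  · exact le_rfl
  · exact le_rfl

/-- The coefficients of a bilinear term are summable, even with the loss of the energy estimate and
with a weight, in terms of the weighted norm only. -/
theorem weighted_sum_seq {φ : ℝ → ℝ} {K : ℝ} (h : Admissible φ K) (k : Kind) (c : Bool)
    {x : Bool → ℤ → ℝ} {y : Sq Idx} (hy : ∀ c n, φ (fr n) * |x c n| ≤ |y (c, n)|) :
    (Summable fun p => φ (fr p) * (k.loss p * |k.seq x c p|)) ∧
      ∑' p, φ (fr p) * (k.loss p * |k.seq x c p|) ≤ 8 * K ^ 2 * ‖invSq‖ * ‖y‖ := by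
  have hinj : ∀ c : Bool, Function.Injective fun n : ℤ => (c, n) := fun c a b h => by simpa using h
  let y' : Bool → Sq ℤ := fun c => wcomp (fun _ => 1) (fun n => (c, n)) y
  have hy'a : ∀ c n, y' c n = y (c, n) := fun c n => by
    simp only [y']
    rw [wcomp_apply ⟨⟨1, fun _ => by simp⟩, hinj c⟩, one_mul]
  have hy' : ∀ c n, φ (fr n) * |x c n| ≤ |y' c n| := fun c n => by rw [hy'a]; exact hy c n
  have hn : ∀ c, ‖y' c‖ ≤ ‖y‖ := fun c => by
    simpa using norm_wcomp_apply_le (d := fun _ : ℤ => (1 : ℝ)) (C := 1) (fun _ => by simp)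
      zero_le_one (hinj c) y
  have hK := h.one_le
  have hb : ∀ (f : ℤ → ℝ) (c : Bool) (A : ℝ), A ≤ 16 * K ^ 2 → Summable f →
      ∑' p, f p ≤ A * ‖invSq‖ * ‖y' c‖ →
      Summable (fun p => 1 / 2 * f p) ∧ ∑' p, 1 / 2 * f p ≤ 8 * K ^ 2 * ‖invSq‖ * ‖y‖ := by
    intro f c A hA hs hf
    refine ⟨hs.mul_left _, ?_⟩
    rw [tsum_mul_left]
    have h1 : A * ‖invSq‖ * ‖y' c‖ ≤ 16 * K ^ 2 * ‖invSq‖ * ‖y‖ := by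
      have := hn c
      gcongr
    linarith
  have h2 : |(-(1 / 2) : ℝ)| = 1 / 2 := by norm_num
  have hKK : K ≤ K ^ 2 := by nlinarith
  cases k
  · have h3 := weighted_sum_vSeq h (hy' (!c))
    have e : (fun p => φ (fr p) * (Kind.transport.loss p * |Kind.transport.seq x c p|))
        = fun p => 1 / 2 * (φ (fr p) * (fr p * |vSeq (x (!c)) p|)) := by
      ext1 p
      simp only [Kind.loss, Kind.seq, abs_mul, h2]
      ring
    rw [e]
    exact hb _ (!c) _ (by linarith) h3.1 h3.2
  · have h3 := weighted_sum_cSeq h (hy' (!c))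
    have e : (fun p => φ (fr p) * (Kind.stretch.loss p * |Kind.stretch.seq x c p|))
        = fun p => 1 / 2 * (φ (fr p) * |cSeq (x (!c)) p|) := by
      ext1 p
      simp only [Kind.loss, Kind.seq, abs_mul, h2]
      ring
    rw [e]
    exact hb _ (!c) _ le_rfl h3.1 h3.2
  · have h3 := weighted_sum_aSeq h (hy' c)
    have e : (fun p => φ (fr p) * (Kind.hilbert.loss p * |Kind.hilbert.seq x c p|))
        = fun p => 1 / 2 * (φ (fr p) * |aSeq (x c) p|) := by
      ext1 p
      simp only [Kind.loss, Kind.seq, abs_mul, h2]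
      ring
    rw [e]
    exact hb _ c _ (by linarith) h3.1 h3.2

/-! ### The energy estimates -/

/-- Cauchy–Schwarz for a family dominated by a sum of two products. -/
theorem tsum_abs_mul_add_le {ι : Type*} (x y x' y' : Sq ι) {σ : ι → ι} (hσ : Function.Injective σ)
    {F : ι → ℝ} {C : ℝ} (hC : 0 ≤ C)
    (hF : ∀ i, |F i| ≤ C * (|x i| * |y (σ i)| + |x' i| * |y' (σ i)|)) :
    Summable F ∧ |∑' i, F i| ≤ C * (‖x‖ * ‖y‖ + ‖x'‖ * ‖y'‖) := by
  have h1 := tsum_abs_mul_le x y hσ (F := fun i => C * (|x i| * |y (σ i)|)) hC fun i => by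
    rw [abs_of_nonneg (by positivity)]
  have h2 := tsum_abs_mul_le x' y' hσ (F := fun i => C * (|x' i| * |y' (σ i)|)) hC fun i => by
    rw [abs_of_nonneg (by positivity)]
  have hs := h1.1.add h2.1
  have hF' : ∀ i, ‖F i‖ ≤ C * (|x i| * |y (σ i)|) + C * (|x' i| * |y' (σ i)|) := fun i => by
    rw [Real.norm_eq_abs, ← mul_add]; exact hF i
  refine ⟨Summable.of_norm_bounded hs hF', ?_⟩
  have h3 := tsum_of_norm_bounded hs.hasSum hF'
  rw [h1.1.tsum_add h2.1, Real.norm_eq_abs] at h3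
  have := (le_abs_self _).trans h1.2
  have := (le_abs_self _).trans h2.2
  linarith

theorem hasSum_of_eq {ι : Type*} {f g : ι → ℝ} {a : ℝ} (h : HasSum f a) (e : ∀ i, f i = g i) :
    HasSum g a := funext e ▸ h

section energy

variable {φ : ℝ → ℝ} {K : ℝ}

theorem cut_wt_apply (N : ℝ) (φ : ℝ → ℝ) (z : Sq Idx) (c : Bool) (n : ℤ) :
    cut wt N φ z (c, n) = φ (fr n) * cut wt N (fun _ => 1) z (c, n) := by
  rw [cut_apply wt_fin, cut_apply wt_fin]
  by_cases hN : wt (c, n) ≤ N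
  · rw [if_pos hN, if_pos hN, one_mul]; rfl
  · rw [if_neg hN, if_neg hN]; ring

theorem hasSum_inner_shiftOp {χ : Bool → ℝ} {θ : ℤ → ℝ} {Θ : ℝ} (hχ : ∀ c, |χ c| ≤ 1)
    (hθ : ∀ l, |θ l| ≤ Θ * fr l) (N : ℝ) (φ : ℝ → ℝ) (fl : Bool) (p : ℤ) (z z' : Sq Idx) :
    HasSum (fun i : Idx => φ (fr i.2) ^ 2 * (χ i.1 * θ (i.2 - p)) * (cut wt N (fun _ => 1) z i
        * cut wt N (fun _ => 1) z' (shiftIdx fl p i)))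
      (inner ℝ (cut wt N (fun a => φ a ^ 2) z) (shiftOp 0 χ θ fl p (cut wt N id z'))) := by
  have h := Sq.hasSum_inner (cut wt N (fun a => φ a ^ 2) z) (shiftOp 0 χ θ fl p (cut wt N id z'))
  refine hasSum_of_eq h fun ⟨c, n⟩ => ?_
  rw [shiftOp_apply hχ hθ, cut_wt_apply, cut_wt_apply N id, shiftIdx]
  have := (fr_pos (n - p)).ne'
  simp only [pow_zero, zero_add, pow_one, id]
  field_simp

/-- Terms of order zero, at one frequency of the coefficient. -/
theorem inner_shiftOp_le (h : Admissible φ K) {χ : Bool → ℝ} {θ : ℤ → ℝ} {Θ : ℝ} (hΘ : 0 ≤ Θ)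
    (hχ : ∀ c, |χ c| ≤ 1) (hθ : ∀ l, |θ l| ≤ Θ) (N : ℝ) (fl : Bool) (p : ℤ) (z z' : Sq Idx) :
    |inner ℝ (cut wt N (fun a => φ a ^ 2) z) (shiftOp 0 χ θ fl p (cut wt N id z'))|
      ≤ Θ * K * (‖cut wt N φ z‖ * (‖cut wt N φ z'‖
          + φ (fr p) * ‖cut wt N (fun _ => 1) z'‖)) := by
  have hs := hasSum_inner_shiftOp hχ (fun l => le_mul_fr hΘ (hθ l) l) N φ fl p z z'
  rw [← hs.tsum_eq]
  have hK := zero_le_one.trans h.one_le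
  have hp := h.fr_pos p
  have hy : ‖cut wt N φ z' + φ (fr p) • cut wt N (fun _ => 1) z'‖
      ≤ ‖cut wt N φ z'‖ + φ (fr p) * ‖cut wt N (fun _ => 1) z'‖ := by
    refine (norm_add_le _ _).trans_eq ?_
    rw [norm_smul, Real.norm_of_nonneg hp.le]
  refine (tsum_abs_mul_le (cut wt N φ z) (cut wt N φ z' + φ (fr p) • cut wt N (fun _ => 1) z')
    (shiftIdx_injective fl p) (mul_nonneg hΘ hK) fun ⟨c, n⟩ => ?_).2.trans ?_
  · simp only [shiftIdx, lp.coeFn_add, lp.coeFn_smul, Pi.add_apply, Pi.smul_apply, smul_eq_mul]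
    rw [cut_wt_apply N φ z, cut_wt_apply N φ z']
    set a := cut wt N (fun _ => 1) z (c, n)
    set b := cut wt N (fun _ => 1) z' (xor fl c, n - p)
    have h1 : φ (fr n) ≤ K * (φ (fr (n - p)) + φ (fr p)) := by
      simpa using h.fr_add_le (n - p) p
    have hn := h.fr_pos n
    have hl := h.fr_pos (n - p)
    rw [← add_mul, abs_mul, abs_mul, abs_mul, abs_mul, abs_mul, abs_mul, abs_pow, abs_of_pos hn,
      abs_of_pos (add_pos hl hp)]
    have h2 : |χ c| * |θ (n - p)| ≤ Θ := by
      have := mul_le_mul (hχ c) (hθ (n - p)) (abs_nonneg _) zero_le_one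
      linarith
    calc φ (fr n) ^ 2 * (|χ c| * |θ (n - p)|) * (|a| * |b|)
        ≤ φ (fr n) ^ 2 * Θ * (|a| * |b|) := by gcongr
      _ = φ (fr n) * (φ (fr n) * Θ * (|a| * |b|)) := by ring
      _ ≤ (K * (φ (fr (n - p)) + φ (fr p))) * (φ (fr n) * Θ * (|a| * |b|)) := by gcongr
      _ = _ := by ring
  · have := norm_nonneg (cut wt N φ z)
    gcongr

/-- The transport terms, at one frequency of the velocity and its opposite. -/
theorem inner_transport_le (h : Admissible φ K) {χ : Bool → ℝ} (hχ : ∀ c, |χ c| ≤ 1) (N : ℝ)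
    (p : ℤ) (z : Sq Idx) :
    |inner ℝ (cut wt N (fun a => φ a ^ 2) z) (shiftOp 0 χ (fun l => l) false p (cut wt N id z))
      - inner ℝ (cut wt N (fun a => φ a ^ 2) z)
          (shiftOp 0 χ (fun l => l) false (-p) (cut wt N id z))|
      ≤ 6 * K ^ 2 * fr p * (‖cut wt N φ z‖ * (‖cut wt N φ z‖
          + φ (fr p) * ‖cut wt N (fun _ => 1) z‖)) := by
  have s1 := hasSum_inner_shiftOp hχ abs_id_le N φ false p z z
  have s2 := hasSum_inner_shiftOp hχ abs_id_le N φ false (-p) z z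
  -- the second sum, with the two factors in the roles they have in the first one
  have s3 : HasSum (fun i : Idx => φ (fr (i.2 - p)) ^ 2 * (χ i.1 * i.2) * (cut wt N (fun _ => 1) z i
      * cut wt N (fun _ => 1) z (shiftIdx false p i)))
      (inner ℝ (cut wt N (fun a => φ a ^ 2) z)
          (shiftOp 0 χ (fun l => l) false (-p) (cut wt N id z))) := by
    have s4 := ((Equiv.refl Bool).prodCongr (Equiv.subRight p)).hasSum_iff.2 s2
    refine hasSum_of_eq s4 fun ⟨c, n⟩ => ?_
    simp only [Function.comp, Equiv.prodCongr_apply, Equiv.coe_refl, Prod.map, id,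
      Equiv.subRight_apply, shiftIdx, Bool.false_xor, sub_neg_eq_add, sub_add_cancel]
    ring
  rw [← (s1.sub s3).tsum_eq]
  have hK := zero_le_one.trans h.one_le
  have hp := h.fr_pos p
  have hfp := fr_pos p
  set y := cut wt N φ z + φ (fr p) • cut wt N (fun _ => 1) z with hy
  have hyn : ‖y‖ ≤ ‖cut wt N φ z‖ + φ (fr p) * ‖cut wt N (fun _ => 1) z‖ := by
    refine (norm_add_le _ _).trans_eq ?_
    rw [norm_smul, Real.norm_of_nonneg hp.le]
  refine (tsum_abs_mul_add_le (cut wt N φ z) y (φ (fr p) • cut wt N (fun _ => 1) z)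
    (cut wt N φ z) (shiftIdx_injective false p) (by positivity : 0 ≤ 3 * K ^ 2 * fr p)
    fun ⟨c, n⟩ => ?_).2.trans ?_
  · simp only [hy, shiftIdx, lp.coeFn_add, lp.coeFn_smul, Pi.add_apply, Pi.smul_apply, smul_eq_mul,
      Bool.false_xor]
    rw [cut_wt_apply N φ z, cut_wt_apply N φ z]
    set a := cut wt N (fun _ => 1) z (c, n)
    set b := cut wt N (fun _ => 1) z (c, n - p)
    have hn := h.fr_pos n
    have hl := h.fr_pos (n - p)
    have h1 := h.transport_symbol_le n (n - p)
    rw [sub_sub_cancel] at h1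
    have e : φ (fr n) ^ 2 * (χ c * ((n - p : ℤ) : ℝ)) * (a * b)
          - φ (fr (n - p)) ^ 2 * (χ c * n) * (a * b)
        = χ c * ((φ (fr n) ^ 2 * ((n - p : ℤ) : ℝ) - φ (fr (n - p)) ^ 2 * n) * (a * b)) := by ring
    rw [e, abs_mul, ← add_mul, abs_mul, abs_mul, abs_mul, abs_mul, abs_mul, abs_mul,
      abs_of_pos hn, abs_of_pos hp, abs_of_pos hl, abs_of_pos (add_pos hl hp)]
    refine (mul_le_of_le_one_left (by positivity) (hχ c)).trans ?_
    refine (mul_le_mul_of_nonneg_right h1 (by positivity)).trans_eq ?_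
    ring
  · have h1 := norm_nonneg (cut wt N φ z)
    rw [norm_smul, Real.norm_of_nonneg hp.le]
    have h2 := mul_le_mul_of_nonneg_left hyn h1
    have h3 := norm_nonneg (cut wt N (fun _ => 1) z)
    have h4 : ‖cut wt N φ z‖ * ‖y‖ + φ (fr p) * ‖cut wt N (fun _ => 1) z‖ * ‖cut wt N φ z‖
        ≤ 2 * (‖cut wt N φ z‖ * (‖cut wt N φ z‖ + φ (fr p) * ‖cut wt N (fun _ => 1) z‖)) := by
      nlinarith [mul_nonneg h1 h1]
    have := mul_le_mul_of_nonneg_left h4 (by positivity : 0 ≤ 3 * K ^ 2 * fr p)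
    linarith

/-- The sequences of sine coefficients. -/
def IsOddSeq (u : Sq Idx) : Prop := ∀ c n, u (c, -n) = -u (c, n)

theorem raw_cut_id (N : ℝ) (u : Sq Idx) :
    raw 0 (cut wt N id u) = fun c n => cut wt N (fun _ => 1) u (c, n) := by
  ext c n
  rw [raw, cut_wt_apply]
  have := (fr_pos n).ne'
  simp only [zero_add, pow_one, id]
  field_simp

theorem vSeq_neg {x : ℤ → ℝ} (hx : ∀ n, x (-n) = -x n) (p : ℤ) : vSeq x (-p) = -vSeq x p := by
  have h1 : x (-p + 1) = -x (p - 1) := by rw [← hx, neg_sub]; ring_nf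
  have h2 : x (-p - 1) = -x (p + 1) := by rw [← hx]; ring_nf
  rw [vSeq, vSeq, aSeq, aSeq, h1, h2]
  push_cast
  rw [abs_neg, mul_neg, inv_neg]
  ring

/-- A sum of terms, each tame in the frequency of the coefficient. -/
theorem tsum_seq_le (h : Admissible φ K) (k : Kind) (c : Bool) (N : ℝ) (u z : Sq Idx)
    {J : ℤ → ℝ} {A : ℝ} (hA : 0 ≤ A)
    (hJ : ∀ p, |J p| ≤ A * k.loss p * (‖cut wt N φ z‖ * (‖cut wt N φ z‖
          + φ (fr p) * ‖cut wt N (fun _ => 1) z‖))) :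
    |∑' p, k.seq (raw 0 (cut wt N id u)) c p * J p| ≤ 8 * K ^ 2 * ‖invSq‖ * A *
      (‖cut wt N (fun _ => 1) u‖ * ‖cut wt N φ z‖ ^ 2
        + ‖cut wt N φ u‖ * ‖cut wt N (fun _ => 1) z‖ * ‖cut wt N φ z‖) := by
  have hK := h.one_le
  obtain ⟨s1, b1⟩ := weighted_sum_seq h k c (x := raw 0 (cut wt N id u)) (y := cut wt N φ u)
    fun c n => by
      rw [raw_cut_id, cut_wt_apply N φ, abs_mul, abs_of_pos (h.fr_pos n)]
  obtain ⟨s2, b2⟩ := weighted_sum_seq admissible_one k c (x := raw 0 (cut wt N id u))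
    (y := cut wt N (fun _ => 1) u) fun c n => by rw [raw_cut_id, one_mul]
  simp only [one_mul] at s2 b2
  set f := fun p => k.loss p * |k.seq (raw 0 (cut wt N id u)) c p|
  set X := ‖cut wt N φ z‖
  set Y := ‖cut wt N (fun _ => 1) z‖
  have hX : 0 ≤ X := norm_nonneg _
  have hY : 0 ≤ Y := norm_nonneg _
  have s3 := ((s2.mul_left (X ^ 2)).add (s1.mul_left (X * Y))).mul_left A
  have hle : ∀ p, ‖k.seq (raw 0 (cut wt N id u)) c p * J p‖
      ≤ A * (X ^ 2 * f p + X * Y * (φ (fr p) * f p)) := by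
    intro p
    rw [Real.norm_eq_abs, abs_mul]
    refine (mul_le_mul_of_nonneg_left (hJ p) (abs_nonneg _)).trans_eq ?_
    simp only [f]
    ring
  have h3 := tsum_of_norm_bounded s3.hasSum hle
  rw [Real.norm_eq_abs] at h3
  refine h3.trans ?_
  rw [tsum_mul_left, (s2.mul_left _).tsum_add (s1.mul_left _), tsum_mul_left, tsum_mul_left]
  have hKK : 1 ≤ K ^ 2 := one_le_pow₀ hK
  have b3 : ∑' p, f p ≤ 8 * K ^ 2 * ‖invSq‖ * ‖cut wt N (fun _ => 1) u‖ := by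
    refine b2.trans ?_
    gcongr
  have h4 := mul_le_mul_of_nonneg_left b3 (sq_nonneg X)
  have h5 := mul_le_mul_of_nonneg_left b1 (mul_nonneg hX hY)
  have h6 := mul_le_mul_of_nonneg_left (add_le_add h4 h5) hA
  linarith

/-- The bilinear terms in the energy estimate. -/
theorem inner_bilTerm_le (h : Admissible φ K) (k : Kind) (c : Bool) (N : ℝ) {u z : Sq Idx}
    (hu : IsOddSeq u) :
    |inner ℝ (cut wt N (fun a => φ a ^ 2) z)
        (bil (k.coef 0 c) (bilShift 0 c k) (cut wt N id u) (cut wt N id z))|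
      ≤ 24 * K ^ 4 * ‖invSq‖ *
      (‖cut wt N (fun _ => 1) u‖ * ‖cut wt N φ z‖ ^ 2
        + ‖cut wt N φ u‖ * ‖cut wt N (fun _ => 1) z‖ * ‖cut wt N φ z‖) := by
  have hK := h.one_le
  have hK0 := zero_le_one.trans hK
  have s1 := ((innerSL ℝ (cut wt N (fun a => φ a ^ 2) z)).hasSum
    (hasSum_bilTerm 0 c k (cut wt N id u) (cut wt N id z)))
  simp only [innerSL_apply_apply, real_inner_smul_right] at s1
  rw [← s1.tsum_eq]
  set J : ℤ → ℝ := fun p =>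
    inner ℝ (cut wt N (fun a => φ a ^ 2) z) (bilShift 0 c k p (cut wt N id z)) with hJ
  set S := ‖cut wt N (fun _ => 1) u‖ * ‖cut wt N φ z‖ ^ 2
        + ‖cut wt N φ u‖ * ‖cut wt N (fun _ => 1) z‖ * ‖cut wt N φ z‖ with hS
  have hS0 : 0 ≤ S := by positivity
  have hzero : (∀ l, |k.mult l| ≤ 1) →
      |∑' p, k.seq (raw 0 (cut wt N id u)) c p * J p| ≤ 24 * K ^ 4 * ‖invSq‖ * S := by
    intro hk
    refine (tsum_seq_le h k c N u z (J := J) hK0 fun p => ?_).trans ?_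
    · refine (inner_shiftOp_le h zero_le_one (abs_comp_le c) hk N k.flip p z z).trans ?_
      have hX : 0 ≤ ‖cut wt N φ z‖ * (‖cut wt N φ z‖ + φ (fr p) * ‖cut wt N (fun _ => 1) z‖) := by
        have := (h.fr_pos p).le
        positivity
      have := mul_le_mul_of_nonneg_right (k.one_le_loss p) (mul_nonneg hK0 hX)
      linarith
    · have h1 : 8 * K ^ 2 * ‖invSq‖ * K ≤ 24 * K ^ 4 * ‖invSq‖ := by
        have : K ^ 3 ≤ K ^ 4 := pow_le_pow_right₀ hK (by norm_num)
        have h2 : 8 * K ^ 3 ≤ 24 * K ^ 4 := by nlinarith [pow_nonneg hK0 4]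
        have := mul_le_mul_of_nonneg_right h2 (norm_nonneg invSq)
        nlinarith
      exact mul_le_mul_of_nonneg_right h1 hS0
  cases k with
  | stretch => exact hzero fun l => by simp [Kind.mult]
  | hilbert => exact hzero abs_sign_le
  | transport =>
    -- the coefficients are odd, which pairs the frequencies `p` and `-p`
    have hneg : ∀ p, Kind.transport.seq (raw 0 (cut wt N id u)) c (-p)
        = -Kind.transport.seq (raw 0 (cut wt N id u)) c p := by
      intro p
      simp only [Kind.seq]
      rw [vSeq_neg, mul_neg]
      intro n
      rw [raw_cut_id]
      change cut wt N (fun _ => 1) u (!c, -n) = -cut wt N (fun _ => 1) u (!c, n)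
      rw [cut_apply wt_fin, cut_apply wt_fin, hu]
      rw [show wt (!c, -n) = wt (!c, n) from fr_neg n, mul_neg]
    have s2 := (Equiv.neg ℤ).hasSum_iff.2 s1
    have s3 := (s1.add s2).mul_left (1 / 2)
    have e : ∑' p, Kind.transport.seq (raw 0 (cut wt N id u)) c p * J p
        = ∑' p, Kind.transport.seq (raw 0 (cut wt N id u)) c p * (1 / 2 * (J p - J (-p))) := by
      have h1 := hasSum_of_eq (g := fun p => Kind.transport.seq (raw 0 (cut wt N id u)) c p
          * (1 / 2 * (J p - J (-p)))) s3 fun p => by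
        simp only [Function.comp, Equiv.neg_apply, hneg, hJ]
        ring
      rw [h1.tsum_eq, s1.tsum_eq]
      ring
    rw [e]
    refine (tsum_seq_le h .transport c N u z (A := 3 * K ^ 2) (by positivity) fun p => ?_).trans ?_
    · have h1 := inner_transport_le h (abs_comp_le c) N p z
      rw [abs_mul, abs_of_pos (by norm_num : (0 : ℝ) < 1 / 2)]
      change |J p - J (-p)| ≤ _ at h1
      change _ ≤ 3 * K ^ 2 * fr p * _
      linarith
    · refine le_of_eq ?_
      ring

/-- The energy estimate of the linear part: transport by `sin 2θ / 2`, and terms of order zero. -/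
theorem inner_linearPart_le (h : Admissible φ K) (N : ℝ) (z : Sq Idx) :
    |inner ℝ (cut wt N (fun a => φ a ^ 2) z) (linearPart 0 (cut wt N id z))|
      ≤ 400 * K ^ 4 * ‖cut wt N φ z‖ ^ 2 := by
  have hK := h.one_le
  have hK0 := zero_le_one.trans hK
  set X := ‖cut wt N φ z‖ with hX
  have hX0 : 0 ≤ X := norm_nonneg _
  have hY : ‖cut wt N (fun _ => 1) z‖ ≤ X := by
    refine Sq.norm_le_of_abs_le fun ⟨c, n⟩ => ?_
    rw [cut_wt_apply N φ, abs_mul, abs_of_pos (h.fr_pos n)]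
    exact le_mul_of_one_le_left (abs_nonneg _) (h.one_le_apply (one_le_fr n))
  have hp2 : φ 3 ≤ 3 * K ^ 2 := by
    have h1 := h.add_le (x := 2) (y := 1) (by norm_num) le_rfl
    have h2 := h.add_le (x := 1) (y := 1) le_rfl le_rfl
    rw [h.map_one] at h1 h2
    norm_num at h1 h2
    nlinarith
  have hp : ∀ p ∈ linFreq, φ (fr p) ≤ 3 * K ^ 2 := by
    intro p hp
    have h1 : fr p ≤ 3 := by
      simp only [linFreq, Finset.mem_insert, Finset.mem_singleton] at hp
      rcases hp with rfl | rfl | rfl <;> norm_num [fr]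
    exact (h.mono (one_le_fr p) h1).trans hp2
  have hXY : ∀ p ∈ linFreq, X * (X + φ (fr p) * ‖cut wt N (fun _ => 1) z‖) ≤ 4 * K ^ 2 * X ^ 2 := by
    intro p hpp
    have h1 := hp p hpp
    have h2 : φ (fr p) * ‖cut wt N (fun _ => 1) z‖ ≤ 3 * K ^ 2 * X :=
      mul_le_mul h1 hY (norm_nonneg _) (by positivity)
    have h3 : 1 ≤ K ^ 2 := one_le_pow₀ hK
    nlinarith [mul_le_mul_of_nonneg_left h2 hX0, mul_le_mul_of_nonneg_right h3 (sq_nonneg X)]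
  have ht := inner_transport_le h abs_one_le N 2 z
  have hz : ∀ p ∈ linFreq, ∀ fl (θ : ℤ → ℝ), (∀ l, |θ l| ≤ 5) →
      |inner ℝ (cut wt N (fun a => φ a ^ 2) z)
        (shiftOp 0 (fun _ => 1) θ fl p (cut wt N id z))| ≤ 20 * K ^ 3 * X ^ 2 := by
    intro p hpp fl θ hθ
    refine (inner_shiftOp_le h (by norm_num) abs_one_le hθ N fl p z z).trans ?_
    have := mul_le_mul_of_nonneg_left (hXY p hpp) (by positivity : 0 ≤ 5 * K)
    linarith
  have hKK : K ^ 3 ≤ K ^ 4 := pow_le_pow_right₀ hK (by norm_num)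
  have hsum : |∑ p ∈ linFreq, (inner ℝ (cut wt N (fun a => φ a ^ 2) z)
        (shiftOp 0 (fun _ => 1) (linMult₁ p) false p (cut wt N id z))
      + inner ℝ (cut wt N (fun a => φ a ^ 2) z)
        (shiftOp 0 (fun _ => 1) (linMult₂ p) true p (cut wt N id z)))| ≤ 120 * K ^ 3 * X ^ 2 := by
    refine (Finset.abs_sum_le_sum_abs _ _).trans ((Finset.sum_le_card_nsmul _ _
      (40 * K ^ 3 * X ^ 2) fun p hpp => ?_).trans_eq ?_)
    · refine (abs_add_le _ _).trans ?_
      linarith [hz p hpp false _ (abs_linMult₁_le p), hz p hpp true _ (abs_linMult₂_le p)]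
    · rw [show linFreq.card = 3 by decide]
      simp only [nsmul_eq_mul]
      push_cast
      ring
  have e : inner ℝ (cut wt N (fun a => φ a ^ 2) z) (linearPart 0 (cut wt N id z))
      = -(1 / 4) * (inner ℝ (cut wt N (fun a => φ a ^ 2) z)
          (shiftOp 0 (fun _ => 1) (fun l => l) false 2 (cut wt N id z))
        - inner ℝ (cut wt N (fun a => φ a ^ 2) z)
          (shiftOp 0 (fun _ => 1) (fun l => l) false (-2) (cut wt N id z)))
        + ∑ p ∈ linFreq, (inner ℝ (cut wt N (fun a => φ a ^ 2) z)
        (shiftOp 0 (fun _ => 1) (linMult₁ p) false p (cut wt N id z))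
      + inner ℝ (cut wt N (fun a => φ a ^ 2) z)
        (shiftOp 0 (fun _ => 1) (linMult₂ p) true p (cut wt N id z))) := by
    simp only [linearPart, add_apply, smul_apply, sub_apply, sum_apply, inner_add_right,
      real_inner_smul_right, inner_sub_right, inner_sum]
  rw [e]
  have h3 : (fr 2 : ℝ) = 3 := by norm_num [fr]
  have ht2 : 6 * K ^ 2 * fr 2 * (X * (X + φ (fr 2) * ‖cut wt N (fun _ => 1) z‖))
      ≤ 72 * K ^ 4 * X ^ 2 := by
    have := mul_le_mul_of_nonneg_left (hXY 2 (by decide)) (by positivity : 0 ≤ 18 * K ^ 2)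
    rw [h3] at this ⊢
    linarith
  have hKX := mul_le_mul_of_nonneg_right hKK (sq_nonneg X)
  have hKX0 : 0 ≤ K ^ 4 * X ^ 2 := by positivity
  refine (abs_add_le _ _).trans ?_
  rw [abs_mul, abs_of_neg (by norm_num : (-(1 / 4) : ℝ) < 0)]
  linarith [ht.trans ht2]

/-- The constant of the energy estimates. -/
def energyConst (K : ℝ) : ℝ := 400 * K ^ 4 + 144 * K ^ 4 * ‖invSq‖

theorem card_boolKind : Fintype.card (Bool × Kind) = 6 := rfl

/-- The energy estimate, polarized in the coefficient. -/
theorem polarized_energy_le (h : Admissible φ K) (N : ℝ) {u z : Sq Idx} (hu : IsOddSeq u) :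
    |inner ℝ (cut wt N (fun a => φ a ^ 2) z)
        (linearPart 0 (cut wt N id z) + bilinearPart 0 (cut wt N id u) (cut wt N id z))|
      ≤ energyConst K * ((1 + ‖cut wt N (fun _ => 1) u‖) * ‖cut wt N φ z‖ ^ 2
        + ‖cut wt N φ u‖ * ‖cut wt N (fun _ => 1) z‖ * ‖cut wt N φ z‖) := by
  have hK0 := zero_le_one.trans h.one_le
  rw [inner_add_right, bilinearPart_apply, inner_sum]
  have h1 := inner_linearPart_le h N z
  set S := ‖cut wt N (fun _ => 1) u‖ * ‖cut wt N φ z‖ ^ 2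
        + ‖cut wt N φ u‖ * ‖cut wt N (fun _ => 1) z‖ * ‖cut wt N φ z‖ with hS
  have hS0 : 0 ≤ S := by positivity
  have h2 := (Finset.abs_sum_le_sum_abs (fun j : Bool × Kind =>
      (inner ℝ (cut wt N (fun a => φ a ^ 2) z)
        (bil (j.2.coef 0 j.1) (bilShift 0 j.1 j.2) (cut wt N id u) (cut wt N id z)) : ℝ))
      Finset.univ).trans
    (Finset.sum_le_card_nsmul _ _ _ fun j _ => inner_bilTerm_le h j.2 j.1 N hu)
  rw [Finset.card_univ, card_boolKind, nsmul_eq_mul] at h2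
  refine (abs_add_le _ _).trans ((add_le_add h1 h2).trans ?_)
  have e : (1 + ‖cut wt N (fun _ => 1) u‖) * ‖cut wt N φ z‖ ^ 2
        + ‖cut wt N φ u‖ * ‖cut wt N (fun _ => 1) z‖ * ‖cut wt N φ z‖
      = ‖cut wt N φ z‖ ^ 2 + S := by rw [hS]; ring
  rw [e, energyConst, ← hS]
  push_cast
  have t1 : 0 ≤ 400 * K ^ 4 * S := by positivity
  have t2 : 0 ≤ 144 * K ^ 4 * ‖invSq‖ * ‖cut wt N φ z‖ ^ 2 := by positivity
  linarith

theorem isOddSeq_oddProj (u : Sq Idx) : IsOddSeq (oddProj u) := by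
  intro c n
  rw [oddProj_apply, oddProj_apply, abs_neg, neg_neg]
  split_ifs <;> ring

theorem oddProj_oddProj (u : Sq Idx) : oddProj (oddProj u) = oddProj u := by
  refine Sq.ext fun ⟨c, n⟩ => ?_
  rw [oddProj_apply, oddProj_apply, oddProj_apply, abs_neg, neg_neg]
  split_ifs <;> ring

theorem oddProj_cut (N : ℝ) (φ : ℝ → ℝ) (u : Sq Idx) :
    oddProj (cut wt N φ u) = cut wt N φ (oddProj u) := by
  refine Sq.ext fun ⟨c, n⟩ => ?_
  rw [oddProj_apply, cut_apply wt_fin, cut_apply wt_fin, cut_apply wt_fin, oddProj_apply]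
  simp only [wt, fr_neg]
  by_cases hN : fr n ≤ N
  · simp only [hN, if_true]
    split_ifs <;> ring
  · simp [hN]

theorem norm_oddProj_le (u : Sq Idx) : ‖oddProj u‖ ≤ ‖u‖ := by
  have hinj : Function.Injective fun i : Idx => (i.1, -i.2) := by
    rintro ⟨a, n⟩ ⟨b, k⟩ h
    simpa using h
  have hb : ∀ i : Idx, |(if 2 ≤ |i.2| then 1 else 0 : ℝ)| ≤ 1 := fun i => by
    split_ifs <;> simp
  have h1 := norm_dg_apply_le hb zero_le_one u
  have h2 := norm_wcomp_apply_le hb zero_le_one hinj u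
  have h3 := norm_sub_le (dg (fun i : Idx => if 2 ≤ |i.2| then 1 else 0) u)
    (wcomp (fun i : Idx => if 2 ≤ |i.2| then 1 else 0) (fun i : Idx => (i.1, -i.2)) u)
  rw [oddProj, smul_apply, norm_smul, sub_apply, Real.norm_of_nonneg (by norm_num)]
  linarith

theorem inner_oddProj (u v : Sq Idx) : inner ℝ u (oddProj v) = inner ℝ (oddProj u) v := by
  have s1 := Sq.hasSum_inner u (oddProj v)
  have s2 := Sq.hasSum_inner (oddProj u) v
  have e : ∀ f : Idx → ℝ, ∀ a, HasSum f a → HasSum (fun i : Idx => f (i.1, -i.2)) a := fun f a hf =>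
    ((Equiv.refl Bool).prodCongr (Equiv.neg ℤ)).hasSum_iff.2 hf
  have s3 := (s1.add (e _ _ s1)).mul_left (1 / 2)
  have s4 := (s2.add (e _ _ s2)).mul_left (1 / 2)
  have : (fun i : Idx => 1 / 2 * (u i * oddProj v i + u (i.1, -i.2) * oddProj v (i.1, -i.2)))
      = fun i : Idx => 1 / 2 * (oddProj u i * v i + oddProj u (i.1, -i.2) * v (i.1, -i.2)) := by
    ext ⟨c, n⟩
    simp only [oddProj_apply, abs_neg, neg_neg]
    split_ifs <;> ring
  rw [this] at s3
  have := s3.unique s4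
  linarith

/-- The energy estimate, with a constant that depends on the weight through `K` only. -/
theorem energyBound (h : Admissible φ K) : mhdScale.EnergyBound φ (2 * energyConst K) := by
  intro N u
  change |inner ℝ (cut wt N (fun a => φ a ^ 2) u) (mhdScale.G 0 (cut wt N id u))|
    ≤ 2 * energyConst K * (1 + ‖cut wt N (fun _ => 1) u‖) * ‖cut wt N φ u‖ ^ 2
  rw [mhdScale_G, inner_oddProj, oddProj_cut, oddProj_cut]
  set z := oddProj u with hz
  have h1 := polarized_energy_le h N (z := z) (isOddSeq_oddProj u)
  have hle : ∀ φ, ‖cut wt N φ z‖ ≤ ‖cut wt N φ u‖ := fun φ => by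
    rw [hz, ← oddProj_cut]; exact norm_oddProj_le _
  refine h1.trans ?_
  have hc : 0 ≤ energyConst K := by
    have := zero_le_one.trans h.one_le
    unfold energyConst
    positivity
  have h2 := hle φ
  have h3 := hle (fun _ => 1)
  have h4 : ‖cut wt N φ z‖ ^ 2 ≤ ‖cut wt N φ u‖ ^ 2 := pow_le_pow_left₀ (norm_nonneg _) h2 2
  have h5 : (1 + ‖cut wt N (fun _ => 1) z‖) * ‖cut wt N φ z‖ ^ 2
      + ‖cut wt N φ z‖ * ‖cut wt N (fun _ => 1) z‖ * ‖cut wt N φ z‖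
      ≤ 2 * ((1 + ‖cut wt N (fun _ => 1) u‖) * ‖cut wt N φ u‖ ^ 2) := by
    have t1 := mul_le_mul (add_le_add_right h3 1) h4 (by positivity) (by positivity)
    have t2 := mul_le_mul h3 h4 (by positivity) (norm_nonneg _)
    nlinarith [sq_nonneg ‖cut wt N φ u‖]
  have := mul_le_mul_of_nonneg_left h5 hc
  linarith

/-- Without cancellation, a bilinear term costs one derivative of its second argument and none of
its first. -/
theorem norm_bilTerm_le (k : Kind) (c : Bool) (N : ℝ) (d v : Sq Idx) :
    ‖bil (k.coef 0 c) (bilShift 0 c k) (cut wt N id d) (cut wt N id v)‖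
      ≤ 8 * ‖invSq‖ * ‖cut wt N (fun _ => 1) d‖ * ‖cut wt N id v‖ := by
  obtain ⟨s2, b2⟩ := weighted_sum_seq admissible_one k c (x := raw 0 (cut wt N id d))
    (y := cut wt N (fun _ => 1) d) fun c n => by rw [raw_cut_id, one_mul]
  simp only [one_mul] at s2 b2
  have s1 := hasSum_bilTerm 0 c k (cut wt N id d) (cut wt N id v)
  rw [← s1.tsum_eq]
  refine (tsum_of_norm_bounded (s2.mul_right ‖cut wt N id v‖).hasSum fun p => ?_).trans ?_
  · rw [norm_smul, Real.norm_eq_abs]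
    have h1 := (bilShift 0 c k p).le_of_opNorm_le
      (norm_shiftOp_le zero_le_one (abs_comp_le c) k.abs_mult_le 0 _ p) (cut wt N id v)
    rw [pow_zero, mul_one, one_mul] at h1
    have h2 := mul_le_mul_of_nonneg_left h1 (abs_nonneg (k.seq (raw 0 (cut wt N id d)) c p))
    have h3 := mul_le_mul_of_nonneg_right (k.one_le_loss p)
      (mul_nonneg (abs_nonneg (k.seq (raw 0 (cut wt N id d)) c p)) (norm_nonneg (cut wt N id v)))
    linarith
  · rw [tsum_mul_right]
    refine (mul_le_mul_of_nonneg_right b2 (norm_nonneg _)).trans_eq ?_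
    ring

/-- In `G u - G v = L d + B u d + B d v` with `d = u - v`, the terms in which `d` is transported are
estimated by the energy estimate, and `B d v` directly. -/
theorem differenceBound : mhdScale.DifferenceBound (2 * energyConst 1) := by
  intro N u v
  change |inner ℝ (cut wt N (fun _ => 1) (u - v))
      (mhdScale.G 0 (cut wt N id u) - mhdScale.G 0 (cut wt N id v))|
    ≤ 2 * energyConst 1 * (1 + ‖cut wt N id u‖ + ‖cut wt N id v‖) *
      ‖cut wt N (fun _ => 1) (u - v)‖ ^ 2
  rw [mhdScale_G, mhdScale_G, ← map_sub, inner_oddProj]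
  simp only [oddProj_cut]
  have hle : ∀ φ w, ‖cut wt N φ (oddProj w)‖ ≤ ‖cut wt N φ w‖ := fun φ w => by
    rw [← oddProj_cut]; exact norm_oddProj_le _
  have h0 : ∀ w, ‖cut wt N (fun _ => 1) w‖ ≤ ‖cut wt N id w‖ := fun w => by
    refine Sq.norm_le_of_abs_le fun ⟨c, n⟩ => ?_
    rw [cut_wt_apply N id, abs_mul]
    exact le_mul_of_one_le_left (abs_nonneg _) ((one_le_fr n).trans (le_abs_self _))
  set U := oddProj u with hU
  set V := oddProj v with hV
  set D := oddProj (u - v) with hD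
  have hDU : D = U - V := by rw [hD, map_sub]
  have e : linearPart 0 (cut wt N id U) + bilinearPart 0 (cut wt N id U) (cut wt N id U)
      - (linearPart 0 (cut wt N id V) + bilinearPart 0 (cut wt N id V) (cut wt N id V))
      = (linearPart 0 (cut wt N id D) + bilinearPart 0 (cut wt N id U) (cut wt N id D))
        + bilinearPart 0 (cut wt N id D) (cut wt N id V) := by
    simp only [hDU, map_sub, sub_apply]
    abel
  rw [e, inner_add_right]
  have h1 := polarized_energy_le admissible_one N (u := U) (z := D) (isOddSeq_oddProj u)
  simp only [one_pow] at h1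
  have h2 : |inner ℝ (cut wt N (fun _ => 1) D) (bilinearPart 0 (cut wt N id D) (cut wt N id V))|
      ≤ 48 * ‖invSq‖ * ‖cut wt N id V‖ * ‖cut wt N (fun _ => 1) D‖ ^ 2 := by
    refine (abs_real_inner_le_norm _ _).trans ?_
    have h3 : ‖bilinearPart 0 (cut wt N id D) (cut wt N id V)‖
        ≤ 6 * (8 * ‖invSq‖ * ‖cut wt N (fun _ => 1) D‖ * ‖cut wt N id V‖) := by
      rw [bilinearPart_apply]
      refine (norm_sum_le _ _).trans ((Finset.sum_le_card_nsmul _ _ _ fun j _ =>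
        norm_bilTerm_le j.2 j.1 N D V).trans_eq ?_)
      rw [Finset.card_univ, card_boolKind, nsmul_eq_mul]
      norm_num
    have := mul_le_mul_of_nonneg_left h3 (norm_nonneg (cut wt N (fun _ => 1) D))
    linarith
  have hUn := (h0 U).trans (hle id u)
  have hVn := hle id v
  have hDn := hle (fun _ => 1) (u - v)
  set d := ‖cut wt N (fun _ => 1) D‖
  have hd : 0 ≤ d := norm_nonneg _
  have hd2 : d ^ 2 ≤ ‖cut wt N (fun _ => 1) (u - v)‖ ^ 2 := pow_le_pow_left₀ hd hDn 2
  have hc : 48 * ‖invSq‖ ≤ energyConst 1 := by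
    unfold energyConst
    have := norm_nonneg invSq
    linarith
  have hc0 : 0 ≤ energyConst 1 := by unfold energyConst; positivity
  set E := energyConst 1
  have hun := norm_nonneg (cut wt N id u)
  have hvn := norm_nonneg (cut wt N id v)
  have t1 : E * ((1 + ‖cut wt N (fun _ => 1) U‖) * d ^ 2 + ‖cut wt N (fun _ => 1) U‖ * d * d)
      ≤ E * ((1 + 2 * ‖cut wt N id u‖) * d ^ 2) := by
    refine mul_le_mul_of_nonneg_left ?_ hc0
    nlinarith [mul_le_mul_of_nonneg_right hUn (sq_nonneg d)]
  have t2 : 48 * ‖invSq‖ * ‖cut wt N id V‖ * d ^ 2 ≤ E * ‖cut wt N id v‖ * d ^ 2 := by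
    gcongr
  have t3 : E * (1 + 2 * ‖cut wt N id u‖ + ‖cut wt N id v‖) * d ^ 2
      ≤ 2 * E * (1 + ‖cut wt N id u‖ + ‖cut wt N id v‖)
        * ‖cut wt N (fun _ => 1) (u - v)‖ ^ 2 := by
    refine mul_le_mul ?_ hd2 (sq_nonneg _) (by positivity)
    nlinarith
  refine (abs_add_le _ _).trans ?_
  linarith

end energy

/-! ### Sine and cosine series -/

/-- The sine series `½ ∑ x n sin (n θ)` over all integers `n`. -/
def sinS (x : ℤ → ℝ) (θ : ℝ) : ℝ := 1 / 2 * ∑' n : ℤ, x n * Real.sin (n * θ)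

/-- The cosine series `½ ∑ x n cos (n θ)` over all integers `n`. -/
def cosS (x : ℤ → ℝ) (θ : ℝ) : ℝ := 1 / 2 * ∑' n : ℤ, x n * Real.cos (n * θ)

section series

variable {x y : ℤ → ℝ}

theorem summable_mul_bdd (hx : Summable x) {u : ℤ → ℝ} {C : ℝ} (hu : ∀ n, |u n| ≤ C) :
    Summable fun n => x n * u n := by
  refine Summable.of_norm_bounded (hx.abs.mul_right C) fun n => ?_
  rw [Real.norm_eq_abs, abs_mul]
  exact mul_le_mul_of_nonneg_left (hu n) (abs_nonneg _)

theorem summable_sin (hx : Summable x) (θ : ℝ) : Summable fun n : ℤ => x n * Real.sin (n * θ) :=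
  summable_mul_bdd hx fun _ => Real.abs_sin_le_one _

theorem summable_cos (hx : Summable x) (θ : ℝ) : Summable fun n : ℤ => x n * Real.cos (n * θ) :=
  summable_mul_bdd hx fun _ => Real.abs_cos_le_one _

theorem sinS_zero_right (x : ℤ → ℝ) : sinS x 0 = 0 := by simp [sinS]

theorem sinS_odd (x : ℤ → ℝ) : Function.Odd (sinS x) := by
  intro θ
  simp only [sinS, mul_neg, Real.sin_neg, tsum_neg]

theorem sinS_periodic (x : ℤ → ℝ) : Function.Periodic (sinS x) (2 * Real.pi) := by
  intro θ
  simp only [sinS, mul_add, Real.sin_add_int_mul_two_pi]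

theorem cosS_periodic (x : ℤ → ℝ) : Function.Periodic (cosS x) (2 * Real.pi) := by
  intro θ
  simp only [cosS, mul_add, Real.cos_add_int_mul_two_pi]

theorem continuous_sinS (hx : Summable x) : Continuous (sinS x) := by
  refine continuous_const.mul (continuous_tsum (fun n => by fun_prop) hx.abs fun n θ => ?_)
  rw [Real.norm_eq_abs, abs_mul]
  exact mul_le_of_le_one_right (abs_nonneg _) (Real.abs_sin_le_one _)

theorem continuous_cosS (hx : Summable x) : Continuous (cosS x) := by
  refine continuous_const.mul (continuous_tsum (fun n => by fun_prop) hx.abs fun n θ => ?_)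
  rw [Real.norm_eq_abs, abs_mul]
  exact mul_le_of_le_one_right (abs_nonneg _) (Real.abs_cos_le_one _)

theorem hasDerivAt_sinS (hx : Summable x) (hx' : Summable fun n : ℤ => (n : ℝ) * x n) (θ : ℝ) :
    HasDerivAt (sinS x) (cosS (fun n => n * x n) θ) θ := by
  refine (hasDerivAt_tsum hx'.abs (g := fun (n : ℤ) θ => x n * Real.sin (n * θ))
    (g' := fun (n : ℤ) θ => n * x n * Real.cos (n * θ)) (fun n θ => ?_) (fun n θ => ?_)
    (y₀ := 0) (summable_sin hx 0) θ).const_mul (1 / 2)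
  · convert! (((hasDerivAt_id θ).const_mul (n : ℝ)).sin).const_mul (x n) using 1
    simp only [id]
    ring
  · rw [Real.norm_eq_abs, abs_mul]
    exact mul_le_of_le_one_right (abs_nonneg _) (Real.abs_cos_le_one _)

theorem hasDerivAt_cosS (hx : Summable x) (hx' : Summable fun n : ℤ => (n : ℝ) * x n) (θ : ℝ) :
    HasDerivAt (cosS x) (-sinS (fun n => n * x n) θ) θ := by
  have h := (hasDerivAt_tsum hx'.abs (g := fun (n : ℤ) θ => x n * Real.cos (n * θ))
    (g' := fun (n : ℤ) θ => -(n * x n * Real.sin (n * θ))) (fun n θ => ?_) (fun n θ => ?_)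
    (y₀ := 0) (summable_cos hx 0) θ).const_mul (1 / 2)
  · convert! h using 1
    rw [sinS, tsum_neg]
    ring
  · convert! (((hasDerivAt_id θ).const_mul (n : ℝ)).cos).const_mul (x n) using 1
    simp only [id]
    ring
  · rw [Real.norm_eq_abs, abs_neg, abs_mul]
    exact mul_le_of_le_one_right (abs_nonneg _) (Real.abs_sin_le_one _)

theorem sinS_add (hx : Summable x) (hy : Summable y) (θ : ℝ) :
    sinS (fun n => x n + y n) θ = sinS x θ + sinS y θ := by
  simp only [sinS, add_mul]
  rw [(summable_sin hx θ).tsum_add (summable_sin hy θ)]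
  ring

theorem cosS_add (hx : Summable x) (hy : Summable y) (θ : ℝ) :
    cosS (fun n => x n + y n) θ = cosS x θ + cosS y θ := by
  simp only [cosS, add_mul]
  rw [(summable_cos hx θ).tsum_add (summable_cos hy θ)]
  ring

theorem sinS_smul (a : ℝ) (x : ℤ → ℝ) (θ : ℝ) : sinS (fun n => a * x n) θ = a * sinS x θ := by
  simp only [sinS, mul_assoc, tsum_mul_left]
  ring

theorem cosS_smul (a : ℝ) (x : ℤ → ℝ) (θ : ℝ) : cosS (fun n => a * x n) θ = a * cosS x θ := by
  simp only [cosS, mul_assoc, tsum_mul_left]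
  ring

theorem summable_shift (hx : Summable x) (p : ℤ) : Summable fun n => x (n - p) :=
  hx.comp_injective (sub_left_injective (b := p))

theorem sinS_shift (hx : Summable x) (p : ℤ) (θ : ℝ) :
    sinS (fun n => x (n - p)) θ
      = Real.sin (p * θ) * cosS x θ + Real.cos (p * θ) * sinS x θ := by
  have e : ∑' n : ℤ, x (n - p) * Real.sin (n * θ)
      = ∑' n : ℤ, x n * Real.sin ((n + p : ℤ) * θ) := by
    rw [← (Equiv.subRight p).tsum_eq fun n => x n * Real.sin ((n + p : ℤ) * θ)]
    simp
  have e2 : ∀ n : ℤ, x n * Real.sin ((n + p : ℤ) * θ)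
      = Real.sin (p * θ) * (x n * Real.cos (n * θ))
        + Real.cos (p * θ) * (x n * Real.sin (n * θ)) := by
    intro n
    push_cast
    rw [add_mul, Real.sin_add]
    ring
  rw [sinS, e]
  simp only [e2]
  rw [((summable_cos hx θ).mul_left _).tsum_add ((summable_sin hx θ).mul_left _), tsum_mul_left,
    tsum_mul_left, sinS, cosS]
  ring

theorem cosS_shift (hx : Summable x) (p : ℤ) (θ : ℝ) :
    cosS (fun n => x (n - p)) θ
      = Real.cos (p * θ) * cosS x θ - Real.sin (p * θ) * sinS x θ := by
  have e : ∑' n : ℤ, x (n - p) * Real.cos (n * θ)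
      = ∑' n : ℤ, x n * Real.cos ((n + p : ℤ) * θ) := by
    rw [← (Equiv.subRight p).tsum_eq fun n => x n * Real.cos ((n + p : ℤ) * θ)]
    simp
  have e2 : ∀ n : ℤ, x n * Real.cos ((n + p : ℤ) * θ)
      = Real.cos (p * θ) * (x n * Real.cos (n * θ))
        - Real.sin (p * θ) * (x n * Real.sin (n * θ)) := by
    intro n
    push_cast
    rw [add_mul, Real.cos_add]
    ring
  rw [cosS, e]
  simp only [e2]
  rw [((summable_cos hx θ).mul_left _).tsum_sub ((summable_sin hx θ).mul_left _), tsum_mul_left,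
    tsum_mul_left, sinS, cosS]
  ring

theorem sinS_eq_zero (hx : ∀ n, x (-n) = x n) (θ : ℝ) : sinS x θ = 0 := by
  have h := (Equiv.neg ℤ).tsum_eq fun n : ℤ => x n * Real.sin (n * θ)
  simp only [Equiv.neg_apply, hx, Int.cast_neg, neg_mul, Real.sin_neg, mul_neg, tsum_neg] at h
  rw [sinS]
  linarith

theorem cosS_eq_zero (hx : ∀ n, x (-n) = -x n) (θ : ℝ) : cosS x θ = 0 := by
  have h := (Equiv.neg ℤ).tsum_eq fun n : ℤ => x n * Real.cos (n * θ)
  simp only [Equiv.neg_apply, hx, Int.cast_neg, neg_mul, Real.cos_neg, tsum_neg] at h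
  rw [cosS]
  linarith

theorem summable_succ (hx : Summable x) : Summable fun n => x (n + 1) := by
  simpa using summable_shift hx (-1)

theorem sinS_succ (hx : Summable x) (θ : ℝ) :
    sinS (fun n => x (n + 1)) θ = -(Real.sin θ * cosS x θ) + Real.cos θ * sinS x θ := by
  have := sinS_shift hx (-1) θ
  simpa using this

theorem sinS_pred (hx : Summable x) (θ : ℝ) :
    sinS (fun n => x (n - 1)) θ = Real.sin θ * cosS x θ + Real.cos θ * sinS x θ := by
  have := sinS_shift hx 1 θ
  simpa using this

theorem cosS_succ (hx : Summable x) (θ : ℝ) :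
    cosS (fun n => x (n + 1)) θ = Real.cos θ * cosS x θ + Real.sin θ * sinS x θ := by
  have := cosS_shift hx (-1) θ
  simpa using this

theorem cosS_pred (hx : Summable x) (θ : ℝ) :
    cosS (fun n => x (n - 1)) θ = Real.cos θ * cosS x θ - Real.sin θ * sinS x θ := by
  have := cosS_shift hx 1 θ
  simpa using this

theorem sin_mul_sinS (hx : Summable x) (θ : ℝ) :
    Real.sin θ * sinS x θ = cosS (fun n => 1 / 2 * (x (n + 1) + -1 * x (n - 1))) θ := by
  rw [cosS_smul, cosS_add (summable_succ hx) ((summable_shift hx 1).mul_left _), cosS_smul,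
    cosS_succ hx, cosS_pred hx]
  ring

theorem sin_mul_cosS (hx : Summable x) (θ : ℝ) :
    Real.sin θ * cosS x θ = sinS (fun n => 1 / 2 * (x (n - 1) + -1 * x (n + 1))) θ := by
  rw [sinS_smul, sinS_add (summable_shift hx 1) ((summable_succ hx).mul_left _), sinS_smul,
    sinS_succ hx, sinS_pred hx]
  ring

theorem cos_mul_cosS (hx : Summable x) (θ : ℝ) :
    Real.cos θ * cosS x θ = cosS (fun n => 1 / 2 * (x (n - 1) + x (n + 1))) θ := by
  rw [cosS_smul, cosS_add (summable_shift hx 1) (summable_succ hx), cosS_succ hx, cosS_pred hx]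
  ring

theorem cos_mul_sinS (hx : Summable x) (θ : ℝ) :
    Real.cos θ * sinS x θ = sinS (fun n => 1 / 2 * (x (n - 1) + x (n + 1))) θ := by
  rw [sinS_smul, sinS_add (summable_shift hx 1) (summable_succ hx), sinS_succ hx, sinS_pred hx]
  ring

end series

/-! ### The series of the primitive and of the velocity -/

section primitive

variable {x : ℤ → ℝ}

theorem mul_aSeq (x : ℤ → ℝ) {n : ℤ} (hn : n ≠ 0) :
    (n : ℝ) * aSeq x n = 1 / 2 * (x (n + 1) + -1 * x (n - 1)) := by
  rw [aSeq]
  have : (n : ℝ) ≠ 0 := by exact_mod_cast hn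
  field_simp
  ring

theorem summable_mul_aSeq (hx : Summable x) : Summable fun n : ℤ => (n : ℝ) * aSeq x n := by
  have h := ((summable_succ hx).add ((summable_shift hx 1).mul_left (-1))).mul_left (1 / 2)
  refine Summable.of_norm_bounded h.abs fun n => ?_
  rcases eq_or_ne n 0 with rfl | hn
  · simp
  · rw [mul_aSeq x hn, Real.norm_eq_abs]

theorem abs_sign_mul_le (n : ℤ) (a : ℝ) : |((n.sign : ℤ) : ℝ) * a| ≤ |a| := by
  rw [abs_mul]; exact mul_le_of_le_one_left (abs_nonneg _) (abs_sign_le n)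

theorem summable_aSeq (hx : Summable x) : Summable (aSeq x) := by
  refine Summable.of_norm_bounded (summable_mul_aSeq hx).abs fun n => ?_
  rcases eq_or_ne n 0 with rfl | hn
  · simp [aSeq]
  · rw [Real.norm_eq_abs, abs_mul]
    exact le_mul_of_one_le_left (abs_nonneg _) (abs_cast_le_of_ne hn)

theorem mul_vSeq (x : ℤ → ℝ) (n : ℤ) :
    (n : ℝ) * vSeq x n = -((n.sign : ℤ) : ℝ) * aSeq x n := by
  rw [vSeq]
  rcases lt_trichotomy n 0 with h | h | h
  · have h' : (n : ℝ) < 0 := by exact_mod_cast h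
    rw [abs_of_neg h', Int.sign_eq_neg_one_of_neg h]
    have := h'.ne
    push_cast
    field_simp
  · simp [h]
  · have h' : 0 < (n : ℝ) := by exact_mod_cast h
    rw [abs_of_pos h', Int.sign_eq_one_of_pos h]
    have := h'.ne'
    push_cast
    field_simp

theorem summable_mul_vSeq (hx : Summable x) : Summable fun n : ℤ => (n : ℝ) * vSeq x n := by
  refine Summable.of_norm_bounded (summable_aSeq hx).abs fun n => ?_
  rw [mul_vSeq, neg_mul, norm_neg]
  exact abs_sign_mul_le n _

theorem summable_vSeq (hx : Summable x) : Summable (vSeq x) := by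
  refine Summable.of_norm_bounded (summable_aSeq hx).abs fun n => ?_
  rw [Real.norm_eq_abs, abs_vSeq]
  exact mul_le_of_le_one_left (abs_nonneg _) (inv_abs_cast_le_one n)

/-- The primitive has derivative `sin θ * α`. There is no constant term in the derivative because
the first coefficients vanish. -/
theorem hasDerivAt_sinS_aSeq (hx : Summable x) (h1 : x 1 = x (-1)) (θ : ℝ) :
    HasDerivAt (sinS (aSeq x)) (Real.sin θ * sinS x θ) θ := by
  convert! hasDerivAt_sinS (summable_aSeq hx) (summable_mul_aSeq hx) θ using 1
  rw [sin_mul_sinS hx]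
  congr 1
  ext n
  rcases eq_or_ne n 0 with rfl | hn
  · simp [h1]
  · rw [mul_aSeq x hn]

/-- The Hilbert transform of a sine series. -/
def hilbS (x : ℤ → ℝ) : ℝ → ℝ := cosS fun n => -((n.sign : ℤ) : ℝ) * x n

theorem summable_sign (hx : Summable x) : Summable fun n : ℤ => -((n.sign : ℤ) : ℝ) * x n := by
  refine Summable.of_norm_bounded hx.abs fun n => ?_
  rw [neg_mul, norm_neg]
  exact abs_sign_mul_le n _

/-- The derivative of the velocity is the Hilbert transform of the primitive. -/
theorem hasDerivAt_sinS_vSeq (hx : Summable x) (θ : ℝ) :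
    HasDerivAt (sinS (vSeq x)) (hilbS (aSeq x) θ) θ := by
  convert! hasDerivAt_sinS (summable_vSeq hx) (summable_mul_vSeq hx) θ using 1
  rw [hilbS]
  congr 1
  ext n
  rw [mul_vSeq]

/-- The Hilbert transform commutes with multiplication by `sin θ` on series without low frequencies,
so that `∂_θ H a = sin θ * H α`. -/
theorem hasDerivAt_hilbS_aSeq (hx : Summable x) (h0 : x 0 = 0) (h1 : x 1 = 0) (h2 : x (-1) = 0)
    (θ : ℝ) : HasDerivAt (hilbS (aSeq x)) (Real.sin θ * hilbS x θ) θ := by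
  have hs : Summable fun n : ℤ => (n : ℝ) * (-((n.sign : ℤ) : ℝ) * aSeq x n) :=
    (summable_sign (summable_mul_aSeq hx)).congr fun n => by ring
  convert! hasDerivAt_cosS (summable_sign (summable_aSeq hx)) hs θ using 1
  rw [hilbS, sin_mul_cosS (summable_sign hx),
    ← neg_one_mul (sinS (fun n => (n : ℝ) * (-((n.sign : ℤ) : ℝ) * aSeq x n)) θ), ← sinS_smul]
  congr 1
  ext n
  have key : ∀ k : ℤ, k ≠ 0 → (|k - n| = 1) → ((n.sign : ℤ) : ℝ) * x k = ((k.sign : ℤ) : ℝ) * x k := by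
    intro k hk hkn
    by_cases hk1 : k = 1
    · rw [hk1, h1]; simp
    by_cases hk2 : k = -1
    · rw [hk2, h2]; simp
    congr 2
    have h3 := abs_le.1 hkn.le
    rcases lt_or_gt_of_ne hk with h | h
    · rw [Int.sign_eq_neg_one_of_neg h, Int.sign_eq_neg_one_of_neg (by omega)]
    · rw [Int.sign_eq_one_of_pos h, Int.sign_eq_one_of_pos (by omega)]
  have key' : ∀ k : ℤ, (|k - n| = 1) → ((n.sign : ℤ) : ℝ) * x k = ((k.sign : ℤ) : ℝ) * x k := by
    intro k hkn
    by_cases hk : k = 0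
    · rw [hk, h0]; simp
    · exact key k hk hkn
  have k1 := key' (n - 1) (by simp)
  have k2 := key' (n + 1) (by simp)
  rcases eq_or_ne n 0 with rfl | hn
  · simp [h1, h2]
  · have h3 := mul_aSeq x hn
    calc _ = 1 / 2 * (((n + 1).sign : ℤ) * x (n + 1) + -1 * (((n - 1).sign : ℤ) * x (n - 1))) := by
          ring
      _ = ((n.sign : ℤ) : ℝ) * (1 / 2 * (x (n + 1) + -1 * x (n - 1))) := by rw [← k1, ← k2]; ring
      _ = _ := by rw [← h3]; ring

theorem vSeq_zero (x : ℤ → ℝ) : vSeq x 0 = 0 := by simp [vSeq, aSeq]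

theorem qSeq_neg (x : ℤ → ℝ) (j : ℤ) : qSeq x (-j) = qSeq x j := by simp [qSeq]

theorem qSeq_sub (hx : Summable x) (hodd : ∀ n, x (-n) = -x n) (n : ℤ) :
    1 / 2 * (qSeq x (n - 1) + -1 * qSeq x (n + 1)) = vSeq x n := by
  have hpos : ∀ n : ℤ, 0 < n → 1 / 2 * (qSeq x (n - 1) + -1 * qSeq x (n + 1)) = vSeq x n := by
    intro n hn
    have hinj : Function.Injective fun i : ℕ => |n - 1| + 1 + 2 * (i : ℤ) := fun a b h => by
      simp only at h; omega
    have hs : Summable fun i : ℕ => vSeq x (|n - 1| + 1 + 2 * i) :=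
      (summable_vSeq hx).comp_injective hinj
    rw [qSeq, qSeq, hs.tsum_eq_zero_add]
    have e : ∀ i : ℕ, vSeq x (|n - 1| + 1 + 2 * ((i + 1 : ℕ) : ℤ))
        = vSeq x (|n + 1| + 1 + 2 * i) := by
      intro i
      congr 1
      rw [abs_of_nonneg (by omega), abs_of_nonneg (by omega)]
      push_cast
      ring
    simp only [e]
    rw [show |n - 1| + 1 + 2 * ((0 : ℕ) : ℤ) = n by rw [abs_of_nonneg (by omega)]; simp]
    ring
  rcases lt_trichotomy n 0 with h | h | h
  · have h1 := hpos (-n) (by omega)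
    rw [vSeq_neg hodd, ← qSeq_neg x (-n - 1), ← qSeq_neg x (-n + 1)] at h1
    rw [show -(-n - 1) = n + 1 by ring, show -(-n + 1) = n - 1 by ring] at h1
    linarith
  · subst h
    rw [vSeq_zero, zero_sub, zero_add, qSeq_neg]
    ring
  · exact hpos n h

/-- The velocity of an odd function is divisible by `sin θ`. -/
theorem sinS_vSeq (hx : Summable x) (hq : Summable (qSeq x)) (hodd : ∀ n, x (-n) = -x n) (θ : ℝ) :
    sinS (vSeq x) θ = Real.sin θ * cosS (qSeq x) θ := by
  rw [sin_mul_cosS hq]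
  congr 1
  ext n
  rw [qSeq_sub hx hodd]

theorem cosS_cSeq (hq : Summable (qSeq x)) (θ : ℝ) :
    cosS (cSeq x) θ = Real.cos θ * cosS (qSeq x) θ := by
  rw [cos_mul_cosS hq]
  rfl

end primitive

/-! ### The vector field in physical space -/

theorem summable_inv_fr_sq : Summable fun n : ℤ => ((fr n)⁻¹) ^ 2 := by
  have h : Summable fun n : ℤ => 2 * ((fr n)⁻¹ * |(n : ℝ)|⁻¹) + if n = 0 then 1 else 0 :=
    (summable_inv_sq_int.mul_left 2).add (hasSum_ite_eq 0 (1 : ℝ)).summable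
  refine Summable.of_nonneg_of_le (fun n => by positivity) (fun n => ?_) h
  have hp := fr_pos n
  rcases eq_or_ne n 0 with rfl | hn
  · simp [fr]
  · have h1 := abs_cast_le_of_ne hn
    rw [if_neg hn, add_zero, pow_two]
    have h2 : (fr n)⁻¹ ≤ |(n : ℝ)|⁻¹ := inv_anti₀ (by linarith) (abs_le_fr n)
    have h3 : 0 ≤ (fr n)⁻¹ := by positivity
    nlinarith [mul_le_mul_of_nonneg_left h2 h3, mul_nonneg h3 h3]

/-- The square summable sequence `1 / (1 + |n|)`. -/
def invFr : Sq ℤ := Sq.mk (fun n => (fr n)⁻¹) summable_inv_fr_sq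

/-- A component of a pair of sequences. -/
def compL (c : Bool) : Sq Idx →L[ℝ] Sq ℤ := wcomp (fun _ => 1) fun n => (c, n)

theorem compL_apply (c : Bool) (Z : Sq Idx) (n : ℤ) : compL c Z n = Z (c, n) := by
  rw [compL, wcomp_apply ⟨⟨1, fun _ => by simp⟩, fun a b h => by simpa using h⟩, one_mul]

theorem summable_inv_fr_mul (Z : Sq Idx) (c : Bool) : Summable fun n : ℤ => (fr n)⁻¹ * Z (c, n) :=
  (tsum_abs_mul_le invFr (compL c Z) Function.injective_id zero_le_one fun n => by
    rw [one_mul, abs_mul, id, compL_apply]; exact le_rfl).1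

theorem summable_raw_zero (Z : Sq Idx) (c : Bool) : Summable (raw 0 Z c) := by
  refine (summable_inv_fr_mul Z c).congr fun n => ?_
  rw [raw, zero_add, pow_one]

theorem summable_fr_raw_one (Z : Sq Idx) (c : Bool) :
    Summable fun n : ℤ => fr n * raw 1 Z c n := by
  refine (summable_inv_fr_mul Z c).congr fun n => ?_
  rw [raw]
  have := (fr_pos n).ne'
  field_simp
  ring

theorem summable_of_fr {x u : ℤ → ℝ} (hx : Summable fun n => fr n * x n)
    (hu : ∀ n, |u n| ≤ fr n * |x n|) : Summable u := by
  refine Summable.of_norm_bounded hx.abs fun n => ?_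
  rw [abs_mul, abs_of_pos (fr_pos n)]
  exact hu n

theorem summable_raw_one (Z : Sq Idx) (c : Bool) : Summable (raw 1 Z c) :=
  summable_of_fr (summable_fr_raw_one Z c) fun n =>
    le_mul_of_one_le_left (abs_nonneg _) (one_le_fr n)

theorem summable_mul_raw_one (Z : Sq Idx) (c : Bool) :
    Summable fun n : ℤ => (n : ℝ) * raw 1 Z c n :=
  summable_of_fr (summable_fr_raw_one Z c) fun n => by
    rw [abs_mul]; exact mul_le_mul_of_nonneg_right (abs_le_fr n) (abs_nonneg _)

theorem summable_qSeq (Z : Sq Idx) (c : Bool) : Summable (qSeq (raw 1 Z c)) := by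
  have h := (weighted_sum_qSeq admissible_one (x := raw 1 Z c) (y := compL c Z) fun n => by
    rw [one_mul, compL_apply, raw, abs_mul]
    refine mul_le_of_le_one_left (abs_nonneg _) ?_
    rw [abs_inv, abs_of_pos (pow_pos (fr_pos n) _)]
    exact inv_le_one_of_one_le₀ (one_le_pow₀ (one_le_fr n))).1
  simp only [one_mul] at h
  exact h.of_abs

theorem raw_neg {Z : Sq Idx} (hZ : IsOddSeq Z) (s : ℕ) (c : Bool) (n : ℤ) :
    raw s Z c (-n) = -raw s Z c n := by
  rw [raw, raw, fr_neg, hZ, mul_neg]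

/-- The value at `θ` of the sine series with coefficients `raw 0 W c`. -/
def sineF (c : Bool) (θ : ℝ) : Sq Idx →L[ℝ] ℝ :=
  (innerSL ℝ (Sq.mk (fun n : ℤ => 1 / 2 * ((fr n)⁻¹ * Real.sin (n * θ))) (by
    refine Summable.of_nonneg_of_le (fun n => sq_nonneg _) (fun n => ?_) summable_inv_fr_sq
    rw [mul_pow, mul_pow]
    have h1 : Real.sin (n * θ) ^ 2 ≤ 1 := Real.sin_sq_le_one _
    have h2 : 0 ≤ ((fr n)⁻¹) ^ 2 := sq_nonneg _
    nlinarith))) ∘L compL c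

theorem sineF_apply (c : Bool) (θ : ℝ) (W : Sq Idx) : sineF c θ W = sinS (raw 0 W c) θ := by
  rw [sineF, ContinuousLinearMap.comp_apply, innerSL_apply_apply, Sq.inner_eq, sinS,
    ← tsum_mul_left]
  refine tsum_congr fun n => ?_
  rw [compL_apply, Sq.mk_apply, raw, zero_add, pow_one]
  ring

theorem sineF_shiftOp {χ : Bool → ℝ} {θ : ℤ → ℝ} {Θ : ℝ} (hχ : ∀ c, |χ c| ≤ 1)
    (hθ : ∀ l, |θ l| ≤ Θ * fr l) (fl : Bool) (p : ℤ) (c : Bool) (t : ℝ) (Z : Sq Idx) :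
    sineF c t (shiftOp 1 χ θ fl p Z)
      = χ c * sinS (fun n => θ (n - p) * raw 1 Z (xor fl c) (n - p)) t := by
  rw [sineF_apply, ← sinS_smul]
  congr 1
  ext n
  rw [raw, shiftOp_apply hχ hθ, raw]
  have h1 := (fr_pos n).ne'
  have h2 := (fr_pos (n - p)).ne'
  field_simp
  ring

theorem sinS_neg (x : ℤ → ℝ) (θ : ℝ) : sinS (fun n => -x n) θ = -sinS x θ := by
  simpa only [neg_one_mul] using sinS_smul (-1) x θ

/-- A bilinear term with odd coefficients acting on an even series is a product. -/
theorem tsum_mul_sinS_shift_of_odd {f g : ℤ → ℝ} (hg : Summable g)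
    (hge : ∀ n, g (-n) = g n) (θ : ℝ) :
    ∑' p, f p * sinS (fun n => g (n - p)) θ = 2 * (sinS f θ * cosS g θ) := by
  have e : ∀ p : ℤ, f p * sinS (fun n => g (n - p)) θ
      = (f p * Real.sin (p * θ)) * cosS g θ := by
    intro p
    rw [sinS_shift hg, sinS_eq_zero hge]
    ring
  simp only [e]
  rw [tsum_mul_right, sinS]
  ring

/-- A bilinear term with even coefficients acting on an odd series is a product. -/
theorem tsum_mul_sinS_shift_of_even {f g : ℤ → ℝ} (hg : Summable g)
    (hgo : ∀ n, g (-n) = -g n) (θ : ℝ) :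
    ∑' p, f p * sinS (fun n => g (n - p)) θ = 2 * (cosS f θ * sinS g θ) := by
  have e : ∀ p : ℤ, f p * sinS (fun n => g (n - p)) θ
      = (f p * Real.cos (p * θ)) * sinS g θ := by
    intro p
    rw [sinS_shift hg, cosS_eq_zero hgo]
    ring
  simp only [e]
  rw [tsum_mul_right, cosS]
  ring

theorem sign_neg_cast (n : ℤ) : (((-n).sign : ℤ) : ℝ) = -((n.sign : ℤ) : ℝ) := by
  rw [Int.sign_neg]; push_cast; rfl

theorem sineF_bilTerm (k : Kind) (b c : Bool) (θ : ℝ) (Z : Sq Idx) :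
    sineF c θ (bil (k.coef 1 b) (bilShift 1 b k) Z Z)
      = comp b c * ∑' p, k.seq (raw 1 Z) b p
          * sinS (fun n => k.mult (n - p) * raw 1 Z (xor k.flip c) (n - p)) θ := by
  have h := (sineF c θ).hasSum (hasSum_bilTerm 1 b k Z Z)
  rw [← h.tsum_eq, ← tsum_mul_left]
  refine tsum_congr fun p => ?_
  rw [map_smul, bilShift, sineF_shiftOp (abs_comp_le b) k.abs_mult_le, smul_eq_mul]
  ring

theorem raw_eq_zero {Z : Sq Idx} (hZ : oddProj Z = Z) (s : ℕ) (c : Bool) {n : ℤ} (hn : |n| < 2) :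
    raw s Z c n = 0 := by
  rw [raw, ← hZ, oddProj_apply, if_neg (by omega), mul_zero]

theorem isOddSeq_of_oddProj {Z : Sq Idx} (hZ : oddProj Z = Z) : IsOddSeq Z :=
  hZ ▸ isOddSeq_oddProj Z

/-- The linear part of the vector field, as a function. -/
theorem sineF_linearPart {Z : Sq Idx} (hZ : oddProj Z = Z) (c : Bool) (θ : ℝ) :
    sineF c θ (linearPart 1 Z)
      = -(1 / 2) * (Real.sin (2 * θ) * cosS (fun n => n * raw 1 Z c n) θ)
        - Real.cos θ ^ 2 * sinS (raw 1 Z c) θ - 4 * Real.cos θ * sinS (aSeq (raw 1 Z c)) θ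
        - Real.sin (2 * θ) * hilbS (raw 1 Z (!c)) θ
        - 8 * Real.cos θ * sinS (vSeq (raw 1 Z (!c))) θ := by
  have h1 := fun (p l : ℤ) => le_mul_fr (by norm_num) (abs_linMult₁_le p l) l
  have h2 := fun (p l : ℤ) => le_mul_fr (by norm_num) (abs_linMult₂_le p l) l
  have hodd := isOddSeq_of_oddProj hZ
  simp only [linearPart, add_apply, smul_apply, sub_apply, sum_apply, map_add, map_smul, map_sub,
    map_sum, sineF_shiftOp abs_one_le abs_id_le, sineF_shiftOp abs_one_le (h1 _),
    sineF_shiftOp abs_one_le (h2 _), Bool.false_xor, Bool.true_xor, one_mul, smul_eq_mul]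
  set x := raw 1 Z c with hx
  set y := raw 1 Z (!c) with hy
  have sx : Summable x := summable_raw_one Z c
  have sy : Summable y := summable_raw_one Z (!c)
  have sx' : Summable fun n : ℤ => (n : ℝ) * x n := summable_mul_raw_one Z c
  have xo : ∀ n, x (-n) = -x n := raw_neg hodd 1 c
  have yo : ∀ n, y (-n) = -y n := raw_neg hodd 1 (!c)
  have s5 : ∀ (g : ℤ → ℝ) (z : ℤ → ℝ), Summable z → (∀ l, |g l| ≤ 5) → ∀ p : ℤ,
      Summable fun n => g (n - p) * z (n - p) := by
    intro g z hz hg p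
    have h3 : Summable fun n => g n * z n := by
      simpa only [mul_comm] using summable_mul_bdd hz hg
    exact summable_shift h3 p
  -- the transport by `½ sin 2θ`
  have t1 := sinS_shift sx' 2 θ
  have t2 := sinS_shift sx' (-2) θ
  rw [sinS_eq_zero (x := fun n : ℤ => (n : ℝ) * x n) (fun n => by rw [xo]; push_cast; ring)]
    at t1 t2
  have t3 : sinS (fun n => (((n - 2 : ℤ) : ℝ)) * x (n - 2)) θ
      - sinS (fun n => (((n - -2 : ℤ) : ℝ)) * x (n - -2)) θ
      = 2 * (Real.sin (2 * θ) * cosS (fun n => n * x n) θ) := by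
    rw [t1, t2]
    push_cast
    rw [neg_mul, Real.sin_neg]
    ring
  -- the terms without derivative
  have u1 : ∑ p ∈ linFreq, sinS (fun n => linMult₁ p (n - p) * x (n - p)) θ
      = -(Real.cos θ ^ 2 * sinS x θ) - 4 * Real.cos θ * sinS (aSeq x) θ := by
    have e1 := cos_mul_sinS sx θ
    have sc : Summable fun n => 1 / 2 * (x (n - 1) + x (n + 1)) :=
      ((summable_shift sx 1).add (summable_succ sx)).mul_left (1 / 2)
    have e2 := cos_mul_sinS sc θ
    have e3 := cos_mul_sinS (summable_aSeq sx) θ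
    have e4 : ∀ p ∈ linFreq, Summable fun n => linMult₁ p (n - p) * x (n - p) := fun p _ =>
      s5 _ _ sx (abs_linMult₁_le p) p
    have e5 : ∑ p ∈ linFreq, sinS (fun n => linMult₁ p (n - p) * x (n - p)) θ
        = sinS (fun n => linMult₁ 0 (n - 0) * x (n - 0) + (linMult₁ 2 (n - 2) * x (n - 2)
          + linMult₁ (-2) (n - -2) * x (n - -2))) θ := by
      rw [sinS_add (e4 0 (by decide)) ((e4 2 (by decide)).add (e4 (-2) (by decide))),
        sinS_add (e4 2 (by decide)) (e4 (-2) (by decide))]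
      simp [linFreq]
    rw [e5, pow_two, mul_assoc (Real.cos θ), e1, e2, mul_assoc 4, e3, ← sinS_smul, sub_eq_add_neg,
      ← sinS_neg, ← sinS_neg, ← sinS_add]
    · congr 1
      ext n
      simp only [linMult₁, aSeq]
      norm_num
      rw [show n - 1 - 1 = n - 2 by ring, show n + 1 + 1 = n + 2 by ring,
        show ((n : ℝ) - 2 + 1) = n - 1 by ring, show ((n : ℝ) + 2 - 1) = n + 1 by ring]
      ring
    · exact (((summable_shift sc 1).add (summable_succ sc)).mul_left (1 / 2)).neg
    · exact ((((summable_shift (summable_aSeq sx) 1).add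
        (summable_succ (summable_aSeq sx))).mul_left (1 / 2)).mul_left 4).neg
  have u2 : ∑ p ∈ linFreq, sinS (fun n => linMult₂ p (n - p) * y (n - p)) θ
      = -(Real.sin (2 * θ) * hilbS y θ) - 8 * Real.cos θ * sinS (vSeq y) θ := by
    have e3 := cos_mul_sinS (summable_vSeq sy) θ
    have e4 : ∀ p ∈ linFreq, Summable fun n => linMult₂ p (n - p) * y (n - p) := fun p _ =>
      s5 _ _ sy (abs_linMult₂_le p) p
    have e5 : ∑ p ∈ linFreq, sinS (fun n => linMult₂ p (n - p) * y (n - p)) θ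
        = sinS (fun n => linMult₂ 0 (n - 0) * y (n - 0) + (linMult₂ 2 (n - 2) * y (n - 2)
          + linMult₂ (-2) (n - -2) * y (n - -2))) θ := by
      rw [sinS_add (e4 0 (by decide)) ((e4 2 (by decide)).add (e4 (-2) (by decide))),
        sinS_add (e4 2 (by decide)) (e4 (-2) (by decide))]
      simp [linFreq]
    set w : ℤ → ℝ := fun n => -((n.sign : ℤ) : ℝ) * y n with hw
    have sw : Summable w := summable_sign sy
    have we : ∀ n, w (-n) = w n := fun n => by
      simp only [hw, yo, sign_neg_cast]; ring
    have f1 := sinS_shift sw 2 θ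
    have f2 := sinS_shift sw (-2) θ
    rw [sinS_eq_zero we] at f1 f2
    push_cast at f1 f2
    rw [neg_mul, Real.sin_neg] at f2
    have f3 : -(Real.sin (2 * θ) * hilbS y θ)
        = sinS (fun n => -(1 / 2) * w (n - 2) + 1 / 2 * w (n - -2)) θ := by
      rw [sinS_add ((summable_shift sw 2).mul_left _) ((summable_shift sw (-2)).mul_left _),
        sinS_smul, sinS_smul, f1, f2, hilbS]
      ring
    rw [e5, f3, mul_assoc 8, e3, ← sinS_smul, sub_eq_add_neg, ← sinS_neg,
      ← sinS_add]
    · congr 1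
      ext n
      simp only [linMult₂, vSeq, aSeq, hw]
      norm_num
      rw [show n - 1 - 1 = n - 2 by ring, show n + 1 + 1 = n + 2 by ring,
        show ((n : ℝ) - 2 + 1) = n - 1 by ring, show ((n : ℝ) + 2 - 1) = n + 1 by ring]
      ring
    · exact ((summable_shift sw 2).mul_left _).add ((summable_shift sw (-2)).mul_left _)
    · exact ((((summable_shift (summable_vSeq sy) 1).add
        (summable_succ (summable_vSeq sy))).mul_left (1 / 2)).mul_left 8).neg
  rw [Finset.sum_add_distrib, u1, u2, t3]
  ring

/-- The quadratic part of the vector field, as a function: transport, multiplication by `v cot θ`, and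
the product of the primitive with the Hilbert transform. -/
theorem sineF_bilinearPart {Z : Sq Idx} (hZ : oddProj Z = Z) (c : Bool) (θ : ℝ) :
    sineF c θ (bilinearPart 1 Z Z)
      = -(sinS (vSeq (raw 1 Z (!c))) θ * cosS (fun n => n * raw 1 Z c n) θ)
        - cosS (cSeq (raw 1 Z (!c))) θ * sinS (raw 1 Z c) θ
        + sinS (aSeq (raw 1 Z c)) θ * hilbS (raw 1 Z (!c)) θ := by
  have hodd := isOddSeq_of_oddProj hZ
  rw [bilinearPart_apply, map_sum]
  simp only [sineF_bilTerm]
  rw [Fintype.sum_prod_type]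
  have hb : ∀ F : Bool → ℝ, ∑ b, comp b c * F b = F c := by
    intro F
    rw [Fintype.sum_bool]
    cases c <;> simp [comp]
  have hk : ∀ F : Kind → ℝ, ∑ k, F k = F .transport + (F .stretch + F .hilbert) := by
    intro F
    change ∑ k ∈ {Kind.transport, Kind.stretch, Kind.hilbert}, F k = _
    rw [Finset.sum_insert (by decide), Finset.sum_pair (by decide)]
  simp only [← Finset.mul_sum]
  rw [hb, hk]
  simp only [Kind.flip, Bool.false_xor, Bool.true_xor, Kind.mult, Kind.seq, one_mul, mul_assoc,
    tsum_mul_left]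
  have sx := summable_raw_one Z c
  have sy := summable_raw_one Z (!c)
  have h1 := tsum_mul_sinS_shift_of_odd (f := vSeq (raw 1 Z (!c))) (summable_mul_raw_one Z c)
    (fun n => by rw [raw_neg hodd]; push_cast; ring) θ
  have h2 := tsum_mul_sinS_shift_of_even (f := cSeq (raw 1 Z (!c))) sx (raw_neg hodd 1 c) θ
  have h3 := tsum_mul_sinS_shift_of_odd (f := aSeq (raw 1 Z c)) (summable_sign sy)
    (fun n => by rw [raw_neg hodd, sign_neg_cast]; ring) θ
  rw [h1, h2]
  have e : ∀ p : ℤ, sinS (fun n => -(((n - p).sign : ℤ) : ℝ) * raw 1 Z (!c) (n - p)) θ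
      = -sinS (fun n => (((n - p).sign : ℤ) : ℝ) * raw 1 Z (!c) (n - p)) θ := by
    intro p
    rw [← neg_one_mul, ← sinS_smul]
    congr 1
    ext n
    ring
  simp only [e, mul_neg, tsum_neg] at h3
  rw [← hilbS] at h3
  linarith

/-! ### The vector field as a bracket -/

theorem eq_of_hasDerivAt_eq {f g : ℝ → ℝ} {f' : ℝ → ℝ} (hf : ∀ t, HasDerivAt f (f' t) t)
    (hg : ∀ t, HasDerivAt g (f' t) t) {t₀ : ℝ} (h0 : f t₀ = g t₀) : f = g := by
  have h : ∀ t, HasDerivAt (fun t => f t - g t) 0 t := fun t => by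
    convert! (hf t).sub (hg t) using 1
    rw [sub_self]
  have h2 := is_const_of_deriv_eq_zero (fun t => (h t).differentiableAt) fun t => (h t).deriv
  ext t
  have h3 := h2 t t₀
  simp only [h0, sub_self] at h3
  exact sub_eq_zero.1 h3

/-- The projection changes the function that an odd part represents by a multiple of `sin θ` only. -/
theorem sinS_raw_oddProj (W : Sq Idx) (c : Bool) : ∃ κ : ℝ, ∀ θ,
    sinS (raw 0 (oddProj W) c) θ = sinS (raw 0 W c) θ - κ * Real.sin θ := by
  set w := raw 0 W c with hw
  have sw : Summable w := summable_raw_zero W c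
  have sn : Summable fun n => w (-n) := (Equiv.neg ℤ).summable_iff.2 sw
  refine ⟨1 / 2 * (w 1 - w (-1)), fun θ => ?_⟩
  set e : ℤ → ℝ := fun n =>
    if n = 1 then 1 / 2 * (w 1 - w (-1)) else if n = -1 then -(1 / 2 * (w 1 - w (-1))) else 0
    with he
  have he0 : ∀ n ∉ ({1, -1} : Finset ℤ), e n = 0 := by
    intro n hn
    simp only [Finset.mem_insert, Finset.mem_singleton, not_or] at hn
    simp [he, hn.1, hn.2]
  have se : Summable e := summable_of_ne_finset_zero he0
  have e1 : sinS e θ = 1 / 2 * (w 1 - w (-1)) * Real.sin θ := by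
    rw [sinS, tsum_eq_sum (s := {1, -1}) fun n hn => by rw [he0 n hn, zero_mul],
      Finset.sum_pair (by decide)]
    simp [he]
    ring
  have e2 : sinS (fun n => raw 0 (oddProj W) c n + e n) θ
      = sinS (fun n => 1 / 2 * (w n + -w (-n))) θ := by
    congr 1
    ext n
    have h1 : raw 0 (oddProj W) c n = if 2 ≤ |n| then 1 / 2 * (w n - w (-n)) else 0 := by
      rw [raw, oddProj_apply, hw, raw, raw, fr_neg]
      split_ifs <;> ring
    rw [h1]
    by_cases h2 : 2 ≤ |n|
    · have h3 : n ≠ 1 := by rintro rfl; norm_num at h2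
      have h4 : n ≠ -1 := by rintro rfl; norm_num at h2
      simp only [he, h2, h3, h4, if_true, if_false]
      ring
    · have h3 : n = 0 ∨ n = 1 ∨ n = -1 := by
        have := abs_lt.1 (not_le.1 h2)
        omega
      rcases h3 with rfl | rfl | rfl
      · simp [he]
      · simp [he]
        ring
      · simp [he]
        ring
  have e3 : sinS (fun n => w (-n)) θ = -sinS w θ := by
    have h := (Equiv.neg ℤ).tsum_eq fun n : ℤ => w (-n) * Real.sin (n * θ)
    simp only [Equiv.neg_apply, neg_neg, Int.cast_neg, neg_mul, Real.sin_neg, mul_neg,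
      tsum_neg] at h
    rw [sinS, sinS]
    linarith
  rw [sinS_add (summable_raw_zero _ c) se, sinS_smul, sinS_add sw sn.neg, sinS_neg, e1, e3] at e2
  linarith

/-- The bracket `{a - S, v + S / 2}`, with `S = sin 2θ`, for the primitive `a` of component `c` and
the velocity `v` of the other component. -/
def bracketS (x : Bool → ℤ → ℝ) (c : Bool) (θ : ℝ) : ℝ :=
  (sinS (aSeq (x c)) θ - Real.sin (2 * θ)) * (hilbS (aSeq (x (!c))) θ + Real.cos (2 * θ))
    - (sinS (vSeq (x (!c))) θ + 1 / 2 * Real.sin (2 * θ))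
      * (Real.sin θ * sinS (x c) θ - 2 * Real.cos (2 * θ))

/-- The vector field on coefficients is the bracket in physical space. -/
theorem sinS_aSeq_G {Z : Sq Idx} (hZ : oddProj Z = Z) (c : Bool) (θ : ℝ) :
    sinS (aSeq (raw 0 (mhdScale.G 1 Z) c)) θ = bracketS (raw 1 Z) c θ := by
  have hodd := isOddSeq_of_oddProj hZ
  set x := raw 1 Z c with hx
  set y := raw 1 Z (!c) with hy
  have sx : Summable x := summable_raw_one Z c
  have sy : Summable y := summable_raw_one Z (!c)
  have sx' : Summable fun n : ℤ => (n : ℝ) * x n := summable_mul_raw_one Z c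
  have y0 : y 0 = 0 := raw_eq_zero hZ 1 (!c) (by norm_num)
  have y1 : y 1 = 0 := raw_eq_zero hZ 1 (!c) (by norm_num)
  have y2 : y (-1) = 0 := raw_eq_zero hZ 1 (!c) (by norm_num)
  have x1 : x 1 = 0 := raw_eq_zero hZ 1 c (by norm_num)
  have x2 : x (-1) = 0 := raw_eq_zero hZ 1 c (by norm_num)
  set W := linearPart 1 Z + bilinearPart 1 Z Z with hW
  have hG : mhdScale.G 1 Z = oddProj W := by rw [mhdScale_G, hZ]
  obtain ⟨κ, hκ⟩ := sinS_raw_oddProj W c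
  rw [hG]
  -- the primitive of the projected vector field
  have d1 : ∀ θ, HasDerivAt (sinS (aSeq (raw 0 (oddProj W) c)))
      (Real.sin θ * (sinS (raw 0 W c) θ - κ * Real.sin θ)) θ := by
    intro θ
    rw [← hκ]
    have hWW := oddProj_oddProj W
    exact hasDerivAt_sinS_aSeq (summable_raw_zero _ c) (by
      rw [raw_eq_zero hWW 0 c (by norm_num), raw_eq_zero hWW 0 c (by norm_num)]) θ
  have hg : ∀ θ, Real.sin θ * sinS (raw 0 W c) θ
      = (sinS (aSeq x) θ - Real.sin (2 * θ))
          * (Real.sin θ * hilbS y θ - 2 * Real.sin (2 * θ))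
        - (sinS (vSeq y) θ + 1 / 2 * Real.sin (2 * θ)) * (Real.cos θ * sinS x θ
          + Real.sin θ * cosS (fun n => n * x n) θ + 4 * Real.sin (2 * θ)) := by
    intro θ
    rw [← sineF_apply, hW, map_add, sineF_linearPart hZ, sineF_bilinearPart hZ, ← hx, ← hy,
      cosS_cSeq (summable_qSeq Z (!c)), sinS_vSeq sy (summable_qSeq Z (!c)) (raw_neg hodd 1 _),
      Real.sin_two_mul]
    ring
  have h2s : ∀ θ : ℝ, HasDerivAt (fun θ : ℝ => Real.sin (2 * θ)) (2 * Real.cos (2 * θ)) θ :=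
    fun θ => by
      convert! ((hasDerivAt_id θ).const_mul 2).sin using 1
      simp only [id]
      ring
  have h2c : ∀ θ : ℝ, HasDerivAt (fun θ : ℝ => Real.cos (2 * θ)) (-(2 * Real.sin (2 * θ))) θ :=
    fun θ => by
      convert! ((hasDerivAt_id θ).const_mul 2).cos using 1
      simp only [id]
      ring
  have d2 : ∀ θ, HasDerivAt (bracketS (raw 1 Z) c) (Real.sin θ * sinS (raw 0 W c) θ) θ := by
    intro θ
    have a1 := (hasDerivAt_sinS_aSeq sx (x1.trans x2.symm) θ).sub (h2s θ)
    have a2 := (hasDerivAt_hilbS_aSeq sy y0 y1 y2 θ).add (h2c θ)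
    have a3 := (hasDerivAt_sinS_vSeq sy θ).add ((h2s θ).const_mul (1 / 2))
    have a4 := ((Real.hasDerivAt_sin θ).mul (hasDerivAt_sinS sx sx' θ)).sub
      ((h2c θ).const_mul 2)
    convert! (a1.mul a2).sub (a3.mul a4) using 1
    rw [hg]
    simp only [Pi.add_apply, Pi.sub_apply, Pi.mul_apply]
    ring
  have d3 : ∀ θ, HasDerivAt (fun θ => sinS (aSeq (raw 0 (oddProj W) c)) θ
      + κ * (θ / 2 - Real.sin (2 * θ) / 4)) (Real.sin θ * sinS (raw 0 W c) θ) θ := by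
    intro θ
    convert! (d1 θ).add ((((hasDerivAt_id θ).div_const 2).sub
      ((h2s θ).div_const 4)).const_mul κ) using 1
    rw [Real.cos_two_mul, Real.cos_sq']
    ring
  have h0 : bracketS (raw 1 Z) c 0 = 0 := by
    simp [bracketS, sinS_zero_right]
  have heq := eq_of_hasDerivAt_eq d2 d3 (t₀ := 0) (by simp [h0, sinS_zero_right])
  -- both sides are periodic, so that `κ` vanishes
  have hκ0 : κ = 0 := by
    have h1 := congrFun heq (0 + 2 * Real.pi)
    have hp : bracketS (raw 1 Z) c (0 + 2 * Real.pi) = bracketS (raw 1 Z) c 0 := by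
      have s1 : Real.sin (2 * (0 + 2 * Real.pi)) = Real.sin (2 * 0) := by
        rw [mul_add]; simpa using Real.sin_add_nat_mul_two_pi (2 * 0) 2
      have s2 : Real.cos (2 * (0 + 2 * Real.pi)) = Real.cos (2 * 0) := by
        rw [mul_add]; simpa using Real.cos_add_nat_mul_two_pi (2 * 0) 2
      simp only [bracketS, hilbS, sinS_periodic _ 0, cosS_periodic _ 0, s1, s2, Real.sin_periodic 0]
    have s1 : Real.sin (2 * (0 + 2 * Real.pi)) = 0 := by
      rw [zero_add, show 2 * (2 * Real.pi) = (4 : ℕ) * Real.pi by push_cast; ring,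
        Real.sin_nat_mul_pi]
    rw [hp, h0, sinS_periodic _ 0, sinS_zero_right, s1] at h1
    have := Real.pi_pos
    have h3 : κ * Real.pi = 0 := by linarith
    exact (mul_eq_zero.1 h3).resolve_right this.ne'
  rw [heq, hκ0]
  ring

/-! ### The Hilbert transform of a sine series -/

/-- `cot (s / 2) * sin (n s)` for `s ≠ 0`, as a trigonometric polynomial. -/
def conjKernel : ℕ → ℝ → ℝ
  | 0, _ => 0
  | n + 1, s => conjKernel n s + (Real.cos ((n + 1 : ℕ) * s) + Real.cos (n * s))

theorem continuous_conjKernel (n : ℕ) : Continuous (conjKernel n) := by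
  induction n with
  | zero => exact continuous_const
  | succ n ih => exact ih.add (by fun_prop)

theorem conjKernel_eq (n : ℕ) {s : ℝ} (hs : Real.sin (s / 2) ≠ 0) :
    Real.cot (s / 2) * Real.sin (n * s) = conjKernel n s := by
  induction n with
  | zero => simp [conjKernel]
  | succ n ih =>
    rw [conjKernel, ← ih]
    have h1 : Real.sin ((n + 1 : ℕ) * s) - Real.sin (n * s)
        = 2 * Real.sin (s / 2) * Real.cos (n * s + s / 2) := by
      rw [Real.sin_sub_sin]
      push_cast
      congr 2 <;> ring_nf
    have h2 : Real.cos ((n + 1 : ℕ) * s) + Real.cos (n * s)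
        = 2 * Real.cos (s / 2) * Real.cos (n * s + s / 2) := by
      rw [Real.cos_add_cos]
      push_cast
      rw [mul_right_comm]
      congr 2 <;> ring_nf
    have h3 : Real.sin ((n + 1 : ℕ) * s) = Real.sin (n * s)
        + 2 * Real.sin (s / 2) * Real.cos (n * s + s / 2) := by linarith
    rw [h3, h2, Real.cot_eq_cos_div_sin]
    field_simp

theorem integral_cos_nat {k : ℕ} (hk : k ≠ 0) : ∫ s in (0 : ℝ)..Real.pi, Real.cos (k * s) = 0 := by
  have hk' : (k : ℝ) ≠ 0 := by exact_mod_cast hk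
  rw [intervalIntegral.integral_comp_mul_left (fun x => Real.cos x) hk', integral_cos, mul_zero,
    Real.sin_zero, Real.sin_nat_mul_pi, sub_zero, smul_zero]

theorem integral_conjKernel (n : ℕ) :
    ∫ s in (0 : ℝ)..Real.pi, conjKernel (n + 1) s = Real.pi := by
  have hc : ∀ k : ℕ, IntervalIntegrable (fun s => Real.cos (k * s)) volume 0 Real.pi := fun k =>
    (by fun_prop : Continuous fun s : ℝ => Real.cos (k * s)).intervalIntegrable _ _
  have h : ∀ n, ∫ s in (0 : ℝ)..Real.pi, conjKernel (n + 1) s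
      = (∫ s in (0 : ℝ)..Real.pi, conjKernel n s) + ((∫ s in (0 : ℝ)..Real.pi,
        Real.cos ((n + 1 : ℕ) * s)) + ∫ s in (0 : ℝ)..Real.pi, Real.cos (n * s)) := by
    intro n
    rw [← intervalIntegral.integral_add (hc _) (hc _), ← intervalIntegral.integral_add
      ((continuous_conjKernel n).intervalIntegrable _ _) ((hc _).add (hc _))]
    rfl
  induction n with
  | zero =>
    rw [h, integral_cos_nat (by norm_num)]
    simp [conjKernel]
  | succ n ih => rw [h, ih, integral_cos_nat (by norm_num), integral_cos_nat (by norm_num)]; ring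

theorem sin_half_pos {s : ℝ} (hs : s ∈ Ioc 0 Real.pi) : 0 < Real.sin (s / 2) :=
  Real.sin_pos_of_pos_of_lt_pi (by linarith [hs.1]) (by linarith [hs.2, Real.pi_pos])

theorem conjKernel_neg_eq (n : ℤ) {s : ℝ} (hs : s ∈ Ioc 0 Real.pi) :
    Real.cot (s / 2) * Real.sin (n * s) = (n.sign : ℤ) * conjKernel n.natAbs s := by
  have h := conjKernel_eq n.natAbs (sin_half_pos hs).ne'
  rcases lt_trichotomy n 0 with hn | hn | hn
  · rw [Int.sign_eq_neg_one_of_neg hn, ← h]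
    have : ((n.natAbs : ℕ) : ℝ) = -(n : ℝ) := by
      rw [← Int.cast_natCast, Int.ofNat_natAbs_of_nonpos hn.le, Int.cast_neg]
    rw [this, neg_mul, Real.sin_neg]
    push_cast
    ring
  · subst hn; simp
  · rw [Int.sign_eq_one_of_pos hn, ← h]
    have : ((n.natAbs : ℕ) : ℝ) = (n : ℝ) := by
      rw [← Int.cast_natCast, Int.natAbs_of_nonneg hn.le]
    rw [this]
    push_cast
    ring

theorem integral_conjKernel_int (n : ℤ) :
    ∫ s in (0 : ℝ)..Real.pi, ((n.sign : ℤ) : ℝ) * conjKernel n.natAbs s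
      = (n.sign : ℤ) * Real.pi := by
  rw [intervalIntegral.integral_const_mul]
  rcases eq_or_ne n 0 with rfl | hn
  · simp
  · obtain ⟨k, hk⟩ := Nat.exists_eq_succ_of_ne_zero (Int.natAbs_ne_zero.2 hn)
    rw [hk, Nat.succ_eq_add_one, integral_conjKernel]

theorem abs_sin_le_rpow (x : ℝ) : |Real.sin x| ≤ |x| ^ (1 / 4 : ℝ) := by
  rcases le_total |x| 1 with h | h
  · refine Real.abs_sin_le_abs.trans ?_
    calc |x| = |x| ^ (1 : ℝ) := (Real.rpow_one _).symm
      _ ≤ _ := by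
        rcases eq_or_lt_of_le (abs_nonneg x) with h0 | h0
        · rw [← h0, Real.zero_rpow (by norm_num), Real.zero_rpow (by norm_num)]
        · exact Real.rpow_le_rpow_of_exponent_ge h0 h (by norm_num)
  · exact (Real.abs_sin_le_one x).trans (Real.one_le_rpow h (by norm_num))

/-- A weak bound on the growth of the kernels, enough for the series of `C¹` functions. -/
theorem abs_conjKernel_le (n : ℤ) {s : ℝ} (hs : s ∈ Ioc 0 Real.pi) :
    |((n.sign : ℤ) : ℝ) * conjKernel n.natAbs s|
      ≤ Real.pi * fr n ^ (1 / 4 : ℝ) * s ^ (-(3 / 4) : ℝ) := by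
  rw [← conjKernel_neg_eq n hs, abs_mul]
  have hs0 := hs.1
  have h1 : |Real.cot (s / 2)| ≤ Real.pi * s⁻¹ := by
    have h2 := Real.mul_le_sin (x := s / 2) (by linarith) (by linarith [hs.2])
    have h3 := sin_half_pos hs
    rw [Real.cot_eq_cos_div_sin, abs_div, abs_of_pos h3, div_le_iff₀ h3]
    refine (Real.abs_cos_le_one _).trans ?_
    have h4 : Real.pi * s⁻¹ * (2 / Real.pi * (s / 2)) = 1 := by
      have := Real.pi_pos.ne'
      field_simp
    rw [← h4]
    have := Real.pi_pos
    gcongr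
  have h2 : |Real.sin (n * s)| ≤ fr n ^ (1 / 4 : ℝ) * s ^ (1 / 4 : ℝ) := by
    refine (abs_sin_le_rpow _).trans ?_
    rw [abs_mul, abs_of_pos hs0, Real.mul_rpow (abs_nonneg _) hs0.le]
    gcongr
    exact abs_le_fr n
  have h3 : s⁻¹ * s ^ (1 / 4 : ℝ) = s ^ (-(3 / 4) : ℝ) := by
    rw [← Real.rpow_neg_one, ← Real.rpow_add hs0]
    norm_num
  rw [← h3]
  have := mul_le_mul h1 h2 (abs_nonneg _) (by have := Real.pi_pos; positivity)
  linarith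

theorem intervalIntegrable_rpow_aux :
    IntervalIntegrable (fun s : ℝ => s ^ (-(3 / 4) : ℝ)) volume 0 Real.pi :=
  intervalIntegral.intervalIntegrable_rpow' (by norm_num)

theorem hasSum_integral_conj {y : ℤ → ℝ} (hy : Summable fun n => fr n ^ (1 / 4 : ℝ) * y n) :
    IntegrableOn (fun s => ∑' n : ℤ, y n * (((n.sign : ℤ) : ℝ) * conjKernel n.natAbs s))
      (Ioc 0 Real.pi) ∧
    ∫ s in Ioc 0 Real.pi, ∑' n : ℤ, y n * (((n.sign : ℤ) : ℝ) * conjKernel n.natAbs s)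
      = Real.pi * ∑' n : ℤ, ((n.sign : ℤ) : ℝ) * y n := by
  set F : ℤ → ℝ → ℝ := fun n s => y n * (((n.sign : ℤ) : ℝ) * conjKernel n.natAbs s) with hF
  have hFc : ∀ n, Continuous (F n) := fun n =>
    continuous_const.mul (continuous_const.mul (continuous_conjKernel _))
  have hFi : ∀ n, IntegrableOn (F n) (Ioc 0 Real.pi) := fun n =>
    ((hFc n).continuousOn.integrableOn_Icc (a := 0) (b := Real.pi)).mono_set Ioc_subset_Icc_self
  have hI : IntegrableOn (fun s : ℝ => s ^ (-(3 / 4) : ℝ)) (Ioc 0 Real.pi) :=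
    (intervalIntegrable_iff_integrableOn_Ioc_of_le Real.pi_pos.le).1 intervalIntegrable_rpow_aux
  set A := ∫ s in Ioc 0 Real.pi, s ^ (-(3 / 4) : ℝ) with hA
  have hb : ∀ n, ∫ s in Ioc 0 Real.pi, ‖F n s‖
      ≤ Real.pi * A * |fr n ^ (1 / 4 : ℝ) * y n| := by
    intro n
    have h1 : ∫ s in Ioc 0 Real.pi, ‖F n s‖
        ≤ ∫ s in Ioc 0 Real.pi, (|y n| * (Real.pi * fr n ^ (1 / 4 : ℝ))) * s ^ (-(3 / 4) : ℝ) := by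
      refine setIntegral_mono_on (hFi n).norm (hI.const_mul _) measurableSet_Ioc fun s hs => ?_
      rw [hF, Real.norm_eq_abs, abs_mul, mul_assoc]
      exact mul_le_mul_of_nonneg_left (abs_conjKernel_le n hs) (abs_nonneg _)
    rw [integral_const_mul, ← hA] at h1
    refine h1.trans (le_of_eq ?_)
    rw [abs_mul, abs_of_nonneg (Real.rpow_nonneg (fr_pos n).le _)]
    ring
  have hs : Summable fun n => ∫ s in Ioc 0 Real.pi, ‖F n s‖ :=
    Summable.of_nonneg_of_le (fun n => integral_nonneg fun _ => norm_nonneg _) hb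
      (hy.abs.mul_left _)
  have h1 := hasSum_integral_of_summable_integral_norm hFi hs
  have hpt : ∀ s ∈ Ioc 0 Real.pi, ∀ n,
      ‖F n s‖ ≤ |fr n ^ (1 / 4 : ℝ) * y n| * (Real.pi * s ^ (-(3 / 4) : ℝ)) := by
    intro s hs n
    rw [hF, Real.norm_eq_abs, abs_mul]
    refine (mul_le_mul_of_nonneg_left (abs_conjKernel_le n hs) (abs_nonneg _)).trans_eq ?_
    rw [abs_mul, abs_of_nonneg (Real.rpow_nonneg (fr_pos n).le _)]
    ring
  have hmeas : AEStronglyMeasurable (fun s => ∑' n : ℤ, F n s)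
      (volume.restrict (Ioc 0 Real.pi)) := by
    refine aestronglyMeasurable_of_tendsto_ae (atTop : Filter (Finset ℤ))
      (f := fun S s => ∑ n ∈ S, F n s)
      (fun S => (continuous_finsetSum S fun n _ => hFc n).aestronglyMeasurable) ?_
    filter_upwards [ae_restrict_mem measurableSet_Ioc] with s hs
    exact (Summable.of_norm_bounded (hy.abs.mul_right _) (hpt s hs)).hasSum
  have hkI : IntegrableOn (fun s => ∑' n : ℤ, F n s) (Ioc 0 Real.pi) := by
    refine (hI.const_mul ((∑' n, |fr n ^ (1 / 4 : ℝ) * y n|) * Real.pi)).mono' hmeas ?_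
    filter_upwards [ae_restrict_mem measurableSet_Ioc] with s hs
    have := tsum_of_norm_bounded (hy.abs.mul_right (Real.pi * s ^ (-(3 / 4) : ℝ))).hasSum
      (hpt s hs)
    rw [tsum_mul_right] at this
    linarith
  refine ⟨hkI, ?_⟩
  rw [← h1.tsum_eq, ← tsum_mul_left]
  refine tsum_congr fun n => ?_
  rw [← intervalIntegral.integral_of_le Real.pi_pos.le, hF, intervalIntegral.integral_const_mul,
    integral_conjKernel_int]
  ring

/-- The principal value integral of a sine series is the conjugate series. -/
theorem hilbert_sinS {x : ℤ → ℝ} (hx : Summable fun n => fr n ^ (1 / 4 : ℝ) * x n) (θ : ℝ) :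
    hilbert (sinS x) θ = hilbS x θ := by
  have hx0 : Summable x := by
    refine Summable.of_norm_bounded hx.abs fun n => ?_
    rw [abs_mul]
    refine le_mul_of_one_le_left (abs_nonneg _) ?_
    rw [abs_of_nonneg (Real.rpow_nonneg (fr_pos n).le _)]
    exact Real.one_le_rpow (one_le_fr n) (by norm_num)
  set y : ℤ → ℝ := fun n => x n * Real.cos (n * θ) with hy
  have sy : Summable fun n => fr n ^ (1 / 4 : ℝ) * y n := by
    have := summable_cos hx θ
    simpa only [hy, mul_assoc] using this
  obtain ⟨hint, hval⟩ := hasSum_integral_conj sy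
  set k : ℝ → ℝ := fun s => ∑' n : ℤ, y n * (((n.sign : ℤ) : ℝ) * conjKernel n.natAbs s) with hk
  have hdiff : ∀ s ∈ Ioc 0 Real.pi,
      Real.cot (s / 2) * sinS x (θ - s) - Real.cot (s / 2) * sinS x (θ + s) = -k s := by
    intro s hs
    have e : ∀ n : ℤ, y n * (((n.sign : ℤ) : ℝ) * conjKernel n.natAbs s)
        = -(1 / 2) * (Real.cot (s / 2) * (x n * Real.sin (n * (θ - s))
          - x n * Real.sin (n * (θ + s)))) := by
      intro n
      rw [← conjKernel_neg_eq n hs, mul_sub (n : ℝ), mul_add (n : ℝ), Real.sin_sub, Real.sin_add,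
        hy]
      ring
    simp only [hk, e]
    rw [tsum_mul_left, tsum_mul_left, (summable_sin hx0 _).tsum_sub (summable_sin hx0 _), sinS,
      sinS]
    ring
  have hcot : ∀ ε ∈ Ioo 0 Real.pi, ContinuousOn (fun s => Real.cot (s / 2)) (Icc ε Real.pi) := by
    intro ε hε
    simp only [Real.cot_eq_cos_div_sin]
    refine ContinuousOn.div (by fun_prop) (by fun_prop) fun s hs => ?_
    exact (sin_half_pos ⟨hε.1.trans_le hs.1, hs.2⟩).ne'
  have hev : ∀ ε ∈ Ioo 0 Real.pi,
      1 / (2 * Real.pi) * ((∫ s in (-Real.pi)..(-ε), Real.cot (s / 2) * sinS x (θ - s))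
        + ∫ s in ε..Real.pi, Real.cot (s / 2) * sinS x (θ - s))
      = 1 / (2 * Real.pi) * ∫ s in ε..Real.pi, -k s := by
    intro ε hε
    congr 1
    have h1 := intervalIntegral.integral_comp_neg (a := ε) (b := Real.pi)
      fun s => Real.cot (s / 2) * sinS x (θ - s)
    have hc1 : ∀ σ : ℝ, IntervalIntegrable
        (fun s => Real.cot (s / 2) * sinS x (θ + σ * s)) volume ε Real.pi := fun σ => by
      refine ContinuousOn.intervalIntegrable ?_
      rw [uIcc_of_le hε.2.le]
      exact (hcot ε hε).mul ((continuous_sinS hx0).comp (by fun_prop)).continuousOn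
    have hca := hc1 1
    have hcb := hc1 (-1)
    simp only [one_mul, neg_mul, ← sub_eq_add_neg] at hca hcb
    have e1 : ∫ s in ε..Real.pi, Real.cot (-s / 2) * sinS x (θ - -s)
        = ∫ s in ε..Real.pi, -(Real.cot (s / 2) * sinS x (θ + s)) := by
      congr 1
      ext s
      rw [neg_div, Real.cot_eq_cos_div_sin, Real.cot_eq_cos_div_sin, Real.cos_neg, Real.sin_neg,
        sub_neg_eq_add]
      ring
    have hcan : IntervalIntegrable (fun s => -(Real.cot (s / 2) * sinS x (θ + s))) volume ε
      Real.pi := hca.neg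
    rw [← h1, e1, ← intervalIntegral.integral_add hcan hcb]
    refine intervalIntegral.integral_congr fun s hs => ?_
    rw [uIcc_of_le hε.2.le] at hs
    rw [← hdiff s ⟨hε.1.trans_le hs.1, hs.2⟩]
    ring
  have hlim : Tendsto (fun ε => 1 / (2 * Real.pi) * ∫ s in ε..Real.pi, -k s) (𝓝[>] 0)
      (𝓝 (1 / (2 * Real.pi) * ∫ s in (0 : ℝ)..Real.pi, -k s)) := by
    refine Tendsto.const_mul _ ?_
    have hii : IntervalIntegrable (fun s => -k s) volume Real.pi 0 :=
      ((intervalIntegrable_iff_integrableOn_Ioc_of_le Real.pi_pos.le).2 hint).neg.symm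
    have h2 := intervalIntegral.continuousOn_primitive_interval'
      (μ := volume) hii left_mem_uIcc
    rw [uIcc_of_ge Real.pi_pos.le] at h2
    have h3 : Tendsto (fun ε => ∫ s in Real.pi..ε, -k s) (𝓝[>] 0)
        (𝓝 (∫ s in Real.pi..0, -k s)) := by
      have h4 := (h2 0 (left_mem_Icc.2 Real.pi_pos.le)).tendsto
      refine h4.mono_left ?_
      rw [← nhdsWithin_Ioo_eq_nhdsGT Real.pi_pos]
      exact nhdsWithin_mono _ Ioo_subset_Icc_self
    have h5 := h3.neg
    simpa only [← intervalIntegral.integral_symm] using h5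
  have hlim2 := hlim.congr' (f₂ := fun ε =>
      1 / (2 * Real.pi) * ((∫ s in (-Real.pi)..(-ε), Real.cot (s / 2) * sinS x (θ - s))
        + ∫ s in ε..Real.pi, Real.cot (s / 2) * sinS x (θ - s))) (by
    filter_upwards [Ioo_mem_nhdsGT Real.pi_pos] with ε hε using (hev ε hε).symm)
  rw [hilbert, hlim2.limUnder_eq, intervalIntegral.integral_neg,
    intervalIntegral.integral_of_le Real.pi_pos.le, hval, hilbS, cosS]
  have e : ∀ n : ℤ, -((n.sign : ℤ) : ℝ) * x n * Real.cos (n * θ)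
      = -(((n.sign : ℤ) : ℝ) * y n) := fun n => by rw [hy]; ring
  simp only [e, tsum_neg]
  have := Real.pi_pos.ne'
  field_simp

/-! ### Fourier coefficients of square integrable functions -/

instance : IsFiniteMeasure periodMeasure := by unfold periodMeasure; infer_instance

theorem integral_periodMeasure {E : Type*} [NormedAddCommGroup E] [NormedSpace ℝ E] (f : ℝ → E) :
    ∫ θ, f θ ∂periodMeasure = ∫ θ in (-Real.pi)..Real.pi, f θ :=
  (intervalIntegral.integral_of_le (by linarith [Real.pi_pos])).symm

theorem integrable_of_continuous {f : ℝ → ℝ} (hf : Continuous f) : Integrable f periodMeasure :=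
  (hf.continuousOn.integrableOn_Icc (a := -Real.pi) (b := Real.pi)).mono_set Ioc_subset_Icc_self

theorem memLp_of_continuous {f : ℝ → ℝ} (hf : Continuous f) : MemLp f 2 periodMeasure := by
  obtain ⟨K, hK⟩ := (isCompact_Icc (a := -Real.pi) (b := Real.pi)).exists_bound_of_continuousOn
    hf.continuousOn
  refine MemLp.of_bound hf.aestronglyMeasurable K ?_
  unfold periodMeasure
  exact (ae_restrict_mem measurableSet_Ioc).mono fun θ hθ => hK θ (Ioc_subset_Icc_self hθ)

theorem integrable_mul_of_continuous {f g : ℝ → ℝ} (hf : Integrable f periodMeasure)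
    (hg : Continuous g) : Integrable (fun θ => f θ * g θ) periodMeasure := by
  obtain ⟨K, hK⟩ := (isCompact_Icc (a := -Real.pi) (b := Real.pi)).exists_bound_of_continuousOn
    hg.continuousOn
  refine hf.mul_bdd (c := K) hg.aestronglyMeasurable ?_
  unfold periodMeasure
  exact (ae_restrict_mem measurableSet_Ioc).mono fun θ hθ => hK θ (Ioc_subset_Icc_self hθ)

theorem fourier_eq_cos_add_sin {T : ℝ} (hT : T = 2 * Real.pi) (n : ℤ) (x : ℝ) :
    (fourier n (x : AddCircle T) : ℂ)
      = (Real.cos (n * x) : ℂ) + (Real.sin (n * x) : ℂ) * Complex.I := by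
  rw [fourier_coe_apply, hT, Complex.ofReal_cos, Complex.ofReal_sin, ← Complex.exp_mul_I]
  congr 1
  have : (Real.pi : ℂ) ≠ 0 := by exact_mod_cast Real.pi_pos.ne'
  push_cast
  field_simp

theorem integral_fourier_smul {T : ℝ} (hT : T = 2 * Real.pi) (n : ℤ) {f : ℝ → ℝ}
    (hf : Integrable f periodMeasure) :
    ∫ x in (-Real.pi)..Real.pi, (fourier (-n) (x : AddCircle T) : ℂ) • (f x : ℂ)
      = ((∫ x, f x * Real.cos (n * x) ∂periodMeasure : ℝ) : ℂ)
        - ((∫ x, f x * Real.sin (n * x) ∂periodMeasure : ℝ) : ℂ) * Complex.I := by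
  rw [← integral_periodMeasure, ← integral_complex_ofReal, ← integral_complex_ofReal,
    ← integral_mul_const, ← integral_sub]
  · refine integral_congr_ae (ae_of_all _ fun x => ?_)
    simp only [fourier_eq_cos_add_sin hT, smul_eq_mul]
    push_cast
    rw [neg_mul, Complex.cos_neg, Complex.sin_neg]
    ring
  · exact (integrable_mul_of_continuous hf (by fun_prop)).ofReal
  · exact (integrable_mul_of_continuous hf (by fun_prop)).ofReal.mul_const _

theorem hasSum_sq_coeff {f : ℝ → ℝ} (hf : MemLp f 2 periodMeasure) :
    HasSum (fun n : ℤ => (∫ x, f x * Real.cos (n * x) ∂periodMeasure) ^ 2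
      + (∫ x, f x * Real.sin (n * x) ∂periodMeasure) ^ 2)
      (2 * Real.pi * ∫ x, f x ^ 2 ∂periodMeasure) := by
  have hab : -Real.pi < Real.pi := by linarith [Real.pi_pos]
  have hT : Real.pi - -Real.pi = 2 * Real.pi := by ring
  have hi : Integrable f periodMeasure := hf.integrable (by norm_num)
  have h := (hasSum_sq_fourierCoeffOn hab (f := fun x => (f x : ℂ)) hf.ofReal).mul_left
    ((2 * Real.pi) ^ 2)
  have hpi := Real.pi_pos
  convert! h using 1
  · ext n
    rw [fourierCoeffOn_eq_integral, integral_fourier_smul hT n hi, norm_smul, hT, mul_pow,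
      mul_pow ‖_‖ ‖_‖]
    rw [Real.norm_of_nonneg (by positivity)]
    set A := ∫ x, f x * Real.cos (n * x) ∂periodMeasure
    set B := ∫ x, f x * Real.sin (n * x) ∂periodMeasure
    have : ‖(A : ℂ) - (B : ℂ) * Complex.I‖ ^ 2 = A ^ 2 + B ^ 2 := by
      rw [← Complex.normSq_eq_norm_sq, Complex.normSq_apply]
      simp
      ring
    rw [this]
    field_simp
  · rw [hT, integral_periodMeasure]
    simp only [Complex.norm_real, Real.norm_eq_abs, sq_abs, smul_eq_mul]
    field_simp

theorem integral_mul_sin_add {f : ℝ → ℝ} (hf : Integrable f periodMeasure) (φ : ℝ) (n : ℤ) :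
    ∫ x, f x * Real.sin (n * x + φ) ∂periodMeasure
      = Real.cos φ * ∫ x, f x * Real.sin (n * x) ∂periodMeasure
        + Real.sin φ * ∫ x, f x * Real.cos (n * x) ∂periodMeasure := by
  rw [← integral_const_mul, ← integral_const_mul, ← integral_add]
  · refine integral_congr_ae (ae_of_all _ fun x => ?_)
    simp only [Real.sin_add]
    ring
  · exact (integrable_mul_of_continuous hf (by fun_prop)).const_mul _
  · exact (integrable_mul_of_continuous hf (by fun_prop)).const_mul _

/-- Bessel's inequality, for waves with an arbitrary common phase. -/
theorem bessel {f : ℝ → ℝ} (hf : MemLp f 2 periodMeasure) (φ : ℝ) :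
    (Summable fun n : ℤ => (∫ x, f x * Real.sin (n * x + φ) ∂periodMeasure) ^ 2) ∧
    ∑' n : ℤ, (∫ x, f x * Real.sin (n * x + φ) ∂periodMeasure) ^ 2
      ≤ 2 * Real.pi * ∫ x, f x ^ 2 ∂periodMeasure := by
  have h := hasSum_sq_coeff hf
  have hle : ∀ n : ℤ, (∫ x, f x * Real.sin (n * x + φ) ∂periodMeasure) ^ 2
      ≤ (∫ x, f x * Real.cos (n * x) ∂periodMeasure) ^ 2
      + (∫ x, f x * Real.sin (n * x) ∂periodMeasure) ^ 2 := by
    intro n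
    rw [integral_mul_sin_add (hf.integrable (by norm_num))]
    nlinarith [Real.sin_sq_add_cos_sq φ,
      sq_nonneg (Real.cos φ * (∫ x, f x * Real.cos (n * x) ∂periodMeasure)
        - Real.sin φ * ∫ x, f x * Real.sin (n * x) ∂periodMeasure)]
  have hs := Summable.of_nonneg_of_le (fun _ => sq_nonneg _) hle h.summable
  exact ⟨hs, (hs.tsum_le_tsum hle h.summable).trans_eq h.tsum_eq⟩

/-- The class of a continuous function. -/
def contL (f : ℝ → ℝ) (hf : Continuous f) : L2 := (memLp_of_continuous hf).toLp f

theorem coeFn_contL {f : ℝ → ℝ} (hf : Continuous f) : (contL f hf : ℝ → ℝ) =ᵐ[periodMeasure] f :=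
  MemLp.coeFn_toLp _

theorem inner_contL {f : ℝ → ℝ} (hf : Continuous f) (g : L2) :
    inner ℝ (contL f hf) g = ∫ θ, g θ * f θ ∂periodMeasure := by
  rw [L2.inner_def]
  refine integral_congr_ae ?_
  filter_upwards [coeFn_contL hf] with θ hθ
  rw [hθ]
  rfl

theorem L2_norm_sq (g : L2) : ‖g‖ ^ 2 = ∫ θ, g θ ^ 2 ∂periodMeasure := by
  rw [← real_inner_self_eq_norm_sq, L2.inner_def]
  refine integral_congr_ae (ae_of_all _ fun θ => ?_)
  simp [pow_two]

theorem continuous_wave (φ : ℝ) (n : ℤ) : Continuous fun θ : ℝ => Real.sin (n * θ + φ) := by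
  fun_prop

theorem inner_wave (φ : ℝ) (n : ℤ) (g : L2) :
    inner ℝ (contL _ (continuous_wave φ n)) g
      = ∫ θ, g θ * Real.sin (n * θ + φ) ∂periodMeasure := inner_contL _ _

/-- The Fourier coefficients of a square integrable function with respect to the waves
`sin (n θ + φ)`. -/
def waveCoef (φ : ℝ) : L2 →L[ℝ] Sq ℤ :=
  LinearMap.mkContinuous
    { toFun := fun g => Sq.mk (fun n => inner ℝ (contL _ (continuous_wave φ n)) g) (by
        simp only [inner_wave]
        exact (bessel (Lp.memLp g) φ).1)
      map_add' := fun f g => Sq.ext fun n => by simp [inner_add_right]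
      map_smul' := fun c f => Sq.ext fun n => by simp [real_inner_smul_right] }
    (Real.sqrt (2 * Real.pi)) fun g => by
      refine le_of_sq_le_sq ?_ (by positivity)
      rw [Sq.norm_sq, mul_pow, Real.sq_sqrt (by positivity), L2_norm_sq]
      simp only [LinearMap.coe_mk, AddHom.coe_mk, Sq.mk_apply, inner_wave]
      exact (bessel (Lp.memLp g) φ).2

theorem waveCoef_apply (φ : ℝ) (g : L2) (n : ℤ) :
    waveCoef φ g n = ∫ θ, g θ * Real.sin (n * θ + φ) ∂periodMeasure := inner_wave φ n g

theorem norm_waveCoef_le (φ : ℝ) : ‖waveCoef φ‖ ≤ Real.sqrt (2 * Real.pi) :=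
  LinearMap.mkContinuous_norm_le _ (by positivity) _

/-- The sum of the waves `x n sin (n θ + φ)`. -/
def waveSum (φ : ℝ) : Sq ℤ →L[ℝ] L2 := ContinuousLinearMap.adjoint (waveCoef φ)

theorem norm_waveSum_le (φ : ℝ) (x : Sq ℤ) : ‖waveSum φ x‖ ≤ Real.sqrt (2 * Real.pi) * ‖x‖ := by
  refine ((waveSum φ).le_opNorm x).trans (mul_le_mul_of_nonneg_right ?_ (norm_nonneg _))
  rw [waveSum, LinearIsometryEquiv.norm_map]
  exact norm_waveCoef_le φ

theorem inner_waveSum (φ : ℝ) (x : Sq ℤ) (g : L2) :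
    inner ℝ (waveSum φ x) g = inner ℝ x (waveCoef φ g) :=
  ContinuousLinearMap.adjoint_inner_left _ _ _

theorem integral_waveSum_mul (φ : ℝ) (x : Sq ℤ) {ψ : ℝ → ℝ} (hψ : Continuous ψ) :
    ∫ θ, waveSum φ x θ * ψ θ ∂periodMeasure
      = ∑' n : ℤ, x n * ∫ θ, ψ θ * Real.sin (n * θ + φ) ∂periodMeasure := by
  rw [← inner_contL hψ, real_inner_comm, inner_waveSum, Sq.inner_eq]
  refine tsum_congr fun n => ?_
  rw [waveCoef_apply]
  congr 1
  refine integral_congr_ae ?_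
  filter_upwards [coeFn_contL hψ] with θ hθ
  rw [hθ]

/-- A wave sum with summable coefficients is the pointwise sum. -/
theorem waveSum_ae_eq (φ : ℝ) {x : Sq ℤ} (hx : Summable x) :
    (waveSum φ x : ℝ → ℝ) =ᵐ[periodMeasure] fun θ => ∑' n : ℤ, x n * Real.sin (n * θ + φ) := by
  have hc : Continuous fun θ : ℝ => ∑' n : ℤ, x n * Real.sin (n * θ + φ) := by
    refine continuous_tsum (fun n => by fun_prop) hx.abs fun n θ => ?_
    rw [Real.norm_eq_abs, abs_mul]
    exact mul_le_of_le_one_right (abs_nonneg _) (Real.abs_sin_le_one _)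
  have h : waveSum φ x = contL _ hc := by
    refine ext_inner_right ℝ fun g => ?_
    rw [inner_waveSum, inner_contL, Sq.inner_eq]
    have hg : Integrable (g : ℝ → ℝ) periodMeasure := (Lp.memLp g).integrable (by norm_num)
    have hi : ∀ n : ℤ, Integrable (fun θ => g θ * (x n * Real.sin (n * θ + φ))) periodMeasure :=
      fun n => integrable_mul_of_continuous hg (by fun_prop)
    have hb : ∀ n : ℤ, ∫ θ, ‖g θ * (x n * Real.sin (n * θ + φ))‖ ∂periodMeasure
        ≤ |x n| * ∫ θ, ‖g θ‖ ∂periodMeasure := by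
      intro n
      rw [← integral_const_mul]
      refine integral_mono (hi n).norm (hg.norm.const_mul _) fun θ => ?_
      simp only [norm_mul, Real.norm_eq_abs]
      have h1 := Real.abs_sin_le_one (n * θ + φ)
      have h2 : 0 ≤ |g θ| * |x n| := by positivity
      nlinarith
    have h1 := hasSum_integral_of_summable_integral_norm hi
      (Summable.of_nonneg_of_le (fun n => integral_nonneg fun _ => norm_nonneg _) hb
        (hx.abs.mul_right _))
    simp only [tsum_mul_left] at h1
    rw [← h1.tsum_eq]
    refine tsum_congr fun n => ?_
    rw [waveCoef_apply, ← integral_const_mul]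
    refine integral_congr_ae (ae_of_all _ fun θ => ?_)
    simp only
    ring
  rw [h]
  exact coeFn_contL hc

theorem integral_deriv_mul {f g f' g' : ℝ → ℝ} (hf : ∀ x, HasDerivAt f (f' x) x)
    (hg : ∀ x, HasDerivAt g (g' x) x) (hf' : Continuous f') (hg' : Continuous g')
    (hfp : Function.Periodic f (2 * Real.pi)) (hgp : Function.Periodic g (2 * Real.pi)) :
    ∫ θ, f' θ * g θ ∂periodMeasure = -∫ θ, f θ * g' θ ∂periodMeasure := by
  have h := intervalIntegral.integral_mul_deriv_eq_deriv_mul (a := -Real.pi) (b := Real.pi)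
    (u := f) (v := g) (u' := f') (v' := g') (fun x _ => hf x) (fun x _ => hg x)
    (hf'.intervalIntegrable _ _) (hg'.intervalIntegrable _ _)
  have e1 : f Real.pi = f (-Real.pi) := by
    have := hfp (-Real.pi); rw [← this]; ring_nf
  have e2 : g Real.pi = g (-Real.pi) := by
    have := hgp (-Real.pi); rw [← this]; ring_nf
  rw [integral_periodMeasure, integral_periodMeasure, h, e1, e2]
  ring

theorem wave_periodic (φ : ℝ) (n : ℤ) :
    Function.Periodic (fun θ : ℝ => Real.sin (n * θ + φ)) (2 * Real.pi) := by
  intro θ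
  simp only
  rw [show (n : ℝ) * (θ + 2 * Real.pi) + φ = n * θ + φ + n * (2 * Real.pi) by ring,
    Real.sin_add_int_mul_two_pi]

theorem hasDerivAt_wave (φ : ℝ) (n : ℤ) (θ : ℝ) :
    HasDerivAt (fun θ : ℝ => Real.sin (n * θ + φ))
      (n * Real.sin (n * θ + (φ + Real.pi / 2))) θ := by
  have h := (((hasDerivAt_id θ).const_mul (n : ℝ)).add_const φ).sin
  convert! h using 1
  rw [← add_assoc, Real.sin_add_pi_div_two]
  simp only [id]
  ring

/-- Termwise differentiation: the phase `φ + π / 2` turns sines into cosines. -/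
theorem isWeakDeriv_waveSum (φ : ℝ) {x x' : Sq ℤ} (h : ∀ n, x' n = n * x n) :
    IsWeakDeriv (waveSum φ x) (waveSum (φ + Real.pi / 2) x') := by
  intro ψ hψ hp
  have hψ' : Continuous (deriv ψ) := hψ.continuous_deriv (by simp)
  have hd : ∀ θ, HasDerivAt ψ (deriv ψ θ) θ := fun θ =>
    (hψ.differentiable (by simp) θ).hasDerivAt
  rw [integral_waveSum_mul _ _ hψ', integral_waveSum_mul _ _ hψ.continuous, ← tsum_neg]
  refine tsum_congr fun n => ?_
  rw [integral_deriv_mul hd (hasDerivAt_wave φ n) hψ' (by fun_prop) hp (wave_periodic φ n), h]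
  have : ∀ θ, ψ θ * (n * Real.sin (n * θ + (φ + Real.pi / 2)))
      = n * (ψ θ * Real.sin (n * θ + (φ + Real.pi / 2))) := fun θ => by ring
  simp only [this]
  rw [integral_const_mul]
  ring

/-- The sine coefficients of a function. -/
def sineCoeff (f : ℝ → ℝ) (n : ℤ) : ℝ :=
  Real.pi⁻¹ * ∫ θ, f θ * Real.sin (n * θ) ∂periodMeasure

theorem integral_odd_periodMeasure {f : ℝ → ℝ} (hf : Function.Odd f) :
    ∫ θ, f θ ∂periodMeasure = 0 := by
  rw [integral_periodMeasure]
  have h := intervalIntegral.integral_comp_neg (a := -Real.pi) (b := Real.pi) f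
  rw [neg_neg] at h
  have e : ∀ x, f (-x) = -f x := hf
  simp only [e, intervalIntegral.integral_neg] at h
  linarith

theorem integral_odd_mul_cos {f : ℝ → ℝ} (hf : Function.Odd f) (n : ℤ) :
    ∫ θ, f θ * Real.cos (n * θ) ∂periodMeasure = 0 :=
  integral_odd_periodMeasure fun θ => by rw [hf, mul_neg, Real.cos_neg, neg_mul]

/-- A continuous odd function with summable sine coefficients is the sum of its sine series. -/
theorem eq_sinS_of_odd {f : ℝ → ℝ} (hc : Continuous f) (hp : Function.Periodic f (2 * Real.pi))
    (ho : Function.Odd f) (hs : Summable (sineCoeff f)) (θ : ℝ) : f θ = sinS (sineCoeff f) θ := by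
  have : Fact (0 < 2 * Real.pi) := ⟨by positivity⟩
  have hpC : Function.Periodic (fun x => (f x : ℂ)) (2 * Real.pi) := fun x => by simp [hp x]
  let F : C(AddCircle (2 * Real.pi), ℂ) := ⟨hpC.lift, by
    refine continuous_coinduced_dom.2 ?_
    exact Complex.continuous_ofReal.comp hc⟩
  have hF : ∀ x : ℝ, F (x : AddCircle (2 * Real.pi)) = f x := fun x => rfl
  have hcoef : ∀ n, fourierCoeff F n = -(1 / 2) * ((sineCoeff f n : ℝ) : ℂ) * Complex.I := by
    intro n
    rw [fourierCoeff_eq_intervalIntegral _ n (-Real.pi),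
      show -Real.pi + 2 * Real.pi = Real.pi by ring]
    simp only [hF]
    rw [integral_fourier_smul rfl n (integrable_of_continuous hc), integral_odd_mul_cos ho,
      sineCoeff, Complex.real_smul]
    have : (Real.pi : ℂ) ≠ 0 := by exact_mod_cast Real.pi_pos.ne'
    push_cast
    field_simp
    ring
  have hsum : Summable (fourierCoeff F) := by
    rw [show fourierCoeff F = _ from funext hcoef]
    exact ((Complex.ofRealCLM.summable hs).mul_left _).mul_right _
  have h := has_pointwise_sum_fourier_series_of_summable hsum (θ : AddCircle (2 * Real.pi))
  rw [hF] at h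
  have h2 := Complex.reCLM.hasSum h
  rw [sinS, ← tsum_mul_left]
  have h3 : f θ = Complex.reCLM (f θ : ℂ) := by simp
  rw [h3, ← h2.tsum_eq]
  refine tsum_congr fun n => ?_
  rw [hcoef, fourier_eq_cos_add_sin rfl, smul_eq_mul]
  simp only [Complex.reCLM_apply]
  simp [-Complex.ofReal_cos, -Complex.ofReal_sin]
  ring

/-! ### The Hilbert transform and the velocity of odd functions of class `C¹` -/

/-- `f` is odd, periodic, and of class `C¹` with derivative `f'`. -/
structure OddC1 (f f' : ℝ → ℝ) : Prop where
  hasDerivAt : ∀ x, HasDerivAt f (f' x) x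
  continuous_deriv : Continuous f'
  periodic : Function.Periodic f (2 * Real.pi)
  odd : Function.Odd f

theorem continuous_of_hasDerivAt {f f' : ℝ → ℝ} (h : ∀ x, HasDerivAt f (f' x) x) : Continuous f :=
  continuous_iff_continuousAt.2 fun x => (h x).continuousAt

theorem sineCoeff_zero (f : ℝ → ℝ) : sineCoeff f 0 = 0 := by simp [sineCoeff]

theorem tsum_sineCoeff_sq_le {f : ℝ → ℝ} (hf : Continuous f) :
    (Summable fun n => sineCoeff f n ^ 2) ∧
      ∑' n, sineCoeff f n ^ 2 ≤ 2 * Real.pi⁻¹ * ∫ θ, f θ ^ 2 ∂periodMeasure := by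
  obtain ⟨h1, h2⟩ := bessel (memLp_of_continuous hf) 0
  simp only [add_zero] at h1 h2
  have e : (fun n => sineCoeff f n ^ 2) = fun n : ℤ =>
      (Real.pi⁻¹) ^ 2 * (∫ θ, f θ * Real.sin (n * θ) ∂periodMeasure) ^ 2 := by
    ext n; rw [sineCoeff, mul_pow]
  rw [e]
  refine ⟨h1.mul_left _, ?_⟩
  rw [tsum_mul_left]
  refine (mul_le_mul_of_nonneg_left h2 (sq_nonneg _)).trans_eq ?_
  have := Real.pi_pos.ne'
  field_simp

theorem summable_rpow_sq : Summable fun n : ℤ => (fr n ^ (-(3 / 4) : ℝ)) ^ 2 := by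
  have h := (Real.summable_one_div_int_add_rpow 0 (3 / 2)).2 (by norm_num)
  have h2 : Summable fun n : ℤ => 1 / |(n : ℝ)| ^ (3 / 2 : ℝ) + if n = 0 then 1 else 0 := by
    refine Summable.add (by simpa using h) (hasSum_ite_eq 0 (1 : ℝ)).summable
  refine Summable.of_nonneg_of_le (fun _ => sq_nonneg _) (fun n => ?_) h2
  have hp := fr_pos n
  have e : (fr n ^ (-(3 / 4) : ℝ)) ^ 2 = fr n ^ (-(3 / 2) : ℝ) := by
    rw [← Real.rpow_natCast, ← Real.rpow_mul hp.le]
    norm_num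
  rw [e]
  rcases eq_or_ne n 0 with rfl | hn
  · simp [fr]
  · have h1 := abs_cast_le_of_ne hn
    rw [if_neg hn, add_zero, Real.rpow_neg hp.le, one_div]
    refine inv_anti₀ (Real.rpow_pos_of_pos (by linarith) _) ?_
    exact Real.rpow_le_rpow (abs_nonneg _) (abs_le_fr n) (by norm_num)

namespace OddC1

variable {f f' g g' : ℝ → ℝ} (h : OddC1 f f')
include h

theorem continuous : Continuous f := continuous_of_hasDerivAt h.hasDerivAt

theorem mul_sineCoeff (n : ℤ) :
    (n : ℝ) * sineCoeff f n = Real.pi⁻¹ * ∫ θ, f' θ * Real.sin (n * θ + Real.pi / 2)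
      ∂periodMeasure := by
  have e := integral_deriv_mul h.hasDerivAt (g := fun θ => Real.cos (n * θ))
    (g' := fun θ => -(n * Real.sin (n * θ))) (fun x => by
      convert! ((hasDerivAt_id x).const_mul (n : ℝ)).cos using 1
      simp only [id]
      ring) h.continuous_deriv (by fun_prop) h.periodic (fun θ => by
      simp only [mul_add, Real.cos_add_int_mul_two_pi])
  have e2 : ∀ θ, f θ * -(n * Real.sin (n * θ)) = -n * (f θ * Real.sin (n * θ)) := fun θ => by ring
  simp only [e2] at e
  rw [integral_const_mul] at e
  simp only [Real.sin_add_pi_div_two]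
  rw [e, sineCoeff]
  ring

/-- The sine coefficients of a `C¹` function, multiplied by the frequency. -/
theorem exists_coeff : ∃ y : Sq ℤ, (∀ n, y n = n * sineCoeff f n) ∧
    ‖y‖ ^ 2 ≤ 2 * Real.pi⁻¹ * ∫ θ, f' θ ^ 2 ∂periodMeasure := by
  obtain ⟨h1, h2⟩ := bessel (memLp_of_continuous h.continuous_deriv) (Real.pi / 2)
  have e : (fun n : ℤ => ((n : ℝ) * sineCoeff f n) ^ 2) = fun n : ℤ =>
      (Real.pi⁻¹) ^ 2 * (∫ θ, f' θ * Real.sin (n * θ + Real.pi / 2) ∂periodMeasure) ^ 2 := by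
    ext n; rw [h.mul_sineCoeff, mul_pow]
  refine ⟨Sq.mk (fun n : ℤ => (n : ℝ) * sineCoeff f n) (e ▸ h1.mul_left _), fun n => rfl, ?_⟩
  rw [Sq.norm_sq]
  simp only [Sq.mk_apply]
  rw [e, tsum_mul_left]
  refine (mul_le_mul_of_nonneg_left h2 (sq_nonneg _)).trans_eq ?_
  have := Real.pi_pos.ne'
  field_simp

/-- The sine coefficients of a function of class `C¹` decay well enough for `hilbert_sinS`. -/
theorem summable_rpow : Summable fun n => fr n ^ (1 / 4 : ℝ) * sineCoeff f n := by
  obtain ⟨y, hy, -⟩ := h.exists_coeff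
  refine (tsum_abs_mul_le (Sq.mk _ summable_rpow_sq) y (σ := id) Function.injective_id zero_le_two
    fun n => ?_).1
  rw [Sq.mk_apply, id, hy]
  have hp := fr_pos n
  rcases eq_or_ne n 0 with rfl | hn
  · simp [sineCoeff_zero]
  · rw [abs_mul, abs_mul, abs_of_pos (Real.rpow_pos_of_pos hp _),
      abs_of_pos (Real.rpow_pos_of_pos hp _)]
    have h1 : fr n ^ (1 / 4 : ℝ) = fr n ^ (-(3 / 4) : ℝ) * fr n := by
      nth_rewrite 3 [← Real.rpow_one (fr n)]
      rw [← Real.rpow_add hp]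
      norm_num
    rw [h1]
    have h2 := fr_le_two_mul_abs hn
    have h3 : 0 ≤ fr n ^ (-(3 / 4) : ℝ) * |sineCoeff f n| := by positivity
    have := mul_le_mul_of_nonneg_left h2 h3
    linarith

theorem summable_coeff : Summable (sineCoeff f) := by
  refine Summable.of_norm_bounded h.summable_rpow.abs fun n => ?_
  rw [abs_mul, abs_of_nonneg (Real.rpow_nonneg (fr_pos n).le _)]
  exact le_mul_of_one_le_left (abs_nonneg _) (Real.one_le_rpow (one_le_fr n) (by norm_num))

theorem eq_sinS : f = sinS (sineCoeff f) :=
  funext fun θ => eq_sinS_of_odd h.continuous h.periodic h.odd h.summable_coeff θ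

theorem hilbert_eq : hilbert f = hilbS (sineCoeff f) := by
  ext θ
  have := hilbert_sinS h.summable_rpow θ
  rwa [← h.eq_sinS] at this

theorem continuous_hilbert : Continuous (hilbert f) := by
  rw [h.hilbert_eq]
  exact continuous_cosS (summable_sign h.summable_coeff)

theorem hasDerivAt_velocity (θ : ℝ) : HasDerivAt (velocity f) (hilbert f θ) θ :=
  intervalIntegral.integral_hasDerivAt_right (h.continuous_hilbert.intervalIntegrable _ _)
    (h.continuous_hilbert.stronglyMeasurableAtFilter _ _) h.continuous_hilbert.continuousAt

theorem abs_hilbert_le (θ : ℝ) : |hilbert f θ|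
    ≤ ‖invSq‖ * Real.sqrt (2 * Real.pi⁻¹ * ∫ θ, f' θ ^ 2 ∂periodMeasure) := by
  obtain ⟨y, hy, hyn⟩ := h.exists_coeff
  have hyn' : ‖y‖ ≤ Real.sqrt (2 * Real.pi⁻¹ * ∫ θ, f' θ ^ 2 ∂periodMeasure) :=
    Real.le_sqrt_of_sq_le hyn
  have h1 := (tsum_abs_mul_le invSq y (σ := id) Function.injective_id zero_le_one
    (F := fun n : ℤ => -((n.sign : ℤ) : ℝ) * sineCoeff f n * Real.cos (n * θ)) fun n => by
      rw [one_mul, id, hy]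
      change _ ≤ |(|(n : ℝ)|⁻¹)| * _
      rw [abs_inv, abs_abs, abs_mul ((n : ℤ) : ℝ)]
      rcases eq_or_ne n 0 with rfl | hn
      · simp
      · rw [← mul_assoc, inv_mul_cancel₀ (by linarith [abs_cast_le_of_ne hn]), one_mul, abs_mul,
          neg_mul, abs_neg]
        have h2 := abs_sign_mul_le n (sineCoeff f n)
        have h3 := Real.abs_cos_le_one (n * θ)
        have := mul_le_mul h2 h3 (abs_nonneg _) (abs_nonneg _)
        linarith).2
  rw [h.hilbert_eq, hilbS, cosS, abs_mul, abs_of_pos (by norm_num : (0 : ℝ) < 1 / 2)]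
  have h4 := mul_le_mul_of_nonneg_left hyn' (norm_nonneg invSq)
  have h5 := mul_nonneg (norm_nonneg invSq) (norm_nonneg y)
  linarith

/-- The Hilbert transform is a contraction of `L²`. -/
theorem integral_hilbert_sq_le :
    ∫ θ, hilbert f θ ^ 2 ∂periodMeasure ≤ ∫ θ, f θ ^ 2 ∂periodMeasure := by
  obtain ⟨h1, h2⟩ := tsum_sineCoeff_sq_le h.continuous
  have hle : ∀ n : ℤ, (1 / 2 * (-((n.sign : ℤ) : ℝ) * sineCoeff f n)) ^ 2
      ≤ 1 / 4 * sineCoeff f n ^ 2 := by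
    intro n
    have := abs_sign_mul_le n (sineCoeff f n)
    have := sq_le_sq.2 this
    nlinarith
  have hs := Summable.of_nonneg_of_le (fun _ => sq_nonneg _) hle (h1.mul_left _)
  set x : Sq ℤ := Sq.mk _ hs with hx
  have hxs : Summable x := (summable_sign h.summable_coeff).mul_left (1 / 2)
  have hxn : ‖x‖ ^ 2 ≤ 1 / 4 * (2 * Real.pi⁻¹ * ∫ θ, f θ ^ 2 ∂periodMeasure) := by
    rw [Sq.norm_sq]
    refine (hs.tsum_le_tsum hle (h1.mul_left _)).trans ?_
    rw [tsum_mul_left]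
    linarith
  have h3 : ∫ θ, hilbert f θ ^ 2 ∂periodMeasure = ‖waveSum (Real.pi / 2) x‖ ^ 2 := by
    rw [L2_norm_sq]
    refine integral_congr_ae ?_
    filter_upwards [waveSum_ae_eq (Real.pi / 2) hxs] with θ hθ
    rw [hθ, h.hilbert_eq, hilbS, cosS, ← tsum_mul_left]
    congr 1
    refine tsum_congr fun n => ?_
    rw [Real.sin_add_pi_div_two, hx, Sq.mk_apply]
    ring
  rw [h3]
  have h4 := pow_le_pow_left₀ (norm_nonneg _) (norm_waveSum_le (Real.pi / 2) x) 2
  rw [mul_pow, Real.sq_sqrt (by positivity)] at h4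
  have h5 := mul_le_mul_of_nonneg_left hxn (by positivity : 0 ≤ 2 * Real.pi)
  have hpi := Real.pi_pos.ne'
  have e : 2 * Real.pi * (1 / 4 * (2 * Real.pi⁻¹ * ∫ θ, f θ ^ 2 ∂periodMeasure))
      = ∫ θ, f θ ^ 2 ∂periodMeasure := by field_simp; norm_num
  linarith

theorem add (h2 : OddC1 g g') : OddC1 (fun θ => f θ + g θ) (fun θ => f' θ + g' θ) where
  hasDerivAt x := (h.hasDerivAt x).add (h2.hasDerivAt x)
  continuous_deriv := h.continuous_deriv.add h2.continuous_deriv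
  periodic x := by simp only [h.periodic x, h2.periodic x]
  odd x := by simp only [h.odd x, h2.odd x]; ring

theorem const_mul (a : ℝ) : OddC1 (fun θ => a * f θ) (fun θ => a * f' θ) where
  hasDerivAt x := (h.hasDerivAt x).const_mul a
  continuous_deriv := continuous_const.mul h.continuous_deriv
  periodic x := by simp only [h.periodic x]
  odd x := by simp only [h.odd x]; ring

theorem hilbert_add (h2 : OddC1 g g') (θ : ℝ) :
    hilbert (fun θ => f θ + g θ) θ = hilbert f θ + hilbert g θ := by
  rw [(h.add h2).hilbert_eq, h.hilbert_eq, h2.hilbert_eq, hilbS, hilbS, hilbS,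
    ← cosS_add (summable_sign h.summable_coeff) (summable_sign h2.summable_coeff)]
  congr 1
  ext n
  have : sineCoeff (fun θ => f θ + g θ) n = sineCoeff f n + sineCoeff g n := by
    have i1 : Integrable (fun θ => f θ * Real.sin (n * θ)) periodMeasure :=
      integrable_of_continuous (h.continuous.mul (by fun_prop))
    have i2 : Integrable (fun θ => g θ * Real.sin (n * θ)) periodMeasure :=
      integrable_of_continuous (h2.continuous.mul (by fun_prop))
    simp only [sineCoeff, add_mul]
    rw [integral_add i1 i2]
    ring
  rw [this]
  ring

theorem velocity_add (h2 : OddC1 g g') (θ : ℝ) :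
    velocity (fun θ => f θ + g θ) θ = velocity f θ + velocity g θ := by
  simp only [velocity, h.hilbert_add h2]
  rw [intervalIntegral.integral_add (h.continuous_hilbert.intervalIntegrable _ _)
    (h2.continuous_hilbert.intervalIntegrable _ _)]

/-- The velocity is bounded on a period by the `L²` norm. -/
theorem velocity_sq_le {θ : ℝ} (hθ : θ ∈ Icc (-Real.pi) Real.pi) :
    velocity f θ ^ 2 ≤ 2 * Real.pi * ∫ θ, f θ ^ 2 ∂periodMeasure := by
  have hc := h.continuous_hilbert
  set A := ∫ θ, |hilbert f θ| ∂periodMeasure with hA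
  have i1 : Integrable (fun θ => |hilbert f θ|) periodMeasure := integrable_of_continuous hc.abs
  have i2 : Integrable (fun θ => hilbert f θ ^ 2) periodMeasure :=
    integrable_of_continuous (hc.pow 2)
  have h1 : |velocity f θ| ≤ A := by
    refine (intervalIntegral.norm_integral_le_integral_norm_uIoc (f := hilbert f) (μ := volume)
      (a := 0) (b := θ)).trans ?_
    refine setIntegral_mono_set i1 (Eventually.of_forall fun _ => abs_nonneg _)
      (LE.le.eventuallyLE ?_)
    intro x hx
    rw [mem_uIoc] at hx
    have := Real.pi_pos
    rcases hx with hx | hx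
    · exact ⟨by linarith, hx.2.trans hθ.2⟩
    · exact ⟨hθ.1.trans_lt hx.1, by linarith⟩
  have hpi := Real.pi_pos
  have h2 : 0 ≤ ∫ θ, (|hilbert f θ| - A / (2 * Real.pi)) ^ 2 ∂periodMeasure :=
    integral_nonneg fun _ => sq_nonneg _
  have e : ∀ θ, (|hilbert f θ| - A / (2 * Real.pi)) ^ 2
      = hilbert f θ ^ 2 - 2 * (A / (2 * Real.pi)) * |hilbert f θ| + (A / (2 * Real.pi)) ^ 2 :=
    fun θ => by rw [← sq_abs (hilbert f θ)]; ring
  have i3 : Integrable (fun θ => 2 * (A / (2 * Real.pi)) * |hilbert f θ|) periodMeasure :=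
    i1.const_mul _
  have i4 : Integrable (fun θ => hilbert f θ ^ 2 - 2 * (A / (2 * Real.pi)) * |hilbert f θ|)
    periodMeasure := i2.sub i3
  simp only [e] at h2
  rw [integral_add i4 (integrable_const _), integral_sub i2 i3, integral_const_mul, ← hA,
    integral_const, periodMeasure, measureReal_restrict_apply_univ, Real.volume_real_Ioc_of_le
      (by linarith), smul_eq_mul] at h2
  have h3 := h.integral_hilbert_sq_le
  rw [periodMeasure] at h3 ⊢
  have h4 : A ^ 2 ≤ 2 * Real.pi * ∫ θ, hilbert f θ ^ 2 ∂periodMeasure := by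
    rw [periodMeasure]
    have := mul_nonneg (by positivity : 0 ≤ 2 * Real.pi) h2
    have e2 : 2 * Real.pi * ((∫ θ in Ioc (-Real.pi) Real.pi, hilbert f θ ^ 2)
        - 2 * (A / (2 * Real.pi)) * A + (Real.pi - -Real.pi) * (A / (2 * Real.pi)) ^ 2)
        = 2 * Real.pi * (∫ θ in Ioc (-Real.pi) Real.pi, hilbert f θ ^ 2) - A ^ 2 := by
      field_simp
      ring
    linarith
  rw [periodMeasure] at h4
  have h5 : velocity f θ ^ 2 ≤ A ^ 2 := by
    rw [← sq_abs]
    exact pow_le_pow_left₀ (abs_nonneg _) h1 2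
  have := mul_le_mul_of_nonneg_left h3 (by positivity : 0 ≤ 2 * Real.pi)
  linarith

end OddC1

/-! ### Uniqueness of classical solutions -/

/-- `f` is continuously differentiable on `[0, T] × ℝ` with partial derivatives `ft` and `fx`. -/
structure SpaceTimeC1 (T : ℝ) (f ft fx : ℝ → ℝ → ℝ) : Prop where
  time : ∀ t ∈ Icc 0 T, ∀ θ, HasDerivWithinAt (fun s => f s θ) (ft t θ) (Icc 0 T) t
  space : ∀ t ∈ Icc 0 T, ∀ θ, HasDerivAt (f t) (fx t θ) θ
  continuousOn_time : ContinuousOn (Function.uncurry ft) (Icc 0 T ×ˢ univ)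
  continuousOn_space : ContinuousOn (Function.uncurry fx) (Icc 0 T ×ˢ univ)

theorem exists_spaceTimeC1 {T : ℝ} (hT : 0 < T) {f : ℝ → ℝ → ℝ}
    (hf : ContDiffOn ℝ 1 (fun p : ℝ × ℝ => f p.1 p.2) (Icc 0 T ×ˢ univ)) :
    ∃ ft fx, SpaceTimeC1 T f ft fx := by
  set S : Set (ℝ × ℝ) := Icc 0 T ×ˢ univ with hS
  set F : ℝ × ℝ → ℝ := fun p => f p.1 p.2 with hF
  have hu : UniqueDiffOn ℝ S := (uniqueDiffOn_Icc hT).prod uniqueDiffOn_univ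
  have hc := hf.continuousOn_fderivWithin hu le_rfl
  have hd : ∀ t ∈ Icc 0 T, ∀ θ, HasFDerivWithinAt F (fderivWithin ℝ F S (t, θ)) S (t, θ) :=
    fun t ht θ => ((hf.differentiableOn one_ne_zero) (t, θ) ⟨ht, mem_univ _⟩).hasFDerivWithinAt
  refine ⟨fun t θ => fderivWithin ℝ F S (t, θ) (1, 0), fun t θ => fderivWithin ℝ F S (t, θ) (0, 1),
    ?_, ?_, ?_, ?_⟩
  · intro t ht θ
    have h1 : HasDerivWithinAt (fun s : ℝ => (s, θ)) ((1 : ℝ), (0 : ℝ)) (Icc 0 T) t :=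
      (hasDerivWithinAt_id t _).prodMk (hasDerivWithinAt_const t _ θ)
    exact (hd t ht θ).comp_hasDerivWithinAt t h1
      (show MapsTo (fun s : ℝ => (s, θ)) (Icc 0 T) S from fun s hs => ⟨hs, mem_univ _⟩)
  · intro t ht θ
    have h1 : HasDerivWithinAt (fun x : ℝ => (t, x)) ((0 : ℝ), (1 : ℝ)) univ θ :=
      (hasDerivWithinAt_const θ _ t).prodMk (hasDerivWithinAt_id θ _)
    rw [← hasDerivWithinAt_univ]
    exact (hd t ht θ).comp_hasDerivWithinAt θ h1
      (show MapsTo (fun x : ℝ => (t, x)) univ S from fun s _ => ⟨ht, mem_univ _⟩)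
  · exact hc.clm_apply continuousOn_const
  · exact hc.clm_apply continuousOn_const

namespace SpaceTimeC1

variable {T : ℝ} {f ft fx g gt gx : ℝ → ℝ → ℝ} (hf : SpaceTimeC1 T f ft fx)

theorem continuous_section {h : ℝ → ℝ → ℝ}
    (hc : ContinuousOn (Function.uncurry h) (Icc 0 T ×ˢ univ)) {t : ℝ} (ht : t ∈ Icc 0 T) :
    Continuous (h t) := by
  rw [← continuousOn_univ]
  exact hc.comp (f := fun θ => (t, θ)) (by fun_prop) fun θ _ => ⟨ht, mem_univ _⟩

include hf

theorem oddC1 {t : ℝ} (ht : t ∈ Icc 0 T) (hp : Function.Periodic (f t) (2 * Real.pi))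
    (ho : Function.Odd (f t)) : OddC1 (f t) (fx t) where
  hasDerivAt := hf.space t ht
  continuous_deriv := continuous_section hf.continuousOn_space ht
  periodic := hp
  odd := ho

theorem add (hg : SpaceTimeC1 T g gt gx) : SpaceTimeC1 T (fun t θ => f t θ + g t θ)
    (fun t θ => ft t θ + gt t θ) (fun t θ => fx t θ + gx t θ) where
  time t ht θ := (hf.time t ht θ).add (hg.time t ht θ)
  space t ht θ := (hf.space t ht θ).add (hg.space t ht θ)
  continuousOn_time := hf.continuousOn_time.add hg.continuousOn_time
  continuousOn_space := hf.continuousOn_space.add hg.continuousOn_space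

theorem sub (hg : SpaceTimeC1 T g gt gx) : SpaceTimeC1 T (fun t θ => f t θ - g t θ)
    (fun t θ => ft t θ - gt t θ) (fun t θ => fx t θ - gx t θ) where
  time t ht θ := (hf.time t ht θ).sub (hg.time t ht θ)
  space t ht θ := (hf.space t ht θ).sub (hg.space t ht θ)
  continuousOn_time := hf.continuousOn_time.sub hg.continuousOn_time
  continuousOn_space := hf.continuousOn_space.sub hg.continuousOn_space

omit hf in
theorem exists_bound {h : ℝ → ℝ → ℝ}
    (hc : ContinuousOn (Function.uncurry h) (Icc 0 T ×ˢ univ)) :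
    ∃ B, ∀ t ∈ Icc 0 T, ∀ θ ∈ Icc (-Real.pi) Real.pi, |h t θ| ≤ B := by
  obtain ⟨B, hB⟩ := ((isCompact_Icc (a := (0 : ℝ)) (b := T)).prod
    (isCompact_Icc (a := -Real.pi) (b := Real.pi))).exists_bound_of_continuousOn
    (hc.mono (prod_mono_right (subset_univ _)))
  exact ⟨B, fun t ht θ hθ => hB (t, θ) ⟨ht, hθ⟩⟩

/-- Differentiation of the `L²` norm in time. The derivative is moved under the integral by
exchanging the integrals over time and space. -/
theorem hasDerivWithinAt_integral_sq {t : ℝ} (ht : t ∈ Icc 0 T) :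
    HasDerivWithinAt (fun s => ∫ θ, f s θ ^ 2 ∂periodMeasure)
      (∫ θ, 2 * f t θ * ft t θ ∂periodMeasure) (Icc 0 T) t := by
  have hT : 0 ≤ T := ht.1.trans ht.2
  have hcf : ∀ t ∈ Icc 0 T, Continuous (f t) := fun t ht => continuous_of_hasDerivAt (hf.space t ht)
  set P : ℝ → ℝ := fun s => projIcc 0 T hT s with hP
  have hPm : ∀ s, P s ∈ Icc 0 T := fun s => (projIcc 0 T hT s).2
  have hPc : Continuous P := continuous_subtype_val.comp continuous_projIcc
  have hPe : ∀ s ∈ Icc 0 T, P s = s := fun s hs => by rw [hP]; simp only [projIcc_of_mem hT hs]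
  have hftP : Continuous fun p : ℝ × ℝ => ft (P p.1) p.2 := by
    rw [← continuousOn_univ]
    exact hf.continuousOn_time.comp (f := fun p : ℝ × ℝ => (P p.1, p.2)) (by fun_prop)
      fun p _ => ⟨hPm _, mem_univ _⟩
  have hdP : ∀ θ, ∀ s ∈ Icc 0 T, f s θ = f 0 θ + ∫ r in (0 : ℝ)..s, ft (P r) θ := by
    intro θ s hs
    refine integral_of_hasDerivWithinAt_Icc (f := fun s => f s θ)
      (g := fun r => ft (P r) θ) ?_ (fun r hr => ?_) hs
    · exact (hftP.comp (by fun_prop : Continuous fun r : ℝ => (r, θ))).continuousOn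
    · simp only [hPe r hr]
      exact hf.time r hr θ
  have hfP : Continuous fun p : ℝ × ℝ => f (P p.1) p.2 := by
    have e : (fun p : ℝ × ℝ => f (P p.1) p.2)
        = fun p : ℝ × ℝ => f 0 p.2 + ∫ r in (0 : ℝ)..P p.1, ft (P r) p.2 :=
      funext fun p => hdP p.2 _ (hPm _)
    rw [e]
    refine ((hcf 0 ⟨le_rfl, hT⟩).comp continuous_snd).add ?_
    refine intervalIntegral.continuous_parametric_intervalIntegral_of_continuous ?_
      (hPc.comp continuous_fst)
    exact hftP.comp (by fun_prop : Continuous fun q : (ℝ × ℝ) × ℝ => (q.2, q.1.2))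
  have hD : Continuous fun p : ℝ × ℝ => 2 * f (P p.1) p.2 * ft (P p.1) p.2 :=
    (continuous_const.mul hfP).mul hftP
  have hsq : ∀ θ, ∀ s ∈ Icc 0 T,
      f s θ ^ 2 = f 0 θ ^ 2 + ∫ r in (0 : ℝ)..s, 2 * f (P r) θ * ft (P r) θ := by
    intro θ s hs
    refine integral_of_hasDerivWithinAt_Icc (f := fun s => f s θ ^ 2)
      (g := fun r => 2 * f (P r) θ * ft (P r) θ) ?_ (fun r hr => ?_) hs
    · exact (hD.comp (by fun_prop : Continuous fun r : ℝ => (r, θ))).continuousOn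
    · simp only [hPe r hr]
      have := (hf.time r hr θ).fun_pow 2
      simpa using this
  have hE : ∀ s ∈ Icc 0 T, ∫ θ, f s θ ^ 2 ∂periodMeasure = ∫ θ, f 0 θ ^ 2 ∂periodMeasure
      + ∫ r in (0 : ℝ)..s, ∫ θ, 2 * f (P r) θ * ft (P r) θ ∂periodMeasure := by
    intro s hs
    have hi : Integrable (fun p : ℝ × ℝ => 2 * f (P p.2) p.1 * ft (P p.2) p.1)
        (periodMeasure.prod (volume.restrict (Ioc 0 s))) := by
      rw [periodMeasure, Measure.prod_restrict]
      refine IntegrableOn.mono_set (t := Icc (-Real.pi) Real.pi ×ˢ Icc 0 s) ?_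
        (prod_mono Ioc_subset_Icc_self Ioc_subset_Icc_self)
      exact (hD.comp continuous_swap).continuousOn.integrableOn_compact
        (isCompact_Icc.prod isCompact_Icc)
    have hi2 : Integrable (fun θ => ∫ r in (0 : ℝ)..s, 2 * f (P r) θ * ft (P r) θ)
        periodMeasure := by
      simp only [intervalIntegral.integral_of_le hs.1]
      exact hi.integral_prod_left
    have hi3 : Integrable (fun θ => f 0 θ ^ 2) periodMeasure :=
      integrable_of_continuous ((hcf 0 ⟨le_rfl, hT⟩).pow 2)
    simp only [fun θ => hsq θ s hs]
    rw [integral_add hi3 hi2]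
    congr 1
    simp only [intervalIntegral.integral_of_le hs.1]
    exact integral_integral_swap hi
  have hg : Continuous fun r => ∫ θ, 2 * f (P r) θ * ft (P r) θ ∂periodMeasure := by
    simp only [integral_periodMeasure]
    exact intervalIntegral.continuous_parametric_intervalIntegral_of_continuous' hD _ _
  have := hasDerivWithinAt_Icc_of_eq_integral hg.continuousOn hE ht
  simpa only [hPe t ht] using this

end SpaceTimeC1

/-- The right-hand side of the equation for the Elsasser variable `f = η⁺ ± η⁻`, where
`g = η⁺ ∓ η⁻`: the bracket `{f - sin 2θ, v(g) + ½ sin 2θ}`. -/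
def elsasser (f f' g : ℝ → ℝ) (θ : ℝ) : ℝ :=
  (f θ - Real.sin (2 * θ)) * (hilbert g θ + Real.cos (2 * θ))
    - (velocity g θ + 1 / 2 * Real.sin (2 * θ)) * (f' θ - 2 * Real.cos (2 * θ))

namespace OddC1

variable {f f' g g' a a' b b' : ℝ → ℝ}

theorem sub (h : OddC1 f f') (h2 : OddC1 g g') :
    OddC1 (fun θ => f θ - g θ) (fun θ => f' θ - g' θ) where
  hasDerivAt x := (h.hasDerivAt x).sub (h2.hasDerivAt x)
  continuous_deriv := h.continuous_deriv.sub h2.continuous_deriv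
  periodic x := by simp only [h.periodic x, h2.periodic x]
  odd x := by simp only [h.odd x, h2.odd x]; ring

theorem hilbert_sub (h : OddC1 f f') (h2 : OddC1 g g') (θ : ℝ) :
    hilbert (fun θ => f θ - g θ) θ = hilbert f θ - hilbert g θ := by
  have := (h.sub h2).hilbert_add h2 θ
  simp only [sub_add_cancel] at this
  linarith

theorem velocity_sub (h : OddC1 f f') (h2 : OddC1 g g') (θ : ℝ) :
    velocity (fun θ => f θ - g θ) θ = velocity f θ - velocity g θ := by
  have := (h.sub h2).velocity_add h2 θ
  simp only [sub_add_cancel] at this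
  linarith

theorem hasDerivAt_sin_two (θ : ℝ) :
    HasDerivAt (fun θ : ℝ => Real.sin (2 * θ)) (2 * Real.cos (2 * θ)) θ := by
  have := ((hasDerivAt_id θ).const_mul 2).sin
  simpa [mul_comm] using this

theorem bracket_eq (h : OddC1 f f') (h2 : OddC1 g g') (θ : ℝ) :
    bracket f (velocity g) θ = f θ * hilbert g θ - velocity g θ * f' θ := by
  rw [bracket, (h2.hasDerivAt_velocity θ).deriv, (h.hasDerivAt θ).deriv]

theorem Lplus_eq (h : OddC1 f f') (θ : ℝ) : Lplus f θ =
    (1 / 2 * f θ + velocity f θ) * (2 * Real.cos (2 * θ))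
      - Real.sin (2 * θ) * (1 / 2 * f' θ + hilbert f θ) := by
  have e : HasDerivAt (fun θ => 1 / 2 * f θ + velocity f θ) (1 / 2 * f' θ + hilbert f θ) θ :=
    ((h.hasDerivAt θ).const_mul _).add (h.hasDerivAt_velocity θ)
  rw [Lplus, bracket, e.deriv, (hasDerivAt_sin_two θ).deriv]

theorem Lminus_eq (h : OddC1 f f') (θ : ℝ) : Lminus f θ =
    (1 / 2 * f θ - velocity f θ) * (2 * Real.cos (2 * θ))
      - Real.sin (2 * θ) * (1 / 2 * f' θ - hilbert f θ) := by
  have e : HasDerivAt (fun θ => 1 / 2 * f θ - velocity f θ) (1 / 2 * f' θ - hilbert f θ) θ :=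
    ((h.hasDerivAt θ).const_mul _).sub (h.hasDerivAt_velocity θ)
  rw [Lminus, bracket, e.deriv, (hasDerivAt_sin_two θ).deriv]

/-- The sum of the two equations is the equation for the Elsasser variable `η⁺ + η⁻`. -/
theorem rhs_add (h : OddC1 f f') (h2 : OddC1 g g') (θ : ℝ) :
    (Lplus f θ + N₁ f g θ) + (Lminus g θ + N₂ f g θ)
      = elsasser (fun θ => f θ + g θ) (fun θ => f' θ + g' θ) (fun θ => f θ - g θ) θ := by
  rw [elsasser, h.hilbert_sub h2, h.velocity_sub h2, h.Lplus_eq, h2.Lminus_eq, N₁, N₂,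
    h.bracket_eq h, h2.bracket_eq h2, h2.bracket_eq h, h.bracket_eq h2]
  ring

/-- The difference of the two equations is the equation for the Elsasser variable `η⁺ - η⁻`. -/
theorem rhs_sub (h : OddC1 f f') (h2 : OddC1 g g') (θ : ℝ) :
    (Lplus f θ + N₁ f g θ) - (Lminus g θ + N₂ f g θ)
      = elsasser (fun θ => f θ - g θ) (fun θ => f' θ - g' θ) (fun θ => f θ + g θ) θ := by
  rw [elsasser, h.hilbert_add h2, h.velocity_add h2, h.Lplus_eq, h2.Lminus_eq, N₁, N₂,
    h.bracket_eq h, h2.bracket_eq h2, h2.bracket_eq h, h.bracket_eq h2]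
  ring

theorem apply_pi (h : OddC1 f f') : f Real.pi = 0 ∧ f (-Real.pi) = 0 := by
  have h1 := h.odd Real.pi
  have h2 := h.periodic (-Real.pi)
  have e : -Real.pi + 2 * Real.pi = Real.pi := by ring
  rw [e] at h2
  constructor <;> linarith

/-- The `L²` estimate for the difference `f - a` of two solutions: the transport term is integrated
by parts, and the remaining terms are bounded by the `L²` norms of `f - a` and `g - b`. -/
theorem integral_elsasser_sub_le (hf : OddC1 f f') (ha : OddC1 a a') (hg : OddC1 g g')
    (hb : OddC1 b b') {M : ℝ} (h1 : ∀ θ ∈ Icc (-Real.pi) Real.pi,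
      |hilbert g θ + Real.cos (2 * θ)| ≤ M ∧ |a θ - Real.sin (2 * θ)| ≤ M ∧
        |a' θ - 2 * Real.cos (2 * θ)| ≤ M) :
    ∫ θ, 2 * (f θ - a θ) * (elsasser f f' g θ - elsasser a a' b θ) ∂periodMeasure
      ≤ 5 * M * ∫ θ, (f θ - a θ) ^ 2 ∂periodMeasure
        + M * (1 + 4 * Real.pi ^ 2) * ∫ θ, (g θ - b θ) ^ 2 ∂periodMeasure := by
  have hd := hf.sub ha
  have he := hg.sub hb
  have hpi := Real.pi_pos
  have cf := hf.continuous
  have ca := ha.continuous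
  have cf' := hf.continuous_deriv
  have ca' := ha.continuous_deriv
  have cH := hg.continuous_hilbert
  have cHb := hb.continuous_hilbert
  have cHe := he.continuous_hilbert
  have cv : Continuous (velocity g) := continuous_of_hasDerivAt hg.hasDerivAt_velocity
  have cvb : Continuous (velocity b) := continuous_of_hasDerivAt hb.hasDerivAt_velocity
  have cve : Continuous (velocity fun θ => g θ - b θ) :=
    continuous_of_hasDerivAt he.hasDerivAt_velocity
  set V : ℝ → ℝ := fun θ => velocity g θ + 1 / 2 * Real.sin (2 * θ) with hV
  set V' : ℝ → ℝ := fun θ => hilbert g θ + Real.cos (2 * θ) with hV'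
  set Φ' : ℝ → ℝ := fun θ => 2 * (f θ - a θ) * (f' θ - a' θ) * V θ + (f θ - a θ) ^ 2 * V' θ with hΦ'
  have hΦ : ∀ θ, HasDerivAt (fun θ => (f θ - a θ) ^ 2 * V θ) (Φ' θ) θ := by
    intro θ
    have d1 : HasDerivAt V (V' θ) θ := by
      convert! (hg.hasDerivAt_velocity θ).add ((hasDerivAt_sin_two θ).const_mul (1 / 2)) using 1
      rw [hV']
      ring
    convert! ((hd.hasDerivAt θ).pow 2).mul d1 using 1
    simp only [hΦ', Nat.cast_ofNat, Nat.add_one_sub_one, pow_one, Pi.pow_apply]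
  have cΦ : Continuous Φ' := by fun_prop
  have hΦ0 : ∫ θ, Φ' θ ∂periodMeasure = 0 := by
    rw [integral_periodMeasure, intervalIntegral.integral_eq_sub_of_hasDerivAt (fun θ _ => hΦ θ)
      (cΦ.intervalIntegrable _ _), hd.apply_pi.1, hd.apply_pi.2]
    simp
  have key : ∀ θ ∈ Icc (-Real.pi) Real.pi,
      2 * (f θ - a θ) * (elsasser f f' g θ - elsasser a a' b θ) ≤ 5 * M * (f θ - a θ) ^ 2
        + M * (hilbert (fun θ => g θ - b θ) θ) ^ 2 + M * (velocity (fun θ => g θ - b θ) θ) ^ 2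
        - Φ' θ := by
    intro θ hθ
    obtain ⟨b1, b2, b3⟩ := h1 θ hθ
    set h := hilbert (fun θ => g θ - b θ) θ with hh
    set v := velocity (fun θ => g θ - b θ) θ with hv
    have eh : hilbert b θ = hilbert g θ - h := by rw [hh, hg.hilbert_sub hb]; ring
    have ev : velocity b θ = velocity g θ - v := by rw [hv, hg.velocity_sub hb]; ring
    have e : 2 * (f θ - a θ) * (elsasser f f' g θ - elsasser a a' b θ)
        = 3 * ((f θ - a θ) ^ 2 * V' θ) - Φ' θ
          + 2 * (f θ - a θ) * h * (a θ - Real.sin (2 * θ))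
          + 2 * (f θ - a θ) * (-v) * (a' θ - 2 * Real.cos (2 * θ)) := by
      rw [elsasser, elsasser, eh, ev, hΦ', hV, hV']
      ring
    have hxy : ∀ x y z : ℝ, |z| ≤ M → 2 * x * y * z ≤ M * (x ^ 2 + y ^ 2) := by
      intro x y z hz
      have i1 : 2 * x * y * z ≤ |2 * x * y| * |z| := by
        rw [← abs_mul]; exact le_abs_self _
      have i2 : |2 * x * y| ≤ x ^ 2 + y ^ 2 := by
        rw [abs_le]
        constructor <;> nlinarith [sq_nonneg (x + y), sq_nonneg (x - y)]
      have i3 := mul_le_mul i2 hz (abs_nonneg _) (by positivity)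
      linarith
    have k1 := hxy (f θ - a θ) h _ b2
    have k2 := hxy (f θ - a θ) (-v) _ b3
    have k3 : (f θ - a θ) ^ 2 * V' θ ≤ (f θ - a θ) ^ 2 * M :=
      mul_le_mul_of_nonneg_left ((le_abs_self _).trans b1) (sq_nonneg _)
    rw [e]
    rw [neg_sq] at k2
    linarith
  have cel : Continuous fun θ => 2 * (f θ - a θ) * (elsasser f f' g θ - elsasser a a' b θ) := by
    unfold elsasser
    fun_prop
  have i1 : Integrable (fun θ => 5 * M * (f θ - a θ) ^ 2) periodMeasure :=
    integrable_of_continuous (by fun_prop)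
  have i2 : Integrable (fun θ => M * (hilbert (fun θ => g θ - b θ) θ) ^ 2) periodMeasure :=
    integrable_of_continuous (by fun_prop)
  have i3 : Integrable (fun θ => M * (velocity (fun θ => g θ - b θ) θ) ^ 2) periodMeasure :=
    integrable_of_continuous (by fun_prop)
  have i4 : Integrable Φ' periodMeasure := integrable_of_continuous cΦ
  have i12 : Integrable (fun θ => 5 * M * (f θ - a θ) ^ 2
    + M * (hilbert (fun θ => g θ - b θ) θ) ^ 2) periodMeasure := i1.add i2
  have i123 : Integrable (fun θ => 5 * M * (f θ - a θ) ^ 2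
    + M * (hilbert (fun θ => g θ - b θ) θ) ^ 2
    + M * (velocity (fun θ => g θ - b θ) θ) ^ 2) periodMeasure := i12.add i3
  have hmono := setIntegral_mono_on (integrable_of_continuous cel) (i123.sub i4)
    measurableSet_Ioc (fun θ hθ => key θ (Ioc_subset_Icc_self hθ))
  have hM : 0 ≤ M := (abs_nonneg _).trans (h1 0 ⟨by linarith, hpi.le⟩).1
  have hH := mul_le_mul_of_nonneg_left he.integral_hilbert_sq_le hM
  have hv : ∫ θ, velocity (fun θ => g θ - b θ) θ ^ 2 ∂periodMeasure
      ≤ 4 * Real.pi ^ 2 * ∫ θ, (g θ - b θ) ^ 2 ∂periodMeasure := by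
    have i5 : Integrable (fun θ => velocity (fun θ => g θ - b θ) θ ^ 2) periodMeasure :=
      integrable_of_continuous (by fun_prop)
    refine (setIntegral_mono_on i5 (integrable_const
      (2 * Real.pi * ∫ θ, (g θ - b θ) ^ 2 ∂periodMeasure)) measurableSet_Ioc
      fun θ hθ => he.velocity_sq_le (Ioc_subset_Icc_self hθ)).trans_eq ?_
    rw [setIntegral_const, Real.volume_real_Ioc_of_le (by linarith), smul_eq_mul]
    ring
  have hv' := mul_le_mul_of_nonneg_left hv hM
  change ∫ θ, _ ∂periodMeasure ≤ ∫ θ, (_ - Φ' θ) ∂periodMeasure at hmono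
  rw [integral_sub i123 i4, integral_add i12 i3, integral_add i1 i2, hΦ0, integral_const_mul,
    integral_const_mul, integral_const_mul] at hmono
  linarith

theorem eq_zero_of_integral_sq (h : OddC1 f f') (h0 : ∫ θ, f θ ^ 2 ∂periodMeasure = 0) (θ : ℝ) :
    f θ = 0 := by
  obtain ⟨h1, h2⟩ := tsum_sineCoeff_sq_le h.continuous
  rw [h0, mul_zero] at h2
  have h3 : ∀ n, sineCoeff f n = 0 := fun n =>
    pow_eq_zero_iff two_ne_zero |>.1
      (le_antisymm ((h1.le_tsum n fun _ _ => sq_nonneg _).trans h2) (sq_nonneg _))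
  rw [h.eq_sinS, sinS]
  simp [h3]

end OddC1

theorem abs_hilbert_le_of_bound {f f' : ℝ → ℝ} (h : OddC1 f f') {B : ℝ}
    (hB : ∀ θ ∈ Icc (-Real.pi) Real.pi, |f' θ| ≤ B) (θ : ℝ) :
    |hilbert f θ| ≤ ‖invSq‖ * Real.sqrt (4 * B ^ 2) := by
  refine (h.abs_hilbert_le θ).trans ?_
  refine mul_le_mul_of_nonneg_left (Real.sqrt_le_sqrt ?_) (norm_nonneg _)
  have i1 : Integrable (fun θ => f' θ ^ 2) periodMeasure :=
    integrable_of_continuous (h.continuous_deriv.pow 2)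
  have hpi := Real.pi_pos
  have h1 : ∫ θ, f' θ ^ 2 ∂periodMeasure ≤ 2 * Real.pi * B ^ 2 := by
    refine (setIntegral_mono_on i1 (integrable_const (B ^ 2)) measurableSet_Ioc
      fun θ hθ => ?_).trans_eq ?_
    · rw [← sq_abs]
      exact pow_le_pow_left₀ (abs_nonneg _) (hB θ (Ioc_subset_Icc_self hθ)) 2
    · rw [setIntegral_const, Real.volume_real_Ioc_of_le (by linarith), smul_eq_mul]
      ring
  have h2 := mul_le_mul_of_nonneg_left h1 (by positivity : 0 ≤ 2 * Real.pi⁻¹)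
  have e : 2 * Real.pi⁻¹ * (2 * Real.pi * B ^ 2) = 4 * B ^ 2 := by field_simp; ring
  linarith

/-- Classical odd solutions in Elsasser variables. -/
theorem IsClassicalOddSolution.exists_elsasser {T : ℝ} (hT : 0 < T) {ηp ηm : ℝ → ℝ → ℝ}
    (h : IsClassicalOddSolution T ηp ηm) : ∃ at' ax bt bx : ℝ → ℝ → ℝ,
      SpaceTimeC1 T (fun t θ => ηp t θ + ηm t θ) at' ax ∧
      SpaceTimeC1 T (fun t θ => ηp t θ - ηm t θ) bt bx ∧
      (∀ t ∈ Icc 0 T, OddC1 (fun θ => ηp t θ + ηm t θ) (ax t) ∧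
        OddC1 (fun θ => ηp t θ - ηm t θ) (bx t)) ∧
      ∀ t ∈ Ioc 0 T, ∀ θ,
        at' t θ = elsasser (fun θ => ηp t θ + ηm t θ) (ax t) (fun θ => ηp t θ - ηm t θ) θ ∧
        bt t θ = elsasser (fun θ => ηp t θ - ηm t θ) (bx t) (fun θ => ηp t θ + ηm t θ) θ := by
  obtain ⟨pt, px, hp⟩ := exists_spaceTimeC1 hT h.contDiffOn_p
  obtain ⟨mt, mx, hm⟩ := exists_spaceTimeC1 hT h.contDiffOn_m
  have op := fun t ht => hp.oddC1 ht (h.periodic_p t ht) (h.odd_p t ht)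
  have om := fun t ht => hm.oddC1 ht (h.periodic_m t ht) (h.odd_m t ht)
  refine ⟨_, _, _, _, hp.add hm, hp.sub hm, fun t ht => ⟨(op t ht).add (om t ht),
    (op t ht).sub (om t ht)⟩, fun t ht θ => ?_⟩
  have ht' := Ioc_subset_Icc_self ht
  have e1 := h.eq_p t ht θ
  have e2 := h.eq_m t ht θ
  rw [(hp.time t ht' θ).derivWithin (uniqueDiffOn_Icc hT t ht')] at e1
  rw [(hm.time t ht' θ).derivWithin (uniqueDiffOn_Icc hT t ht')] at e2
  rw [← (op t ht').rhs_add (om t ht'), ← (op t ht').rhs_sub (om t ht'), e1, e2]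
  exact ⟨rfl, rfl⟩

/-- Uniqueness of classical odd solutions, by Grönwall's inequality for the `L²` norm of the
difference of two solutions in Elsasser variables. -/
theorem IsClassicalOddSolution.unique {T : ℝ} (hT : 0 < T) {ηp ηm ξp ξm : ℝ → ℝ → ℝ}
    (hη : IsClassicalOddSolution T ηp ηm) (hξ : IsClassicalOddSolution T ξp ξm)
    (h0p : ∀ θ, ξp 0 θ = ηp 0 θ) (h0m : ∀ θ, ξm 0 θ = ηm 0 θ) :
    ∀ t ∈ Icc 0 T, ∀ θ, ξp t θ = ηp t θ ∧ ξm t θ = ηm t θ := by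
  obtain ⟨at1, ax1, bt1, bx1, hA1, hB1, o1, q1⟩ := hξ.exists_elsasser hT
  obtain ⟨at2, ax2, bt2, bx2, hA2, hB2, o2, q2⟩ := hη.exists_elsasser hT
  obtain ⟨Ba, hBa⟩ := SpaceTimeC1.exists_bound hA1.continuousOn_space
  obtain ⟨Bb, hBb⟩ := SpaceTimeC1.exists_bound hB1.continuousOn_space
  obtain ⟨Ca, hCa⟩ := SpaceTimeC1.exists_bound hA2.continuousOn_space
  obtain ⟨Cb, hCb⟩ := SpaceTimeC1.exists_bound hB2.continuousOn_space
  have hpi := Real.pi_pos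
  -- an odd `C¹` function is bounded on the period by the bound on its derivative
  have hval : ∀ {f f' : ℝ → ℝ} {B : ℝ}, OddC1 f f' →
      (∀ θ ∈ Icc (-Real.pi) Real.pi, |f' θ| ≤ B) → ∀ θ ∈ Icc (-Real.pi) Real.pi,
        |f θ| ≤ B * Real.pi := by
    intro f f' B hf hB θ hθ
    have hf0 : f 0 = 0 := by have := hf.odd 0; rw [neg_zero] at this; linarith
    have hB0 : 0 ≤ B := (abs_nonneg _).trans (hB 0 ⟨by linarith, hpi.le⟩)
    have := (convex_Icc (-Real.pi) Real.pi).norm_image_sub_le_of_norm_hasDerivWithin_le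
      (fun x _ => (hf.hasDerivAt x).hasDerivWithinAt) (C := B) hB
      (show (0 : ℝ) ∈ Icc (-Real.pi) Real.pi from ⟨by linarith, hpi.le⟩) hθ
    rw [hf0, sub_zero, sub_zero, Real.norm_eq_abs, Real.norm_eq_abs] at this
    exact this.trans (mul_le_mul_of_nonneg_left (abs_le.2 hθ) hB0)
  set Ha := ‖invSq‖ * Real.sqrt (4 * Ba ^ 2) with hHa
  set Hb := ‖invSq‖ * Real.sqrt (4 * Bb ^ 2) with hHb
  obtain ⟨M, hM⟩ : ∃ M, Ha + 1 ≤ M ∧ Hb + 1 ≤ M ∧ Ca * Real.pi + 1 ≤ M ∧ Cb * Real.pi + 1 ≤ M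
      ∧ Ca + 2 ≤ M ∧ Cb + 2 ≤ M := by
    refine ⟨max (max (Ha + 1) (Hb + 1)) (max (max (Ca * Real.pi + 1) (Cb * Real.pi + 1))
      (max (Ca + 2) (Cb + 2))), ?_, ?_, ?_, ?_, ?_, ?_⟩ <;> simp
  obtain ⟨m1, m2, m3, m4, m5, m6⟩ := hM
  have hM0 : 0 ≤ M := by
    have : 0 ≤ Ha := by positivity
    linarith
  set dA := hA1.sub hA2
  set dB := hB1.sub hB2
  have hcs : ∀ θ : ℝ, |Real.cos (2 * θ)| ≤ 1 ∧ |Real.sin (2 * θ)| ≤ 1 ∧ |2 * Real.cos (2 * θ)| ≤ 2 :=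
    fun θ => ⟨Real.abs_cos_le_one _, Real.abs_sin_le_one _, by
      rw [abs_mul, abs_two]; linarith [Real.abs_cos_le_one (2 * θ)]⟩
  set E : ℝ → ℝ := fun t =>
    ∫ θ, ((ξp t θ + ξm t θ) - (ηp t θ + ηm t θ)) ^ 2 ∂periodMeasure
      + ∫ θ, ((ξp t θ - ξm t θ) - (ηp t θ - ηm t θ)) ^ 2 ∂periodMeasure with hE
  have hE0 : E 0 = 0 := by simp [hE, h0p, h0m]
  have hE1 : ∀ t ∈ Icc 0 T, HasDerivWithinAt E _ (Icc 0 T) t := fun t ht =>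
    (dA.hasDerivWithinAt_integral_sq ht).add (dB.hasDerivWithinAt_integral_sq ht)
  have hEnn : ∀ t, 0 ≤ ∫ θ, ((ξp t θ + ξm t θ) - (ηp t θ + ηm t θ)) ^ 2 ∂periodMeasure ∧
      0 ≤ ∫ θ, ((ξp t θ - ξm t θ) - (ηp t θ - ηm t θ)) ^ 2 ∂periodMeasure := fun t =>
    ⟨integral_nonneg fun _ => sq_nonneg _, integral_nonneg fun _ => sq_nonneg _⟩
  have hfin := fun (t : ℝ) (ht : t ∈ Icc 0 T) => gronwall_Icc (K := M * (6 + 4 * Real.pi ^ 2)) (c := 0) (by positivity)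
    le_rfl hE1 (fun t ht => by
      rcases ht.1.eq_or_lt with rfl | hpos
      · simp [hE0, h0p, h0m]
      · obtain ⟨oa1, ob1⟩ := o1 t ht
        obtain ⟨oa2, ob2⟩ := o2 t ht
        have k1 := oa1.integral_elsasser_sub_le oa2 ob1 ob2 (M := M) fun θ hθ => by
          have j1 := abs_hilbert_le_of_bound ob1 (hBb t ht) θ
          have j2 := hval oa2 (hCa t ht) θ hθ
          have j3 := hCa t ht θ hθ
          obtain ⟨c1, c2, c3⟩ := hcs θ
          exact ⟨(abs_add_le _ _).trans (by linarith), (abs_sub _ _).trans (by linarith),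
            (abs_sub _ _).trans (by linarith)⟩
        have k2 := ob1.integral_elsasser_sub_le ob2 oa1 oa2 (M := M) fun θ hθ => by
          have j1 := abs_hilbert_le_of_bound oa1 (hBa t ht) θ
          have j2 := hval ob2 (hCb t ht) θ hθ
          have j3 := hCb t ht θ hθ
          obtain ⟨c1, c2, c3⟩ := hcs θ
          exact ⟨(abs_add_le _ _).trans (by linarith), (abs_sub _ _).trans (by linarith),
            (abs_sub _ _).trans (by linarith)⟩
        have e1 := q1 t ⟨hpos, ht.2⟩
        have e2 := q2 t ⟨hpos, ht.2⟩
        simp only [fun θ => (e1 θ).1, fun θ => (e1 θ).2, fun θ => (e2 θ).1, fun θ => (e2 θ).2]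
        simp only [hE]
        linarith) ht
  intro t ht
  have hEt : E t ≤ 0 := by simpa [hE0] using hfin t ht
  obtain ⟨n1, n2⟩ := hEnn t
  simp only [hE] at hEt
  have z1 := ((o1 t ht).1.sub (o2 t ht).1).eq_zero_of_integral_sq (by linarith)
  have z2 := ((o1 t ht).2.sub (o2 t ht).2).eq_zero_of_integral_sq (by linarith)
  intro θ
  have := z1 θ
  have := z2 θ
  constructor <;> linarith

/-! ### The sine coefficients of the initial data -/

theorem wave_contDiff (φ : ℝ) (n : ℤ) : ContDiff ℝ ∞ fun θ : ℝ => Real.sin (n * θ + φ) := by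
  fun_prop

theorem IsWeakDeriv.waveCoef_eq {f g : L2} (h : IsWeakDeriv f g) (φ : ℝ) (n : ℤ) :
    waveCoef φ g n = -n * waveCoef (φ + Real.pi / 2) f n := by
  have h1 := h _ (wave_contDiff φ n) (wave_periodic φ n)
  simp only [(hasDerivAt_wave φ n _).deriv] at h1
  rw [waveCoef_apply, waveCoef_apply]
  have e : ∀ θ : ℝ, f θ * (n * Real.sin (n * θ + (φ + Real.pi / 2)))
      = n * (f θ * Real.sin (n * θ + (φ + Real.pi / 2))) := fun θ => by ring
  simp only [e] at h1
  rw [integral_const_mul] at h1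
  linarith

theorem waveCoef_jet {m : ℕ} (F : Sobolev m) (n : ℤ) (k : ℕ) (hk : k < m + 1) (φ : ℝ) :
    waveCoef φ (jet F ⟨k, hk⟩) n
      = (-n : ℝ) ^ k * waveCoef (φ + k * (Real.pi / 2)) (jet F 0) n := by
  induction k generalizing φ with
  | zero => simp
  | succ k ih =>
    have h := F.2 ⟨k, by omega⟩
    have h' : IsWeakDeriv (jet F ⟨k, by omega⟩) (jet F ⟨k + 1, hk⟩) := h
    rw [h'.waveCoef_eq, ih]
    push_cast
    rw [show φ + Real.pi / 2 + k * (Real.pi / 2) = φ + (k + 1) * (Real.pi / 2) by ring]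
    ring

theorem norm_jet_le {m : ℕ} (F : Sobolev m) (k : Fin (m + 1)) : ‖jet F k‖ ≤ ‖F‖ :=
  PiLp.norm_apply_le (F : PiLp 2 fun _ : Fin (m + 1) => L2) k

theorem norm_waveCoef_apply_le (φ : ℝ) (g : L2) : ‖waveCoef φ g‖ ≤ 3 * ‖g‖ := by
  refine (ContinuousLinearMap.le_of_opNorm_le _ (norm_waveCoef_le φ) g).trans ?_
  refine mul_le_mul_of_nonneg_right ?_ (norm_nonneg _)
  rw [Real.sqrt_le_left (by norm_num)]
  linarith [Real.pi_lt_four]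

theorem ae_sin_ne_zero : ∀ᵐ θ ∂periodMeasure, Real.sin θ ≠ 0 := by
  refine ae_restrict_of_ae ?_
  have hc : {θ : ℝ | Real.sin θ = 0}.Countable := by
    refine (countable_range fun n : ℤ => (n : ℝ) * Real.pi).mono ?_
    intro θ hθ
    exact Real.sin_eq_zero_iff.1 hθ
  filter_upwards [hc.ae_notMem volume] with θ hθ
  exact hθ

/-- Comparison of `(1 + |n|)^m` with the powers `1` and `|n|^m`. -/
theorem fr_pow_mul_abs_le (m : ℕ) (n : ℤ) (a : ℝ) :
    fr n ^ m * |a| ≤ 2 ^ m * (|a| + |(-n : ℝ) ^ m * a|) := by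
  have h1 : fr n ^ m ≤ 2 ^ m * (1 + |(n : ℝ)| ^ m) := by
    have h2 : fr n ≤ 2 * max 1 |(n : ℝ)| := by
      unfold fr
      linarith [le_max_left 1 |(n : ℝ)|, le_max_right 1 |(n : ℝ)|]
    refine (pow_le_pow_left₀ (fr_pos n).le h2 m).trans ?_
    rw [mul_pow]
    refine mul_le_mul_of_nonneg_left ?_ (by positivity)
    rcases max_cases 1 |(n : ℝ)| with h | h <;> rw [h.1]
    · rw [one_pow]; linarith [pow_nonneg (abs_nonneg (n : ℝ)) m]
    · linarith
  rw [abs_mul, abs_pow, abs_neg]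
  have := mul_le_mul_of_nonneg_right h1 (abs_nonneg a)
  linarith

/-- Odd functions with weighted derivative in `H^m` in terms of their sine coefficients: these are
`aSeq X`, where `X` is up to a factor the sequence of sine coefficients of the weighted
derivative. -/
theorem IsWeightedDeriv.exists_coeff {m : ℕ} {η : ℝ → ℝ} {F : Sobolev m}
    (h : IsWeightedDeriv η F) : ∃ X Y : Sq ℤ, (∀ n, Y n = fr n ^ m * X n) ∧
      ‖X‖ ≤ 6 * ‖F‖ ∧ ‖Y‖ ≤ 2 ^ m * 12 * ‖F‖ ∧ (∀ n, X (-n) = -X n) ∧ X 1 = 0 ∧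
      sineCoeff η = aSeq X := by
  obtain ⟨G, hG0, hF0⟩ := h
  have hpi := Real.pi_pos
  set q := Real.sqrt Real.pi with hq
  have hqp : 0 < q := Real.sqrt_pos.2 hpi
  have hqq : q * q = Real.pi := Real.mul_self_sqrt hpi.le
  have hq1 : 2 * q * Real.pi⁻¹ ≤ 2 := by
    have h1 : 1 ≤ q := Real.one_le_sqrt.2 (by linarith [Real.pi_gt_three])
    rw [← div_eq_mul_inv, div_le_iff₀ hpi]
    nlinarith
  set s : Sq ℤ := waveCoef 0 (jet F 0) with hs
  set B : Sq ℤ := waveCoef (-(m * (Real.pi / 2))) (jet F (Fin.last m)) with hB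
  have hBs : ∀ n, B n = (-n : ℝ) ^ m * s n := by
    intro n
    have := waveCoef_jet F n m (by omega) (-(m * (Real.pi / 2)))
    rw [neg_add_cancel] at this
    exact this
  set κ := 2 * q * Real.pi⁻¹ with hκ
  have hκ0 : 0 ≤ κ := by positivity
  have hsB : ‖s‖ ≤ 3 * ‖F‖ ∧ ‖B‖ ≤ 3 * ‖F‖ := by
    constructor <;>
    · refine (norm_waveCoef_apply_le _ _).trans ?_
      exact mul_le_mul_of_nonneg_left (norm_jet_le F _) (by norm_num)
  have hle : ∀ n, (fr n ^ m * (κ * s n)) ^ 2 ≤ 2 * (2 * 2 ^ m) ^ 2 * (s n ^ 2 + B n ^ 2) := by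
    intro n
    have h1 : |fr n ^ m * (κ * s n)| ≤ 2 * 2 ^ m * (|s n| + |B n|) := by
      rw [abs_mul, abs_mul, abs_of_nonneg hκ0, abs_of_pos (pow_pos (fr_pos n) m), hBs]
      have h2 := fr_pow_mul_abs_le m n (s n)
      have h3 : 0 ≤ fr n ^ m * |s n| := mul_nonneg (pow_nonneg (fr_pos n).le m) (abs_nonneg _)
      nlinarith [mul_le_mul_of_nonneg_right hq1 h3]
    rw [← sq_abs]
    refine (pow_le_pow_left₀ (abs_nonneg _) h1 2).trans ?_
    rw [mul_pow]
    have h4 : (|s n| + |B n|) ^ 2 ≤ 2 * (s n ^ 2 + B n ^ 2) := by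
      rw [← sq_abs (s n), ← sq_abs (B n)]
      nlinarith [sq_nonneg (|s n| - |B n|)]
    have := mul_le_mul_of_nonneg_left h4 (by positivity : (0 : ℝ) ≤ (2 * 2 ^ m) ^ 2)
    linarith
  have hsum := (s.summable_sq.add B.summable_sq).mul_left (2 * (2 * 2 ^ m : ℝ) ^ 2)
  have hYs : Summable fun n : ℤ => (fr n ^ m * (κ * s n)) ^ 2 :=
    Summable.of_nonneg_of_le (fun _ => sq_nonneg _) hle hsum
  have hweak : ∀ n : ℤ, 2 * q * (1 / 2 * (s (n + 1) - s (n - 1)))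
      = n * ∫ θ, η θ * Real.sin (n * θ) ∂periodMeasure := by
    intro n
    have h1 : IsWeakDeriv (jet G 0) (jet G 1) := G.2 0
    have h2 := h1.waveCoef_eq (Real.pi / 2) n
    rw [waveCoef_apply, waveCoef_apply] at h2
    have h3 : ∫ θ, jet G 1 θ * Real.sin (n * θ + Real.pi / 2) ∂periodMeasure
        = ∫ θ, (q * (jet F 0 θ * Real.sin ((n + 1 : ℤ) * θ + 0))
          - q * (jet F 0 θ * Real.sin ((n - 1 : ℤ) * θ + 0))) ∂periodMeasure := by
      refine integral_congr_ae ?_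
      filter_upwards [hF0, ae_sin_ne_zero] with θ h4 h5
      have e : jet G 1 θ = jet F 0 θ * (2 * q * Real.sin θ) := by
        rw [h4, rhoSqrt, ← hq]
        field_simp
      rw [e, Real.sin_add_pi_div_two]
      push_cast
      rw [add_zero, add_zero, add_mul, sub_mul, one_mul, Real.sin_add, Real.sin_sub]
      ring
    have i : ∀ k : ℤ, Integrable (fun θ => q * (jet F 0 θ * Real.sin (k * θ + 0)))
        periodMeasure := fun k => (integrable_mul _ (continuous_wave 0 k)).const_mul _
    rw [h3, integral_sub (i _) (i _), integral_const_mul, integral_const_mul] at h2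
    rw [hs, waveCoef_apply, waveCoef_apply]
    have h6 : ∫ θ, jet G 0 θ * Real.sin (n * θ + (Real.pi / 2 + Real.pi / 2)) ∂periodMeasure
        = ∫ θ, -(η θ * Real.sin (n * θ)) ∂periodMeasure := by
      refine integral_congr_ae ?_
      filter_upwards [hG0] with θ h7
      rw [h7, ← add_assoc, Real.sin_add_pi_div_two, Real.cos_add_pi_div_two]
      ring
    rw [h6, integral_neg] at h2
    linarith
  have hodd : ∀ n, s (-n) = -s n := by
    intro n
    rw [hs, waveCoef_apply, waveCoef_apply, ← integral_neg]
    congr 1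
    ext θ
    push_cast
    rw [add_zero, add_zero, neg_mul, Real.sin_neg]
    ring
  have hs1 : s 1 = 0 := by
    have h1 := hweak 0
    simp only [zero_add, zero_sub, hodd 1, Int.cast_zero, zero_mul] at h1
    have h2 : q * s 1 = 0 := by linarith
    exact (mul_eq_zero.1 h2).resolve_left hqp.ne'
  refine ⟨κ • s, Sq.mk _ hYs, fun n => rfl, ?_, ?_, fun n => ?_, ?_, ?_⟩
  · rw [norm_smul, Real.norm_of_nonneg hκ0]
    nlinarith [mul_le_mul_of_nonneg_right hq1 (norm_nonneg s)]
  · refine le_of_sq_le_sq ?_ (by positivity)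
    rw [Sq.norm_sq]
    refine (hYs.tsum_le_tsum hle hsum).trans ?_
    rw [tsum_mul_left, s.summable_sq.tsum_add B.summable_sq, ← Sq.norm_sq, ← Sq.norm_sq]
    have h1 := pow_le_pow_left₀ (norm_nonneg _) hsB.1 2
    have h2 := pow_le_pow_left₀ (norm_nonneg _) hsB.2 2
    have h3 := mul_le_mul_of_nonneg_left (add_le_add h1 h2)
      (by positivity : (0 : ℝ) ≤ 2 * (2 * 2 ^ m) ^ 2)
    refine h3.trans_eq ?_
    ring
  · change κ * s (-n) = -(κ * s n)
    rw [hodd]; ring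
  · change κ * s 1 = 0
    rw [hs1, mul_zero]
  · ext n
    change _ = (2 * (n : ℝ))⁻¹ * (κ * s (n + 1) - κ * s (n - 1))
    rcases eq_or_ne n 0 with rfl | hn
    · simp [sineCoeff_zero]
    · have hn' : (n : ℝ) ≠ 0 := by exact_mod_cast hn
      have h1 := hweak n
      rw [sineCoeff, hκ]
      have h2 : ∫ θ, η θ * Real.sin (n * θ) ∂periodMeasure
          = (n : ℝ)⁻¹ * (2 * q * (1 / 2 * (s (n + 1) - s (n - 1)))) := by
        rw [h1, inv_mul_cancel_left₀ hn']
      rw [h2]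
      field_simp

theorem hasSum_pair (u v : Sq ℤ) :
    HasSum (fun i : Idx => (if i.1 then u i.2 else v i.2) ^ 2) (‖u‖ ^ 2 + ‖v‖ ^ 2) := by
  have h1 : HasSum (fun i : Idx => if i.1 then u i.2 ^ 2 else 0) (‖u‖ ^ 2) := by
    refine (Function.Injective.hasSum_iff (g := fun n : ℤ => ((true, n) : Idx))
      (fun a b h => by simpa using h) ?_).1 u.hasSum_sq
    rintro ⟨c, n⟩ h
    cases c
    · simp
    · exact absurd ⟨n, rfl⟩ h
  have h2 : HasSum (fun i : Idx => if i.1 then 0 else v i.2 ^ 2) (‖v‖ ^ 2) := by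
    refine (Function.Injective.hasSum_iff (g := fun n : ℤ => ((false, n) : Idx))
      (fun a b h => by simpa using h) ?_).1 v.hasSum_sq
    rintro ⟨c, n⟩ h
    cases c
    · exact absurd ⟨n, rfl⟩ h
    · simp
  convert! h1.add h2 using 2 with i
  split_ifs <;> simp

/-- The element of `ℓ²(Bool × ℤ)` with components `u` and `v`. -/
def pairSq (u v : Sq ℤ) : Sq Idx :=
  Sq.mk (fun i : Idx => if i.1 then u i.2 else v i.2) (hasSum_pair u v).summable

theorem norm_pairSq_sq (u v : Sq ℤ) : ‖pairSq u v‖ ^ 2 = ‖u‖ ^ 2 + ‖v‖ ^ 2 := by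
  rw [Sq.norm_sq]
  exact (hasSum_pair u v).tsum_eq

/-! ### Classical solutions from coefficient sequences -/

/-- The Elsasser variable with coefficient sequence `Z`: evaluation at `θ` as a functional of `Z`,
differentiable in `θ`. -/
def fieldF (c : Bool) (θ : ℝ) : Sq Idx →L[ℝ] ℝ :=
  (1 / 2 : ℝ) • ∑' n : ℤ, Real.sin (n * θ) • aF 1 c n

theorem summable_norm_aF (c : Bool) : Summable fun n : ℤ => ‖aF 1 c n‖ := by
  refine Summable.of_nonneg_of_le (fun _ => norm_nonneg _) (fun n => ?_) (summable_aF 1 c)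
  rw [pow_one]
  exact le_mul_of_one_le_left (norm_nonneg _) (one_le_fr n)

theorem fieldF_apply (c : Bool) (θ : ℝ) (Z : Sq Idx) :
    fieldF c θ Z = sinS (aSeq (raw 1 Z c)) θ := by
  have hs : Summable fun n : ℤ => Real.sin (n * θ) • aF 1 c n := by
    refine Summable.of_norm_bounded (summable_norm_aF c) fun n => ?_
    rw [norm_smul]
    exact mul_le_of_le_one_left (norm_nonneg _) (Real.abs_sin_le_one _)
  rw [fieldF, smul_apply, sinS, smul_eq_mul]
  congr 1
  have := (ContinuousLinearMap.apply ℝ ℝ Z).map_tsum hs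
  simp only [ContinuousLinearMap.apply_apply] at this
  rw [this]
  refine tsum_congr fun n => ?_
  rw [smul_apply, aF_apply, smul_eq_mul, mul_comm]

theorem contDiff_fieldF (c : Bool) : ContDiff ℝ 1 (fieldF c) := by
  have hsin : ∀ n : ℤ, ContDiff ℝ 1 fun θ : ℝ => Real.sin (n * θ) := fun n => by fun_prop
  refine ContDiff.const_smul _ (contDiff_tsum (N := 1) (v := fun _ n => fr n ^ 1 * ‖aF 1 c n‖)
    (fun n => (hsin n).smul contDiff_const) (fun _ _ => summable_aF 1 c) ?_)
  intro k n θ hk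
  have hn := norm_nonneg (aF 1 c n)
  have hk' : k ≤ 1 := by exact_mod_cast hk
  rw [norm_iteratedFDeriv_eq_norm_iteratedDeriv, pow_one]
  interval_cases k
  · rw [iteratedDeriv_zero, norm_smul]
    exact mul_le_mul_of_nonneg_right ((Real.abs_sin_le_one _).trans (one_le_fr n)) hn
  · have h1 : HasDerivAt (fun θ : ℝ => Real.sin (n * θ)) (Real.cos (n * θ) * n) θ := by
      simpa using ((hasDerivAt_id θ).const_mul (n : ℝ)).sin
    rw [iteratedDeriv_one, (h1.smul_const (aF 1 c n)).deriv, norm_smul, Real.norm_eq_abs, abs_mul]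
    refine mul_le_mul_of_nonneg_right ?_ hn
    have := mul_le_mul_of_nonneg_right (Real.abs_cos_le_one (n * θ)) (abs_nonneg (n : ℝ))
    linarith [abs_le_fr n]

section Static

variable {Z : Sq Idx} (hZ : oddProj Z = Z) (c : Bool)
include hZ

theorem oddC1_field : OddC1 (sinS (aSeq (raw 1 Z c)))
    (fun θ => Real.sin θ * sinS (raw 1 Z c) θ) where
  hasDerivAt := hasDerivAt_sinS_aSeq (summable_raw_one Z c) (by
    rw [raw_eq_zero hZ 1 c (by norm_num), raw_eq_zero hZ 1 c (by norm_num)])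
  continuous_deriv := Real.continuous_sin.mul (continuous_sinS (summable_raw_one Z c))
  periodic := sinS_periodic _
  odd := sinS_odd _

omit hZ in
theorem hilbert_field : hilbert (sinS (aSeq (raw 1 Z c))) = hilbS (aSeq (raw 1 Z c)) := by
  have hx := summable_raw_one Z c
  have h1 := (summable_aSeq hx).abs.add (summable_mul_aSeq hx).abs
  refine funext fun θ => hilbert_sinS (Summable.of_norm_bounded h1 fun n => ?_) θ
  have h2 : fr n ^ (1 / 4 : ℝ) ≤ fr n := by
    nth_rewrite 2 [← Real.rpow_one (fr n)]
    exact Real.rpow_le_rpow_of_exponent_le (one_le_fr n) (by norm_num)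
  rw [Real.norm_eq_abs, abs_mul, abs_of_nonneg (Real.rpow_nonneg (fr_pos n).le _), abs_mul]
  refine (mul_le_mul_of_nonneg_right h2 (abs_nonneg _)).trans_eq ?_
  rw [fr]
  ring

theorem velocity_field : velocity (sinS (aSeq (raw 1 Z c))) = sinS (vSeq (raw 1 Z c)) := by
  have h1 := (oddC1_field hZ c).hasDerivAt_velocity
  rw [hilbert_field c] at h1
  exact eq_of_hasDerivAt_eq h1 (hasDerivAt_sinS_vSeq (summable_raw_one Z c)) (t₀ := 0)
    (by rw [velocity, intervalIntegral.integral_same, sinS_zero_right])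

/-- The vector field on coefficients is the Elsasser field with the principal value Hilbert transform. -/
theorem elsasser_field (θ : ℝ) :
    elsasser (sinS (aSeq (raw 1 Z c))) (fun θ => Real.sin θ * sinS (raw 1 Z c) θ)
      (sinS (aSeq (raw 1 Z (!c)))) θ = sinS (aSeq (raw 0 (mhdScale.G 1 Z) c)) θ := by
  rw [sinS_aSeq_G hZ, elsasser, bracketS, hilbert_field (!c), velocity_field hZ (!c)]

end Static

theorem raw_smoothing_pow (s j : ℕ) (y : Sq Idx) : raw s ((smoothing wt ^ j) y) = raw (s + j) y := by
  induction j generalizing s with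
  | zero => rfl
  | succ j ih =>
    rw [pow_succ', mul_apply_eq_comp, raw_smoothing, ih]
    congr 1
    omega

/-- A curve of odd coefficient sequences which solves the system. The entries of `y` are the
coefficients of the solution multiplied by `(1 + |n|)^(j + 3)`, and the derivative is taken after
smoothing by one order. -/
structure IsCoeffSolution (j : ℕ) (T : ℝ) (y : ℝ → Sq Idx) : Prop where
  continuousOn : ContinuousOn y (Icc 0 T)
  odd : ∀ t ∈ Icc 0 T, oddProj (y t) = y t
  hasDeriv : ∀ t ∈ Icc 0 T,
    HasDerivWithinAt (fun s => smoothing wt (y s)) (mhdScale.G (j + 2) (y t)) (Icc 0 T) t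

/-- Oddness is propagated by the flow. -/
theorem oddProj_eq_of_hasDeriv {s : ℕ} {T : ℝ} {y : ℝ → Sq Idx} (h0 : oddProj (y 0) = y 0)
    (hd : ∀ t ∈ Icc 0 T,
      HasDerivWithinAt (fun s => smoothing wt (y s)) (mhdScale.G s (y t)) (Icc 0 T) t) :
    ∀ t ∈ Icc 0 T, oddProj (y t) = y t := by
  intro t ht
  have h1 : ∀ t ∈ Icc 0 T, HasDerivWithinAt
      (fun r => oddProj (smoothing wt (y r)) - smoothing wt (y r)) 0 (Icc 0 T) t := by
    intro t ht
    have := (oddProj.hasFDerivAt.comp_hasDerivWithinAt t (hd t ht)).sub (hd t ht)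
    rw [mhdScale_G, oddProj_oddProj, sub_self] at this
    exact this
  have h2 := constant_Icc_of_hasDerivWithinAt_zero h1 ht
  rw [← smoothing_oddProj, ← smoothing_oddProj, h0, sub_self, sub_eq_zero] at h2
  have h3 := smoothing_injective one_le_wt 1
  rw [pow_one] at h3
  exact h3 h2

theorem contDiffOn_one_of_hasDerivWithinAt {F : Type*} [NormedAddCommGroup F] [NormedSpace ℝ F]
    {T : ℝ} (hT : 0 < T) {f f' : ℝ → F} (h : ∀ t ∈ Icc 0 T, HasDerivWithinAt f (f' t) (Icc 0 T) t)
    (hc : ContinuousOn f' (Icc 0 T)) : ContDiffOn ℝ 1 f (Icc 0 T) := by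
  rw [contDiffOn_one_iff_derivWithin (uniqueDiffOn_Icc hT)]
  exact ⟨fun t ht => (h t ht).differentiableWithinAt, hc.congr fun t ht =>
    (h t ht).derivWithin (uniqueDiffOn_Icc hT t ht)⟩

namespace IsCoeffSolution

variable {j : ℕ} {T : ℝ} {y : ℝ → Sq Idx} (h : IsCoeffSolution j T y)
include h

theorem continuousOn_G (s : ℕ) : ContinuousOn (fun t => mhdScale.G s (y t)) (Icc 0 T) :=
  (mhdScale.continuous_G s).comp_continuousOn h.continuousOn

theorem odd_smoothing {t : ℝ} (ht : t ∈ Icc 0 T) :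
    oddProj ((smoothing wt ^ (j + 1)) (y t)) = (smoothing wt ^ (j + 1)) (y t) := by
  have : ∀ k, oddProj ((smoothing wt ^ k) (y t)) = (smoothing wt ^ k) (y t) := by
    intro k
    induction k with
    | zero => exact h.odd t ht
    | succ k ih => rw [pow_succ', mul_apply_eq_comp, ← smoothing_oddProj, ih]
  exact this _

theorem hasDeriv_smoothing {t : ℝ} (ht : t ∈ Icc 0 T) :
    HasDerivWithinAt (fun s => (smoothing wt ^ (j + 1)) (y s))
      ((smoothing wt ^ j) (mhdScale.G (j + 2) (y t))) (Icc 0 T) t := by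
  have := (smoothing wt ^ j).hasFDerivAt.comp_hasDerivWithinAt t (h.hasDeriv t ht)
  refine this.congr_of_mem (fun s _ => ?_) ht
  rw [pow_succ, mul_apply_eq_comp]
  rfl

/-- The Elsasser variables of a solution. -/
theorem field_time {t : ℝ} (ht : t ∈ Icc 0 T) (c : Bool) (θ : ℝ) :
    HasDerivWithinAt (fun s => sinS (aSeq (raw (j + 2) (y s) c)) θ)
      (elsasser (sinS (aSeq (raw (j + 2) (y t) c)))
        (fun θ => Real.sin θ * sinS (raw (j + 2) (y t) c) θ)
        (sinS (aSeq (raw (j + 2) (y t) (!c)))) θ) (Icc 0 T) t := by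
  have e : ∀ s, raw (j + 2) (y s) = raw 1 ((smoothing wt ^ (j + 1)) (y s)) := fun s => by
    rw [raw_smoothing_pow]; congr 1; omega
  have h1 := (fieldF c θ).hasFDerivAt.comp_hasDerivWithinAt t (h.hasDeriv_smoothing ht)
  simp only [e]
  rw [elsasser_field (h.odd_smoothing ht) c θ]
  have h2 := mhdScale.smoothing_pow_G 1 (j + 1) (y t)
  change (smoothing wt ^ (j + 1)) _ = mhdScale.G 1 ((smoothing wt ^ (j + 1)) _) at h2
  have e2 : sinS (aSeq (raw 0 (mhdScale.G 1 ((smoothing wt ^ (j + 1)) (y t))) c)) θ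
      = fieldF c θ ((smoothing wt ^ j) (mhdScale.G (j + 2) (y t))) := by
    rw [← h2, pow_succ', mul_apply_eq_comp, raw_smoothing, fieldF_apply,
      show 1 + (j + 1) = j + 2 by omega]
  rw [e2]
  refine h1.congr_of_mem (fun s _ => ?_) ht
  rw [← fieldF_apply]
  rfl

theorem field_contDiffOn (hT : 0 < T) (c : Bool) :
    ContDiffOn ℝ 1 (fun p : ℝ × ℝ => sinS (aSeq (raw (j + 2) (y p.1) c)) p.2)
      (Icc 0 T ×ˢ univ) := by
  have h1 : ContDiffOn ℝ 1 (fun s => (smoothing wt ^ (j + 1)) (y s)) (Icc 0 T) :=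
    contDiffOn_one_of_hasDerivWithinAt hT (fun t ht => h.hasDeriv_smoothing ht)
      ((smoothing wt ^ j).continuous.comp_continuousOn (h.continuousOn_G _))
  have h2 : ContDiffOn ℝ 1 (fun p : ℝ × ℝ => fieldF c p.2 ((smoothing wt ^ (j + 1)) (y p.1)))
      (Icc 0 T ×ˢ univ) :=
    ((contDiff_fieldF c).comp contDiff_snd).contDiffOn.clm_apply
      (h1.comp contDiff_fst.contDiffOn fun p hp => hp.1)
  refine h2.congr fun p _ => ?_
  rw [fieldF_apply, raw_smoothing_pow, show 1 + (j + 1) = j + 2 by omega]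

theorem oddC1 {t : ℝ} (ht : t ∈ Icc 0 T) (c : Bool) :
    OddC1 (sinS (aSeq (raw (j + 2) (y t) c)))
      (fun θ => Real.sin θ * sinS (raw (j + 2) (y t) c) θ) := by
  have := oddC1_field (h.odd_smoothing ht) c
  rwa [raw_smoothing_pow, show 1 + (j + 1) = j + 2 by omega] at this

/-- `η^±` is one half of the sum and of the difference of the Elsasser variables. -/
theorem isClassicalOddSolution (hT : 0 < T) : IsClassicalOddSolution T
    (fun t θ => 1 / 2 * sinS (aSeq (raw (j + 2) (y t) true)) θ
      + 1 / 2 * sinS (aSeq (raw (j + 2) (y t) false)) θ)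
    (fun t θ => 1 / 2 * sinS (aSeq (raw (j + 2) (y t) true)) θ
      + -(1 / 2) * sinS (aSeq (raw (j + 2) (y t) false)) θ) := by
  have op := fun t (ht : t ∈ Icc 0 T) =>
    ((h.oddC1 ht true).const_mul (1 / 2)).add ((h.oddC1 ht false).const_mul (1 / 2))
  have om := fun t (ht : t ∈ Icc 0 T) =>
    ((h.oddC1 ht true).const_mul (1 / 2)).add ((h.oddC1 ht false).const_mul (-(1 / 2)))
  have hA := h.field_contDiffOn hT true
  have hB := h.field_contDiffOn hT false
  have key := fun t (ht : t ∈ Icc 0 T) θ => (op t ht).rhs_add (om t ht) θ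
  have key' := fun t (ht : t ∈ Icc 0 T) θ => (op t ht).rhs_sub (om t ht) θ
  have e1 : ∀ a b : ℝ, 1 / 2 * a + 1 / 2 * b + (1 / 2 * a + -(1 / 2) * b) = a := fun a b => by ring
  have e2 : ∀ a b : ℝ, 1 / 2 * a + 1 / 2 * b - (1 / 2 * a + -(1 / 2) * b) = b := fun a b => by ring
  simp only [e1, e2] at key key'
  constructor
  · exact (contDiffOn_const.mul hA).add (contDiffOn_const.mul hB)
  · exact (contDiffOn_const.mul hA).add (contDiffOn_const.mul hB)
  · exact fun t ht => (op t ht).periodic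
  · exact fun t ht => (om t ht).periodic
  · exact fun t ht => (op t ht).odd
  · exact fun t ht => (om t ht).odd
  · intro t ht θ
    have ht' := Ioc_subset_Icc_self ht
    have d := ((h.field_time ht' true θ).const_mul (1 / 2)).add
      ((h.field_time ht' false θ).const_mul (1 / 2))
    refine (d.derivWithin (uniqueDiffOn_Icc hT t ht')).trans ?_
    simp only [Bool.not_true, Bool.not_false]
    rw [← key t ht' θ, ← key' t ht' θ]
    ring
  · intro t ht θ
    have ht' := Ioc_subset_Icc_self ht
    have d := ((h.field_time ht' true θ).const_mul (1 / 2)).add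
      ((h.field_time ht' false θ).const_mul (-(1 / 2)))
    refine (d.derivWithin (uniqueDiffOn_Icc hT t ht')).trans ?_
    simp only [Bool.not_true, Bool.not_false]
    rw [← key t ht' θ, ← key' t ht' θ]
    ring

end IsCoeffSolution

/-! ### Sobolev regularity -/

theorem wcompOK_jet {s k : ℕ} (hk : k ≤ s) (c : Bool) :
    WcompOK (fun n : ℤ => (n : ℝ) ^ k * (fr n ^ s)⁻¹) fun n : ℤ => ((c, n) : Idx) := by
  refine ⟨⟨1, fun n => ?_⟩, fun a b h => by simpa using h⟩
  have hp := fr_pos n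
  rw [abs_mul, abs_pow, abs_inv, abs_of_pos (pow_pos hp s), ← div_eq_mul_inv,
    div_le_one (pow_pos hp s)]
  exact (pow_le_pow_left₀ (abs_nonneg _) (abs_le_fr n) k).trans
    (pow_le_pow_right₀ (one_le_fr n) hk)

/-- The `k`-th weak derivative of `½ ∑ (1 + |n|)^(-s) y (c, n) sin (n θ) / (2 √π)`. -/
def jetOp (s : ℕ) (c : Bool) (k : ℕ) : Sq Idx →L[ℝ] L2 :=
  (1 / (4 * Real.sqrt Real.pi)) • (waveSum (k * (Real.pi / 2)) ∘L
    wcomp (fun n : ℤ => (n : ℝ) ^ k * (fr n ^ s)⁻¹) fun n : ℤ => ((c, n) : Idx))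

/-- The map that sends a coefficient sequence to the weighted derivative in `H^s`. -/
def sobolevOp (s : ℕ) (c : Bool) : Sq Idx →L[ℝ] Sobolev s :=
  ((PiLp.continuousLinearEquiv 2 ℝ fun _ : Fin (s + 1) => L2).symm.toContinuousLinearMap ∘L
    ContinuousLinearMap.pi fun k : Fin (s + 1) => jetOp s c k).codRestrict (Sobolev s) (by
      intro y k
      change IsWeakDeriv (jetOp s c k y) (jetOp s c (k + 1 : ℕ) y)
      rw [jetOp, jetOp, smul_apply, smul_apply, ContinuousLinearMap.comp_apply,
        ContinuousLinearMap.comp_apply]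
      refine IsWeakDeriv.smul _ ?_
      have e : ((k + 1 : ℕ) : ℝ) * (Real.pi / 2) = k * (Real.pi / 2) + Real.pi / 2 := by
        push_cast; ring
      rw [e]
      refine isWeakDeriv_waveSum _ fun n => ?_
      rw [wcomp_apply (wcompOK_jet (by omega) c), wcomp_apply (wcompOK_jet (by omega) c), pow_succ]
      ring)

theorem jetOp_smoothing (s : ℕ) (c : Bool) (y : Sq Idx) :
    jetOp s c 0 (smoothing wt y) = jetOp (s + 1) c 0 y := by
  rw [jetOp, jetOp, smul_apply, smul_apply, ContinuousLinearMap.comp_apply,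
    ContinuousLinearMap.comp_apply]
  congr 2
  refine Sq.ext fun n => ?_
  rw [wcomp_apply (wcompOK_jet (Nat.zero_le _) c), wcomp_apply (wcompOK_jet (Nat.zero_le _) c),
    smoothing_wt_apply, pow_succ, mul_inv]
  ring

theorem jetOp_ae_eq (s : ℕ) (c : Bool) (y : Sq Idx) (hs : Summable (raw s y c)) :
    (jetOp (s + 1) c 0 y : ℝ → ℝ) =ᵐ[periodMeasure]
      fun θ => 1 / (2 * Real.sqrt Real.pi) * sinS (raw s y c) θ := by
  rw [jetOp, smul_apply, ContinuousLinearMap.comp_apply]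
  set x := wcomp (fun n : ℤ => (n : ℝ) ^ 0 * (fr n ^ (s + 1))⁻¹) (fun n : ℤ => ((c, n) : Idx)) y
    with hx
  have e : ∀ n, x n = raw s y c n := fun n => by
    rw [hx, wcomp_apply (wcompOK_jet (Nat.zero_le _) c), pow_zero, one_mul, raw]
  have hxs : Summable x := hs.congr fun n => (e n).symm
  filter_upwards [Lp.coeFn_smul (1 / (4 * Real.sqrt Real.pi))
    (waveSum ((0 : ℕ) * (Real.pi / 2)) x), waveSum_ae_eq ((0 : ℕ) * (Real.pi / 2)) hxs]
    with θ h1 h2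
  rw [h1, Pi.smul_apply, h2, sinS, smul_eq_mul]
  simp only [e, Nat.cast_zero, zero_mul, add_zero]
  generalize ∑' n : ℤ, raw s y c n * Real.sin (n * θ) = S
  have := (Real.sqrt_pos.2 Real.pi_pos).ne'
  field_simp
  ring

/-- A sufficient condition for `F` to be the weighted derivative of a function of class `C¹`. -/
theorem OddC1.isWeightedDeriv {f f' : ℝ → ℝ} (h : OddC1 f f') {s : ℕ} {F : Sobolev s}
    (hF : (jet F 0 : ℝ → ℝ) =ᵐ[periodMeasure] fun θ => rhoSqrt θ * f' θ) :
    IsWeightedDeriv f F := by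
  have hw : IsWeakDeriv (contL f h.continuous) (contL f' h.continuous_deriv) := by
    intro φ hφ hp
    have h1 := integral_deriv_mul h.hasDerivAt (g := φ) (g' := deriv φ)
      (fun x => (hφ.differentiable (by simp) x).hasDerivAt) h.continuous_deriv
      (hφ.continuous_deriv (by simp)) h.periodic hp
    have h2 : ∫ θ, contL f h.continuous θ * deriv φ θ ∂periodMeasure
        = ∫ θ, f θ * deriv φ θ ∂periodMeasure := by
      refine integral_congr_ae ?_
      filter_upwards [coeFn_contL h.continuous] with θ hθ
      rw [hθ]
    have h3 : ∫ θ, contL f' h.continuous_deriv θ * φ θ ∂periodMeasure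
        = ∫ θ, f' θ * φ θ ∂periodMeasure := by
      refine integral_congr_ae ?_
      filter_upwards [coeFn_contL h.continuous_deriv] with θ hθ
      rw [hθ]
    rw [h2, h3, h1, neg_neg]
  let G : Sobolev 1 := ⟨WithLp.toLp 2 ![contL f h.continuous, contL f' h.continuous_deriv], by
    intro k
    obtain rfl : k = 0 := Subsingleton.elim _ _
    exact hw⟩
  refine ⟨G, coeFn_contL h.continuous, hF.trans ?_⟩
  have h4 : (jet G 1 : ℝ → ℝ) =ᵐ[periodMeasure] f' := coeFn_contL h.continuous_deriv
  filter_upwards [h4] with θ hθ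
  rw [hθ]

theorem QuadraticScale.hasFDerivAt_G {ι : Type*} (𝒬 : QuadraticScale ι) (s : ℕ) (y : Sq ι) :
    HasFDerivAt (𝒬.G s) (𝒬.L s + (𝒬.B s y + (𝒬.B s).flip y)) y := by
  have h1 := (𝒬.L s).hasFDerivAt (x := y)
  have h2 := (𝒬.B s).hasFDerivAt (x := y).clm_apply (hasFDerivAt_id y)
  refine (h1.add h2).congr_fderiv ?_
  ext1 z
  simp

/-- The map that sends a coefficient sequence to the weighted derivative, in `H^s`, of a linear
combination of the two Elsasser variables. -/
def weightedOp (α β : ℝ) (s : ℕ) : Sq Idx →L[ℝ] Sobolev s :=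
  α • sobolevOp s true + β • sobolevOp s false

theorem jet_weightedOp (α β : ℝ) (s : ℕ) (x : Sq Idx) :
    jet (weightedOp α β s x) 0 = α • jetOp s true 0 x + β • jetOp s false 0 x := rfl

theorem jet_weightedOp_smoothing (α β : ℝ) (s : ℕ) (x : Sq Idx) :
    jet (weightedOp α β s (smoothing wt x)) 0 = jet (weightedOp α β (s + 1) x) 0 := by
  rw [jet_weightedOp, jet_weightedOp, jetOp_smoothing, jetOp_smoothing]

theorem smoothing_mhdScale_G (s : ℕ) (x : Sq Idx) :
    smoothing wt (mhdScale.G (s + 1) x) = mhdScale.G s (smoothing wt x) :=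
  mhdScale.smoothing_G s x

theorem norm_mhdScale_G_le (s : ℕ) {x : Sq Idx} {R : ℝ} (hx : ‖x‖ ≤ R) :
    ‖mhdScale.G s x‖ ≤ (‖mhdScale.L s‖ + ‖mhdScale.B s‖ * R) * R := by
  refine (mhdScale.norm_G_le _ _).trans ?_
  have h2 : 0 ≤ R := (norm_nonneg _).trans hx
  gcongr

theorem norm_fderiv_mhdScale_G_le (s s' : ℕ) {x : Sq Idx} {R : ℝ} (hx : ‖x‖ ≤ R) :
    ‖(mhdScale.L s + (mhdScale.B s (smoothing wt x) + (mhdScale.B s).flip (smoothing wt x)))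
        (mhdScale.G s' x)‖
      ≤ (‖mhdScale.L s‖ + 2 * (‖mhdScale.B s‖ * R))
        * ((‖mhdScale.L s'‖ + ‖mhdScale.B s'‖ * R) * R) := by
  have h0 : 0 ≤ R := (norm_nonneg _).trans hx
  refine (ContinuousLinearMap.le_opNorm _ _).trans
    (mul_le_mul ?_ (norm_mhdScale_G_le _ hx) (norm_nonneg _) (by positivity))
  have h5 : ‖smoothing wt x‖ ≤ R := by
    have := norm_smoothing_pow_apply_le one_le_wt 1 x
    rw [pow_one] at this
    exact this.trans hx
  have h6 := ((mhdScale.B s).le_opNorm (smoothing wt x)).trans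
    (mul_le_mul_of_nonneg_left h5 (norm_nonneg _))
  have h7 := ((mhdScale.B s).flip.le_opNorm (smoothing wt x)).trans
    (mul_le_mul_of_nonneg_left h5 (norm_nonneg _))
  rw [ContinuousLinearMap.opNorm_flip] at h7
  refine (norm_add_le _ _).trans ?_
  have h8 := norm_add_le (mhdScale.B s (smoothing wt x)) ((mhdScale.B s).flip (smoothing wt x))
  linarith

namespace IsCoeffSolution

variable {j : ℕ} {T : ℝ} {y : ℝ → Sq Idx} (h : IsCoeffSolution j T y)
include h

theorem isWeightedDeriv {t : ℝ} (ht : t ∈ Icc 0 T) {α β : ℝ} {s : ℕ} {F : Sobolev s}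
    (hF : jet F 0 = jet (weightedOp α β (j + 3) (y t)) 0) :
    IsWeightedDeriv (fun θ => α * sinS (aSeq (raw (j + 2) (y t) true)) θ
      + β * sinS (aSeq (raw (j + 2) (y t) false)) θ) F := by
  refine (((h.oddC1 ht true).const_mul α).add
    ((h.oddC1 ht false).const_mul β)).isWeightedDeriv ?_
  have hs : ∀ c, Summable (raw (j + 2) (y t) c) := fun c => by
    have := summable_raw_one ((smoothing wt ^ (j + 1)) (y t)) c
    rwa [raw_smoothing_pow, show 1 + (j + 1) = j + 2 by omega] at this
  rw [hF, jet_weightedOp]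
  filter_upwards [Lp.coeFn_add (α • jetOp (j + 3) true 0 (y t)) (β • jetOp (j + 3) false 0 (y t)),
    Lp.coeFn_smul α (jetOp (j + 3) true 0 (y t)), Lp.coeFn_smul β (jetOp (j + 3) false 0 (y t)),
    jetOp_ae_eq (j + 2) true (y t) (hs true), jetOp_ae_eq (j + 2) false (y t) (hs false),
    ae_sin_ne_zero] with θ h1 h2 h3 h4 h5 h6
  rw [h1, Pi.add_apply, h2, h3, Pi.smul_apply, Pi.smul_apply, h4, h5, rhoSqrt, smul_eq_mul,
    smul_eq_mul]
  have := (Real.sqrt_pos.2 Real.pi_pos).ne'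
  field_simp

theorem hasDeriv_smoothing_two {t : ℝ} (ht : t ∈ Icc 0 T) :
    HasDerivWithinAt (fun s => smoothing wt (smoothing wt (y s)))
      (mhdScale.G (j + 1) (smoothing wt (y t))) (Icc 0 T) t := by
  have h1 := (smoothing wt).hasFDerivAt.comp_hasDerivWithinAt t (h.hasDeriv t ht)
  rw [smoothing_mhdScale_G] at h1
  exact h1

/-- The second derivative in time of the solution, smoothed by two orders. -/
theorem hasDeriv_G {t : ℝ} (ht : t ∈ Icc 0 T) :
    HasDerivWithinAt (fun s => mhdScale.G (j + 1) (smoothing wt (y s)))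
      ((mhdScale.L (j + 1) + (mhdScale.B (j + 1) (smoothing wt (y t))
        + (mhdScale.B (j + 1)).flip (smoothing wt (y t)))) (mhdScale.G (j + 2) (y t)))
      (Icc 0 T) t :=
  HasFDerivAt.comp_hasDerivWithinAt (l := mhdScale.G (j + 1)) (f := fun s => smoothing wt (y s)) t
    (mhdScale.hasFDerivAt_G (j + 1) (smoothing wt (y t))) (h.hasDeriv t ht)

end IsCoeffSolution

/-- The regularity of a linear combination of the Elsasser variables, with bounds in terms of a
bound `R` for the solution. -/
theorem IsCoeffSolution.regular {j : ℕ} {T : ℝ} {y : ℝ → Sq Idx} (h : IsCoeffSolution j T y)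
    (hT : 0 < T) {R B : ℝ} (hR : ∀ t ∈ Icc 0 T, ‖y t‖ ≤ R) (α β : ℝ)
    (h1 : ‖weightedOp α β (j + 3)‖ * R ≤ B)
    (h2 : ‖weightedOp α β (j + 2)‖ * ((‖mhdScale.L (j + 2)‖ + ‖mhdScale.B (j + 2)‖ * R) * R) ≤ B)
    (h3 : ‖weightedOp α β (j + 1)‖ * ((‖mhdScale.L (j + 1)‖ + 2 * (‖mhdScale.B (j + 1)‖ * R))
      * ((‖mhdScale.L (j + 2)‖ + ‖mhdScale.B (j + 2)‖ * R) * R)) ≤ B) :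
    RegularWithBound (j + 3) T B (fun t θ =>
        α * sinS (aSeq (raw (j + 2) (y t) true)) θ
          + β * sinS (aSeq (raw (j + 2) (y t) false)) θ) := by
  have hu := uniqueDiffOn_Icc hT
  set Ψ : Sq Idx →L[ℝ] Sobolev (j + 1) := weightedOp α β (j + 1) with hΨ
  set W : ℝ → Sobolev (j + 1) := fun t => Ψ (smoothing wt (smoothing wt (y t))) with hW
  have hW1 : ∀ t ∈ Icc 0 T, HasDerivWithinAt W
      (Ψ (mhdScale.G (j + 1) (smoothing wt (y t)))) (Icc 0 T) t := fun t ht =>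
    Ψ.hasFDerivAt.comp_hasDerivWithinAt t (h.hasDeriv_smoothing_two ht)
  have hdW : EqOn (derivWithin W (Icc 0 T))
      (fun s => Ψ (mhdScale.G (j + 1) (smoothing wt (y s)))) (Icc 0 T) := fun t ht =>
    (hW1 t ht).derivWithin (hu t ht)
  have hC2 : ContDiffOn ℝ 2 W (Icc 0 T) := by
    rw [show (2 : ℕ∞ω) = 1 + 1 by norm_num, contDiffOn_succ_iff_derivWithin hu]
    refine ⟨fun t ht => (hW1 t ht).differentiableWithinAt, fun h => by simp at h, ?_⟩
    refine ContDiffOn.congr ?_ hdW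
    exact Ψ.contDiff.comp_contDiffOn
      (((mhdScale.contDiff_G (j + 1)).of_le (by norm_num)).comp_contDiffOn
        (contDiffOn_one_of_hasDerivWithinAt hT h.hasDeriv (h.continuousOn_G _)))
  have hsecond : ∀ t ∈ Icc 0 T, ‖iteratedDerivWithin 2 W (Icc 0 T) t‖ ≤ B := by
    intro t ht
    obtain ⟨v, e, hv⟩ : ∃ v, iteratedDerivWithin 2 W (Icc 0 T) t = Ψ v ∧ ‖v‖ ≤ _ := by
      refine ⟨_, ?_, norm_fderiv_mhdScale_G_le (j + 1) (j + 2) (hR t ht)⟩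
      rw [iteratedDerivWithin_succ, iteratedDerivWithin_one, derivWithin_congr hdW (hdW ht)]
      exact (Ψ.hasFDerivAt.comp_hasDerivWithinAt t (h.hasDeriv_G ht)).derivWithin (hu t ht)
    rw [e]
    exact (Ψ.le_opNorm _).trans
      ((mul_le_mul_of_nonneg_left hv (norm_nonneg Ψ)).trans h3)
  have hU : ContinuousOn (fun t => weightedOp α β (j + 3) (y t)) (Icc 0 T) :=
    (weightedOp α β (j + 3)).continuous.comp_continuousOn h.continuousOn
  have hVW : ∀ t ∈ Icc 0 T, jet (weightedOp α β (j + 2) (mhdScale.G (j + 2) (y t))) 0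
      = jet (derivWithin W (Icc 0 T) t) 0 := by
    intro t ht
    rw [hdW ht]
    simp only [← smoothing_mhdScale_G]
    rw [hΨ, jet_weightedOp_smoothing]
  have hjW : ∀ t, jet (W t) 0 = jet (weightedOp α β (j + 3) (y t)) 0 := fun t => by
    rw [hW, hΨ, jet_weightedOp_smoothing, jet_weightedOp_smoothing]
  have hV : ∀ t ∈ Icc 0 T, ‖weightedOp α β (j + 2) (mhdScale.G (j + 2) (y t))‖ ≤ B := fun t ht =>
    ((weightedOp α β (j + 2)).le_opNorm _).trans
      ((mul_le_mul_of_nonneg_left (norm_mhdScale_G_le _ (hR t ht)) (norm_nonneg (weightedOp α β (j + 2)))).trans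
        h2)
  have hUb : ∀ t ∈ Icc 0 T, ‖weightedOp α β (j + 3) (y t)‖ ≤ B := fun t ht =>
    ((weightedOp α β (j + 3)).le_opNorm _).trans
      ((mul_le_mul_of_nonneg_left (hR t ht) (norm_nonneg (weightedOp α β (j + 3)))).trans h1)
  exact ⟨fun t => weightedOp α β (j + 3) (y t),
    fun t => weightedOp α β (j + 2) (mhdScale.G (j + 2) (y t)), W, hU, hC2,
    fun t ht => ⟨h.isWeightedDeriv ht rfl, h.isWeightedDeriv ht (hjW t), hVW t ht, hUb t ht,
      hV t ht, hsecond t ht⟩⟩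

/-! ### Local well-posedness -/

theorem energyConst_pos {K : ℝ} (hK : 0 < K) : 0 < energyConst K := by
  unfold energyConst
  positivity

/-- The coefficient sequence of the Elsasser variables of the initial data. -/
theorem exists_initial_coeff (j : ℕ) {η₀p η₀m : ℝ → ℝ} {u₀p u₀m : Sobolev (j + 3)} {δ : ℝ}
    (hcp : Continuous η₀p) (hcm : Continuous η₀m) (hpp : Function.Periodic η₀p (2 * Real.pi))
    (hpm : Function.Periodic η₀m (2 * Real.pi)) (hop : Function.Odd η₀p) (hom : Function.Odd η₀m)
    (hup : IsWeightedDeriv η₀p u₀p) (hum : IsWeightedDeriv η₀m u₀m) (hδ : 0 < δ)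
    (hn : ‖u₀p‖ ^ 2 + ‖u₀m‖ ^ 2 = δ ^ 2) : ∃ y₀ : Sq Idx, oddProj y₀ = y₀ ∧
      ‖(smoothing wt ^ (j + 3)) y₀‖ ^ 2 ≤ (12 * δ) ^ 2 / 2 ∧ ‖y₀‖ ≤ 2 ^ (j + 3) * 24 * δ ∧
      ∀ θ, 1 / 2 * sinS (aSeq (raw (j + 2) y₀ true)) θ
            + 1 / 2 * sinS (aSeq (raw (j + 2) y₀ false)) θ = η₀p θ ∧
          1 / 2 * sinS (aSeq (raw (j + 2) y₀ true)) θ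
            + -(1 / 2) * sinS (aSeq (raw (j + 2) y₀ false)) θ = η₀m θ := by
  obtain ⟨Xp, Yp, hYp, nXp, nYp, oXp, zXp, eXp⟩ := hup.exists_coeff
  obtain ⟨Xm, Ym, hYm, nXm, nYm, oXm, zXm, eXm⟩ := hum.exists_coeff
  have hodd : ∀ X Y : Sq ℤ, (∀ n, Y n = fr n ^ (j + 3) * X n) → (∀ n, X (-n) = -X n) → X 1 = 0 →
      ∀ n, Y n = if 2 ≤ |n| then 1 / 2 * (Y n - Y (-n)) else 0 := by
    intro X Y h1 h2 h3 n
    split_ifs with h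
    · rw [h1, h1, h2, fr_neg]; ring
    · have hX : X n = 0 := by
        have h4 : n = 0 ∨ n = 1 ∨ n = -1 := by rw [not_le, abs_lt] at h; omega
        rcases h4 with rfl | rfl | rfl
        · have := h2 0
          rw [neg_zero] at this
          linarith
        · exact h3
        · rw [h2, h3, neg_zero]
      rw [h1, hX, mul_zero]
  have hraw : ∀ X Y : Sq ℤ, (∀ n, Y n = fr n ^ (j + 3) * X n) →
      ∀ n, (fr n ^ (j + 2 + 1))⁻¹ * Y n = X n := by
    intro X Y h1 n
    rw [h1, inv_mul_cancel_left₀ (pow_pos (fr_pos n) _).ne']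
  have hsum : ∀ X Y : Sq ℤ, (∀ n, Y n = fr n ^ (j + 3) * X n) → Summable X := by
    intro X Y h1
    have h2 := summable_raw_one ((smoothing wt ^ (j + 1)) (pairSq Y Y)) true
    rw [raw_smoothing_pow, show 1 + (j + 1) = j + 2 by omega] at h2
    exact h2.congr fun n => hraw X Y h1 n
  have hpar : ∀ u v : Sq ℤ, ‖pairSq (u + v) (u - v)‖ ^ 2 = 2 * (‖u‖ ^ 2 + ‖v‖ ^ 2) := by
    intro u v
    rw [norm_pairSq_sq]
    have := parallelogram_law_with_norm ℝ u v
    linarith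
  have hY : ∀ n, (Yp + Ym) n = fr n ^ (j + 3) * (Xp + Xm) n := fun n => by
    rw [lp.coeFn_add, lp.coeFn_add, Pi.add_apply, Pi.add_apply, hYp, hYm]; ring
  have hY' : ∀ n, (Yp - Ym) n = fr n ^ (j + 3) * (Xp - Xm) n := fun n => by
    rw [lp.coeFn_sub, lp.coeFn_sub, Pi.sub_apply, Pi.sub_apply, hYp, hYm]; ring
  have sp := hsum Xp Yp hYp
  have sm := hsum Xm Ym hYm
  refine ⟨pairSq (Yp + Ym) (Yp - Ym), ?_, ?_, ?_, fun θ => ?_⟩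
  · refine Sq.ext fun ⟨c, n⟩ => ?_
    rw [oddProj_apply]
    cases c
    · exact (hodd (Xp - Xm) (Yp - Ym) hY' (fun n => by
        rw [lp.coeFn_sub, Pi.sub_apply, Pi.sub_apply, oXp, oXm]; ring) (by
        rw [lp.coeFn_sub, Pi.sub_apply, zXp, zXm, sub_zero]) n).symm
    · exact (hodd (Xp + Xm) (Yp + Ym) hY (fun n => by
        rw [lp.coeFn_add, Pi.add_apply, Pi.add_apply, oXp, oXm]; ring) (by
        rw [lp.coeFn_add, Pi.add_apply, zXp, zXm, add_zero]) n).symm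
  · have e : (smoothing wt ^ (j + 3)) (pairSq (Yp + Ym) (Yp - Ym)) = pairSq (Xp + Xm) (Xp - Xm) := by
      refine Sq.ext fun ⟨c, n⟩ => ?_
      rw [smoothing_pow_apply one_le_wt]
      cases c
      · exact hraw _ _ hY' n
      · exact hraw _ _ hY n
    rw [e, hpar]
    have h1 := pow_le_pow_left₀ (norm_nonneg _) nXp 2
    have h2 := pow_le_pow_left₀ (norm_nonneg _) nXm 2
    nlinarith
  · refine le_of_sq_le_sq ?_ (by positivity)
    rw [hpar]
    have h1 := pow_le_pow_left₀ (norm_nonneg _) nYp 2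
    have h2 := pow_le_pow_left₀ (norm_nonneg _) nYm 2
    calc 2 * (‖Yp‖ ^ 2 + ‖Ym‖ ^ 2)
        ≤ 2 * ((2 ^ (j + 3) * 12 * ‖u₀p‖) ^ 2 + (2 ^ (j + 3) * 12 * ‖u₀m‖) ^ 2) := by linarith
      _ = 2 * (2 ^ (j + 3) * 12) ^ 2 * (‖u₀p‖ ^ 2 + ‖u₀m‖ ^ 2) := by ring
      _ = 2 * (2 ^ (j + 3) * 12 * δ) ^ 2 := by rw [hn]; ring
      _ ≤ 4 * (2 ^ (j + 3) * 12 * δ) ^ 2 := by nlinarith [sq_nonneg (2 ^ (j + 3) * 12 * δ)]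
      _ = (2 ^ (j + 3) * 24 * δ) ^ 2 := by ring
  · have a1 : aSeq (raw (j + 2) (pairSq (Yp + Ym) (Yp - Ym)) true)
        = fun n => aSeq Xp n + aSeq Xm n := by
      ext n
      have : ∀ k, raw (j + 2) (pairSq (Yp + Ym) (Yp - Ym)) true k = Xp k + Xm k := hraw _ _ hY
      rw [aSeq, this, this, aSeq, aSeq]
      ring
    have a2 : aSeq (raw (j + 2) (pairSq (Yp + Ym) (Yp - Ym)) false)
        = fun n => aSeq Xp n + -1 * aSeq Xm n := by
      ext n
      have : ∀ k, raw (j + 2) (pairSq (Yp + Ym) (Yp - Ym)) false k = Xp k - Xm k := hraw _ _ hY'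
      rw [aSeq, this, this, aSeq, aSeq]
      ring
    have e1 : η₀p θ = sinS (aSeq Xp) θ := by
      rw [eq_sinS_of_odd hcp hpp hop (by rw [eXp]; exact summable_aSeq sp) θ, eXp]
    have e2 : η₀m θ = sinS (aSeq Xm) θ := by
      rw [eq_sinS_of_odd hcm hpm hom (by rw [eXm]; exact summable_aSeq sm) θ, eXm]
    rw [a1, a2, sinS_add (summable_aSeq sp) (summable_aSeq sm),
      sinS_add (summable_aSeq sp) ((summable_aSeq sm).mul_left (-1)), sinS_smul, e1, e2]
    constructor <;> ring

theorem existenceTime_pos {C₁ C₂ δ : ℝ} (h1 : 0 < C₁) (h2 : 0 < C₂) (hδ : 0 < δ) :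
    0 < existenceTime C₁ C₂ δ :=
  mul_pos (by positivity) (Real.log_pos (by
    have : 0 < C₁ / (2 * C₂ * δ) := by positivity
    linarith))

theorem exp_existenceTime {C₁ C₂ δ : ℝ} (h1 : 0 < C₁) (h2 : 0 < C₂) (hδ : 0 < δ) :
    Real.exp (C₁ * existenceTime C₁ C₂ δ) = 1 + C₁ / (2 * C₂ * δ) := by
  rw [existenceTime, ← mul_assoc, mul_one_div_cancel h1.ne', one_mul, Real.exp_log (by positivity)]

/-- The existence time determines the size of the data. -/
theorem existenceTime_injective {C₁ C₂ δ δ' : ℝ} (h1 : 0 < C₁) (h2 : 0 < C₂) (hδ : 0 < δ)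
    (hδ' : 0 < δ') (h : existenceTime C₁ C₂ δ = existenceTime C₁ C₂ δ') : δ = δ' := by
  have e1 := exp_existenceTime h1 h2 hδ
  rw [h, exp_existenceTime h1 h2 hδ', add_right_inj,
    div_eq_div_iff (by positivity) (by positivity)] at e1
  have : 2 * C₁ * C₂ * (δ - δ') = 0 := by linarith
  have := (mul_eq_zero.1 this).resolve_left (by positivity)
  linarith

/-- Existence for data of given size, with the constants of the energy estimates. -/
theorem exists_coeffSolution (j : ℕ) {δ T : ℝ} (hδ : 0 < δ)
    (hT : T = existenceTime (2 * energyConst 1) (24 * energyConst 1) δ) {y₀ : Sq Idx}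
    (hodd : oddProj y₀ = y₀) (hy₀ : ‖(smoothing wt ^ (j + 3)) y₀‖ ^ 2 ≤ (12 * δ) ^ 2 / 2) :
    ∃ y, y 0 = y₀ ∧ IsCoeffSolution j T y ∧ ∀ t ∈ Icc 0 T, ‖y t‖ ≤ ‖y₀‖
      * Real.exp (2 * energyConst (2 ^ (j + 3)) * (1 + (2 * (12 * δ) + 1)) * T) := by
  have hc := energyConst_pos one_pos
  have hCm : 0 ≤ energyConst (2 ^ (j + 3)) := (energyConst_pos (by positivity)).le
  have hexp : Real.exp (2 * energyConst 1 * T) ≤ 1 + 1 / (2 * (12 * δ)) := by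
    rw [hT, exp_existenceTime (by positivity) (by positivity) hδ]
    refine le_of_eq ?_
    field_simp
    ring
  obtain ⟨y, h0, h1, h2, h3⟩ := mhdScale.exists_solution (m := j + 3) (r := 12 * δ) (T := T)
    (by omega) (by positivity) (by positivity) (by positivity) (energyBound admissible_one)
    (fun K hK => energyBound (admissible_cappedPow (by omega) hK)) differenceBound (by positivity)
    (by rw [hT]; exact (existenceTime_pos (by positivity) (by positivity) hδ).le) hexp y₀ hy₀
  exact ⟨y, h0, ⟨h1, oddProj_eq_of_hasDeriv (by rw [h0, hodd]) h3, h3⟩, h2⟩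

/-- All data of size `δ` have a solution on `[0, T]` which is regular with the bound `K * δ`. -/
def SolvableWithBound (j : ℕ) (δ T K : ℝ) : Prop :=
  ∀ (η₀p η₀m : ℝ → ℝ) (u₀p u₀m : Sobolev (j + 3)),
    Continuous η₀p → Continuous η₀m →
    Function.Periodic η₀p (2 * Real.pi) → Function.Periodic η₀m (2 * Real.pi) →
    Function.Odd η₀p → Function.Odd η₀m →
    IsWeightedDeriv η₀p u₀p → IsWeightedDeriv η₀m u₀m →
    ‖u₀p‖ ^ 2 + ‖u₀m‖ ^ 2 = δ ^ 2 →
    ∃ ηp ηm : ℝ → ℝ → ℝ,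
      (IsClassicalOddSolution T ηp ηm ∧
        (∀ θ, ηp 0 θ = η₀p θ) ∧ (∀ θ, ηm 0 θ = η₀m θ)) ∧
      RegularWithBound (j + 3) T (K * δ) ηp ∧ RegularWithBound (j + 3) T (K * δ) ηm

theorem exists_solvableWithBound (j : ℕ) {δ T : ℝ} (hδ : 0 < δ)
    (hT : T = existenceTime (2 * energyConst 1) (24 * energyConst 1) δ) :
    ∃ K : ℝ, SolvableWithBound j δ T K := by
  have hc := energyConst_pos one_pos
  have hT0 : 0 < T := by rw [hT]; exact existenceTime_pos (by positivity) (by positivity) hδ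
  set R := 2 ^ (j + 3) * 24 * δ
    * Real.exp (2 * energyConst (2 ^ (j + 3)) * (1 + (2 * (12 * δ) + 1)) * T) with hR
  have hR0 : 0 ≤ R := by positivity
  set b : ℝ → ℝ := fun β => ‖weightedOp (1 / 2) β (j + 3)‖ * R
    + ‖weightedOp (1 / 2) β (j + 2)‖ * ((‖mhdScale.L (j + 2)‖ + ‖mhdScale.B (j + 2)‖ * R) * R)
    + ‖weightedOp (1 / 2) β (j + 1)‖ * ((‖mhdScale.L (j + 1)‖ + 2 * (‖mhdScale.B (j + 1)‖ * R))
      * ((‖mhdScale.L (j + 2)‖ + ‖mhdScale.B (j + 2)‖ * R) * R)) with hb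
  refine ⟨max (b (1 / 2)) (b (-(1 / 2))) / δ, ?_⟩
  intro η₀p η₀m u₀p u₀m hcp hcm hpp hpm hop hom hup hum hn
  obtain ⟨y₀, hodd, hs, hny, hinit⟩ := exists_initial_coeff j hcp hcm hpp hpm hop hom hup hum hδ hn
  obtain ⟨y, h0, hy, hyn⟩ := exists_coeffSolution j hδ hT hodd hs
  have hyR : ∀ t ∈ Icc 0 T, ‖y t‖ ≤ R := fun t ht =>
    (hyn t ht).trans (mul_le_mul_of_nonneg_right hny (Real.exp_pos _).le)
  have hreg : ∀ β, b β ≤ max (b (1 / 2)) (b (-(1 / 2))) / δ * δ →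
      RegularWithBound (j + 3) T (max (b (1 / 2)) (b (-(1 / 2))) / δ * δ) (fun t θ =>
        1 / 2 * sinS (aSeq (raw (j + 2) (y t) true)) θ
          + β * sinS (aSeq (raw (j + 2) (y t) false)) θ) := by
    intro β hβ
    have n1 : 0 ≤ ‖weightedOp (1 / 2) β (j + 3)‖ * R := by positivity
    have n2 : 0 ≤ ‖weightedOp (1 / 2) β (j + 2)‖
      * ((‖mhdScale.L (j + 2)‖ + ‖mhdScale.B (j + 2)‖ * R) * R) := by positivity
    have n3 : 0 ≤ ‖weightedOp (1 / 2) β (j + 1)‖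
      * ((‖mhdScale.L (j + 1)‖ + 2 * (‖mhdScale.B (j + 1)‖ * R))
      * ((‖mhdScale.L (j + 2)‖ + ‖mhdScale.B (j + 2)‖ * R) * R)) := by positivity
    simp only [hb] at hβ
    refine hy.regular hT0 hyR _ _ ?_ ?_ ?_ <;> linarith
  rw [div_mul_cancel₀ _ hδ.ne'] at hreg ⊢
  exact ⟨_, _, ⟨hy.isClassicalOddSolution hT0, fun θ => by rw [h0]; exact (hinit θ).1,
    fun θ => by rw [h0]; exact (hinit θ).2⟩, hreg _ (le_max_left _ _), hreg _ (le_max_right _ _)⟩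

end MHD

end

theorem mainTheorem4 :
    ∃ C₁ : ℝ, 0 < C₁ ∧ ∃ C₂ : ℝ, 0 < C₂ ∧ ∀ m : ℕ, 3 < m → ∃ C : ℝ → ℝ,
      ∀ (η₀p η₀m : ℝ → ℝ) (u₀p u₀m : MHD.Sobolev m) (δ T₀ : ℝ),
        Continuous η₀p → Continuous η₀m →
        Function.Periodic η₀p (2 * Real.pi) → Function.Periodic η₀m (2 * Real.pi) →
        Function.Odd η₀p → Function.Odd η₀m →
        MHD.IsWeightedDeriv η₀p u₀p → MHD.IsWeightedDeriv η₀m u₀m →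
        0 < δ → ‖u₀p‖ ^ 2 + ‖u₀m‖ ^ 2 = δ ^ 2 →
        T₀ = MHD.existenceTime C₁ C₂ δ →
        0 < T₀ ∧
        ∃ ηp ηm : ℝ → ℝ → ℝ,
          (MHD.IsClassicalOddSolution T₀ ηp ηm ∧
            (∀ θ, ηp 0 θ = η₀p θ) ∧ (∀ θ, ηm 0 θ = η₀m θ)) ∧
          MHD.RegularWithBound m T₀ (C T₀ * δ) ηp ∧
          MHD.RegularWithBound m T₀ (C T₀ * δ) ηm ∧
          ∀ ξp ξm : ℝ → ℝ → ℝ,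
            MHD.IsClassicalOddSolution T₀ ξp ξm →
            (∀ θ, ξp 0 θ = η₀p θ) → (∀ θ, ξm 0 θ = η₀m θ) →
            ∀ t ∈ Set.Icc 0 T₀, ∀ θ, ξp t θ = ηp t θ ∧ ξm t θ = ηm t θ := by
  -- the rate of the `L²` energy estimate, and the ratio for which `C₁ / (2 C₂ δ) = 1 / (2 r)` with
  -- the bound `r = 12 δ` on the coefficients of the data
  have hc := MHD.energyConst_pos one_pos
  have h1 : 0 < 2 * MHD.energyConst 1 := by positivity
  have h2 : 0 < 24 * MHD.energyConst 1 := by positivity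
  refine ⟨2 * MHD.energyConst 1, h1, 24 * MHD.energyConst 1, h2, fun m hm => ?_⟩
  obtain ⟨j, rfl⟩ : ∃ j, m = j + 3 := ⟨m - 3, by omega⟩
  -- the existence time determines the size of the data, so that the bound may depend on both
  have hK : ∀ T, ∃ K : ℝ, ∀ δ, 0 < δ →
      T = MHD.existenceTime (2 * MHD.energyConst 1) (24 * MHD.energyConst 1) δ →
        MHD.SolvableWithBound j δ T K := by
    intro T
    by_cases hT : ∃ δ, 0 < δ ∧
        T = MHD.existenceTime (2 * MHD.energyConst 1) (24 * MHD.energyConst 1) δ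
    · obtain ⟨δ, hδ, hTδ⟩ := hT
      obtain ⟨K, hK⟩ := MHD.exists_solvableWithBound j hδ hTδ
      refine ⟨K, fun δ' hδ' hTδ' => ?_⟩
      obtain rfl : δ = δ' := MHD.existenceTime_injective h1 h2 hδ hδ' (hTδ.symm.trans hTδ')
      exact hK
    · exact ⟨0, fun δ hδ hTδ => (hT ⟨δ, hδ, hTδ⟩).elim⟩
  choose C hC using hK
  refine ⟨C, ?_⟩
  intro η₀p η₀m u₀p u₀m δ T₀ hcp hcm hpp hpm hop hom hup hum hδ hn hT
  have hT0 : 0 < T₀ := hT ▸ MHD.existenceTime_pos h1 h2 hδ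
  obtain ⟨ηp, ηm, hη, hrp, hrm⟩ :=
    hC T₀ δ hδ hT η₀p η₀m u₀p u₀m hcp hcm hpp hpm hop hom hup hum hn
  exact ⟨hT0, ηp, ηm, hη, hrp, hrm, fun ξp ξm hξ h0p h0m => hη.1.unique hT0 hξ
    (fun θ => (h0p θ).trans (hη.2.1 θ).symm) fun θ => (h0m θ).trans (hη.2.2 θ).symm⟩
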